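/- **Theorem 2.7.** Let $S$ be a commutative ring and $\mathcal C$ a minimal (i.e. $m_1=0$) strictly unital $S$-linear $A_\infty$-category. We write $m_k(x_k,\dots,x_1)$ for the product of $x_1\in\operatorname{Hom}(X_0,X_1),\dots,x_k\in\operatorname{Hom}(X_{k-1},X_k)$ (so that $x_1$ is applied first, and $m_2(x_2,x_1)=x_2\circ x_1$); signs are normalized so that, with arguments listed in the order of application, $\sum_{r+s+t=k}(-1)^{r+st}m_{r+1+t}(1^{\otimes r}\otimes m_s\otimes 1^{\otimes t})=0$ (with the Koszul rule). An object $F$ is *$1$-spherical* if for every object $Y$ the graded modules $\operatorname{Hom}^*(F,Y)$ and $\operatorname{Hom}^*(Y,F)$ are finitely generated projective and bounded, $\operatorname{Hom}^0(F,F)=S\cdot\operatorname{id}_F\simeq S$, $\operatorname{Hom}^1(F,F)$ is an invertible $S$-module, $\operatorname{Hom}^d(F,F)=0$ for $d\ne0,1$, and for every $Y$ and $i$ the composition induces an isomorphism $\operatorname{Hom}^{1-i}(Y,F)\to\operatorname{Hom}_S(\operatorname{Hom}^{i}(F,Y),\operatorname{Hom}^1(F,F))$. Let $n\ge 2$ and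 let $(E,F)$ be a *weak $n$-pair* in $\mathcal C$: $F$ is $1$-spherical with $\operatorname{Hom}^1(F,F)\simeq S$; $\operatorname{Hom}^0(E,E)\simeq S$, $\operatorname{Hom}^{d}(E,E)=0$ for $d\neq 0,1$, and $\mathcal L_E:=\operatorname{Hom}^1(E,E)$ is an invertible $S$-module; $\operatorname{Hom}^d(E,F)=0$ for $d\ne 0$, and $V:=\operatorname{Hom}^0(E,F)\simeq S^n$. Fix a trivialization $\operatorname{Hom}^1(F,F)\simeq S$, with generator $\xi_F$. Identify $\operatorname{Hom}^1(F,E)$ with $V^\vee$ by $v\circ v^*=\langle v^*,v\rangle\,\xi_F$, and let $g\in\operatorname{End}(V)\otimes\mathcal L_E$ be the element with $v^*\circ v=\langle v^*,gv\rangle$ for $v\in V$, $v^*\in V^\vee$. Assume that $h\in\operatorname{End}(V)\otimes\mathcal L_E^{-1}$ satisfies $\operatorname{tr}(gh)=1$. Put $$\operatorname{End}_g(V)=\{a\in\operatorname{End}(V):\operatorname{tr}(ga)=0\},\qquad \mathcal E(V,g)=\{a_0+a_1z+\dots\in\operatorname{End}(V)[z]: a_0\in S\cdot\operatorname{id},\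 a_1\in\operatorname{End}_g(V)\},$$ a graded $S$-algebra with $\deg z=1$. Let $(e_i)$, $(e_i^*)$ be dual bases of $V$ and $V^\vee$, and define $S$-linear maps $r,r':\operatorname{End}(V)\to\operatorname{End}(V)$, $s:\operatorname{End}(V)\to\mathcal L_E$ and $m_4:\operatorname{End}(V)\otimes\operatorname{End}(V)\to\operatorname{Hom}^0(E,E)=S$ by $$r(v\otimes v^*)=\sum_i m_3(e_i,v^*,v)\otimes e_i^*,\quad r'(v\otimes v^*)=\sum_i e_i\otimes m_3(v^*,v,e_i^*),\quad s(v\otimes v^*)=m_3(v^*,\xi_F,v),$$ $$m_4\big((v\otimes v^*)\otimes(w\otimes w^*)\big)=m_4(v^*,v,w^*,w).$$ Let $T=T_F$, $T(X)=\operatorname{Cone}(\operatorname{hom}(F,X)\otimes F\to X)$, be the spherical twist on twisted complexes over $\mathcal C$, where twisted complexes are built from objects $P\otimes X$ with $X\in\mathcal C$ and $P$ a shifted finitely generated projective $S$-module. Set $E_i=T^i(E)$, and let $\operatorname{Hom}^*$ denote the cohomology of the complexes of morphisms of twisted complexes. Consider $\mathcal R=\bigoplus_{i\ge0}\mathcal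 R_i$, $\mathcal R_i=\operatorname{Hom}^0(E_0,E_i)$, with the product $ab=T^j(a)\circ b$ for $a\in\mathcal R_i$, $b\in\mathcal R_j$. Then the $E_i$ are twisted complexes, $\mathcal R$ is a graded associative $S$-algebra with unit $\operatorname{id}_E$, and: (i) There are an $S$-algebra $A$ with an increasing exhaustive filtration $(F_iA)_{i\ge0}$, an isomorphism of graded $S$-algebras between $\mathcal R$ and the Rees algebra $\bigoplus_i F_iA\,t^i\subset A[t]$, under which the element $t$ corresponds to the class in $\mathcal R_1$ of the canonical morphism $E\to T(E)$, and an isomorphism of graded $S$-algebras $\operatorname{gr}^FA\simeq\mathcal E(V,g)^{op}$. Moreover, transposition of coefficients is an isomorphism $\mathcal E(V,g)^{op}\simeq\mathcal E(V^\vee,g^*)$. In addition, $\operatorname{Hom}^{k}(E_0,E_i)=0$ for all $i>0$ and $k\ne0$. (ii) There are $S$-linear embeddings $\operatorname{End}_g(V)\hookrightarrow\mathcal R_1$ and $\operatorname{End}(V)\hookrightarrow\mathcal R_2$, lifting $a\mapsto az$ and $a\mapsto az^2$ with respect to the isomorphisms of (i), such that $$\mathcal R_1=\operatorname{End}_g(V)\oplus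 S\cdot t,\qquad \mathcal R_2=\operatorname{End}(V)\oplus\operatorname{End}_g(V)\cdot t\oplus S\cdot t^2,$$ and with respect to these decompositions, for all $a,b\in\operatorname{End}_g(V)\subset\mathcal R_1$, $$a\cdot b=ba+[\,r(b)a+b\,r'(a)+s(ba)h\,]\,t+m_4(a\otimes b)\,t^2,$$ where $s(ba)h\in\operatorname{End}(V)$ is the contraction $\mathcal L_E\otimes\mathcal L_E^{-1}\to S$; in particular the coefficient of $t$ lies in $\operatorname{End}_g(V)$. -/

import Mathlib

universe u w

open scoped TensorProduct DirectSum

open Polynomial (monomial)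

noncomputable section

attribute [local instance] Classical.propDecidable

/-! ### Filtered algebras -/

/-- An `S`-algebra with an increasing exhaustive filtration `F_0 ⊂ F_1 ⊂ ⋯` (and `F_{-1} = 0`). -/
structure FilteredAlg (S : Type u) [CommRing S] where
  A : Type u
  [ring : Ring A]
  [algebra : Algebra S A]
  fil : ℕ → Submodule S A
  mono : Monotone fil
  one_mem : 1 ∈ fil 0
  mul_mem : ∀ {i j : ℕ} {x y : A}, x ∈ fil i → y ∈ fil j → x * y ∈ fil (i + j)
  exhaustive : ∀ x, ∃ i, x ∈ fil i

attribute [instance] FilteredAlg.ring FilteredAlg.algebra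

namespace FilteredAlg

variable {S : Type u} [CommRing S] (A : FilteredAlg S)

/-- The Rees algebra `⊕ F_n t^n`, as a subalgebra of `A[t]`. -/
def rees : Subalgebra S (Polynomial A.A) where
  carrier := {p | ∀ i, p.coeff i ∈ A.fil i}
  mul_mem' {p q} hp hq i := by
    rw [Polynomial.coeff_mul]
    refine Submodule.sum_mem _ fun x hx => ?_
    rw [← Finset.HasAntidiagonal.mem_antidiagonal.mp hx]
    exact A.mul_mem (hp _) (hq _)
  add_mem' {p q} hp hq i := by
    rw [Polynomial.coeff_add]
    exact Submodule.add_mem _ (hp i) (hq i)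
  algebraMap_mem' r i := by
    rw [Polynomial.algebraMap_apply, Polynomial.coeff_C]
    split_ifs with h
    · subst h
      rw [Algebra.algebraMap_eq_smul_one]
      exact Submodule.smul_mem _ _ A.one_mem
    · exact Submodule.zero_mem _

/-- `F_{i-1}`. -/
def filPred : ℕ → Submodule S A.A
  | 0 => ⊥
  | i + 1 => A.fil i

theorem mul_mem_filPred_left {i j : ℕ} {x y : A.A} (hx : x ∈ A.filPred i) (hy : y ∈ A.fil j) :
    x * y ∈ A.filPred (i + j) := by
  cases i with
  | zero =>
    have : x = 0 := hx
    simp [this]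
  | succ i =>
    rw [Nat.succ_add]
    exact A.mul_mem hx hy

theorem mul_mem_filPred_right {i j : ℕ} {x y : A.A} (hx : x ∈ A.fil i) (hy : y ∈ A.filPred j) :
    x * y ∈ A.filPred (i + j) := by
  cases j with
  | zero =>
    have : y = 0 := hy
    simp [this]
  | succ j => exact A.mul_mem hx hy

/-- `gr_i A = F_i / F_{i-1}`. -/
def Gr (i : ℕ) : Type u := A.fil i ⧸ (A.filPred i).submoduleOf (A.fil i)

instance (i : ℕ) : AddCommGroup (A.Gr i) :=
  inferInstanceAs (AddCommGroup (A.fil i ⧸ (A.filPred i).submoduleOf (A.fil i)))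

instance (i : ℕ) : Module S (A.Gr i) :=
  inferInstanceAs (Module S (A.fil i ⧸ (A.filPred i).submoduleOf (A.fil i)))

/-- The symbol in `gr_i A` of an element of `F_i`. -/
def symb {i : ℕ} (x : A.fil i) : A.Gr i :=
  ((A.filPred i).submoduleOf (A.fil i)).mkQ x

/-- The product `gr_i A × gr_j A → gr_{i+j} A`. -/
def grMul {i j : ℕ} : A.Gr i → A.Gr j → A.Gr (i + j) :=
  Quotient.map₂ (fun x y => ⟨x * y, A.mul_mem x.2 y.2⟩) fun x x' hx y y' hy => by
    replace hx : (x : A.A) - x' ∈ A.filPred i :=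
      (Submodule.quotientRel_def ((A.filPred i).submoduleOf (A.fil i))).mp hx
    replace hy : (y : A.A) - y' ∈ A.filPred j :=
      (Submodule.quotientRel_def ((A.filPred j).submoduleOf (A.fil j))).mp hy
    refine (Submodule.quotientRel_def _).mpr ?_
    have e : (x : A.A) * y - x' * y' = (x - x') * y + x' * (y - y') := by noncomm_ring
    change (x : A.A) * y - x' * y' ∈ A.filPred (i + j)
    rw [e]
    exact Submodule.add_mem _ (A.mul_mem_filPred_left hx y.2) (A.mul_mem_filPred_right x'.2 hy)

theorem symb_surjective {i : ℕ} (x : A.Gr i) : ∃ y, A.symb y = x :=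
  Submodule.Quotient.mk_surjective _ x

theorem grMul_symb {i j : ℕ} (x : A.fil i) (y : A.fil j) :
    A.grMul (A.symb x) (A.symb y) = A.symb ⟨x * y, A.mul_mem x.2 y.2⟩ := rfl

theorem symb_add {i : ℕ} (x y : A.fil i) : A.symb x + A.symb y = A.symb (x + y) := rfl

theorem symb_congr {i j : ℕ} (h : i = j) (x : A.fil i) (y : A.fil j) (hxy : (x : A.A) = y) :
    (⟨i, A.symb x⟩ : GradedMonoid A.Gr) = ⟨j, A.symb y⟩ := by
  subst h
  rw [Subtype.ext hxy]

instance : GradedMonoid.GOne A.Gr := ⟨A.symb ⟨1, A.one_mem⟩⟩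

instance : GradedMonoid.GMul A.Gr := ⟨A.grMul⟩

instance : GradedMonoid.GMonoid A.Gr where
  one_mul := by
    rintro ⟨i, x⟩
    obtain ⟨x, rfl⟩ := A.symb_surjective x
    exact A.symb_congr (zero_add i) _ _ (one_mul (x : A.A))
  mul_one := by
    rintro ⟨i, x⟩
    obtain ⟨x, rfl⟩ := A.symb_surjective x
    exact A.symb_congr (add_zero i) _ _ (mul_one (x : A.A))
  mul_assoc := by
    rintro ⟨i, x⟩ ⟨j, y⟩ ⟨k, z⟩
    obtain ⟨x, rfl⟩ := A.symb_surjective x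
    obtain ⟨y, rfl⟩ := A.symb_surjective y
    obtain ⟨z, rfl⟩ := A.symb_surjective z
    exact A.symb_congr (add_assoc i j k) _ _ (mul_assoc (x : A.A) y z)

/-- The associated graded algebra `gr A = ⊕ F_i / F_{i-1}`. -/
instance : DirectSum.GRing A.Gr where
  mul_zero x := by
    obtain ⟨x, rfl⟩ := A.symb_surjective x
    exact congrArg A.symb (Subtype.ext (mul_zero (x : A.A)))
  zero_mul x := by
    obtain ⟨x, rfl⟩ := A.symb_surjective x
    exact congrArg A.symb (Subtype.ext (zero_mul (x : A.A)))
  mul_add x y z := by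
    obtain ⟨x, rfl⟩ := A.symb_surjective x
    obtain ⟨y, rfl⟩ := A.symb_surjective y
    obtain ⟨z, rfl⟩ := A.symb_surjective z
    exact congrArg A.symb (Subtype.ext (mul_add (x : A.A) y z))
  add_mul x y z := by
    obtain ⟨x, rfl⟩ := A.symb_surjective x
    obtain ⟨y, rfl⟩ := A.symb_surjective y
    obtain ⟨z, rfl⟩ := A.symb_surjective z
    exact congrArg A.symb (Subtype.ext (add_mul (x : A.A) y z))
  natCast n := n • A.symb ⟨1, A.one_mem⟩
  natCast_zero := zero_smul _ _
  natCast_succ n := succ_nsmul _ n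
  intCast n := n • A.symb ⟨1, A.one_mem⟩
  intCast_ofNat n := natCast_zsmul _ n
  intCast_negSucc_ofNat n := negSucc_zsmul _ n

end FilteredAlg

/-! ### The algebras `E(V,g)` -/

section EndAlgebra

variable {S : Type u} [CommRing S] {V L : Type u} [AddCommGroup V] [Module S V]
  [AddCommGroup L] [Module S L]

/-- `a ↦ tr(ga)`, for `g ∈ End(V) ⊗ L`. -/
def trMul : Module.End S V ⊗[S] L →ₗ[S] Module.End S V →ₗ[S] L :=
  TensorProduct.lift (LinearMap.smulRightₗ ∘ₗ
    (LinearMap.mul S (Module.End S V)).compr₂ (LinearMap.trace S V))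

/-- `tr(gh) ∈ S`, for `g ∈ End(V) ⊗ L` and `h ∈ End(V) ⊗ L⁻¹`. -/
def trPair (g : Module.End S V ⊗[S] L) (h : Module.End S V ⊗[S] Module.Dual S L) : S :=
  TensorProduct.lift (Module.Dual.eval S L ∘ₗ trMul g) h

/-- The contraction `l ↦ lh ∈ End(V)`, for `l ∈ L` and `h ∈ End(V) ⊗ L⁻¹`. -/
def contract (h : Module.End S V ⊗[S] Module.Dual S L) : L →ₗ[S] Module.End S V :=
  dualTensorHom S L (Module.End S V) (TensorProduct.comm S _ _ h)

/-- `End_g(V) = {a | tr(ga) = 0}`. -/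
def EndG (g : Module.End S V ⊗[S] L) : Submodule S (Module.End S V) := LinearMap.ker (trMul g)

/-- `E(V,g) = {a_0 + a_1 z + ⋯ | a_0 ∈ S·id, a_1 ∈ End_g(V)} ⊂ End(V)[z]`. -/
def EAlg (g : Module.End S V ⊗[S] L) : Subalgebra S (Polynomial (Module.End S V)) where
  carrier := {p | (∃ s : S, p.coeff 0 = algebraMap S _ s) ∧ p.coeff 1 ∈ EndG g}
  mul_mem' := by
    rintro p q ⟨⟨s, hs⟩, hp⟩ ⟨⟨s', hs'⟩, hq⟩
    refine ⟨⟨s * s', by rw [Polynomial.mul_coeff_zero, hs, hs', map_mul]⟩, ?_⟩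
    rw [Polynomial.mul_coeff_one, hs, hs', ← Algebra.commutes s', ← Algebra.smul_def,
      ← Algebra.smul_def]
    exact Submodule.add_mem _ (Submodule.smul_mem _ _ hq) (Submodule.smul_mem _ _ hp)
  add_mem' := by
    rintro p q ⟨⟨s, hs⟩, hp⟩ ⟨⟨s', hs'⟩, hq⟩
    refine ⟨⟨s + s', by rw [Polynomial.coeff_add, hs, hs', map_add]⟩, ?_⟩
    rw [Polynomial.coeff_add]
    exact Submodule.add_mem _ hp hq
  algebraMap_mem' s := by
    refine ⟨⟨s, by simp [Polynomial.algebraMap_apply]⟩, ?_⟩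
    rw [Polynomial.algebraMap_apply, Polynomial.coeff_C_of_ne_zero one_ne_zero]
    exact Submodule.zero_mem _

/-- `g^* ∈ End(V^∨) ⊗ L`. -/
def gDual (g : Module.End S V ⊗[S] L) : Module.End S (Module.Dual S V) ⊗[S] L :=
  (Module.Dual.transpose (R := S) (M := V) (M' := V)).rTensor L g

end EndAlgebra

/-! ### Minimal `A_∞`-categories -/

/-- An `S`-linear graded quiver: objects and graded morphism modules, all of them placed as
independent summands `Hom X Y d` (morphisms `X → Y` of degree `d`) of one module `Mor`. -/
structure GradedQuiver (S : Type u) [CommRing S] where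
  Obj : Type w
  Mor : Type u
  [addCommGroup : AddCommGroup Mor]
  [module : Module S Mor]
  Hom : Obj → Obj → ℤ → Submodule S Mor
  isInternal : DirectSum.IsInternal (fun p : Obj × Obj × ℤ => Hom p.1 p.2.1 p.2.2)

attribute [instance] GradedQuiver.addCommGroup GradedQuiver.module

namespace GradedQuiver

variable {S : Type u} [CommRing S] (Q : GradedQuiver.{u, w} S)

/-- The decomposition of `Mor` into its summands. -/
def decomp : Q.Mor ≃ₗ[S] ⨁ p : Q.Obj × Q.Obj × ℤ, Q.Hom p.1 p.2.1 p.2.2 :=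
  (LinearEquiv.ofBijective
    (DirectSum.coeLinearMap (fun p : Q.Obj × Q.Obj × ℤ => Q.Hom p.1 p.2.1 p.2.2))
    Q.isInternal).symm

/-- The projection onto the summand `Hom X Y d`. -/
def proj (X Y : Q.Obj) (d : ℤ) : Q.Mor →ₗ[S] Q.Hom X Y d :=
  DirectSum.component S (Q.Obj × Q.Obj × ℤ) (fun p => Q.Hom p.1 p.2.1 p.2.2) (X, Y, d) ∘ₗ
    Q.decomp.toLinearMap

/-- The sign involution: multiplication by `(-1)^d` on `Hom X Y d`. -/
def sgn : Module.End S Q.Mor :=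
  DirectSum.toModule S (Q.Obj × Q.Obj × ℤ) Q.Mor
      (fun p => (Int.negOnePow p.2.2 : ℤ) • (Q.Hom p.1 p.2.1 p.2.2).subtype) ∘ₗ
    Q.decomp.toLinearMap

end GradedQuiver

/-- A minimal strictly unital `S`-linear `A_∞`-category.

Arguments are written in the order in which the morphisms are applied:
`m n` is `Hom(X₀,X₁) ⊗ ⋯ ⊗ Hom(Xₙ₋₁,Xₙ) → Hom(X₀,Xₙ)[2-n]`, extended by zero to sequences that are
not composable.  The field `stasheff` says
`∑_{r+s+t=n, s ≥ 1} (-1)^{r+st} m_{r+1+t} (1^{⊗r} ⊗ m_s ⊗ 1^{⊗t}) = 0` with the Koszul rule: moving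
`m_s`, of degree `2-s`, past `x₁,…,x_r` gives `(-1)^{s(|x₁|+⋯+|x_r|)}`. -/
structure MinimalAInfCat (S : Type u) [CommRing S] extends GradedQuiver.{u, w} S where
  m : (n : ℕ) → MultilinearMap S (fun _ : Fin n => Mor) Mor
  m_zero : m 0 = 0
  m_one : m 1 = 0
  m_mem : ∀ (n : ℕ) (X : Fin (n + 1) → Obj) (d : Fin n → ℤ) (x : Fin n → Mor),
    (∀ i, x i ∈ Hom (X i.castSucc) (X i.succ) (d i)) →
      m n x ∈ Hom (X 0) (X (Fin.last n)) (∑ i, d i + 2 - n)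
  m_eq_zero_of_ne : ∀ (n : ℕ) (X Y : Fin n → Obj) (d : Fin n → ℤ) (x : Fin n → Mor),
    (∀ i, x i ∈ Hom (X i) (Y i) (d i)) →
      ∀ i j : Fin n, (j : ℕ) = i + 1 → Y i ≠ X j → m n x = 0
  stasheff : ∀ l : List Mor,
    ∑ r ∈ Finset.range (l.length + 1), ∑ s ∈ Finset.Icc 1 (l.length - r),
      (-1 : ℤ) ^ (r + s * (l.length - r - s)) •
        (fun k : List Mor => m k.length k.get)
          ((l.take r).map (toGradedQuiver.sgn ^ s) ++
            [m ((l.drop r).take s).length ((l.drop r).take s).get] ++ l.drop (r + s)) = 0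
  id : Obj → Mor
  id_mem : ∀ X, id X ∈ Hom X X 0
  id_m : ∀ (X Y : Obj) (d : ℤ), ∀ x ∈ Hom X Y d, m 2 ![id X, x] = x
  m_id : ∀ (X Y : Obj) (d : ℤ), ∀ x ∈ Hom X Y d, m 2 ![x, id Y] = x
  m_eq_zero_of_id : ∀ (n : ℕ), n ≠ 2 → ∀ (x : Fin n → Mor) (i : Fin n) (X : Obj),
    x i = id X → m n x = 0

namespace MinimalAInfCat

variable {S : Type u} [CommRing S] (C : MinimalAInfCat.{u, w} S)

/-! The products in operator order (the last argument is applied first). -/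

/-- `m₂(a,b) = a ∘ b`. -/
def m₂ (a b : C.Mor) : C.Mor := C.m 2 ![b, a]

/-- `m₃(a,b,c)`, with `c` applied first. -/
def m₃ (a b c : C.Mor) : C.Mor := C.m 3 ![c, b, a]

/-- `m₄(a,b,c,d)`, with `d` applied first. -/
def m₄ (a b c d : C.Mor) : C.Mor := C.m 4 ![d, c, b, a]

/-- The composition `(y, x) ↦ y ∘ x`, `Hom^b(Y,Z) × Hom^a(X,Y) → Hom^c(X,Z)`, meant for
`c = a + b`. -/
def compHom (X Y Z : C.Obj) (a b c : ℤ) :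
    C.Hom Y Z b →ₗ[S] C.Hom X Y a →ₗ[S] C.Hom X Z c :=
  LinearMap.mk₂ S (fun y x => C.proj X Z c (C.m₂ y x))
    (fun y y' x => by
      have h := (C.m 2).map_update_add ![(x : C.Mor), 0] 1 (y : C.Mor) y'
      have e : ∀ z : C.Mor, Function.update ![(x : C.Mor), 0] 1 z = ![(x : C.Mor), z] := by
        intro z; ext i; fin_cases i <;> simp
      simp only [e] at h
      simp [m₂, h])
    (fun c' y x => by
      have h := (C.m 2).map_update_smul ![(x : C.Mor), 0] 1 c' (y : C.Mor)
      have e : ∀ z : C.Mor, Function.update ![(x : C.Mor), 0] 1 z = ![(x : C.Mor), z] := by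
        intro z; ext i; fin_cases i <;> simp
      simp only [e] at h
      simp [m₂, h])
    (fun y x x' => by
      have h := (C.m 2).map_update_add ![0, (y : C.Mor)] 0 (x : C.Mor) x'
      have e : ∀ z : C.Mor, Function.update ![0, (y : C.Mor)] 0 z = ![z, (y : C.Mor)] := by
        intro z; ext i; fin_cases i <;> simp
      simp only [e] at h
      simp [m₂, h])
    (fun c' y x => by
      have h := (C.m 2).map_update_smul ![0, (y : C.Mor)] 0 c' (x : C.Mor)
      have e : ∀ z : C.Mor, Function.update ![0, (y : C.Mor)] 0 z = ![z, (y : C.Mor)] := by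
        intro z; ext i; fin_cases i <;> simp
      simp only [e] at h
      simp [m₂, h])

/-! ### Spherical objects and weak `n`-pairs -/

/-- `hom(X,Y)` is a bounded complex of finitely generated projective modules (its differential
vanishes, the category being minimal). -/
def IsPerfectHom (X Y : C.Obj) : Prop :=
  {d : ℤ | C.Hom X Y d ≠ ⊥}.Finite ∧
    ∀ d, Module.Finite S (C.Hom X Y d) ∧ Module.Projective S (C.Hom X Y d)

/-- `X` is a `1`-spherical object.  As the category is minimal, the quasi-isomorphism
`hom(Y,X) → hom(X,Y)^∨ ⊗ τ_{≥1} hom(X,X)` is a degreewise isomorphism. -/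
structure IsOneSpherical (X : C.Obj) : Prop where
  perfect_left : ∀ Y, C.IsPerfectHom X Y
  perfect_right : ∀ Y, C.IsPerfectHom Y X
  hom_eq_bot : ∀ d, d ≠ 0 → d ≠ 1 → C.Hom X X d = ⊥
  hom_zero : Function.Bijective (fun s : S => (⟨s • C.id X,
    Submodule.smul_mem _ s (C.id_mem X)⟩ : C.Hom X X 0))
  invertible : Module.Invertible S (C.Hom X X 1)
  duality : ∀ (Y : C.Obj) (i j : ℤ), i + j = 1 → Function.Bijective (C.compHom X Y X i j 1)

/-- `(E,F)` is a weak `n`-pair. -/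
structure IsWeakPair (n : ℕ) (E F : C.Obj) : Prop where
  spherical : C.IsOneSpherical F
  homFF : Nonempty (C.Hom F F 1 ≃ₗ[S] S)
  homEE_zero : Nonempty (C.Hom E E 0 ≃ₗ[S] S)
  homEE_eq_bot : ∀ d, d ≠ 0 → d ≠ 1 → C.Hom E E d = ⊥
  homEE_one : Module.Invertible S (C.Hom E E 1)
  homEF_eq_bot : ∀ d, d ≠ 0 → C.Hom E F d = ⊥
  homEF_zero : Nonempty (C.Hom E F 0 ≃ₗ[S] (Fin n → S))

/-! ### Twisted complexes -/

/-- The suspended products `b_n(x₁,…,xₙ) = (-1)^{∑ (n-j)|x_j|} m_n(x₁,…,xₙ)`. -/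
def bn (n : ℕ) : MultilinearMap S (fun _ : Fin n => C.Mor) C.Mor :=
  (C.m n).compLinearMap (fun j => C.sgn ^ (n - 1 - (j : ℕ)))

/-- All the products `b_n` together, as a map on the tensor algebra. -/
def b : TensorAlgebra S C.Mor →ₗ[S] C.Mor :=
  DirectSum.toModule S ℕ C.Mor (fun n => PiTensorProduct.lift (C.bn n)) ∘ₗ
    (TensorAlgebra.equivDirectSum (R := S) (M := C.Mor)).toLinearMap

/-- A formal sum of objects `P_i ⊗ X_i`, where `P_i` is a finitely generated projective
`S`-module placed in degree `deg i`, with a strictly triangular matrix `δ` of degree `1`.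
A matrix entry from `P ⊗ X` to `P' ⊗ X'` is a map `P → Hom(X,X') ⊗ P'`.  It is a twisted complex
if `δ` satisfies the Maurer-Cartan equation (`PreTw.IsTwisted` below). -/
structure PreTw where
  I : Type
  [fintype : Fintype I]
  obj : I → C.Obj
  deg : I → ℤ
  P : I → Type u
  [addCommGroup : ∀ i, AddCommGroup (P i)]
  [module : ∀ i, Module S (P i)]
  [finite : ∀ i, Module.Finite S (P i)]
  [projective : ∀ i, Module.Projective S (P i)]
  rk : I → ℕ
  δ : ∀ i j, P i →ₗ[S] C.Mor ⊗[S] P j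
  δ_mem : ∀ i j p, δ i j p ∈
    LinearMap.range ((C.Hom (obj i) (obj j) (1 + deg i - deg j)).subtype.rTensor (P j))
  δ_triangular : ∀ i j, δ i j ≠ 0 → rk i < rk j

attribute [instance] PreTw.fintype PreTw.addCommGroup PreTw.module PreTw.finite PreTw.projective

namespace PreTw

variable {C}

/-- An object of `C` as a twisted complex. -/
def single (X : C.Obj) : C.PreTw where
  I := Unit
  obj _ := X
  deg _ := 0
  P _ := S
  rk _ := 0
  δ _ _ := 0
  δ_mem _ _ _ := by simp
  δ_triangular _ _ h := absurd rfl h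

/-- Matrices with entries `P_i → Mor ⊗ P'_j`; the morphisms of degree `k` from `X` to `Y` are the
elements of the submodule `homDeg X Y k`. -/
def Mat (X Y : C.PreTw) : Type u := ∀ i j, X.P i →ₗ[S] C.Mor ⊗[S] Y.P j

instance (X Y : C.PreTw) : AddCommGroup (Mat X Y) :=
  inferInstanceAs (AddCommGroup (∀ i j, X.P i →ₗ[S] C.Mor ⊗[S] Y.P j))

instance (X Y : C.PreTw) : Module S (Mat X Y) :=
  inferInstanceAs (Module S (∀ i j, X.P i →ₗ[S] C.Mor ⊗[S] Y.P j))

theorem Mat.add_apply {X Y : C.PreTw} (f g : Mat X Y) (i j) : (f + g) i j = f i j + g i j := rfl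

theorem Mat.smul_apply {X Y : C.PreTw} (c : S) (f : Mat X Y) (i j) : (c • f) i j = c • f i j := rfl

/-- The morphisms of degree `k`. -/
def homDeg (X Y : C.PreTw) (k : ℤ) : Submodule S (Mat X Y) where
  carrier := {f | ∀ i j p, f i j p ∈
    LinearMap.range ((C.Hom (X.obj i) (Y.obj j) (k + X.deg i - Y.deg j)).subtype.rTensor (Y.P j))}
  zero_mem' _ _ _ := Submodule.zero_mem _
  add_mem' hf hg i j p := Submodule.add_mem _ (hf i j p) (hg i j p)
  smul_mem' c _ hf i j p := Submodule.smul_mem _ c (hf i j p)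

/-- Matrices with entries in the tensor algebra of `Mor`: (sums of) sequences of morphisms. -/
abbrev TMat (X Y : C.PreTw) : Type u := ∀ i j, X.P i →ₗ[S] TensorAlgebra S C.Mor ⊗[S] Y.P j

/-- A matrix of morphisms, regarded as a matrix of sequences of length one. -/
def toT (X Y : C.PreTw) : Mat X Y →ₗ[S] TMat X Y where
  toFun f i j := (TensorAlgebra.ι S).rTensor (Y.P j) ∘ₗ f i j
  map_add' f g := by
    funext i j
    simp [Mat.add_apply, LinearMap.comp_add]
  map_smul' c f := by
    funext i j
    simp [Mat.smul_apply, LinearMap.comp_smul]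

/-- Apply an entry `ψ : P → T ⊗ P'` after a sequence of morphisms: `x ⊗ p ↦ x · ψ(p)`. -/
def extend {P P' : Type u} [AddCommGroup P] [Module S P] [AddCommGroup P'] [Module S P']
    (ψ : P →ₗ[S] TensorAlgebra S C.Mor ⊗[S] P') :
    TensorAlgebra S C.Mor ⊗[S] P →ₗ[S] TensorAlgebra S C.Mor ⊗[S] P' :=
  (LinearMap.mul' S (TensorAlgebra S C.Mor)).rTensor P' ∘ₗ
    (TensorProduct.assoc S (TensorAlgebra S C.Mor) (TensorAlgebra S C.Mor) P').symm.toLinearMap ∘ₗ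
      ψ.lTensor (TensorAlgebra S C.Mor)

/-- The matrix product (first `f`, then `g`), concatenating sequences of morphisms. -/
def cat {X Y Z : C.PreTw} (f : TMat X Y) (g : TMat Y Z) : TMat X Z :=
  fun i k => ∑ j, extend (g j k) ∘ₗ f i j

/-- The powers `δ, δ ⊗ δ, …`, and the empty sequence for `n = 0`. -/
def δpow (X : C.PreTw) : ℕ → TMat X X
  | 0 => fun i => Pi.single i (TensorProduct.mk S (TensorAlgebra S C.Mor) (X.P i) 1)
  | n + 1 => cat (δpow X n) (toT X X X.δ)

/-- `1 + δ + δ ⊗ δ + ⋯`; the powers from the number of summands of `X` on vanish. -/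
def geom (X : C.PreTw) : TMat X X := ∑ n ∈ Finset.range (Fintype.card X.I), δpow X n

/-- Apply the products `b_n` to a matrix of sequences of morphisms. -/
def applyB {X Y : C.PreTw} (f : TMat X Y) : Mat X Y := fun i j => C.b.rTensor (Y.P j) ∘ₗ f i j

/-- The Maurer-Cartan equation `∑_{n ≥ 1} b_n(δ,…,δ) = 0` (`b` vanishes on the empty sequence). -/
def IsTwisted (X : C.PreTw) : Prop := applyB (geom X) = 0

/-- The Koszul sign of the degree of the source summand. -/
def signed {X Y : C.PreTw} (f : Mat X Y) : Mat X Y := fun i j => (Int.negOnePow (X.deg i) : ℤ) • f i j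

theorem extend_add {P P' : Type u} [AddCommGroup P] [Module S P] [AddCommGroup P'] [Module S P']
    (ψ ψ' : P →ₗ[S] TensorAlgebra S C.Mor ⊗[S] P') :
    extend (C := C) (ψ + ψ') = extend ψ + extend ψ' := by
  simp [extend, LinearMap.lTensor_add, LinearMap.comp_add]

theorem extend_smul {P P' : Type u} [AddCommGroup P] [Module S P] [AddCommGroup P'] [Module S P']
    (c : S) (ψ : P →ₗ[S] TensorAlgebra S C.Mor ⊗[S] P') :
    extend (C := C) (c • ψ) = c • extend ψ := by
  simp [extend, LinearMap.lTensor_smul, LinearMap.comp_smul]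

/-- The differential `f ↦ ± ∑ b(δ,…,δ,f,δ,…,δ)` of twisted complexes. -/
def d (X Y : C.PreTw) : Mat X Y →ₗ[S] Mat X Y where
  toFun f := signed (applyB (cat (cat (geom X) (toT X Y f)) (geom Y)))
  map_add' f g := by
    funext i j
    simp only [signed, applyB, cat, map_add, Mat.add_apply, Pi.add_apply, extend_add, LinearMap.add_comp,
      Finset.sum_add_distrib, LinearMap.comp_add, smul_add]
  map_smul' c f := by
    funext i j
    simp only [signed, applyB, cat, map_smul, Mat.smul_apply, Pi.smul_apply, extend_smul, LinearMap.smul_comp,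
      ← Finset.smul_sum, LinearMap.comp_smul, RingHom.id_apply]
    rw [smul_comm]

/-- The product `± ∑ b(δ,…,δ,f,δ,…,δ,g,δ,…,δ)` of twisted complexes (first `f`, then `g`).
On morphisms of degree `0` it represents the composition `g ∘ f`. -/
def comp {X Y Z : C.PreTw} (f : Mat X Y) (g : Mat Y Z) : Mat X Z :=
  signed (applyB (cat (cat (cat (cat (geom X) (toT X Y f)) (geom Y)) (toT Y Z g)) (geom Z)))

/-- The identity morphism. -/
def idMat (X : C.PreTw) : Mat X X :=
  signed (fun i => Pi.single i (TensorProduct.mk S C.Mor (X.P i) (C.id (X.obj i))))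

/-- The cocycles of degree `k`. -/
def cocycles (X Y : C.PreTw) (k : ℤ) : Submodule S (Mat X Y) :=
  homDeg X Y k ⊓ LinearMap.ker (d X Y)

/-- The coboundaries of degree `k`. -/
def coboundaries (X Y : C.PreTw) (k : ℤ) : Submodule S (Mat X Y) :=
  (homDeg X Y (k - 1)).map (d X Y)

/-- The cohomology `Hom^k(X,Y)` of the complex of morphisms of twisted complexes. -/
abbrev HomH (X Y : C.PreTw) (k : ℤ) : Type u :=
  cocycles X Y k ⧸ (coboundaries X Y k).submoduleOf (cocycles X Y k)

/-- The matrix `f` is a cocycle of degree `k` with cohomology class `x`. -/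
def Represents {X Y : C.PreTw} {k : ℤ} (f : Mat X Y) (x : HomH X Y k) : Prop :=
  ∃ hf : f ∈ cocycles X Y k, Submodule.Quotient.mk ⟨f, hf⟩ = x

/-! ### The spherical twist -/

theorem δpow_triangular (X : C.PreTw) (n : ℕ) :
    ∀ i j, δpow X (n + 1) i j ≠ 0 → X.rk i < X.rk j := by
  have step : ∀ (n : ℕ) (i k), δpow X (n + 1) i k ≠ 0 →
      ∃ j, δpow X n i j ≠ 0 ∧ X.rk j < X.rk k := by
    intro n i k h
    obtain ⟨j, -, hj⟩ := Finset.exists_ne_zero_of_sum_ne_zero h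
    refine ⟨j, fun h0 => hj (by rw [h0, LinearMap.comp_zero]), X.δ_triangular j k fun h0 => hj ?_⟩
    simp [toT, h0, extend]
  induction n with
  | zero =>
    intro i k h
    obtain ⟨j, h1, h2⟩ := step 0 i k h
    by_cases hij : j = i
    · rwa [← hij]
    · exact absurd (Pi.single_eq_of_ne hij _) h1
  | succ n ih =>
    intro i k h
    obtain ⟨j, h1, h2⟩ := step (n + 1) i k h
    exact (ih i j h1).trans h2

theorem b_ι (x : C.Mor) : C.b (TensorAlgebra.ι S x) = 0 := by
  have h : TensorAlgebra.equivDirectSum (TensorAlgebra.ι S x) =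
      DirectSum.of (fun n => ⨂[S]^n C.Mor) 1 (PiTensorProduct.tprod S fun _ : Fin 1 => x) :=
    TensorAlgebra.toDirectSum_ι x
  have h' : (C.bn 1) (fun _ => x) = 0 := by simp [bn, C.m_one]
  simp only [b, LinearMap.comp_apply, AlgEquiv.toLinearMap_apply, h]
  erw [DirectSum.toModule_lof]
  simpa using h'

/-- For `k : Mor ⊗ P_i` (a morphism from some object to `X`) and a matrix `f` of sequences of
morphisms: apply the products `b` to `k` followed by `f`. -/
def pushB {X Y : C.PreTw} (f : TMat X Y) (i : X.I) (j : Y.I) :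
    C.Mor ⊗[S] X.P i →ₗ[S] C.Mor ⊗[S] Y.P j :=
  C.b.rTensor (Y.P j) ∘ₗ extend (f i j) ∘ₗ (TensorAlgebra.ι S).rTensor (X.P i)

theorem pushB_geom_triangular (X : C.PreTw) (i j : X.I) (h : pushB (geom X) i j ≠ 0) :
    X.rk i < X.rk j := by
  by_contra hlt
  apply h
  have hpow : ∀ n, δpow X (n + 1) i j = 0 := fun n => by
    by_contra h0
    exact hlt (δpow_triangular X n i j h0)
  have hz : ∀ n, C.b.rTensor (X.P j) ∘ₗ extend (δpow X n i j) ∘ₗ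
      (TensorAlgebra.ι S).rTensor (X.P i) = 0 := by
    intro n
    cases n with
    | succ n => rw [hpow]; simp [extend]
    | zero =>
      by_cases hij : j = i
      · subst hij
        ext x p
        simp [δpow, extend, b_ι]
      · have : δpow X 0 i j = 0 := Pi.single_eq_of_ne hij _
        rw [this]; simp [extend]
  have hsum : ∀ s : Finset ℕ, C.b.rTensor (X.P j) ∘ₗ extend ((∑ n ∈ s, δpow X n) i j) ∘ₗ
      (TensorAlgebra.ι S).rTensor (X.P i) = 0 := by
    intro s
    induction s using Finset.induction_on with
    | empty => simp [extend]
    | insert a s ha ih =>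
      rw [Finset.sum_insert ha, Pi.add_apply, Pi.add_apply, extend_add, LinearMap.add_comp,
        LinearMap.comp_add, hz, ih, add_zero]
  exact hsum _

variable {F : C.Obj}

/-- The degrees in which `Hom(F,Y)` does not vanish. -/
abbrev Supp (F Y : C.Obj) : Type := {e : ℤ // C.Hom F Y e ≠ ⊥}

/-- The multiplicity modules of `T_F(X)`: the summands `Hom^e(F,X_i) ⊗ P_i` of `hom(F,X)`,
followed by those of `X`. -/
abbrev TwistP (F : C.Obj) (X : C.PreTw) : (Σ i, Supp F (X.obj i)) ⊕ X.I → Type u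
  | .inl q => C.Hom F (X.obj q.1) q.2 ⊗[S] X.P q.1
  | .inr i => X.P i

instance (X : C.PreTw) : ∀ q, AddCommGroup (TwistP F X q)
  | .inl q => inferInstanceAs (AddCommGroup (C.Hom F (X.obj q.1) q.2 ⊗[S] X.P q.1))
  | .inr i => inferInstanceAs (AddCommGroup (X.P i))

instance (X : C.PreTw) : ∀ q, Module S (TwistP F X q)
  | .inl q => inferInstanceAs (Module S (C.Hom F (X.obj q.1) q.2 ⊗[S] X.P q.1))
  | .inr i => inferInstanceAs (Module S (X.P i))

/-- The differential of `T_F(X) = Cone(hom(F,X) ⊗ F → X)`: the negative of the differential of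
`hom(F,X)`, tensored with `id_F`; the evaluation map; and the differential of `X`. -/
def twistδ (F : C.Obj) (X : C.PreTw) : ∀ q q' : (Σ i, Supp F (X.obj i)) ⊕ X.I,
    TwistP F X q →ₗ[S] C.Mor ⊗[S] TwistP F X q'
  | .inl ⟨i, e⟩, .inl ⟨j, e'⟩ =>
      if (e' : ℤ) = e + X.deg i - X.deg j + 1 then
        -(TensorProduct.mk S C.Mor (C.Hom F (X.obj j) e' ⊗[S] X.P j) (C.id F) ∘ₗ
          (C.proj F (X.obj j) e').rTensor (X.P j) ∘ₗ pushB (geom X) i j ∘ₗ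
            (C.Hom F (X.obj i) e).subtype.rTensor (X.P i))
      else 0
  | .inl ⟨i, e⟩, .inr j =>
      (Pi.single i ((C.Hom F (X.obj i) e).subtype.rTensor (X.P i)) :
        ∀ j, C.Hom F (X.obj i) e ⊗[S] X.P i →ₗ[S] C.Mor ⊗[S] X.P j) j
  | .inr _, .inl _ => 0
  | .inr i, .inr j => X.δ i j

/-- The spherical twist `T_F(X) = Cone(hom(F,X) ⊗ F → X)` on objects. -/
def twist (hF : C.IsOneSpherical F) (X : C.PreTw) : C.PreTw where
  I := (Σ i, Supp F (X.obj i)) ⊕ X.I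
  fintype :=
    haveI : ∀ Y, Finite (Supp F Y) := fun Y => (hF.perfect_left Y).1.to_subtype
    Fintype.ofFinite _
  obj := Sum.elim (fun _ => F) X.obj
  deg := Sum.elim (fun q => q.2 + X.deg q.1 - 1) X.deg
  P := TwistP F X
  finite
    | .inl q =>
      haveI := ((hF.perfect_left (X.obj q.1)).2 q.2).1
      inferInstanceAs (Module.Finite S (C.Hom F (X.obj q.1) q.2 ⊗[S] X.P q.1))
    | .inr i => inferInstanceAs (Module.Finite S (X.P i))
  projective
    | .inl q =>
      haveI := ((hF.perfect_left (X.obj q.1)).2 q.2).2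
      inferInstanceAs (Module.Projective S (C.Hom F (X.obj q.1) q.2 ⊗[S] X.P q.1))
    | .inr i => inferInstanceAs (Module.Projective S (X.P i))
  rk := Sum.elim (fun q => X.rk q.1) (fun i => X.rk i + 1)
  δ := twistδ F X
  δ_mem := by
    rintro (⟨i, e⟩ | i) (⟨j, e'⟩ | j) p
    · by_cases h : (e' : ℤ) = e + X.deg i - X.deg j + 1
      · have h0 : 1 + ((e : ℤ) + X.deg i - 1) - ((e' : ℤ) + X.deg j - 1) = 0 := by omega
        have hid : C.id F ∈ C.Hom F F (1 + ((e : ℤ) + X.deg i - 1) - ((e' : ℤ) + X.deg j - 1)) := by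
          rw [h0]; exact C.id_mem F
        have key : twistδ F X (.inl ⟨i, e⟩) (.inl ⟨j, e'⟩) = _ := if_pos h
        rw [key]
        refine Submodule.neg_mem _ (x := (TensorProduct.mk S C.Mor _ (C.id F)) _) ?_
        exact LinearMap.mem_range.mpr ⟨⟨C.id F, hid⟩ ⊗ₜ _, rfl⟩
      · have key : twistδ F X (.inl ⟨i, e⟩) (.inl ⟨j, e'⟩) = 0 := if_neg h
        rw [key]
        exact Submodule.zero_mem _
    · by_cases hij : j = i
      · subst hij
        have h0 : 1 + ((e : ℤ) + X.deg j - 1) - X.deg j = e := by omega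
        have key : twistδ F X (.inl ⟨j, e⟩) (.inr j) = _ := Pi.single_eq_same _ _
        rw [key]
        change (C.Hom F (X.obj j) e).subtype.rTensor (X.P j) p ∈ LinearMap.range
          ((C.Hom F (X.obj j) (1 + ((e : ℤ) + X.deg j - 1) - X.deg j)).subtype.rTensor (X.P j))
        rw [h0]
        exact ⟨p, rfl⟩
      · have key : twistδ F X (.inl ⟨i, e⟩) (.inr j) = 0 := Pi.single_eq_of_ne hij _
        rw [key]
        exact Submodule.zero_mem _
    · exact Submodule.zero_mem _
    · exact X.δ_mem i j p
  δ_triangular := by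
    rintro (⟨i, e⟩ | i) (⟨j, e'⟩ | j) h
    · refine pushB_geom_triangular X i j fun h0 => h ?_
      simp only [twistδ, h0, LinearMap.zero_comp, LinearMap.comp_zero, neg_zero]
      exact ite_self _
    · by_cases hij : j = i
      · subst hij; simp
      · exact absurd (Pi.single_eq_of_ne hij _) h
    · exact absurd rfl h
    · simpa using X.δ_triangular i j h

/-- The spherical twist on morphisms: a morphism `f : X → Y` acts by `f` on `X` and by the product
with `f` on `hom(F,X)`. -/
def twistMap (hF : C.IsOneSpherical F) {X Y : C.PreTw} (f : Mat X Y) :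
    Mat (twist hF X) (twist hF Y)
  | .inl ⟨i, e⟩, .inl ⟨j, e'⟩ =>
      -(TensorProduct.mk S C.Mor (C.Hom F (Y.obj j) e' ⊗[S] Y.P j) (C.id F) ∘ₗ
        (C.proj F (Y.obj j) e').rTensor (Y.P j) ∘ₗ
          pushB (cat (cat (geom X) (toT X Y f)) (geom Y)) i j ∘ₗ
            (C.Hom F (X.obj i) e).subtype.rTensor (X.P i))
  | .inl _, .inr _ => 0
  | .inr _, .inl _ => 0
  | .inr i, .inr j => f i j

/-- The natural morphism `X → T_F(X)`. -/
def toTwist (hF : C.IsOneSpherical F) (X : C.PreTw) : Mat X (twist hF X)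
  | _, .inl _ => 0
  | i, .inr j => idMat X i j

/-- `E_i = T_F^i(E)`. -/
def tower (hF : C.IsOneSpherical F) (E : C.Obj) : ℕ → C.PreTw
  | 0 => single E
  | i + 1 => twist hF (tower hF E i)

/-- `T_F^j(a) : E_j → E_{i+j}` for `a : E_0 → E_i`. -/
def twistPow (hF : C.IsOneSpherical F) {E : C.Obj} {i : ℕ}
    (a : Mat (tower hF E 0) (tower hF E i)) : ∀ j, Mat (tower hF E j) (tower hF E (i + j))
  | 0 => a
  | j + 1 => twistMap hF (twistPow hF a j)

/-- The product `a b = T_F^j(a) ∘ b` of `a : E_0 → E_i` and `b : E_0 → E_j`. -/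
def mulMat (hF : C.IsOneSpherical F) {E : C.Obj} {i j : ℕ}
    (a : Mat (tower hF E 0) (tower hF E i)) (b : Mat (tower hF E 0) (tower hF E j)) :
    Mat (tower hF E 0) (tower hF E (i + j)) :=
  comp b (twistPow hF a j)

/-- The component `R_i = Hom⁰(E_0,E_i)`. -/
abbrev R (hF : C.IsOneSpherical F) (E : C.Obj) (i : ℕ) : Type u :=
  HomH (tower hF E 0) (tower hF E i) 0

end PreTw

/-! ### The products of a weak `n`-pair -/

section Pair

variable {E F : C.Obj} (θ : S ≃ₗ[S] C.Hom F F 1)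

/-- The pairing `Hom¹(F,E) × Hom⁰(E,F) → Hom¹(F,F) ≅ S`, `⟨u,v⟩ ξ_F = v ∘ u`. -/
def pair : C.Hom F E 1 →ₗ[S] Module.Dual S (C.Hom E F 0) :=
  (C.compHom F E F 1 0 1).flip.compr₂ θ.symm.toLinearMap

theorem pair_bijective (hF : C.IsOneSpherical F) : Function.Bijective (C.pair (E := E) θ) := by
  have := ((hF.perfect_left E).2 1).1
  have := ((hF.perfect_left E).2 1).2
  have hb := hF.duality E 1 0 (by norm_num)
  let ψ : C.Hom E F 0 ≃ₗ[S] Module.Dual S (C.Hom F E 1) :=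
    (LinearEquiv.ofBijective _ hb).trans (LinearEquiv.congrRight θ.symm)
  have h : C.pair (E := E) θ = ((Module.evalEquiv S (C.Hom F E 1)).trans ψ.dualMap).toLinearMap := by
    ext u v
    simp [pair, ψ]
    rfl
  rw [h]
  exact LinearEquiv.bijective _

/-- The identification `Hom¹(F,E) ≅ V^∨`, where `V = Hom⁰(E,F)`. -/
def pairEquiv (hF : C.IsOneSpherical F) : C.Hom F E 1 ≃ₗ[S] Module.Dual S (C.Hom E F 0) :=
  LinearEquiv.ofBijective (C.pair θ) (C.pair_bijective θ hF)

variable {n : ℕ} (hF : C.IsOneSpherical F) (e : Module.Basis (Fin n) S (C.Hom E F 0))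

/-- The dual basis `(e_i^*)` of `Hom¹(F,E) ≅ V^∨`. -/
def dualVec (i : Fin n) : C.Hom F E 1 := (C.pairEquiv θ hF).symm (e.coord i)

/-- The element `g ∈ End(V) ⊗ L_E`, with `⟨e_i^*, g e_j⟩ = e_i^* ∘ e_j ∈ Hom¹(E,E) = L_E`. -/
def gElt : Module.End S (C.Hom E F 0) ⊗[S] C.Hom E E 1 :=
  ∑ i, ∑ j, (e.coord j).smulRight (e i) ⊗ₜ[S] C.compHom E F E 0 1 1 (C.dualVec θ hF e i) (e j)

/-- `r(v ⊗ v^*) = ∑_i m₃(e_i, v^*, v) ⊗ e_i^*`; here `a = ∑_j a(e_j) ⊗ e_j^*`. -/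
def rMap (a : Module.End S (C.Hom E F 0)) : Module.End S (C.Hom E F 0) :=
  ∑ i, (e.coord i).smulRight (∑ j, C.proj E F 0 (C.m₃ (e i) (C.dualVec θ hF e j) (a (e j))))

/-- `r'(v ⊗ v^*) = ∑_i e_i ⊗ m₃(v^*, v, e_i^*)`; here `a = ∑_j a(e_j) ⊗ e_j^*`. -/
def rMap' (a : Module.End S (C.Hom E F 0)) : Module.End S (C.Hom E F 0) :=
  ∑ i, (C.pair θ (∑ j, C.proj F E 1
    (C.m₃ (C.dualVec θ hF e j) (a (e j)) (C.dualVec θ hF e i)))).smulRight (e i)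

/-- `s(v ⊗ v^*) = m₃(v^*, ξ_F, v)`; here `a = ∑_j a(e_j) ⊗ e_j^*`. -/
def sMap (a : Module.End S (C.Hom E F 0)) : C.Hom E E 1 :=
  ∑ j, C.proj E E 1 (C.m₃ (C.dualVec θ hF e j) (θ 1) (a (e j)))

/-- `m₄((v ⊗ v^*) ⊗ (w ⊗ w^*)) = m₄(v^*, v, w^*, w)`; here `a = ∑_j a(e_j) ⊗ e_j^*`, and similarly
for `b`. -/
def m₄Map (a b : Module.End S (C.Hom E F 0)) : C.Mor :=
  ∑ j, ∑ k, C.m₄ (C.dualVec θ hF e j) (a (e j)) (C.dualVec θ hF e k) (b (e k))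

end Pair

end MinimalAInfCat

end

noncomputable section

attribute [local instance] Classical.propDecidable

/-! ### Matrices with coefficients -/

section Entry

variable {S : Type u} [CommRing S] {M N K M' N' K' : Type u}
  [AddCommMonoid M] [Module S M] [AddCommMonoid N] [Module S N] [AddCommMonoid K] [Module S K]
  [AddCommMonoid M'] [Module S M'] [AddCommMonoid N'] [Module S N'] [AddCommMonoid K'] [Module S K']
  {P Q R : Type u} [AddCommGroup P] [Module S P] [AddCommGroup Q] [Module S Q]
  [AddCommGroup R] [Module S R]

/-- Apply an entry `ψ : P → N ⊗ Q` to `M ⊗ P`, multiplying the coefficients by `β`. -/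
def extendBy (β : M →ₗ[S] N →ₗ[S] K) (ψ : P →ₗ[S] N ⊗[S] Q) : M ⊗[S] P →ₗ[S] K ⊗[S] Q :=
  (TensorProduct.lift β).rTensor Q ∘ₗ (TensorProduct.assoc S M N Q).symm.toLinearMap ∘ₗ
    ψ.lTensor M

theorem extendBy_tmul (β : M →ₗ[S] N →ₗ[S] K) (ψ : P →ₗ[S] N ⊗[S] Q) (m : M) (p : P) :
    extendBy β ψ (m ⊗ₜ p) = (β m).rTensor Q (ψ p) := by
  simp only [extendBy, LinearMap.comp_apply, LinearMap.lTensor_tmul]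
  generalize ψ p = z
  induction z using TensorProduct.induction_on with
  | zero => simp
  | tmul n q => simp
  | add x y hx hy => rw [TensorProduct.tmul_add, map_add, map_add, map_add, hx, hy]

theorem extendBy_add (β : M →ₗ[S] N →ₗ[S] K) (ψ ψ' : P →ₗ[S] N ⊗[S] Q) :
    extendBy β (ψ + ψ') = extendBy β ψ + extendBy β ψ' := by
  simp [extendBy, LinearMap.lTensor_add, LinearMap.comp_add]

theorem extendBy_smul (β : M →ₗ[S] N →ₗ[S] K) (c : S) (ψ : P →ₗ[S] N ⊗[S] Q) :
    extendBy β (c • ψ) = c • extendBy β ψ := by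
  simp [extendBy, LinearMap.lTensor_smul, LinearMap.comp_smul]

theorem extendBy_zero (β : M →ₗ[S] N →ₗ[S] K) : extendBy β (0 : P →ₗ[S] N ⊗[S] Q) = 0 := by
  simp [extendBy]

theorem rTensor_comp_extendBy (β : M →ₗ[S] N →ₗ[S] K) (θ : K →ₗ[S] K')
    (ψ : P →ₗ[S] N ⊗[S] Q) :
    θ.rTensor Q ∘ₗ extendBy β ψ = extendBy (β.compr₂ θ) ψ := by
  refine TensorProduct.ext' fun m p => ?_
  rw [LinearMap.comp_apply, extendBy_tmul, extendBy_tmul, ← LinearMap.comp_apply,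
    ← LinearMap.rTensor_comp]
  rfl

theorem extendBy_comp_rTensor (β : M →ₗ[S] N →ₗ[S] K) (θ : M' →ₗ[S] M)
    (ψ : P →ₗ[S] N ⊗[S] Q) :
    extendBy β ψ ∘ₗ θ.rTensor P = extendBy (β ∘ₗ θ) ψ := by
  refine TensorProduct.ext' fun m p => ?_
  rw [LinearMap.comp_apply, LinearMap.rTensor_tmul, extendBy_tmul, extendBy_tmul]
  rfl

theorem extendBy_rTensor_comp (β : M →ₗ[S] N →ₗ[S] K) (θ : N' →ₗ[S] N)
    (ψ : P →ₗ[S] N' ⊗[S] Q) :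
    extendBy β (θ.rTensor Q ∘ₗ ψ) = extendBy (β.compl₂ θ) ψ := by
  refine TensorProduct.ext' fun m p => ?_
  rw [extendBy_tmul, extendBy_tmul, LinearMap.comp_apply, ← LinearMap.comp_apply,
    ← LinearMap.rTensor_comp]
  rfl

theorem extendBy_assoc {L : Type u} [AddCommMonoid L] [Module S L]
    (β : M →ₗ[S] N →ₗ[S] M') (β' : M' →ₗ[S] K →ₗ[S] L)
    (γ : N →ₗ[S] K →ₗ[S] N') (γ' : M →ₗ[S] N' →ₗ[S] L)
    (h : ∀ m n k, β' (β m n) k = γ' m (γ n k))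
    (φ : P →ₗ[S] N ⊗[S] Q) (ψ : Q →ₗ[S] K ⊗[S] R) :
    extendBy β' ψ ∘ₗ extendBy β φ = extendBy γ' (extendBy γ ψ ∘ₗ φ) := by
  refine TensorProduct.ext' fun m p => ?_
  rw [LinearMap.comp_apply, extendBy_tmul, extendBy_tmul, LinearMap.comp_apply]
  generalize φ p = z
  induction z using TensorProduct.induction_on with
  | zero => simp
  | tmul n q =>
    rw [LinearMap.rTensor_tmul, extendBy_tmul, extendBy_tmul,
      ← LinearMap.comp_apply (LinearMap.rTensor R (γ' m)), ← LinearMap.rTensor_comp]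
    congr 2
    ext k
    exact h m n k
  | add x y hx hy => rw [map_add, map_add, map_add, map_add, hx, hy]

end Entry

namespace MinimalAInfCat

namespace PreTw

variable {S : Type u} [CommRing S] {C : MinimalAInfCat.{u, w} S}
  {M N K M' N' K' : Type u}
  [AddCommMonoid M] [Module S M] [AddCommMonoid N] [Module S N] [AddCommMonoid K] [Module S K]
  [AddCommMonoid M'] [Module S M'] [AddCommMonoid N'] [Module S N'] [AddCommMonoid K'] [Module S K']
  {W X Y Z : C.PreTw}

variable (M) in
/-- Matrices with coefficients in `M`. -/
abbrev CMat (X Y : C.PreTw) : Type u := ∀ i j, X.P i →ₗ[S] M ⊗[S] Y.P j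

/-- Matrices of linear maps. -/
abbrev LMat (X Y : C.PreTw) : Type u := ∀ i j, X.P i →ₗ[S] Y.P j

/-- The matrix product (first `f`, then `g`), multiplying the coefficients by `β`. -/
def mulBy (β : M →ₗ[S] N →ₗ[S] K) (f : CMat M X Y) (g : CMat N Y Z) : CMat K X Z :=
  fun i k => ∑ j, extendBy β (g j k) ∘ₗ f i j

theorem mulBy_apply (β : M →ₗ[S] N →ₗ[S] K) (f : CMat M X Y) (g : CMat N Y Z) (i k) :
    mulBy β f g i k = ∑ j, extendBy β (g j k) ∘ₗ f i j := rfl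

/-- Change of coefficients. -/
def mapC (θ : M →ₗ[S] N) (f : CMat M X Y) : CMat N X Y := fun i j => θ.rTensor (Y.P j) ∘ₗ f i j

theorem mapC_apply (θ : M →ₗ[S] N) (f : CMat M X Y) (i j) :
    mapC θ f i j = θ.rTensor (Y.P j) ∘ₗ f i j := rfl

/-- The product of matrices of linear maps (first `A`, then `B`). -/
def lmul (A : LMat X Y) (B : LMat Y Z) : LMat X Z := fun i k => ∑ j, B j k ∘ₗ A i j

/-- The left action of matrices of linear maps (first `A`, then `f`). -/
def lact (A : LMat X Y) (f : CMat M Y Z) : CMat M X Z := fun i k => ∑ j, f j k ∘ₗ A i j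

/-- The right action of matrices of linear maps (first `f`, then `A`). -/
def ract (f : CMat M X Y) (A : LMat Y Z) : CMat M X Z :=
  fun i k => ∑ j, (A j k).lTensor M ∘ₗ f i j

theorem lmul_apply (A : LMat X Y) (B : LMat Y Z) (i k) :
    lmul A B i k = ∑ j, B j k ∘ₗ A i j := rfl

theorem lact_apply (A : LMat X Y) (f : CMat M Y Z) (i k) :
    lact A f i k = ∑ j, f j k ∘ₗ A i j := rfl

theorem ract_apply (f : CMat M X Y) (A : LMat Y Z) (i k) :
    ract f A i k = ∑ j, (A j k).lTensor M ∘ₗ f i j := rfl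

theorem mapC_mulBy (θ : K →ₗ[S] K') (β : M →ₗ[S] N →ₗ[S] K) (f : CMat M X Y) (g : CMat N Y Z) :
    mapC θ (mulBy β f g) = mulBy (β.compr₂ θ) f g := by
  funext i k
  simp only [mapC_apply, mulBy_apply, ← rTensor_comp_extendBy, LinearMap.comp_assoc]
  ext p
  simp

theorem mulBy_mapC_left (θ : M' →ₗ[S] M) (β : M →ₗ[S] N →ₗ[S] K) (f : CMat M' X Y)
    (g : CMat N Y Z) : mulBy β (mapC θ f) g = mulBy (β ∘ₗ θ) f g := by
  funext i k
  simp only [mapC_apply, mulBy_apply, ← extendBy_comp_rTensor, LinearMap.comp_assoc]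

theorem mulBy_mapC_right (θ : N' →ₗ[S] N) (β : M →ₗ[S] N →ₗ[S] K) (f : CMat M X Y)
    (g : CMat N' Y Z) : mulBy β f (mapC θ g) = mulBy (β.compl₂ θ) f g := by
  funext i k
  simp only [mapC_apply, mulBy_apply, ← extendBy_rTensor_comp]

theorem mapC_mapC (θ : M →ₗ[S] N) (θ' : N →ₗ[S] K) (f : CMat M X Y) :
    mapC θ' (mapC θ f) = mapC (θ' ∘ₗ θ) f := by
  funext i k
  simp only [mapC_apply, LinearMap.rTensor_comp, LinearMap.comp_assoc]

theorem mapC_id (f : CMat M X Y) : mapC LinearMap.id f = f := by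
  funext i k
  simp only [mapC_apply, LinearMap.rTensor_id, LinearMap.id_comp]

theorem mapC_map_add (θ θ' : M →ₗ[S] N) (f : CMat M X Y) :
    mapC (θ + θ') f = mapC θ f + mapC θ' f := by
  funext i k
  simp only [mapC_apply, LinearMap.rTensor_add, LinearMap.add_comp, Pi.add_apply]

theorem mapC_map_smul (c : S) (θ : M →ₗ[S] N) (f : CMat M X Y) :
    mapC (c • θ) f = c • mapC θ f := by
  funext i k
  simp only [mapC_apply, LinearMap.rTensor_smul, LinearMap.smul_comp, Pi.smul_apply]

theorem mapC_map_zero (f : CMat M X Y) : mapC (0 : M →ₗ[S] N) f = 0 := by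
  funext i k
  simp only [mapC_apply, LinearMap.rTensor_zero, LinearMap.zero_comp, Pi.zero_apply]

theorem mulBy_assoc {L : Type u} [AddCommMonoid L] [Module S L]
    (β : M →ₗ[S] N →ₗ[S] M') (β' : M' →ₗ[S] K →ₗ[S] L)
    (γ : N →ₗ[S] K →ₗ[S] N') (γ' : M →ₗ[S] N' →ₗ[S] L)
    (h : ∀ m n k, β' (β m n) k = γ' m (γ n k))
    (e : CMat M W X) (f : CMat N X Y) (g : CMat K Y Z) :
    mulBy β' (mulBy β e f) g = mulBy γ' e (mulBy γ f g) := by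
  funext i l
  have hs : ∀ j, extendBy γ' (∑ k, extendBy γ (g k l) ∘ₗ f j k) =
      ∑ k, extendBy γ' (extendBy γ (g k l) ∘ₗ f j k) := fun j => by
    refine map_sum (⟨⟨extendBy γ', extendBy_zero γ'⟩, extendBy_add γ'⟩ :
      (X.P j →ₗ[S] N' ⊗[S] Z.P l) →+ _) _ _
  simp only [mulBy_apply, hs, ← extendBy_assoc β β' γ γ' h]
  ext p
  simp only [LinearMap.sum_apply, LinearMap.comp_apply, map_sum]
  exact Finset.sum_comm

theorem mulBy_add_coeff (β β' : M →ₗ[S] N →ₗ[S] K) (f : CMat M X Y) (g : CMat N Y Z) :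
    mulBy (β + β') f g = mulBy β f g + mulBy β' f g := by
  funext i k
  have : ∀ j, extendBy (β + β') (g j k) = extendBy β (g j k) + extendBy β' (g j k) := fun j => by
    refine TensorProduct.ext' fun m p => ?_
    simp [extendBy_tmul, LinearMap.rTensor_add]
  simp only [mulBy_apply, this, LinearMap.add_comp, Finset.sum_add_distrib, Pi.add_apply]

theorem mulBy_add_left (β : M →ₗ[S] N →ₗ[S] K) (f f' : CMat M X Y) (g : CMat N Y Z) :
    mulBy β (f + f') g = mulBy β f g + mulBy β f' g := by
  funext i k
  simp only [mulBy_apply, Pi.add_apply, LinearMap.comp_add, Finset.sum_add_distrib]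

theorem mulBy_add_right (β : M →ₗ[S] N →ₗ[S] K) (f : CMat M X Y) (g g' : CMat N Y Z) :
    mulBy β f (g + g') = mulBy β f g + mulBy β f g' := by
  funext i k
  simp only [mulBy_apply, Pi.add_apply, extendBy_add, LinearMap.add_comp, Finset.sum_add_distrib]

theorem mulBy_smul_left (β : M →ₗ[S] N →ₗ[S] K) (c : S) (f : CMat M X Y) (g : CMat N Y Z) :
    mulBy β (c • f) g = c • mulBy β f g := by
  funext i k
  simp only [mulBy_apply, Pi.smul_apply, LinearMap.comp_smul, Finset.smul_sum]

theorem mulBy_smul_right (β : M →ₗ[S] N →ₗ[S] K) (c : S) (f : CMat M X Y) (g : CMat N Y Z) :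
    mulBy β f (c • g) = c • mulBy β f g := by
  funext i k
  simp only [mulBy_apply, Pi.smul_apply, extendBy_smul, LinearMap.smul_comp, Finset.smul_sum]

theorem mulBy_zero_left (β : M →ₗ[S] N →ₗ[S] K) (g : CMat N Y Z) :
    mulBy β (0 : CMat M X Y) g = 0 := by
  simpa only [zero_smul] using mulBy_smul_left β 0 (0 : CMat M X Y) g

theorem mulBy_zero_right (β : M →ₗ[S] N →ₗ[S] K) (f : CMat M X Y) :
    mulBy β f (0 : CMat N Y Z) = 0 := by
  simpa only [zero_smul] using mulBy_smul_right β 0 f (0 : CMat N Y Z)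

theorem mulBy_sum_left {ι : Type*} (β : M →ₗ[S] N →ₗ[S] K) (s : Finset ι) (f : ι → CMat M X Y)
    (g : CMat N Y Z) : mulBy β (∑ k ∈ s, f k) g = ∑ k ∈ s, mulBy β (f k) g :=
  map_sum (⟨⟨fun f => mulBy β f g, mulBy_zero_left β g⟩, fun f f' => mulBy_add_left β f f' g⟩ :
    CMat M X Y →+ CMat K X Z) _ _

theorem mulBy_sum_right {ι : Type*} (β : M →ₗ[S] N →ₗ[S] K) (s : Finset ι) (f : CMat M X Y)
    (g : ι → CMat N Y Z) : mulBy β f (∑ k ∈ s, g k) = ∑ k ∈ s, mulBy β f (g k) :=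
  map_sum (⟨⟨mulBy β f, mulBy_zero_right β f⟩, mulBy_add_right β f⟩ :
    CMat N Y Z →+ CMat K X Z) _ _

theorem mapC_add (θ : M →ₗ[S] N) (f g : CMat M X Y) : mapC θ (f + g) = mapC θ f + mapC θ g := by
  funext i k
  simp only [mapC_apply, Pi.add_apply, LinearMap.comp_add]

theorem mapC_smul (θ : M →ₗ[S] N) (c : S) (f : CMat M X Y) : mapC θ (c • f) = c • mapC θ f := by
  funext i k
  simp only [mapC_apply, Pi.smul_apply, LinearMap.comp_smul]

theorem mapC_zero (θ : M →ₗ[S] N) : mapC θ (0 : CMat M X Y) = 0 := by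
  funext i k
  simp only [mapC_apply, Pi.zero_apply, LinearMap.comp_zero]

theorem mapC_sum {ι : Type*} (θ : M →ₗ[S] N) (s : Finset ι) (f : ι → CMat M X Y) :
    mapC θ (∑ k ∈ s, f k) = ∑ k ∈ s, mapC θ (f k) :=
  map_sum (⟨⟨mapC θ, mapC_zero θ⟩, mapC_add θ⟩ : CMat M X Y →+ CMat N X Y) _ _

theorem lact_add (A : LMat X Y) (f g : CMat M Y Z) : lact A (f + g) = lact A f + lact A g := by
  funext i k
  simp only [lact_apply, Pi.add_apply, LinearMap.add_comp, Finset.sum_add_distrib]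

theorem add_lact (A B : LMat X Y) (f : CMat M Y Z) : lact (A + B) f = lact A f + lact B f := by
  funext i k
  simp only [lact_apply, Pi.add_apply, LinearMap.comp_add, Finset.sum_add_distrib]

theorem lact_smul (A : LMat X Y) (c : S) (f : CMat M Y Z) : lact A (c • f) = c • lact A f := by
  funext i k
  simp only [lact_apply, Pi.smul_apply, LinearMap.smul_comp, Finset.smul_sum]

theorem smul_lact (c : S) (A : LMat X Y) (f : CMat M Y Z) : lact (c • A) f = c • lact A f := by
  funext i k
  simp only [lact_apply, Pi.smul_apply, LinearMap.comp_smul, Finset.smul_sum]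

theorem lact_zero (A : LMat X Y) : lact A (0 : CMat M Y Z) = 0 := by
  funext i k
  simp only [lact_apply, Pi.zero_apply, LinearMap.zero_comp, Finset.sum_const_zero]

theorem zero_lact (f : CMat M Y Z) : lact (0 : LMat X Y) f = 0 := by
  funext i k
  simp only [lact_apply, Pi.zero_apply, LinearMap.comp_zero, Finset.sum_const_zero]

theorem lact_sum {ι : Type*} (A : LMat X Y) (s : Finset ι) (f : ι → CMat M Y Z) :
    lact A (∑ k ∈ s, f k) = ∑ k ∈ s, lact A (f k) :=
  map_sum (⟨⟨lact A, lact_zero A⟩, lact_add A⟩ : CMat M Y Z →+ CMat M X Z) _ _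

theorem add_ract (f g : CMat M X Y) (A : LMat Y Z) : ract (f + g) A = ract f A + ract g A := by
  funext i k
  simp only [ract_apply, Pi.add_apply, LinearMap.comp_add, Finset.sum_add_distrib]

theorem ract_add (f : CMat M X Y) (A B : LMat Y Z) : ract f (A + B) = ract f A + ract f B := by
  funext i k
  simp only [ract_apply, Pi.add_apply, LinearMap.lTensor_add, LinearMap.add_comp,
    Finset.sum_add_distrib]

theorem smul_ract (c : S) (f : CMat M X Y) (A : LMat Y Z) : ract (c • f) A = c • ract f A := by
  funext i k
  simp only [ract_apply, Pi.smul_apply, LinearMap.comp_smul, Finset.smul_sum]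

theorem ract_smul (f : CMat M X Y) (c : S) (A : LMat Y Z) : ract f (c • A) = c • ract f A := by
  funext i k
  simp only [ract_apply, Pi.smul_apply, LinearMap.lTensor_smul, LinearMap.smul_comp,
    Finset.smul_sum]

theorem zero_ract (A : LMat Y Z) : ract (0 : CMat M X Y) A = 0 := by
  simpa only [zero_smul] using smul_ract 0 (0 : CMat M X Y) A

theorem ract_zero (f : CMat M X Y) : ract f (0 : LMat Y Z) = 0 := by
  simpa only [zero_smul] using ract_smul f 0 (0 : LMat Y Z)

theorem sum_ract {ι : Type*} (s : Finset ι) (f : ι → CMat M X Y) (A : LMat Y Z) :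
    ract (∑ k ∈ s, f k) A = ∑ k ∈ s, ract (f k) A :=
  map_sum (⟨⟨fun f => ract f A, zero_ract A⟩, fun f g => add_ract f g A⟩ :
    CMat M X Y →+ CMat M X Z) _ _

theorem lmul_add (A : LMat X Y) (B D : LMat Y Z) : lmul A (B + D) = lmul A B + lmul A D := by
  funext i k
  simp only [lmul_apply, Pi.add_apply, LinearMap.add_comp, Finset.sum_add_distrib]

theorem lmul_smul (A : LMat X Y) (c : S) (B : LMat Y Z) : lmul A (c • B) = c • lmul A B := by
  funext i k
  simp only [lmul_apply, Pi.smul_apply, LinearMap.smul_comp, Finset.smul_sum]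

theorem smul_lmul (c : S) (A : LMat X Y) (B : LMat Y Z) : lmul (c • A) B = c • lmul A B := by
  funext i k
  simp only [lmul_apply, Pi.smul_apply, LinearMap.comp_smul, Finset.smul_sum]

theorem lmul_zero (A : LMat X Y) : lmul A (0 : LMat Y Z) = 0 := by
  simpa only [zero_smul] using lmul_smul A 0 (0 : LMat Y Z)

theorem zero_lmul (A : LMat Y Z) : lmul (0 : LMat X Y) A = 0 := by
  simpa only [zero_smul] using smul_lmul 0 (0 : LMat X Y) A

theorem neg_lmul (A : LMat X Y) (B : LMat Y Z) : lmul (-A) B = -lmul A B := by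
  funext i k
  simp only [lmul_apply, Pi.neg_apply, LinearMap.comp_neg, Finset.sum_neg_distrib]

theorem lmul_neg (A : LMat X Y) (B : LMat Y Z) : lmul A (-B) = -lmul A B := by
  funext i k
  simp only [lmul_apply, Pi.neg_apply, LinearMap.neg_comp, Finset.sum_neg_distrib]

section Group

variable {M N : Type u} [AddCommGroup M] [Module S M] [AddCommGroup N] [Module S N]

theorem neg_lact (A : LMat X Y) (f : CMat M Y Z) : lact (-A) f = -lact A f := by
  funext i k
  simp only [lact_apply, Pi.neg_apply, LinearMap.comp_neg, Finset.sum_neg_distrib]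

theorem lact_neg (A : LMat X Y) (f : CMat M Y Z) : lact A (-f) = -lact A f := by
  funext i k
  simp only [lact_apply, Pi.neg_apply, LinearMap.neg_comp, Finset.sum_neg_distrib]

theorem neg_ract (f : CMat M X Y) (A : LMat Y Z) : ract (-f) A = -ract f A := by
  funext i k
  simp only [ract_apply, Pi.neg_apply, LinearMap.comp_neg, Finset.sum_neg_distrib]

theorem ract_neg (f : CMat M X Y) (A : LMat Y Z) : ract f (-A) = -ract f A := by
  funext i k
  simp only [ract_apply, Pi.neg_apply, LinearMap.lTensor_neg, LinearMap.neg_comp,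
    Finset.sum_neg_distrib]

end Group

theorem cmat_add_left_cancel {f g h : CMat M X Y} (e : f + g = f + h) : g = h := by
  have h0 : ∀ x : CMat M X Y, (-1 : S) • f + (f + x) = x := fun x => by
    conv_lhs => rw [← add_assoc, ← one_smul S f, smul_smul, mul_one, ← add_smul, neg_add_cancel,
      zero_smul, zero_add]
  rw [← h0 g, e, h0]

/-! #### Matrices of linear maps -/

theorem lact_lact (A : LMat W X) (B : LMat X Y) (f : CMat M Y Z) :
    lact A (lact B f) = lact (lmul A B) f := by
  funext i l
  ext p
  simp only [lact_apply, lmul_apply, LinearMap.sum_apply, LinearMap.comp_apply, map_sum]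
  exact Finset.sum_comm

theorem ract_ract (f : CMat M W X) (A : LMat X Y) (B : LMat Y Z) :
    ract (ract f A) B = ract f (lmul A B) := by
  funext i l
  ext p
  have : ∀ j, (∑ k, B k l ∘ₗ A j k).lTensor M = ∑ k, (B k l).lTensor M ∘ₗ (A j k).lTensor M :=
    fun j => by
      simp only [← LinearMap.lTensor_comp]
      exact map_sum (LinearMap.lTensorHom M) _ _
  simp only [ract_apply, lmul_apply, this, LinearMap.sum_apply, LinearMap.comp_apply, map_sum]
  exact Finset.sum_comm

theorem lmul_assoc (A : LMat W X) (B : LMat X Y) (D : LMat Y Z) :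
    lmul (lmul A B) D = lmul A (lmul B D) := by
  funext i l
  ext p
  simp only [lmul_apply, LinearMap.sum_apply, LinearMap.comp_apply, map_sum]
  exact Finset.sum_comm

theorem lact_ract (A : LMat W X) (f : CMat M X Y) (B : LMat Y Z) :
    lact A (ract f B) = ract (lact A f) B := by
  funext i l
  ext p
  simp only [lact_apply, ract_apply, LinearMap.sum_apply, LinearMap.comp_apply, map_sum]
  exact Finset.sum_comm

theorem mulBy_lact (β : M →ₗ[S] N →ₗ[S] K) (A : LMat W X) (f : CMat M X Y) (g : CMat N Y Z) :
    mulBy β (lact A f) g = lact A (mulBy β f g) := by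
  funext i l
  ext p
  simp only [lact_apply, mulBy_apply, LinearMap.sum_apply, LinearMap.comp_apply, map_sum]
  exact Finset.sum_comm

theorem mulBy_ract_right (β : M →ₗ[S] N →ₗ[S] K) (f : CMat M W X) (g : CMat N X Y)
    (A : LMat Y Z) : mulBy β f (ract g A) = ract (mulBy β f g) A := by
  funext i l
  have h1 : ∀ j k, extendBy β ((A k l).lTensor N ∘ₗ g j k) =
      (A k l).lTensor K ∘ₗ extendBy β (g j k) := fun j k => by
    refine TensorProduct.ext' fun m p => ?_
    simp only [LinearMap.comp_apply, extendBy_tmul]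
    rw [← LinearMap.comp_apply, LinearMap.rTensor_comp_lTensor,
      ← LinearMap.lTensor_comp_rTensor, LinearMap.comp_apply]
  have hs : ∀ j, extendBy β (∑ k, (A k l).lTensor N ∘ₗ g j k) =
      ∑ k, (A k l).lTensor K ∘ₗ extendBy β (g j k) := fun j => by
    simp only [← h1]
    exact map_sum (⟨⟨extendBy β, extendBy_zero β⟩, extendBy_add β⟩ :
      (X.P j →ₗ[S] N ⊗[S] Z.P l) →+ _) _ _
  simp only [mulBy_apply, ract_apply, hs]
  ext p
  simp only [LinearMap.sum_apply, LinearMap.comp_apply, map_sum]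
  exact Finset.sum_comm

theorem mulBy_ract_left (β : M →ₗ[S] N →ₗ[S] K) (f : CMat M W X) (A : LMat X Y)
    (g : CMat N Y Z) : mulBy β (ract f A) g = mulBy β f (lact A g) := by
  funext i l
  have h1 : ∀ j k, extendBy β (g k l ∘ₗ A j k) =
      extendBy β (g k l) ∘ₗ (A j k).lTensor M := fun j k => by
    refine TensorProduct.ext' fun m p => ?_
    simp only [LinearMap.comp_apply, extendBy_tmul, LinearMap.lTensor_tmul]
  have hs : ∀ j, extendBy β (∑ k, g k l ∘ₗ A j k) =
      ∑ k, extendBy β (g k l) ∘ₗ (A j k).lTensor M := fun j => by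
    simp only [← h1]
    exact map_sum (⟨⟨extendBy β, extendBy_zero β⟩, extendBy_add β⟩ :
      (X.P j →ₗ[S] N ⊗[S] Z.P l) →+ _) _ _
  simp only [mulBy_apply, ract_apply, lact_apply, hs]
  ext p
  simp only [LinearMap.sum_apply, LinearMap.comp_apply, map_sum]
  exact Finset.sum_comm

theorem mapC_lact (θ : M →ₗ[S] N) (A : LMat X Y) (f : CMat M Y Z) :
    mapC θ (lact A f) = lact A (mapC θ f) := by
  funext i l
  ext p
  simp only [lact_apply, mapC_apply, LinearMap.sum_apply, LinearMap.comp_apply, map_sum]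

theorem mapC_ract (θ : M →ₗ[S] N) (f : CMat M X Y) (A : LMat Y Z) :
    mapC θ (ract f A) = ract (mapC θ f) A := by
  funext i l
  have h : ∀ j, (A j l).lTensor N ∘ₗ θ.rTensor (Y.P j) =
      θ.rTensor (Z.P l) ∘ₗ (A j l).lTensor M := fun j => by
    rw [LinearMap.lTensor_comp_rTensor, LinearMap.rTensor_comp_lTensor]
  simp only [ract_apply, mapC_apply, ← LinearMap.comp_assoc, h]
  ext p
  simp only [LinearMap.sum_apply, LinearMap.comp_apply, map_sum]

/-- The diagonal matrix with the scalars `c i`. -/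
def ldiag (c : X.I → S) : LMat X X := fun i => Pi.single i (c i • LinearMap.id)

theorem lact_ldiag_apply (c : X.I → S) (f : CMat M X Y) (i j) :
    lact (ldiag c) f i j = c i • f i j := by
  rw [lact_apply, Finset.sum_eq_single i]
  · simp [ldiag, LinearMap.comp_smul]
  · intro k _ hk
    rw [ldiag, Pi.single_eq_of_ne hk, LinearMap.comp_zero]
  · intro h
    exact absurd (Finset.mem_univ i) h

theorem ract_ldiag_apply (f : CMat M X Y) (c : Y.I → S) (i j) :
    ract f (ldiag c) i j = c j • f i j := by
  rw [ract_apply, Finset.sum_eq_single j]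
  · simp [ldiag, LinearMap.lTensor_smul, LinearMap.smul_comp]
  · intro k _ hk
    rw [ldiag, Pi.single_eq_of_ne hk.symm, LinearMap.lTensor_zero, LinearMap.zero_comp]
  · intro h
    exact absurd (Finset.mem_univ j) h

theorem lmul_ldiag_left_apply (c : X.I → S) (A : LMat X Y) (i j) :
    lmul (ldiag c) A i j = c i • A i j := by
  rw [lmul_apply, Finset.sum_eq_single i]
  · simp [ldiag, LinearMap.comp_smul]
  · intro k _ hk
    rw [ldiag, Pi.single_eq_of_ne hk, LinearMap.comp_zero]
  · intro h
    exact absurd (Finset.mem_univ i) h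

theorem lmul_ldiag_right_apply (A : LMat X Y) (c : Y.I → S) (i j) :
    lmul A (ldiag c) i j = c j • A i j := by
  rw [lmul_apply, Finset.sum_eq_single j]
  · simp [ldiag, LinearMap.smul_comp]
  · intro k _ hk
    rw [ldiag, Pi.single_eq_of_ne hk.symm, LinearMap.zero_comp]
  · intro h
    exact absurd (Finset.mem_univ j) h

/-- The identity matrix. -/
def lone (X : C.PreTw) : LMat X X := ldiag fun _ => 1

theorem lone_lact (f : CMat M X Y) : lact (lone X) f = f := by
  funext i j
  rw [lone, lact_ldiag_apply, one_smul]

theorem ract_lone (f : CMat M X Y) : ract f (lone Y) = f := by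
  funext i j
  rw [lone, ract_ldiag_apply, one_smul]

theorem lone_lmul (A : LMat X Y) : lmul (lone X) A = A := by
  funext i j
  rw [lone, lmul_ldiag_left_apply, one_smul]

theorem lmul_lone (A : LMat X Y) : lmul A (lone Y) = A := by
  funext i j
  rw [lone, lmul_ldiag_right_apply, one_smul]

/-- The matrix of linear maps `A` with the coefficient `m`. -/
def scal (m : M) (A : LMat X Y) : CMat M X Y := fun i j => TensorProduct.mk S M (Y.P j) m ∘ₗ A i j

theorem scal_apply (m : M) (A : LMat X Y) (i j) :
    scal m A i j = TensorProduct.mk S M (Y.P j) m ∘ₗ A i j := rfl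

theorem scal_add (m : M) (A B : LMat X Y) : scal m (A + B) = scal m A + scal m B := by
  funext i j
  simp only [scal_apply, Pi.add_apply, LinearMap.comp_add]

theorem scal_smul (m : M) (c : S) (A : LMat X Y) : scal m (c • A) = c • scal m A := by
  funext i j
  simp only [scal_apply, Pi.smul_apply, LinearMap.comp_smul]

theorem scal_zero (m : M) : scal m (0 : LMat X Y) = 0 := by
  funext i j
  simp only [scal_apply, Pi.zero_apply, LinearMap.comp_zero]

theorem scal_neg {M : Type u} [AddCommGroup M] [Module S M] (m : M) (A : LMat X Y) :
    scal m (-A) = -scal m A := by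
  funext i j
  simp only [scal_apply, Pi.neg_apply, LinearMap.comp_neg]

theorem scal_eq_lact (m : M) (A : LMat X Y) : scal m A = lact A (scal m (lone Y)) := by
  funext i j
  ext p
  rw [lact_apply, Finset.sum_eq_single j]
  · simp [scal_apply, lone, ldiag]
  · intro k _ hk
    rw [scal_apply, lone, ldiag, Pi.single_eq_of_ne hk.symm]
    simp
  · intro h
    exact absurd (Finset.mem_univ j) h

theorem lact_scal (A : LMat X Y) (m : M) (B : LMat Y Z) :
    lact A (scal m B) = scal m (lmul A B) := by
  rw [scal_eq_lact, lact_lact, ← scal_eq_lact]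

theorem ract_scal (m : M) (A : LMat X Y) (B : LMat Y Z) :
    ract (scal m A) B = scal m (lmul A B) := by
  funext i k
  ext p
  simp [ract_apply, scal_apply, lmul_apply]

theorem mulBy_scal_left (β : M →ₗ[S] N →ₗ[S] K) (m : M) (A : LMat X Y) (g : CMat N Y Z) :
    mulBy β (scal m A) g = lact A (mapC (β m) g) := by
  funext i k
  ext p
  simp [mulBy_apply, scal_apply, lact_apply, mapC_apply, extendBy_tmul]

theorem mulBy_scal_right (β : M →ₗ[S] N →ₗ[S] K) (f : CMat M X Y) (n : N) (A : LMat Y Z) :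
    mulBy β f (scal n A) = ract (mapC (β.flip n) f) A := by
  funext i k
  have h : ∀ j, extendBy β (scal n A j k) =
      (A j k).lTensor K ∘ₗ (β.flip n).rTensor (Y.P j) := fun j => by
    refine TensorProduct.ext' fun m p => ?_
    simp [scal_apply, extendBy_tmul]
  simp only [mulBy_apply, ract_apply, mapC_apply, h, LinearMap.comp_assoc]

theorem mapC_scal (θ : M →ₗ[S] N) (m : M) (A : LMat X Y) :
    mapC θ (scal m A) = scal (θ m) A := by
  funext i k
  ext p
  simp [mapC_apply, scal_apply]

end PreTw

end MinimalAInfCat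

end

noncomputable section

attribute [local instance] Classical.propDecidable

/-! ### Signs -/

/-- The sign `(-1)^d` as an element of `S`. -/
def sg (S : Type u) [CommRing S] (d : ℤ) : S := ((Int.negOnePow d : ℤ) : S)

section Sign

variable {S : Type u} [CommRing S]

theorem sg_add (a b : ℤ) : sg S (a + b) = sg S a * sg S b := by
  simp [sg, Int.negOnePow_add]

theorem sg_zero : sg S 0 = 1 := by simp [sg]

theorem sg_one : sg S 1 = -1 := by simp [sg]

theorem sg_two : sg S 2 = 1 := by simp [sg]

theorem sg_neg (a : ℤ) : sg S (-a) = sg S a := by simp [sg, Int.negOnePow_neg]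

theorem sg_sub (a b : ℤ) : sg S (a - b) = sg S a * sg S b := by
  rw [sub_eq_add_neg, sg_add, sg_neg]

theorem sg_mul_self (a : ℤ) : sg S a * sg S a = 1 := by
  rw [← sg_add, sg, Int.negOnePow_even _ ⟨a, rfl⟩]
  simp

theorem sg_natCast (n : ℕ) : sg S n = (-1) ^ n := by
  simp [sg, Int.negOnePow_def]

theorem sg_sum {n : ℕ} (d : Fin n → ℤ) : sg S (∑ i, d i) = ∏ i, sg S (d i) := by
  induction n with
  | zero => simp [sg_zero]
  | succ k ih => rw [Fin.sum_univ_succ, Fin.prod_univ_succ, sg_add, ih]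

theorem sg_smul_eq {M : Type u} [AddCommGroup M] [Module S M] (d : ℤ) (x : M) :
    (Int.negOnePow d : ℤ) • x = sg S d • x := by
  rw [sg, Int.cast_smul_eq_zsmul]

end Sign

namespace GradedQuiver

variable {S : Type u} [CommRing S] (Q : GradedQuiver.{u, w} S)

theorem decomp_of_mem {X Y : Q.Obj} {d : ℤ} {x : Q.Mor} (hx : x ∈ Q.Hom X Y d) :
    Q.decomp x = DirectSum.lof S (Q.Obj × Q.Obj × ℤ) (fun p => Q.Hom p.1 p.2.1 p.2.2) (X, Y, d)
      ⟨x, hx⟩ := by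
  rw [decomp, LinearEquiv.symm_apply_eq]
  exact (DirectSum.coeLinearMap_lof (fun p : Q.Obj × Q.Obj × ℤ => Q.Hom p.1 p.2.1 p.2.2) (X, Y, d)
    (⟨x, hx⟩ : Q.Hom X Y d)).symm

theorem sgn_of_mem {X Y : Q.Obj} {d : ℤ} {x : Q.Mor} (hx : x ∈ Q.Hom X Y d) :
    Q.sgn x = sg S d • x := by
  rw [sgn, LinearMap.comp_apply, LinearEquiv.coe_coe, Q.decomp_of_mem hx, DirectSum.toModule_lof,
    LinearMap.smul_apply, Submodule.subtype_apply, sg_smul_eq (S := S)]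

theorem proj_of_mem {X Y : Q.Obj} {d : ℤ} {x : Q.Mor} (hx : x ∈ Q.Hom X Y d) :
    Q.proj X Y d x = ⟨x, hx⟩ := by
  rw [proj, LinearMap.comp_apply, LinearEquiv.coe_coe, Q.decomp_of_mem hx,
    DirectSum.component.lof_self]

theorem proj_eq_zero {X Y X' Y' : Q.Obj} {d d' : ℤ} {x : Q.Mor} (hx : x ∈ Q.Hom X Y d)
    (h : (X, Y, d) ≠ (X', Y', d')) : Q.proj X' Y' d' x = 0 := by
  rw [proj, LinearMap.comp_apply, LinearEquiv.coe_coe, Q.decomp_of_mem hx,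
    DirectSum.component.of, dif_neg h]

theorem iSup_hom : ⨆ p : Q.Obj × Q.Obj × ℤ, Q.Hom p.1 p.2.1 p.2.2 = ⊤ :=
  Q.isInternal.submodule_iSup_eq_top

theorem mem_of_hom_le {N : Submodule S Q.Mor} (h : ∀ X Y d, Q.Hom X Y d ≤ N) (x : Q.Mor) :
    x ∈ N := by
  have : (⊤ : Submodule S Q.Mor) ≤ N := by
    rw [← Q.iSup_hom]
    exact iSup_le fun p => h _ _ _
  exact this trivial

theorem hom_ext {N : Type u} [AddCommGroup N] [Module S N] {f g : Q.Mor →ₗ[S] N}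
    (h : ∀ X Y d, ∀ x ∈ Q.Hom X Y d, f x = g x) : f = g := by
  ext x
  exact Q.mem_of_hom_le (N := LinearMap.eqLocus f g) (fun X Y d x hx => h X Y d x hx) x

theorem sgn_mul_sgn : Q.sgn * Q.sgn = 1 := by
  refine Q.hom_ext fun X Y d x hx => ?_
  rw [Module.End.mul_apply, Q.sgn_of_mem hx, map_smul, Q.sgn_of_mem hx, smul_smul, sg_mul_self,
    one_smul, Module.End.one_apply]

theorem sgn_mem {X Y : Q.Obj} {d : ℤ} {x : Q.Mor} (hx : x ∈ Q.Hom X Y d) :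
    Q.sgn x ∈ Q.Hom X Y d := by
  rw [Q.sgn_of_mem hx]
  exact Submodule.smul_mem _ _ hx

theorem sgn_pow_mem {X Y : Q.Obj} {d : ℤ} {x : Q.Mor} (hx : x ∈ Q.Hom X Y d) (n : ℕ) :
    (Q.sgn ^ n) x ∈ Q.Hom X Y d := by
  induction n with
  | zero => simpa using hx
  | succ n ih =>
    rw [pow_succ', Module.End.mul_apply]
    exact Q.sgn_mem ih

end GradedQuiver

namespace MinimalAInfCat

variable {S : Type u} [CommRing S] (C : MinimalAInfCat.{u, w} S)

/-! ### Words -/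

/-- The word with the letters `l`. -/
def word (l : List C.Mor) : TensorAlgebra S C.Mor := (l.map (TensorAlgebra.ι S)).prod

theorem word_nil : C.word [] = 1 := rfl

theorem word_cons (x : C.Mor) (l : List C.Mor) :
    C.word (x :: l) = TensorAlgebra.ι S x * C.word l := by simp [word]

theorem word_append (l l' : List C.Mor) : C.word (l ++ l') = C.word l * C.word l' := by
  simp [word]

theorem word_map_neg (f : Module.End S C.Mor) (l : List C.Mor) :
    C.word (l.map (-f)) = (-1 : S) ^ l.length • C.word (l.map f) := by
  induction l with
  | nil => simp [word]
  | cons x l ih =>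
    rw [List.map_cons, List.map_cons, word_cons, word_cons, ih, LinearMap.neg_apply, map_neg,
      List.length_cons, pow_succ, mul_smul, neg_one_smul, mul_smul_comm, neg_mul, smul_neg]

/-- The letters of `l` are homogeneous. -/
def Homog (l : List C.Mor) : Prop := ∀ x ∈ l, ∃ X Y d, x ∈ C.Hom X Y d

theorem word_mem_span (x : TensorAlgebra S C.Mor) :
    x ∈ Submodule.span S {w | ∃ l, C.Homog l ∧ C.word l = w} := by
  induction x using TensorAlgebra.induction with
  | algebraMap r =>
    rw [Algebra.algebraMap_eq_smul_one]
    exact Submodule.smul_mem _ _ (Submodule.subset_span ⟨[], by simp [Homog], rfl⟩)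
  | ι x =>
    refine C.mem_of_hom_le (N := (Submodule.span S {w | ∃ l, C.Homog l ∧ C.word l = w}).comap
      (TensorAlgebra.ι S)) (fun X Y d x hx => ?_) x
    refine Submodule.subset_span ⟨[x], fun y hy => ?_, by simp [word]⟩
    rw [List.mem_singleton.mp hy]
    exact ⟨X, Y, d, hx⟩
  | mul a b ha hb =>
    induction ha using Submodule.span_induction with
    | mem x hx =>
      obtain ⟨l, hl, rfl⟩ := hx
      induction hb using Submodule.span_induction with
      | mem y hy =>
        obtain ⟨l', hl', rfl⟩ := hy
        refine Submodule.subset_span ⟨l ++ l', fun z hz => ?_, C.word_append l l'⟩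
        exact (List.mem_append.mp hz).elim (hl z) (hl' z)
      | zero => simp
      | add y z _ _ hy hz => rw [mul_add]; exact Submodule.add_mem _ hy hz
      | smul c y _ hy => rw [mul_smul_comm]; exact Submodule.smul_mem _ _ hy
    | zero => simp
    | add y z _ _ hy hz => rw [add_mul]; exact Submodule.add_mem _ hy hz
    | smul c y _ hy => rw [smul_mul_assoc]; exact Submodule.smul_mem _ _ hy
  | add a b ha hb => exact Submodule.add_mem _ ha hb

theorem word_ext {N : Type u} [AddCommGroup N] [Module S N] {f g : TensorAlgebra S C.Mor →ₗ[S] N}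
    (h : ∀ l, C.Homog l → f (C.word l) = g (C.word l)) : f = g := by
  ext x
  induction C.word_mem_span x using Submodule.span_induction with
  | mem x hx => obtain ⟨l, hl, rfl⟩ := hx; exact h l hl
  | zero => simp
  | add y z _ _ hy hz => rw [map_add, map_add, hy, hz]
  | smul c y _ hy => rw [map_smul, map_smul, hy]

/-- The product `m_n` of a list of `n` morphisms. -/
def ml (l : List C.Mor) : C.Mor := C.m l.length l.get

theorem ml_ofFn {n : ℕ} (x : Fin n → C.Mor) : C.ml (List.ofFn x) = C.m n x := by
  have key : ∀ (l : List C.Mor) (h : l.length = n),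
      C.ml l = C.m n (fun i => l.get (i.cast h.symm)) := by
    rintro l rfl
    rfl
  rw [key _ (List.length_ofFn)]
  congr 1
  funext i
  simp

/-- All the products `m_n` together, as a map on the tensor algebra. -/
def mT : TensorAlgebra S C.Mor →ₗ[S] C.Mor :=
  DirectSum.toModule S ℕ C.Mor (fun n => PiTensorProduct.lift (C.m n)) ∘ₗ
    (TensorAlgebra.equivDirectSum (R := S) (M := C.Mor)).toLinearMap

theorem equivDirectSum_word (l : List C.Mor) : TensorAlgebra.equivDirectSum (C.word l) =
    DirectSum.of (fun n => ⨂[S]^n C.Mor) l.length (PiTensorProduct.tprod S l.get) := by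
  have h : C.word l = TensorAlgebra.tprod S C.Mor l.length l.get := by
    rw [TensorAlgebra.tprod_apply, word]
    congr 1
    refine List.ext_get (by simp) fun i h1 h2 => by simp
  rw [h]
  exact TensorAlgebra.toDirectSum_tensorPower_tprod _

theorem mT_word (l : List C.Mor) : C.mT (C.word l) = C.ml l := by
  simp only [mT, LinearMap.comp_apply, AlgEquiv.toLinearMap_apply, equivDirectSum_word]
  erw [DirectSum.toModule_lof]
  exact PiTensorProduct.lift.tprod _

/-- The list `(…, (-1)^{(n-j)|x_j|} x_j, …)`. -/
def susp : List C.Mor → List C.Mor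
  | [] => []
  | x :: l => (C.sgn ^ l.length) x :: susp l

theorem length_susp (l : List C.Mor) : (C.susp l).length = l.length := by
  induction l with
  | nil => rfl
  | cons x l ih => simp [susp, ih]

theorem b_word (l : List C.Mor) : C.b (C.word l) = C.ml (C.susp l) := by
  have h : C.b (C.word l) = C.bn l.length l.get := by
    simp only [b, LinearMap.comp_apply, AlgEquiv.toLinearMap_apply, equivDirectSum_word]
    erw [DirectSum.toModule_lof]
    exact PiTensorProduct.lift.tprod _
  rw [h, bn, MultilinearMap.compLinearMap_apply, ← ml_ofFn]
  congr 1
  induction l with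
  | nil => rfl
  | cons x l ih =>
    rw [susp, ← ih (by
      simp only [b, LinearMap.comp_apply, AlgEquiv.toLinearMap_apply, equivDirectSum_word]
      erw [DirectSum.toModule_lof]
      exact PiTensorProduct.lift.tprod _)]
    simp only [List.length_cons]
    rw [List.ofFn_succ]
    congr 1
    congr 1
    funext i
    have e : l.length + 1 - 1 - (i.succ : ℕ) = l.length - 1 - (i : ℕ) := by
      rw [Fin.val_succ]; omega
    rw [e]
    rfl

theorem b_one : C.b 1 = 0 := by
  rw [← word_nil, b_word, susp, ml]
  simp [C.m_zero]

theorem b_ι_mul_ι (x y : C.Mor) :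
    C.b (TensorAlgebra.ι S x * TensorAlgebra.ι S y) = C.m 2 ![C.sgn x, y] := by
  have h : TensorAlgebra.ι S x * TensorAlgebra.ι S y = C.word [x, y] := by simp [word]
  have e : C.susp [x, y] = List.ofFn ![C.sgn x, y] := by simp [susp]
  rw [h, b_word, e, ml_ofFn]

theorem susp_map (f : Module.End S C.Mor) (hf : Commute f C.sgn) (l : List C.Mor) :
    C.susp (l.map f) = (C.susp l).map f := by
  induction l with
  | nil => rfl
  | cons x l ih =>
    simp only [List.map_cons, susp, ih, List.length_map]
    congr 1
    rw [← Module.End.mul_apply, ← Module.End.mul_apply, (hf.pow_right l.length).eq]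

theorem susp_take (l : List C.Mor) (r : ℕ) :
    (C.susp l).take r = (C.susp (l.take r)).map (C.sgn ^ (l.length - r)) := by
  induction l generalizing r with
  | nil => simp [susp]
  | cons x l ih =>
    cases r with
    | zero => simp [susp]
    | succ r =>
      simp only [susp, List.take_succ_cons, List.map_cons, List.length_cons, Nat.add_sub_add_right,
        ih, List.length_take]
      congr 1
      rcases le_total r l.length with h | h
      · rw [min_eq_left h, ← Module.End.mul_apply, ← pow_add, Nat.sub_add_cancel h]
      · rw [min_eq_right h, Nat.sub_eq_zero_of_le h, pow_zero, Module.End.one_apply]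

theorem susp_drop (l : List C.Mor) (r : ℕ) : (C.susp l).drop r = C.susp (l.drop r) := by
  induction l generalizing r with
  | nil => simp [susp]
  | cons x l ih =>
    cases r with
    | zero => simp [susp]
    | succ r => simp only [susp, List.drop_succ_cons, ih]

theorem susp_append (l l' : List C.Mor) :
    C.susp (l ++ l') = (C.susp l).map (C.sgn ^ l'.length) ++ C.susp l' := by
  induction l with
  | nil => simp [susp]
  | cons x l ih =>
    simp only [List.cons_append, susp, ih, List.map_cons, List.length_append]
    rw [add_comm, pow_add, Module.End.mul_apply]

theorem Homog.of_sublist {l l' : List C.Mor} (h : C.Homog l') (hl : l.Sublist l') : C.Homog l :=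
  fun x hx => h x (hl.subset hx)

theorem Homog.susp {l : List C.Mor} (h : C.Homog l) : C.Homog (C.susp l) := by
  induction l with
  | nil => exact h
  | cons x l ih =>
    intro y hy
    rcases List.mem_cons.mp hy with rfl | hy
    · obtain ⟨X, Y, d, hx⟩ := h x (by simp)
      exact ⟨X, Y, d, C.sgn_pow_mem hx _⟩
    · exact ih (h.of_sublist C (List.sublist_cons_self x l)) y hy

theorem Homog.map_sgn {l : List C.Mor} (h : C.Homog l) (n : ℕ) :
    C.Homog (l.map (C.sgn ^ n)) := by
  intro y hy
  obtain ⟨x, hx, rfl⟩ := List.mem_map.mp hy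
  obtain ⟨X, Y, d, hx⟩ := h x hx
  exact ⟨X, Y, d, C.sgn_pow_mem hx _⟩

theorem sgn_m (n : ℕ) (X Y : Fin n → C.Obj) (d : Fin n → ℤ) (x : Fin n → C.Mor)
    (hx : ∀ i, x i ∈ C.Hom (X i) (Y i) (d i)) :
    C.sgn (C.m n x) = (-1 : S) ^ n • C.m n (fun i => C.sgn (x i)) := by
  have h1 : (fun i => C.sgn (x i)) = fun i => sg S (d i) • x i :=
    funext fun i => C.sgn_of_mem (hx i)
  rw [h1, MultilinearMap.map_smul_univ, smul_smul]
  by_cases hc : ∃ i j : Fin n, (j : ℕ) = i + 1 ∧ Y i ≠ X j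
  · obtain ⟨i, j, hij, hne⟩ := hc
    rw [C.m_eq_zero_of_ne n X Y d x hx i j hij hne, map_zero, smul_zero]
  push Not at hc
  rcases n with _ | n
  · rw [C.m_zero]; simp
  let X' : Fin (n + 2) → C.Obj := Fin.snoc X (Y (Fin.last n))
  have hX' : ∀ i, x i ∈ C.Hom (X' i.castSucc) (X' i.succ) (d i) := by
    intro i
    have e1 : X' i.castSucc = X i := Fin.snoc_castSucc (α := fun _ => C.Obj) _ _ _
    have e2 : X' i.succ = Y i := by
      rcases Fin.eq_castSucc_or_eq_last i with ⟨j, rfl⟩ | rfl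
      · have : (j.castSucc.succ : Fin (n + 2)) = j.succ.castSucc := rfl
        rw [this]
        have e3 : X' j.succ.castSucc = X j.succ := Fin.snoc_castSucc (α := fun _ => C.Obj) _ _ _
        rw [e3]
        exact (hc j.castSucc j.succ (by simp)).symm
      · exact Fin.snoc_last (α := fun _ => C.Obj) _ _
    rw [e1, e2]
    exact hx i
  rw [C.sgn_of_mem (C.m_mem (n + 1) X' d x hX')]
  congr 1
  rw [sg_sub, sg_add, sg_two, mul_one, sg_natCast, mul_comm]
  rw [sg_sum]

theorem sgn_ml {l : List C.Mor} (h : C.Homog l) :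
    C.sgn (C.ml l) = (-1 : S) ^ l.length • C.ml (l.map C.sgn) := by
  choose X Y d hx using fun i : Fin l.length => h (l.get i) (l.get_mem i)
  rw [ml, C.sgn_m l.length X Y d l.get hx, ← C.ml_ofFn]
  congr 2
  refine List.ext_get (by simp) fun i h1 h2 => by simp

theorem sgn_pow_ml {l : List C.Mor} (h : C.Homog l) (t : ℕ) :
    (C.sgn ^ t) (C.ml l) = (-1 : S) ^ (l.length * t) • C.ml (l.map (C.sgn ^ t)) := by
  induction t with
  | zero => simp [Module.End.one_eq_id]
  | succ t ih =>
    rw [pow_succ', Module.End.mul_apply, ih, map_smul, C.sgn_ml (h.map_sgn C t), smul_smul,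
      List.length_map, ← pow_add, List.map_map, Nat.mul_succ]
    rfl

/-! ### Deconcatenation -/

/-- The automorphism of the tensor algebra that multiplies `Hom X Y d` by `(-1)^{d-1}`. -/
def sgT : TensorAlgebra S C.Mor →ₐ[S] TensorAlgebra S C.Mor :=
  TensorAlgebra.lift S (TensorAlgebra.ι S ∘ₗ (-C.sgn))

theorem sgT_ι (x : C.Mor) : C.sgT (TensorAlgebra.ι S x) = TensorAlgebra.ι S (-C.sgn x) := by
  simp [sgT]

theorem sgT_word (l : List C.Mor) : C.sgT (C.word l) = C.word (l.map (-C.sgn)) := by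
  induction l with
  | nil => simp [word]
  | cons x l ih => rw [List.map_cons, word_cons, map_mul, ih, word_cons, sgT_ι]; rfl

/-- `w ↦ (w ⊗ 1, ∑ u ⊗ v; 0, 1 ⊗ w)`, where `w = uv` and `v` is not empty. -/
def deconcMatrix : TensorAlgebra S C.Mor →ₐ[S]
    Matrix (Fin 2) (Fin 2) (TensorAlgebra S C.Mor ⊗[S] TensorAlgebra S C.Mor) :=
  TensorAlgebra.lift S
    { toFun := fun x => !![TensorAlgebra.ι S x ⊗ₜ 1, 1 ⊗ₜ TensorAlgebra.ι S x;
        0, 1 ⊗ₜ TensorAlgebra.ι S x]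
      map_add' := fun x y => by
        ext i j; fin_cases i <;> fin_cases j <;> simp [TensorProduct.add_tmul, TensorProduct.tmul_add]
      map_smul' := fun c x => by
        ext i j; fin_cases i <;> fin_cases j <;> simp [TensorProduct.smul_tmul'] }

theorem deconcMatrix_apply (w : TensorAlgebra S C.Mor) :
    C.deconcMatrix w 0 0 = w ⊗ₜ 1 ∧ C.deconcMatrix w 1 0 = 0 ∧ C.deconcMatrix w 1 1 = 1 ⊗ₜ w := by
  induction w using TensorAlgebra.induction with
  | algebraMap r =>
    rw [AlgHom.commutes]
    simp [Matrix.algebraMap_matrix_apply, Algebra.algebraMap_eq_smul_one, TensorProduct.smul_tmul,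
      Algebra.TensorProduct.one_def]
  | ι x => simp [deconcMatrix]
  | mul a b ha hb =>
    obtain ⟨a1, a2, a3⟩ := ha
    obtain ⟨b1, b2, b3⟩ := hb
    simp [map_mul, Matrix.mul_apply, Fin.sum_univ_two, a1, a2, a3, b1, b2, b3]
  | add a b ha hb =>
    obtain ⟨a1, a2, a3⟩ := ha
    obtain ⟨b1, b2, b3⟩ := hb
    simp [map_add, a1, a2, a3, b1, b2, b3, TensorProduct.add_tmul, TensorProduct.tmul_add]

/-- Deconcatenation, `w ↦ ∑ u ⊗ v` over `w = uv`. -/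
def deconc : TensorAlgebra S C.Mor →ₗ[S] TensorAlgebra S C.Mor ⊗[S] TensorAlgebra S C.Mor where
  toFun w := C.deconcMatrix w 0 1 + w ⊗ₜ 1
  map_add' a b := by rw [map_add, Matrix.add_apply, TensorProduct.add_tmul]; abel
  map_smul' c a := by
    rw [map_smul, RingHom.id_apply, smul_add, TensorProduct.smul_tmul']
    rfl

theorem deconc_one : C.deconc 1 = 1 ⊗ₜ 1 := by simp [deconc]

theorem deconc_ι (x : C.Mor) : C.deconc (TensorAlgebra.ι S x) =
    1 ⊗ₜ TensorAlgebra.ι S x + TensorAlgebra.ι S x ⊗ₜ 1 := by simp [deconc, deconcMatrix]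

theorem deconc_mul (a b : TensorAlgebra S C.Mor) : C.deconc (a * b) + a ⊗ₜ b =
    C.deconc a * (1 ⊗ₜ b) + (a ⊗ₜ 1) * C.deconc b := by
  obtain ⟨a1, a2, a3⟩ := C.deconcMatrix_apply a
  obtain ⟨b1, b2, b3⟩ := C.deconcMatrix_apply b
  simp only [deconc, LinearMap.coe_mk, AddHom.coe_mk, map_mul, Matrix.mul_apply,
    Fin.sum_univ_two, a1, b3, add_mul, mul_add, Algebra.TensorProduct.tmul_mul_tmul, mul_one,
    one_mul]
  abel

theorem deconc_word (l : List C.Mor) : C.deconc (C.word l) =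
    ∑ r ∈ Finset.range (l.length + 1), C.word (l.take r) ⊗ₜ C.word (l.drop r) := by
  induction l with
  | nil => simp [word, deconc_one]
  | cons x l ih =>
    have h := C.deconc_mul (TensorAlgebra.ι S x) (C.word l)
    rw [deconc_ι, ih, Finset.mul_sum, add_mul] at h
    refine add_right_cancel (h.trans ?_)
    rw [List.length_cons, Finset.sum_range_succ' _ (l.length + 1)]
    simp only [List.take_succ_cons, List.drop_succ_cons, word_cons, List.take_zero, List.drop_zero,
      word_nil, Algebra.TensorProduct.tmul_mul_tmul, one_mul, mul_one]
    abel

/-- The convolution `w ↦ ∑ f(u) g(v)` over `w = uv`. -/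
def conv (f g : TensorAlgebra S C.Mor →ₗ[S] TensorAlgebra S C.Mor) :
    TensorAlgebra S C.Mor →ₗ[S] TensorAlgebra S C.Mor :=
  LinearMap.mul' S _ ∘ₗ TensorProduct.map f g ∘ₗ C.deconc

theorem conv_word (f g : TensorAlgebra S C.Mor →ₗ[S] TensorAlgebra S C.Mor) (l : List C.Mor) :
    C.conv f g (C.word l) =
      ∑ r ∈ Finset.range (l.length + 1), f (C.word (l.take r)) * g (C.word (l.drop r)) := by
  simp [conv, deconc_word]

/-- `w ↦ ∑ b(u) v` over `w = uv`. -/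
def barLeft : TensorAlgebra S C.Mor →ₗ[S] TensorAlgebra S C.Mor :=
  C.conv (TensorAlgebra.ι S ∘ₗ C.b) LinearMap.id

/-- The bar differential `w ↦ ∑ ± u b(v) v'` over `w = u v v'`. -/
def bar : TensorAlgebra S C.Mor →ₗ[S] TensorAlgebra S C.Mor :=
  C.conv C.sgT.toLinearMap C.barLeft

theorem neg_sgn_comm : Commute (-C.sgn) C.sgn := (Commute.refl _).neg_left

theorem bar_term {l : List C.Mor} (hl : C.Homog l) {r s : ℕ} (hr : r + s ≤ l.length) :
    C.b (C.word ((l.take r).map (-C.sgn)) *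
      (TensorAlgebra.ι S (C.b (C.word ((l.drop r).take s))) * C.word (l.drop (r + s)))) =
    (-1 : S) ^ (r + s * (l.length - r - s)) •
      C.ml (((C.susp l).take r).map (C.sgn ^ s) ++ [C.ml (((C.susp l).drop r).take s)] ++
        (C.susp l).drop (r + s)) := by
  set a := l.take r with ha
  set c := (l.drop r).take s with hc
  set e := l.drop (r + s) with he
  have hla : a.length = r := by rw [ha, List.length_take]; omega
  have hlc : c.length = s := by rw [hc, List.length_take, List.length_drop]; omega
  have hle : e.length = l.length - r - s := by rw [he, List.length_drop]; omega
  have hcH : C.Homog c := hl.of_sublist C ((List.take_sublist _ _).trans (List.drop_sublist _ _))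
  have hm : l.length - r = s + e.length := by omega
  have hd : (l.drop r).length = s + e.length := by rw [List.length_drop, hm]
  rw [C.susp_take, C.susp_drop, C.susp_drop, C.susp_take, ← ha, ← hc, ← he, hd, hm,
    Nat.add_sub_cancel_left, ← word_cons, ← word_append, b_word,
    susp_append, susp, C.susp_map _ C.neg_sgn_comm, b_word,
    C.sgn_pow_ml (hcH.susp C), List.length_cons, length_susp, hlc, ← mT_word, ← mT_word, ← mT_word,
    word_append, word_append, word_append, word_cons, List.map_map, List.map_map]
  have h2 : C.sgn ^ 2 = 1 := by rw [pow_two, C.sgn_mul_sgn]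
  have e1 : ⇑(C.sgn ^ (e.length + 1)) ∘ ⇑(-C.sgn) = ⇑(-(C.sgn ^ e.length)) := by
    rw [← Module.End.coe_mul, mul_neg, ← pow_succ, add_assoc, pow_add, h2, mul_one]
  have e2 : ⇑(C.sgn ^ s) ∘ ⇑(C.sgn ^ (s + e.length)) = ⇑(C.sgn ^ e.length) := by
    rw [← Module.End.coe_mul, ← pow_add, ← add_assoc, pow_add, ← two_mul, pow_mul, h2, one_pow,
      one_mul]
  rw [e1, e2, word_map_neg, length_susp, hla, map_smul, smul_mul_assoc, smul_mul_assoc,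
    mul_smul_comm, map_smul, map_smul, smul_smul, pow_add, mul_assoc, word_cons, word_nil, mul_one]

theorem b_comp_bar : C.b ∘ₗ C.bar = 0 := by
  refine C.word_ext fun l hl => ?_
  rw [LinearMap.comp_apply, LinearMap.zero_apply, ← C.stasheff (C.susp l), bar, conv_word, map_sum,
    length_susp]
  refine Finset.sum_congr rfl fun r hr => ?_
  have hr' : r ≤ l.length := Nat.lt_succ_iff.mp (Finset.mem_range.mp hr)
  rw [barLeft, conv_word, Finset.mul_sum, map_sum, Finset.range_eq_Ico, ← Finset.sum_subset
    (s₁ := Finset.Icc 1 (l.length - r))]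
  · refine Finset.sum_congr rfl fun s hs => ?_
    have hs' : s ≤ l.length - r := (Finset.mem_Icc.mp hs).2
    rw [LinearMap.comp_apply, LinearMap.id_apply, AlgHom.toLinearMap_apply, sgT_word,
      List.drop_drop, C.bar_term hl (by omega), ← Int.cast_smul_eq_zsmul S]
    push_cast
    rfl
  · intro s hs
    rw [Finset.mem_Icc] at hs
    rw [Finset.mem_Ico, List.length_drop]
    omega
  · intro s hs hs'
    rw [Finset.mem_Ico, List.length_drop] at hs
    rw [Finset.mem_Icc] at hs'
    have : s = 0 := by omega
    subst this
    simp [word_nil, b_one]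

end MinimalAInfCat

end

noncomputable section

attribute [local instance] Classical.propDecidable

namespace MinimalAInfCat

namespace PreTw

variable {S : Type u} [CommRing S] {C : MinimalAInfCat.{u, w} S} {W X Y Z : C.PreTw}

local notation:70 f:70 "⬝" g:71 => mulBy (LinearMap.mul _ (TensorAlgebra _ _)) f g

/-! ### Matrices of words -/

variable (X) in
/-- The identity matrix, as a matrix of empty words. -/
def tone : TMat X X := scal 1 (lone X)

theorem δpow_zero : δpow X 0 = tone X := by
  funext i j
  by_cases h : j = i
  · subst h
    simp [δpow, tone, scal_apply, lone, ldiag]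
  · simp only [δpow, tone, scal_apply, lone, ldiag]
    rw [Pi.single_eq_of_ne h, Pi.single_eq_of_ne h, LinearMap.comp_zero]

theorem tmul_assoc (f : TMat W X) (g : TMat X Y) (h : TMat Y Z) : f ⬝ g ⬝ h = f ⬝ (g ⬝ h) :=
  mulBy_assoc _ _ _ _ (fun a b c => mul_assoc a b c) f g h

theorem tone_tmul (f : TMat X Y) : tone X ⬝ f = f := by
  have h : LinearMap.mul S (TensorAlgebra S C.Mor) 1 = LinearMap.id := by ext; simp
  rw [tone, mulBy_scal_left, lone_lact, h, mapC_id]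

theorem tmul_tone (f : TMat X Y) : f ⬝ tone Y = f := by
  have h : (LinearMap.mul S (TensorAlgebra S C.Mor)).flip 1 = LinearMap.id := by ext; simp
  rw [tone, mulBy_scal_right, ract_lone, h, mapC_id]

variable (X) in
/-- The differential as a matrix of words of length one. -/
def δT : TMat X X := mapC (TensorAlgebra.ι S) X.δ

theorem δpow_succ (n : ℕ) : δpow X (n + 1) = δpow X n ⬝ δT X := rfl

theorem δpow_succ' (n : ℕ) : δpow X (n + 1) = δT X ⬝ δpow X n := by
  induction n with
  | zero => rw [δpow_succ, δpow_zero, tone_tmul, tmul_tone]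
  | succ n ih => rw [δpow_succ, ih, tmul_assoc, ← δpow_succ, ih]

theorem lt_card_of_δpow_ne_zero (n : ℕ) (i k : X.I) (h : δpow X n i k ≠ 0) :
    n < (Finset.univ.filter fun j => X.rk j ≤ X.rk k).card := by
  induction n generalizing k with
  | zero => exact Finset.card_pos.mpr ⟨k, by simp⟩
  | succ n ih =>
    obtain ⟨j, -, hj⟩ := Finset.exists_ne_zero_of_sum_ne_zero h
    have h1 : δpow X n i j ≠ 0 := fun h0 => hj (by rw [h0, LinearMap.comp_zero])
    have h2 : X.rk j < X.rk k := X.δ_triangular j k fun h0 => hj (by simp [toT, h0, extend])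
    refine Nat.succ_le_of_lt (lt_of_le_of_lt (Nat.succ_le_of_lt (ih j h1)) ?_)
    refine Finset.card_lt_card (Finset.ssubset_iff_of_subset ?_ |>.mpr ⟨k, by simp, by simpa⟩)
    intro l hl
    simp only [Finset.mem_filter, Finset.mem_univ, true_and] at hl ⊢
    exact hl.trans h2.le

theorem δpow_card : δpow X (Fintype.card X.I) = 0 := by
  funext i k
  by_contra h
  exact absurd (lt_card_of_δpow_ne_zero _ i k h)
    (not_lt.mpr (Finset.card_le_univ _))

theorem geom_eq_add_geom_mul : geom X = tone X + geom X ⬝ δT X := by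
  have h : geom X ⬝ δT X = ∑ n ∈ Finset.range (Fintype.card X.I), δpow X (n + 1) := by
    rw [geom, mulBy_sum_left]
    rfl
  rw [h, ← δpow_zero, add_comm, ← Finset.sum_range_succ' (δpow X), Finset.sum_range_succ, δpow_card,
    add_zero, geom]

theorem geom_eq_add_mul_geom : geom X = tone X + δT X ⬝ geom X := by
  have h : δT X ⬝ geom X = ∑ n ∈ Finset.range (Fintype.card X.I), δpow X (n + 1) := by
    rw [geom, mulBy_sum_right]
    exact Finset.sum_congr rfl fun n _ => (δpow_succ' n).symm
  rw [h, ← δpow_zero, add_comm, ← Finset.sum_range_succ' (δpow X), Finset.sum_range_succ, δpow_card,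
    add_zero, geom]

theorem eq_of_eq_add_mul_δT {M : Type u} [AddCommMonoid M] [Module S M]
    (β : M →ₗ[S] TensorAlgebra S C.Mor →ₗ[S] M) (h1 : ∀ m, β m 1 = m)
    (hm : ∀ m a c, β (β m a) c = β m (a * c)) {f g a : CMat M X Y}
    (hf : f = a + mulBy β f (δT Y)) (hg : g = a + mulBy β g (δT Y)) : f = g := by
  have key : ∀ n, f + mulBy β g (δpow Y n) = g + mulBy β f (δpow Y n) := by
    intro n
    induction n with
    | zero =>
      have : β.flip 1 = LinearMap.id := by ext; simp [h1]
      rw [δpow_zero, tone, mulBy_scal_right, mulBy_scal_right, ract_lone, ract_lone, this, mapC_id,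
        mapC_id, add_comm]
    | succ n ih =>
      have e : ∀ {f : CMat M X Y}, f = a + mulBy β f (δT Y) →
          mulBy β f (δpow Y n) = mulBy β a (δpow Y n) + mulBy β f (δpow Y (n + 1)) := fun h => by
        conv_lhs => rw [h, mulBy_add_left, mulBy_assoc β β (LinearMap.mul S (TensorAlgebra S C.Mor)) β hm, ← δpow_succ']
      rw [e hf, e hg] at ih
      refine cmat_add_left_cancel (f := mulBy β a (δpow Y n)) ?_
      rw [add_left_comm, ih, add_left_comm]
  have := key (Fintype.card Y.I)
  rwa [δpow_card, mulBy_zero_right, mulBy_zero_right, add_zero, add_zero] at this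

/-! ### Deconcatenation of matrices -/

/-- The product `f ⊗ g` of matrices of words. -/
def cutMul (f : TMat X Y) (g : TMat Y Z) :
    CMat (TensorAlgebra S C.Mor ⊗[S] TensorAlgebra S C.Mor) X Z :=
  mulBy (TensorProduct.mk S _ _) f g

variable (C) in
/-- `(u ⊗ v, w) ↦ u ⊗ vw`. -/
def cutR : TensorAlgebra S C.Mor ⊗[S] TensorAlgebra S C.Mor →ₗ[S] TensorAlgebra S C.Mor →ₗ[S]
    TensorAlgebra S C.Mor ⊗[S] TensorAlgebra S C.Mor :=
  (LinearMap.mul S (TensorAlgebra S C.Mor ⊗[S] TensorAlgebra S C.Mor)).compl₂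
    (TensorProduct.mk S _ _ 1)

variable (C) in
/-- `(w, u ⊗ v) ↦ wu ⊗ v`. -/
def cutL : TensorAlgebra S C.Mor →ₗ[S] TensorAlgebra S C.Mor ⊗[S] TensorAlgebra S C.Mor →ₗ[S]
    TensorAlgebra S C.Mor ⊗[S] TensorAlgebra S C.Mor :=
  (LinearMap.mul S (TensorAlgebra S C.Mor ⊗[S] TensorAlgebra S C.Mor)) ∘ₗ
    ((TensorProduct.mk S _ _).flip 1)

theorem mapC_deconc_mul (f : TMat X Y) (g : TMat Y Z) : mapC C.deconc (f ⬝ g) + cutMul f g =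
    mulBy (cutR C) (mapC C.deconc f) g + mulBy (cutL C) f (mapC C.deconc g) := by
  have h : (LinearMap.mul S (TensorAlgebra S C.Mor)).compr₂ C.deconc + TensorProduct.mk S _ _ =
      cutR C ∘ₗ C.deconc + (cutL C).compl₂ C.deconc := by
    refine LinearMap.ext₂ fun a b => ?_
    exact C.deconc_mul a b
  rw [mapC_mulBy, cutMul, ← mulBy_add_coeff, h, mulBy_add_coeff, mulBy_mapC_left,
    mulBy_mapC_right]

theorem cutMul_mul (f : TMat W X) (g : TMat X Y) (h : TMat Y Z) :
    mulBy (cutR C) (cutMul f g) h = cutMul f (g ⬝ h) :=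
  mulBy_assoc _ _ _ _ (fun a b c => by simp [cutR]) f g h

theorem mul_cutMul (f : TMat W X) (g : TMat X Y) (h : TMat Y Z) :
    mulBy (cutL C) f (cutMul g h) = cutMul (f ⬝ g) h :=
  (mulBy_assoc _ _ _ _ (fun a b c => by simp [cutL]) f g h).symm

theorem cutMul_add_left (f f' : TMat X Y) (g : TMat Y Z) :
    cutMul (f + f') g = cutMul f g + cutMul f' g := mulBy_add_left _ _ _ _

theorem cutMul_add_right (f : TMat X Y) (g g' : TMat Y Z) :
    cutMul f (g + g') = cutMul f g + cutMul f g' := mulBy_add_right _ _ _ _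

theorem mapC_deconc_tone : mapC C.deconc (tone X) = cutMul (tone X) (tone X) := by
  rw [tone, mapC_scal, C.deconc_one, cutMul, mulBy_scal_left, lone_lact, mapC_scal]
  rfl

theorem mapC_deconc_ι (f : CMat C.Mor X Y) : mapC C.deconc (mapC (TensorAlgebra.ι S) f) =
    cutMul (tone X) (mapC (TensorAlgebra.ι S) f) + cutMul (mapC (TensorAlgebra.ι S) f) (tone Y) := by
  have h : C.deconc ∘ₗ TensorAlgebra.ι S = TensorProduct.mk S _ _ 1 ∘ₗ TensorAlgebra.ι S +
      (TensorProduct.mk S _ _).flip 1 ∘ₗ TensorAlgebra.ι S := by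
    ext x
    simp [C.deconc_ι]
  rw [mapC_mapC, h, mapC_map_add, cutMul, cutMul, tone, mulBy_scal_left, lone_lact, tone,
    mulBy_scal_right, ract_lone, mapC_mapC, mapC_mapC]

theorem mapC_deconc_geom : mapC C.deconc (geom X) = cutMul (geom X) (geom X) := by
  have h1 : mapC C.deconc (geom X) = cutMul (geom X) (tone X) +
      mulBy (cutR C) (mapC C.deconc (geom X)) (δT X) := by
    refine cmat_add_left_cancel (f := cutMul (geom X) (δT X)) ?_
    conv_lhs => rw [geom_eq_add_geom_mul, mapC_add, mapC_deconc_tone, ← geom_eq_add_geom_mul,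
      add_comm, add_assoc, mapC_deconc_mul, δT, mapC_deconc_ι, mulBy_add_right, mul_cutMul,
      mul_cutMul, tmul_tone]
    conv_rhs => rw [geom_eq_add_geom_mul, cutMul_add_left _ _ (tone X), ← geom_eq_add_geom_mul, δT]
    abel
  have h2 : cutMul (geom X) (geom X) = cutMul (geom X) (tone X) +
      mulBy (cutR C) (cutMul (geom X) (geom X)) (δT X) := by
    rw [cutMul_mul, ← cutMul_add_right, ← geom_eq_add_geom_mul]
  exact eq_of_eq_add_mul_δT (cutR C)
    (fun m => by simp [cutR, ← Algebra.TensorProduct.one_def])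
    (fun m a c => by simp [cutR, mul_assoc]) h1 h2

/-- `G f G`, where `G = 1 + δ + δ ⊗ δ + ⋯`. -/
def word₁ (f : CMat C.Mor X Y) : TMat X Y := geom X ⬝ mapC (TensorAlgebra.ι S) f ⬝ geom Y

/-- `G f G g G`. -/
def word₂ (f : CMat C.Mor X Y) (g : CMat C.Mor Y Z) : TMat X Z :=
  word₁ f ⬝ mapC (TensorAlgebra.ι S) g ⬝ geom Z

/-- `G f G g G h G`. -/
def word₃ (f : CMat C.Mor W X) (g : CMat C.Mor X Y) (h : CMat C.Mor Y Z) : TMat W Z :=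
  word₂ f g ⬝ mapC (TensorAlgebra.ι S) h ⬝ geom Z

theorem word₂_eq (f : CMat C.Mor X Y) (g : CMat C.Mor Y Z) :
    word₂ f g = geom X ⬝ mapC (TensorAlgebra.ι S) f ⬝ word₁ g := by
  simp only [word₂, word₁, tmul_assoc]

theorem word₃_eq (f : CMat C.Mor W X) (g : CMat C.Mor X Y) (h : CMat C.Mor Y Z) :
    word₃ f g h = geom W ⬝ mapC (TensorAlgebra.ι S) f ⬝ word₂ g h := by
  simp only [word₃, word₂, word₁, tmul_assoc]

theorem word₁_mul_word₁ (f : CMat C.Mor W X) (g : CMat C.Mor X Y) (h : CMat C.Mor Y Z) :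
    word₁ f ⬝ mapC (TensorAlgebra.ι S) g ⬝ word₁ h = word₃ f g h := by
  simp only [word₃, word₂, word₁, tmul_assoc]

theorem mapC_deconc_step (f : TMat X Y) (g : CMat C.Mor Y Z) {R} (hf : mapC C.deconc f =
    R + cutMul f (geom Y)) :
    mapC C.deconc (f ⬝ mapC (TensorAlgebra.ι S) g ⬝ geom Z) =
      mulBy (cutR C) R (mapC (TensorAlgebra.ι S) g ⬝ geom Z) + cutMul f (word₁ g) +
        cutMul (f ⬝ mapC (TensorAlgebra.ι S) g ⬝ geom Z) (geom Z) := by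
  have h1 : mapC C.deconc (f ⬝ mapC (TensorAlgebra.ι S) g) =
      mulBy (cutR C) R (mapC (TensorAlgebra.ι S) g) +
        cutMul f (geom Y ⬝ mapC (TensorAlgebra.ι S) g) +
        cutMul (f ⬝ mapC (TensorAlgebra.ι S) g) (tone Z) := by
    refine cmat_add_left_cancel (f := cutMul f (mapC (TensorAlgebra.ι S) g)) ?_
    rw [add_comm, mapC_deconc_mul, hf, mapC_deconc_ι, mulBy_add_left, mulBy_add_right, mul_cutMul,
      mul_cutMul, tmul_tone, cutMul_mul]
    abel
  refine cmat_add_left_cancel (f := cutMul (f ⬝ mapC (TensorAlgebra.ι S) g) (geom Z)) ?_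
  rw [add_comm, mapC_deconc_mul, h1, mapC_deconc_geom, mul_cutMul, mulBy_add_left, mulBy_add_left,
    cutMul_mul, cutMul_mul, tone_tmul, word₁,
    mulBy_assoc (cutR C) (cutR C) (LinearMap.mul S (TensorAlgebra S C.Mor)) (cutR C) (fun m a c => by simp [cutR, mul_assoc])]
  abel

theorem mapC_deconc_word₁ (f : CMat C.Mor X Y) : mapC C.deconc (word₁ f) =
    cutMul (geom X) (word₁ f) + cutMul (word₁ f) (geom Y) := by
  rw [word₁, mapC_deconc_step (geom X) f (R := 0) (by rw [mapC_deconc_geom, zero_add]),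
    mulBy_zero_left, zero_add]
  rfl

theorem mapC_deconc_word₂ (f : CMat C.Mor X Y) (g : CMat C.Mor Y Z) :
    mapC C.deconc (word₂ f g) =
    cutMul (geom X) (word₂ f g) + cutMul (word₁ f) (word₁ g) + cutMul (word₂ f g) (geom Z) := by
  rw [word₂, mapC_deconc_step (word₁ f) g (mapC_deconc_word₁ f), cutMul_mul, tmul_assoc]

theorem mapC_deconc_word₃ (f : CMat C.Mor W X) (g : CMat C.Mor X Y) (h : CMat C.Mor Y Z) :
    mapC C.deconc (word₃ f g h) =
    cutMul (geom W) (word₃ f g h) + cutMul (word₁ f) (word₂ g h) + cutMul (word₂ f g) (word₁ h) +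
      cutMul (word₃ f g h) (geom Z) := by
  rw [word₃, mapC_deconc_step (word₂ f g) h (mapC_deconc_word₂ f g), mulBy_add_left,
    cutMul_mul, cutMul_mul]
  simp only [word₂, tmul_assoc]

/-- `u ⊗ v ↦ α(u) γ(v)`. -/
def mulMap (α γ : TensorAlgebra S C.Mor →ₗ[S] TensorAlgebra S C.Mor) :
    TensorAlgebra S C.Mor ⊗[S] TensorAlgebra S C.Mor →ₗ[S] TensorAlgebra S C.Mor :=
  LinearMap.mul' S _ ∘ₗ TensorProduct.map α γ

theorem mapC_conv (α γ : TensorAlgebra S C.Mor →ₗ[S] TensorAlgebra S C.Mor) (f : TMat X Y) :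
    mapC (C.conv α γ) f = mapC (mulMap α γ) (mapC C.deconc f) := by
  rw [mapC_mapC]
  rfl

theorem mapC_cutMul (α γ : TensorAlgebra S C.Mor →ₗ[S] TensorAlgebra S C.Mor)
    (f : TMat X Y) (g : TMat Y Z) : mapC (mulMap α γ) (cutMul f g) = mapC α f ⬝ mapC γ g := by
  rw [cutMul, mapC_mulBy, mulBy_mapC_left, mulBy_mapC_right]
  congr 2

theorem mapC_ι_comp_b (f : TMat X Y) :
    mapC (TensorAlgebra.ι S ∘ₗ C.b) f = mapC (TensorAlgebra.ι S) (mapC C.b f) := (mapC_mapC _ _ _).symm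

theorem mapC_b_lact (A : LMat X Y) (f : TMat Y Z) : mapC C.b (lact A f) = lact A (mapC C.b f) :=
  mapC_lact _ _ _

/-! ### Signs -/

variable (X) in
/-- The diagonal matrix of the signs `(-1)^{deg i}`. -/
def eps : LMat X X := ldiag fun i => sg S (X.deg i)

theorem eps_mul_eps : lmul (eps X) (eps X) = lone X := by
  funext i j
  rw [eps, lmul_ldiag_left_apply]
  by_cases h : j = i
  · subst h
    simp [ldiag, lone, smul_smul, sg_mul_self]
  · simp only [ldiag, lone]
    rw [Pi.single_eq_of_ne h, Pi.single_eq_of_ne h, smul_zero]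

theorem eps_lact_eps_lact {M : Type u} [AddCommGroup M] [Module S M] (f : CMat M X Y) :
    lact (eps X) (lact (eps X) f) = f := by
  rw [lact_lact, eps_mul_eps, lone_lact]

theorem ract_eps_ract_eps {M : Type u} [AddCommGroup M] [Module S M] (f : CMat M X Y) :
    ract (ract f (eps Y)) (eps Y) = f := by
  rw [ract_ract, eps_mul_eps, ract_lone]

theorem rTensor_eq_smul_of_mem {M P : Type u} [AddCommGroup M] [Module S M] [AddCommGroup P]
    [Module S P] (L : M →ₗ[S] M) (c : S) (N : Submodule S M) (hL : ∀ x ∈ N, L x = c • x)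
    {z : M ⊗[S] P} (hz : z ∈ LinearMap.range (N.subtype.rTensor P)) : L.rTensor P z = c • z := by
  obtain ⟨y, rfl⟩ := hz
  induction y using TensorProduct.induction_on with
  | zero => simp
  | tmul x p =>
    rw [LinearMap.rTensor_tmul, LinearMap.rTensor_tmul, Submodule.subtype_apply, hL _ x.2,
      TensorProduct.smul_tmul']
  | add x y hx hy => rw [map_add, map_add, smul_add, hx, hy]

variable (X Y) in
/-- The matrices of degree `k`. -/
def degC (k : ℤ) : Submodule S (CMat C.Mor X Y) where
  carrier := {f | ∀ i j p, f i j p ∈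
    LinearMap.range ((C.Hom (X.obj i) (Y.obj j) (k + X.deg i - Y.deg j)).subtype.rTensor (Y.P j))}
  zero_mem' _ _ _ := Submodule.zero_mem _
  add_mem' hf hg i j p := Submodule.add_mem _ (hf i j p) (hg i j p)
  smul_mem' c _ hf i j p := Submodule.smul_mem _ c (hf i j p)

theorem mapC_sgn {k : ℤ} {f : CMat C.Mor X Y} (hf : f ∈ degC X Y k) :
    mapC C.sgn f = sg S k • ract (lact (eps X) f) (eps Y) := by
  funext i j
  rw [Pi.smul_apply, Pi.smul_apply, eps, eps, ract_ldiag_apply, lact_ldiag_apply, smul_smul,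
    smul_smul]
  ext p
  rw [LinearMap.smul_apply, mapC_apply, LinearMap.comp_apply,
    rTensor_eq_smul_of_mem C.sgn _ _ (fun x hx => C.sgn_of_mem hx) (hf i j p)]
  congr 1
  rw [sg_sub, sg_add]
  ring

theorem mapC_sgT_ι {k : ℤ} {f : CMat C.Mor X Y} (hf : f ∈ degC X Y k) :
    mapC C.sgT.toLinearMap (mapC (TensorAlgebra.ι S) f) =
      sg S (k - 1) • ract (lact (eps X) (mapC (TensorAlgebra.ι S) f)) (eps Y) := by
  have h : C.sgT.toLinearMap ∘ₗ TensorAlgebra.ι S = (-1 : S) • (TensorAlgebra.ι S ∘ₗ C.sgn) := by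
    ext x
    rw [LinearMap.comp_apply, AlgHom.toLinearMap_apply, C.sgT_ι, LinearMap.smul_apply,
      LinearMap.comp_apply, ← map_smul, neg_one_smul]
  rw [mapC_mapC, h, mapC_map_smul, ← mapC_mapC, mapC_sgn hf, mapC_smul, mapC_ract, mapC_lact,
    sg_sub, sg_one, smul_smul, mul_comm]

theorem mapC_sgT_mul (f : TMat X Y) (g : TMat Y Z) : mapC C.sgT.toLinearMap (f ⬝ g) =
    mapC C.sgT.toLinearMap f ⬝ mapC C.sgT.toLinearMap g := by
  have h : (LinearMap.mul S (TensorAlgebra S C.Mor)).compr₂ C.sgT.toLinearMap =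
      (LinearMap.mul S (TensorAlgebra S C.Mor) ∘ₗ C.sgT.toLinearMap).compl₂ C.sgT.toLinearMap :=
    LinearMap.ext₂ fun a b => map_mul C.sgT a b
  rw [mapC_mulBy, mulBy_mapC_left, mulBy_mapC_right, h]

theorem mapC_sgT_tone : mapC C.sgT.toLinearMap (tone X) = tone X := by
  rw [tone, mapC_scal, AlgHom.toLinearMap_apply, map_one]

theorem eps_tone_eps : ract (lact (eps X) (tone X)) (eps X) = tone X := by
  rw [tone, lact_scal, ract_scal, lmul_lone, eps_mul_eps]

theorem eps_mul_eps_mul (f : TMat X Y) (g : TMat Y Z) :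
    ract (lact (eps X) f) (eps Y) ⬝ ract (lact (eps Y) g) (eps Z) =
      ract (lact (eps X) (f ⬝ g)) (eps Z) := by
  rw [mulBy_ract_left, lact_ract, eps_lact_eps_lact, mulBy_ract_right, mulBy_lact]

theorem δ_mem_degC : X.δ ∈ degC X X 1 := X.δ_mem

theorem mapC_sgT_geom : mapC C.sgT.toLinearMap (geom X) = ract (lact (eps X) (geom X)) (eps X) := by
  have h : ∀ n, mapC C.sgT.toLinearMap (δpow X n) = ract (lact (eps X) (δpow X n)) (eps X) := by
    intro n
    induction n with
    | zero => rw [δpow_zero, mapC_sgT_tone, eps_tone_eps]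
    | succ n ih =>
      rw [δpow_succ, mapC_sgT_mul, ih, δT, mapC_sgT_ι δ_mem_degC, sub_self, sg_zero, one_smul,
        eps_mul_eps_mul]
  rw [geom, mapC_sum, lact_sum, sum_ract]
  exact Finset.sum_congr rfl fun n _ => h n

theorem mapC_sgT_word₁ {k : ℤ} {f : CMat C.Mor X Y} (hf : f ∈ degC X Y k) :
    mapC C.sgT.toLinearMap (word₁ f) =
      sg S (k - 1) • ract (lact (eps X) (word₁ f)) (eps Y) := by
  rw [word₁, mapC_sgT_mul, mapC_sgT_mul, mapC_sgT_geom, mapC_sgT_geom, mapC_sgT_ι hf,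
    mulBy_smul_right, eps_mul_eps_mul, mulBy_smul_left, eps_mul_eps_mul]

theorem mapC_sgT_word₂ {k l : ℤ} {f : CMat C.Mor X Y} (hf : f ∈ degC X Y k) {g : CMat C.Mor Y Z}
    (hg : g ∈ degC Y Z l) : mapC C.sgT.toLinearMap (word₂ f g) =
      (sg S (k - 1) * sg S (l - 1)) • ract (lact (eps X) (word₂ f g)) (eps Z) := by
  rw [word₂, mapC_sgT_mul, mapC_sgT_mul, mapC_sgT_geom, mapC_sgT_word₁ hf, mapC_sgT_ι hg,
    mulBy_smul_right, mulBy_smul_left, mulBy_smul_left, mulBy_smul_left, eps_mul_eps_mul,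
    eps_mul_eps_mul, smul_smul, mul_comm]

/-! ### The `A_∞`-relations of twisted complexes -/

theorem mapC_b_bar (f : TMat X Y) : mapC C.b (mapC C.bar f) = 0 := by
  rw [mapC_mapC, C.b_comp_bar, mapC_map_zero]

/-- The differential of matrices. -/
def dif (f : CMat C.Mor X Y) : CMat C.Mor X Y := lact (eps X) (mapC C.b (word₁ f))

/-- The product of matrices (first `f`, then `g`). -/
def prod₂ (f : CMat C.Mor X Y) (g : CMat C.Mor Y Z) : CMat C.Mor X Z :=
  lact (eps X) (mapC C.b (word₂ f g))

/-- The ternary product of matrices (first `f`, then `g`, then `h`). -/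
def prod₃ (f : CMat C.Mor W X) (g : CMat C.Mor X Y) (h : CMat C.Mor Y Z) : CMat C.Mor W Z :=
  lact (eps W) (mapC C.b (word₃ f g h))

theorem IsTwisted.mapC_b_geom (hX : X.IsTwisted) : mapC C.b (geom X) = 0 := hX

theorem mapC_barLeft_geom (hX : X.IsTwisted) : mapC C.barLeft (geom X) = 0 := by
  rw [barLeft, mapC_conv, mapC_deconc_geom, mapC_cutMul, mapC_ι_comp_b, hX.mapC_b_geom, mapC_zero,
    mulBy_zero_left]

theorem mapC_barLeft_word₁ (hX : X.IsTwisted) (f : CMat C.Mor X Y) : mapC C.barLeft (word₁ f) =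
    mapC (TensorAlgebra.ι S) (mapC C.b (word₁ f)) ⬝ geom Y := by
  rw [barLeft, mapC_conv, mapC_deconc_word₁]
  simp only [mapC_add, mapC_cutMul, mapC_ι_comp_b, hX.mapC_b_geom, mapC_zero, mulBy_zero_left,
    zero_add, mapC_id]

theorem mapC_barLeft_word₂ (hX : X.IsTwisted) (f : CMat C.Mor X Y) (g : CMat C.Mor Y Z) :
    mapC C.barLeft (word₂ f g) =
    mapC (TensorAlgebra.ι S) (mapC C.b (word₁ f)) ⬝ word₁ g +
      mapC (TensorAlgebra.ι S) (mapC C.b (word₂ f g)) ⬝ geom Z := by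
  rw [barLeft, mapC_conv, mapC_deconc_word₂]
  simp only [mapC_add, mapC_cutMul, mapC_ι_comp_b, hX.mapC_b_geom, mapC_zero, mulBy_zero_left,
    zero_add, mapC_id]

theorem mapC_barLeft_word₃ (hW : W.IsTwisted) (f : CMat C.Mor W X) (g : CMat C.Mor X Y)
    (h : CMat C.Mor Y Z) : mapC C.barLeft (word₃ f g h) =
    mapC (TensorAlgebra.ι S) (mapC C.b (word₁ f)) ⬝ word₂ g h +
      mapC (TensorAlgebra.ι S) (mapC C.b (word₂ f g)) ⬝ word₁ h +
      mapC (TensorAlgebra.ι S) (mapC C.b (word₃ f g h)) ⬝ geom Z := by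
  rw [barLeft, mapC_conv, mapC_deconc_word₃]
  simp only [mapC_add, mapC_cutMul, mapC_ι_comp_b, hW.mapC_b_geom, mapC_zero, mulBy_zero_left,
    zero_add, mapC_id]

theorem eps_mul_ι_mul (f : TMat W X) (g : CMat C.Mor X Y) (h : TMat Y Z) :
    ract (lact (eps W) f) (eps X) ⬝ (mapC (TensorAlgebra.ι S) g ⬝ h) =
      lact (eps W) (f ⬝ mapC (TensorAlgebra.ι S) (lact (eps X) g) ⬝ h) := by
  rw [mulBy_ract_left, mulBy_lact, ← mulBy_lact _ (eps X), ← mapC_lact, tmul_assoc]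

theorem dif_dif (hX : X.IsTwisted) (hY : Y.IsTwisted) (f : CMat C.Mor X Y) : dif (dif f) = 0 := by
  have h := mapC_b_bar (word₁ f)
  rw [bar, mapC_conv, mapC_deconc_word₁] at h
  simp only [mapC_add, mapC_cutMul, mapC_barLeft_geom hY, mulBy_zero_right, add_zero,
    mapC_barLeft_word₁ hX, mapC_sgT_geom, eps_mul_ι_mul, mapC_b_lact] at h
  exact h

theorem dif_prod₂ (hX : X.IsTwisted) (hY : Y.IsTwisted) (hZ : Z.IsTwisted) {k : ℤ}
    {f : CMat C.Mor X Y} (hf : f ∈ degC X Y k) (g : CMat C.Mor Y Z) :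
    dif (prod₂ f g) + prod₂ (dif f) g + sg S (k - 1) • prod₂ f (dif g) = 0 := by
  have h := mapC_b_bar (word₂ f g)
  rw [bar, mapC_conv, mapC_deconc_word₂] at h
  simp only [mapC_add, mapC_cutMul, mapC_barLeft_geom hZ, mulBy_zero_right, add_zero,
    mapC_barLeft_word₂ hX, mapC_barLeft_word₁ hY, mapC_sgT_geom, mapC_sgT_word₁ hf,
    mulBy_add_right, mulBy_smul_left, eps_mul_ι_mul, mapC_b_lact, mapC_smul, ← word₂_eq] at h
  rw [add_comm (dif _)]
  exact h

theorem dif_prod₃ (hW : W.IsTwisted) (hX : X.IsTwisted) (hY : Y.IsTwisted) (hZ : Z.IsTwisted)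
    {k l : ℤ} {f : CMat C.Mor W X} (hf : f ∈ degC W X k) {g : CMat C.Mor X Y}
    (hg : g ∈ degC X Y l) (h : CMat C.Mor Y Z) :
    prod₃ (dif f) g h + prod₂ (prod₂ f g) h + dif (prod₃ f g h) +
      sg S (k - 1) • (prod₃ f (dif g) h + prod₂ f (prod₂ g h)) +
      (sg S (k - 1) * sg S (l - 1)) • prod₃ f g (dif h) = 0 := by
  have H := mapC_b_bar (word₃ f g h)
  rw [bar, mapC_conv, mapC_deconc_word₃] at H
  simp only [mapC_add, mapC_cutMul, mapC_barLeft_geom hZ, mulBy_zero_right, add_zero,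
    mapC_barLeft_word₃ hW, mapC_barLeft_word₂ hX, mapC_barLeft_word₁ hY, mapC_sgT_geom,
    mapC_sgT_word₁ hf, mapC_sgT_word₂ hf hg,
    mulBy_add_right, mulBy_smul_left, eps_mul_ι_mul, mapC_b_lact, mapC_smul, smul_add, ← word₂_eq, ← word₃_eq, word₁_mul_word₁] at H
  rw [smul_add]
  simp only [add_assoc] at H ⊢
  exact H

end PreTw

end MinimalAInfCat

end

noncomputable section

attribute [local instance] Classical.propDecidable

/-! ### Degrees -/

section Range

variable {S : Type u} [CommRing S] {M K : Type u} [AddCommMonoid M] [Module S M]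
  [AddCommMonoid K] [Module S K] {P Q : Type u} [AddCommGroup P] [Module S P] [AddCommGroup Q]
  [Module S Q]

variable (P) in
/-- The image of `N ⊗ P` in `M ⊗ P`. -/
def Submodule.tens (N : Submodule S M) : Submodule S (M ⊗[S] P) :=
  LinearMap.range (N.subtype.rTensor P)

theorem Submodule.tmul_mem_tens {N : Submodule S M} {m : M} (hm : m ∈ N) (p : P) :
    m ⊗ₜ[S] p ∈ N.tens P := ⟨⟨m, hm⟩ ⊗ₜ p, rfl⟩

theorem Submodule.map_mem_of_mem_tens {N : Submodule S M} {L : M ⊗[S] P →ₗ[S] K}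
    {N' : Submodule S K} (h : ∀ m ∈ N, ∀ p : P, L (m ⊗ₜ p) ∈ N') {z : M ⊗[S] P}
    (hz : z ∈ N.tens P) : L z ∈ N' := by
  obtain ⟨y, rfl⟩ := hz
  induction y using TensorProduct.induction_on with
  | zero => simp
  | tmul x p => exact h x.1 x.2 p
  | add x y hx hy => rw [map_add, map_add]; exact N'.add_mem hx hy

theorem LinearMap.eq_of_mem_tens {N : Submodule S M} {K : Type u} [AddCommGroup K] [Module S K]
    {L L' : M ⊗[S] P →ₗ[S] K}
    (h : ∀ m ∈ N, ∀ p : P, L (m ⊗ₜ p) = L' (m ⊗ₜ p)) {z : M ⊗[S] P}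
    (hz : z ∈ N.tens P) : L z = L' z := by
  obtain ⟨y, rfl⟩ := hz
  induction y using TensorProduct.induction_on with
  | zero => simp
  | tmul x p => exact h x.1 x.2 p
  | add x y hx hy => rw [map_add, map_add, map_add, hx, hy]

end Range

namespace MinimalAInfCat

variable {S : Type u} [CommRing S] (C : MinimalAInfCat.{u, w} S)

/-- The composable sequences of morphisms from `A` to `B`, with `d` the sum of the shifted degrees
`|x| - 1`. -/
inductive IsPath : C.Obj → C.Obj → ℤ → List C.Mor → Prop
  | nil (A) : IsPath A A 0 []
  | cons {A B D d d' x l} : x ∈ C.Hom A B d → IsPath B D d' l → IsPath A D (d - 1 + d') (x :: l)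

/-- The span of the composable sequences. -/
def pathT (A B : C.Obj) (d : ℤ) : Submodule S (TensorAlgebra S C.Mor) :=
  Submodule.span S {z | ∃ l, C.IsPath A B d l ∧ C.word l = z}

variable {C}

theorem IsPath.append {A B D : C.Obj} {d d' : ℤ} {l l' : List C.Mor} (h : C.IsPath A B d l)
    (h' : C.IsPath B D d' l') : C.IsPath A D (d + d') (l ++ l') := by
  induction h with
  | nil => simpa using h'
  | cons hx _ ih =>
    rw [add_assoc]
    exact .cons hx (ih h')

theorem IsPath.susp {A B : C.Obj} {d : ℤ} {l : List C.Mor} (h : C.IsPath A B d l) :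
    C.IsPath A B d (C.susp l) := by
  induction h with
  | nil => exact .nil _
  | cons hx _ ih => exact .cons (C.sgn_pow_mem hx _) ih

theorem IsPath.exists_objects {A B : C.Obj} {d : ℤ} {l : List C.Mor} (h : C.IsPath A B d l) :
    ∃ (X : Fin (l.length + 1) → C.Obj) (k : Fin l.length → ℤ), X 0 = A ∧ X (Fin.last _) = B ∧
      (∀ i, l.get i ∈ C.Hom (X i.castSucc) (X i.succ) (k i)) ∧ ∑ i, k i - l.length = d := by
  induction h with
  | nil A => exact ⟨fun _ => A, fun _ => 0, rfl, rfl, fun i => i.elim0, by simp⟩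
  | @cons A B D d d' x l hx _ ih =>
    obtain ⟨X, k, h0, h1, h2, h3⟩ := ih
    refine ⟨Fin.cons A X, Fin.cons d k, rfl, h1, fun i => ?_, ?_⟩
    · refine Fin.cases ?_ (fun i => ?_) i
      · change x ∈ C.Hom A (X 0) d
        rwa [h0]
      · exact h2 i
    · have e : ∑ i, (Fin.cons d k : Fin (l.length + 1) → ℤ) i = d + ∑ i, k i := by
        rw [Fin.sum_univ_succ]; rfl
      change ∑ i, (Fin.cons d k : Fin (l.length + 1) → ℤ) i - ((l.length + 1 : ℕ) : ℤ) = _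
      rw [e, ← h3]
      push_cast
      ring

theorem IsPath.ml_mem {A B : C.Obj} {d : ℤ} {l : List C.Mor} (h : C.IsPath A B d l) :
    C.ml l ∈ C.Hom A B (d + 2) := by
  obtain ⟨X, k, rfl, rfl, h2, rfl⟩ := h.exists_objects
  have := C.m_mem l.length X k l.get h2
  rw [ml]
  convert this using 2
  ring

theorem b_mem_of_mem_pathT {A B : C.Obj} {d : ℤ} {z : TensorAlgebra S C.Mor}
    (hz : z ∈ C.pathT A B d) : C.b z ∈ C.Hom A B (d + 2) := by
  induction hz using Submodule.span_induction with
  | mem z hz =>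
    obtain ⟨l, hl, rfl⟩ := hz
    rw [C.b_word]
    exact hl.susp.ml_mem
  | zero => simp
  | add x y _ _ hx hy => rw [map_add]; exact Submodule.add_mem _ hx hy
  | smul c x _ hx => rw [map_smul]; exact Submodule.smul_mem _ c hx

theorem ι_mem_pathT {A B : C.Obj} {d : ℤ} {x : C.Mor} (hx : x ∈ C.Hom A B d) :
    TensorAlgebra.ι S x ∈ C.pathT A B (d - 1) := by
  refine Submodule.subset_span ⟨[x], ?_, by simp [word]⟩
  have := IsPath.cons hx (.nil B)
  rwa [add_zero] at this

theorem mul_mem_pathT {A B D : C.Obj} {d d' : ℤ} {y z : TensorAlgebra S C.Mor}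
    (hy : y ∈ C.pathT A B d) (hz : z ∈ C.pathT B D d') : y * z ∈ C.pathT A D (d + d') := by
  induction hy, hz using Submodule.span_induction₂ with
  | mem_mem y z hy hz =>
    obtain ⟨l, hl, rfl⟩ := hy
    obtain ⟨l', hl', rfl⟩ := hz
    exact Submodule.subset_span ⟨l ++ l', hl.append hl', C.word_append l l'⟩
  | zero_left => rw [zero_mul]; exact Submodule.zero_mem _
  | zero_right => rw [mul_zero]; exact Submodule.zero_mem _
  | add_left x y z _ _ _ h1 h2 => rw [add_mul]; exact Submodule.add_mem _ h1 h2
  | add_right x y z _ _ _ h1 h2 => rw [mul_add]; exact Submodule.add_mem _ h1 h2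
  | smul_left r x y _ _ h => rw [smul_mul_assoc]; exact Submodule.smul_mem _ _ h
  | smul_right r x y _ _ h => rw [mul_smul_comm]; exact Submodule.smul_mem _ _ h

namespace PreTw

variable {M N K : Type u}
  [AddCommMonoid M] [Module S M] [AddCommMonoid N] [Module S N] [AddCommMonoid K] [Module S K]
  {W X Y Z : C.PreTw}

local notation:70 f:70 "⬝" g:71 => mulBy (LinearMap.mul _ (TensorAlgebra _ _)) f g

/-- The matrices of degree `k` with respect to a family of submodules of the coefficients. -/
def degBy (U : C.Obj → C.Obj → ℤ → Submodule S M) (X Y : C.PreTw) (k : ℤ) :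
    Submodule S (CMat M X Y) where
  carrier := {f | ∀ i j p, f i j p ∈ (U (X.obj i) (Y.obj j) (k + X.deg i - Y.deg j)).tens (Y.P j)}
  zero_mem' _ _ _ := Submodule.zero_mem _
  add_mem' hf hg i j p := Submodule.add_mem _ (hf i j p) (hg i j p)
  smul_mem' c _ hf i j p := Submodule.smul_mem _ c (hf i j p)

variable {U : C.Obj → C.Obj → ℤ → Submodule S M} {V : C.Obj → C.Obj → ℤ → Submodule S N}
  {U' : C.Obj → C.Obj → ℤ → Submodule S K}

theorem mulBy_mem {β : M →ₗ[S] N →ₗ[S] K} (hβ : ∀ A B D a b, ∀ x ∈ U A B a, ∀ y ∈ V B D b,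
    β x y ∈ U' A D (a + b)) {k l : ℤ} {f : CMat M X Y} (hf : f ∈ degBy U X Y k) {g : CMat N Y Z}
    (hg : g ∈ degBy V Y Z l) : mulBy β f g ∈ degBy U' X Z (k + l) := by
  intro i k' p
  rw [mulBy_apply, LinearMap.sum_apply]
  refine Submodule.sum_mem _ fun j _ => ?_
  rw [LinearMap.comp_apply]
  refine Submodule.map_mem_of_mem_tens (fun m hm q => ?_) (hf i j p)
  rw [extendBy_tmul]
  refine Submodule.map_mem_of_mem_tens (fun n hn r => ?_) (hg j k' q)
  rw [LinearMap.rTensor_tmul]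
  refine Submodule.tmul_mem_tens ?_ r
  convert hβ _ _ _ _ _ m hm n hn using 2
  ring

theorem mapC_mem {θ : M →ₗ[S] N} {a : ℤ} (hθ : ∀ A B d, ∀ x ∈ U A B d, θ x ∈ V A B (d + a)) {k : ℤ}
    {f : CMat M X Y} (hf : f ∈ degBy U X Y k) : mapC θ f ∈ degBy V X Y (k + a) := by
  intro i j p
  rw [mapC_apply, LinearMap.comp_apply]
  refine Submodule.map_mem_of_mem_tens (fun m hm q => ?_) (hf i j p)
  rw [LinearMap.rTensor_tmul]
  refine Submodule.tmul_mem_tens ?_ q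
  convert hθ _ _ _ m hm using 2
  ring

/-- The matrices of linear maps of degree `k`: the entries are nonzero only between equal objects,
with degrees differing by `k`. -/
def IsDegL (A : LMat X Y) (k : ℤ) : Prop :=
  ∀ i j, A i j ≠ 0 → X.obj i = Y.obj j ∧ Y.deg j = X.deg i + k

theorem lact_mem {A : LMat X Y} {a : ℤ} (hA : IsDegL A a) {k : ℤ} {f : CMat M Y Z}
    (hf : f ∈ degBy U Y Z k) : lact A f ∈ degBy U X Z (a + k) := by
  intro i j p
  rw [lact_apply, LinearMap.sum_apply]
  refine Submodule.sum_mem _ fun l _ => ?_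
  by_cases h : A i l = 0
  · rw [h, LinearMap.comp_zero]
    exact Submodule.zero_mem _
  · obtain ⟨h1, h2⟩ := hA i l h
    have := hf l j (A i l p)
    rw [LinearMap.comp_apply, h1]
    convert this using 3
    rw [h2]
    ring

theorem ract_mem {A : LMat Y Z} {a : ℤ} (hA : IsDegL A a) {k : ℤ} {f : CMat M X Y}
    (hf : f ∈ degBy U X Y k) : ract f A ∈ degBy U X Z (k + a) := by
  intro i j p
  rw [ract_apply, LinearMap.sum_apply]
  refine Submodule.sum_mem _ fun l _ => ?_
  by_cases h : A l j = 0
  · rw [h, LinearMap.lTensor_zero, LinearMap.zero_comp]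
    exact Submodule.zero_mem _
  · obtain ⟨h1, h2⟩ := hA l j h
    rw [LinearMap.comp_apply]
    refine Submodule.map_mem_of_mem_tens (fun m hm q => ?_) (hf i l p)
    rw [LinearMap.lTensor_tmul]
    refine Submodule.tmul_mem_tens ?_ _
    rw [← h1, h2]
    convert hm using 2
    ring

theorem isDegL_ldiag (c : X.I → S) : IsDegL (ldiag c) 0 := by
  intro i j h
  by_cases hij : j = i
  · subst hij; simp
  · exact absurd (Pi.single_eq_of_ne hij _) h

theorem lact_eps_mem {k : ℤ} {f : CMat M X Y} (hf : f ∈ degBy U X Y k) :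
    lact (eps X) f ∈ degBy U X Y k := by
  have := lact_mem (isDegL_ldiag fun i => sg S (X.deg i)) hf
  rwa [zero_add] at this

theorem tone_mem : tone X ∈ degBy C.pathT X X 0 := by
  intro i j p
  by_cases hij : j = i
  · subst hij
    have : tone X j j p = 1 ⊗ₜ p := by simp [tone, scal_apply, lone, ldiag]
    rw [this]
    have h1 : (1 : TensorAlgebra S C.Mor) ∈ C.pathT (X.obj j) (X.obj j) (0 + X.deg j - X.deg j) := by
      rw [zero_add, sub_self]
      exact Submodule.subset_span ⟨[], .nil _, rfl⟩
    exact Submodule.tmul_mem_tens h1 p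
  · have : tone X i j = 0 := by
      simp only [tone, scal_apply, lone, ldiag]
      rw [Pi.single_eq_of_ne hij, LinearMap.comp_zero]
    rw [this]
    exact Submodule.zero_mem _

theorem tmul_mem {k l : ℤ} {f : TMat X Y} (hf : f ∈ degBy C.pathT X Y k) {g : TMat Y Z}
    (hg : g ∈ degBy C.pathT Y Z l) : f ⬝ g ∈ degBy C.pathT X Z (k + l) :=
  mulBy_mem (U := C.pathT) (V := C.pathT) (U' := C.pathT)
    (β := LinearMap.mul S (TensorAlgebra S C.Mor)) (fun _ _ _ _ _ _ hx _ hy => mul_mem_pathT hx hy) hf hg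

theorem mapC_ι_mem {k : ℤ} {f : CMat C.Mor X Y} (hf : f ∈ degC X Y k) :
    mapC (TensorAlgebra.ι S) f ∈ degBy C.pathT X Y (k - 1) :=
  mapC_mem (U := C.Hom) (a := -1) (fun _ _ _ _ hx => ι_mem_pathT hx) hf

theorem geom_mem : geom X ∈ degBy C.pathT X X 0 := by
  have h : ∀ n, δpow X n ∈ degBy C.pathT X X 0 := fun n => by
    induction n with
    | zero => rw [δpow_zero]; exact tone_mem
    | succ n ih =>
      have := tmul_mem ih (mapC_ι_mem (δ_mem_degC (X := X)))
      rwa [sub_self, add_zero] at this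
  rw [geom]
  exact Submodule.sum_mem _ fun n _ => h n

theorem mapC_b_mem {k l : ℤ} {f : TMat X Y} (hf : f ∈ degBy C.pathT X Y k) (h : l = k + 2) :
    mapC C.b f ∈ degC X Y l := by
  subst h
  exact mapC_mem (V := C.Hom) (fun _ _ _ _ hx => b_mem_of_mem_pathT hx) hf

theorem word₁_mem {k : ℤ} {f : CMat C.Mor X Y} (hf : f ∈ degC X Y k) :
    word₁ f ∈ degBy C.pathT X Y (k - 1) := by
  have := tmul_mem (tmul_mem geom_mem (mapC_ι_mem hf)) geom_mem
  rwa [zero_add, add_zero] at this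

theorem word₂_mem {k l : ℤ} {f : CMat C.Mor X Y} (hf : f ∈ degC X Y k) {g : CMat C.Mor Y Z}
    (hg : g ∈ degC Y Z l) : word₂ f g ∈ degBy C.pathT X Z (k - 1 + (l - 1)) := by
  have := tmul_mem (tmul_mem (word₁_mem hf) (mapC_ι_mem hg)) geom_mem
  rwa [add_zero] at this

theorem word₃_mem {k l m : ℤ} {f : CMat C.Mor W X} (hf : f ∈ degC W X k) {g : CMat C.Mor X Y}
    (hg : g ∈ degC X Y l) {h : CMat C.Mor Y Z} (hh : h ∈ degC Y Z m) :
    word₃ f g h ∈ degBy C.pathT W Z (k - 1 + (l - 1) + (m - 1)) := by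
  have := tmul_mem (tmul_mem (word₂_mem hf hg) (mapC_ι_mem hh)) geom_mem
  rwa [add_zero] at this

theorem lact_mem_degC {A : LMat X Y} {a : ℤ} (hA : IsDegL A a) {k l : ℤ} {f : CMat C.Mor Y Z}
    (hf : f ∈ degC Y Z k) (h : l = a + k) : lact A f ∈ degC X Z l := by
  subst h
  exact lact_mem (U := C.Hom) hA hf

theorem ract_mem_degC {A : LMat Y Z} {a : ℤ} (hA : IsDegL A a) {k l : ℤ} {f : CMat C.Mor X Y}
    (hf : f ∈ degC X Y k) (h : l = k + a) : ract f A ∈ degC X Z l := by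
  subst h
  exact ract_mem (U := C.Hom) hA hf

theorem dif_mem {k l : ℤ} {f : CMat C.Mor X Y} (hf : f ∈ degC X Y k) (h : l = k + 1) :
    dif f ∈ degC X Y l :=
  lact_eps_mem (U := C.Hom) (mapC_b_mem (word₁_mem hf) (by rw [h]; ring))

theorem prod₂_mem {k l m : ℤ} {f : CMat C.Mor X Y} (hf : f ∈ degC X Y k) {g : CMat C.Mor Y Z}
    (hg : g ∈ degC Y Z l) (h : m = k + l) : prod₂ f g ∈ degC X Z m :=
  lact_eps_mem (U := C.Hom) (mapC_b_mem (word₂_mem hf hg) (by rw [h]; ring))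

theorem prod₃_mem {k l m a : ℤ} {f : CMat C.Mor W X} (hf : f ∈ degC W X k) {g : CMat C.Mor X Y}
    (hg : g ∈ degC X Y l) {h : CMat C.Mor Y Z} (hh : h ∈ degC Y Z m) (e : a = k + l + m - 1) :
    prod₃ f g h ∈ degC W Z a :=
  lact_eps_mem (U := C.Hom) (mapC_b_mem (word₃_mem hf hg hh) (by rw [e]; ring))

/-! ### Linearity -/

theorem dif_add (f g : CMat C.Mor X Y) : dif (f + g) = dif f + dif g := by
  simp only [dif, word₁, mapC_add, mulBy_add_right, mulBy_add_left, lact_add]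

theorem dif_smul (c : S) (f : CMat C.Mor X Y) : dif (c • f) = c • dif f := by
  simp only [dif, word₁, mapC_smul, mulBy_smul_right, mulBy_smul_left, lact_smul]

theorem dif_zero : dif (0 : CMat C.Mor X Y) = 0 := by
  simpa only [zero_smul] using dif_smul 0 (0 : CMat C.Mor X Y)

theorem dif_neg' (f : CMat C.Mor X Y) : dif (-f) = -dif f := by
  refine eq_neg_of_add_eq_zero_left ?_
  rw [← dif_add, neg_add_cancel, dif_zero]

theorem dif_sub (f g : CMat C.Mor X Y) : dif (f - g) = dif f - dif g := by
  rw [sub_eq_add_neg, dif_add, dif_neg', sub_eq_add_neg]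

theorem dif_sum {ι : Type*} (s : Finset ι) (f : ι → CMat C.Mor X Y) :
    dif (∑ a ∈ s, f a) = ∑ a ∈ s, dif (f a) :=
  map_sum (⟨⟨dif, dif_zero⟩, dif_add⟩ : CMat C.Mor X Y →+ CMat C.Mor X Y) _ _

theorem prod₂_add_left (f f' : CMat C.Mor X Y) (g : CMat C.Mor Y Z) :
    prod₂ (f + f') g = prod₂ f g + prod₂ f' g := by
  simp only [prod₂, word₂, word₁, mapC_add, mulBy_add_right, mulBy_add_left, lact_add]

theorem prod₂_add_right (f : CMat C.Mor X Y) (g g' : CMat C.Mor Y Z) :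
    prod₂ f (g + g') = prod₂ f g + prod₂ f g' := by
  simp only [prod₂, word₂, word₁, mapC_add, mulBy_add_right, mulBy_add_left, lact_add]

theorem prod₂_smul_left (c : S) (f : CMat C.Mor X Y) (g : CMat C.Mor Y Z) :
    prod₂ (c • f) g = c • prod₂ f g := by
  simp only [prod₂, word₂, word₁, mapC_smul, mulBy_smul_right, mulBy_smul_left, lact_smul]

theorem prod₂_smul_right (c : S) (f : CMat C.Mor X Y) (g : CMat C.Mor Y Z) :
    prod₂ f (c • g) = c • prod₂ f g := by
  simp only [prod₂, word₂, word₁, mapC_smul, mulBy_smul_right, mulBy_smul_left, lact_smul]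

theorem prod₂_zero_left (g : CMat C.Mor Y Z) : prod₂ (0 : CMat C.Mor X Y) g = 0 := by
  simpa only [zero_smul] using prod₂_smul_left 0 (0 : CMat C.Mor X Y) g

theorem prod₂_zero_right (f : CMat C.Mor X Y) : prod₂ f (0 : CMat C.Mor Y Z) = 0 := by
  simpa only [zero_smul] using prod₂_smul_right 0 f (0 : CMat C.Mor Y Z)

theorem prod₂_neg_left (f : CMat C.Mor X Y) (g : CMat C.Mor Y Z) : prod₂ (-f) g = -prod₂ f g := by
  refine eq_neg_of_add_eq_zero_left ?_
  rw [← prod₂_add_left, neg_add_cancel, prod₂_zero_left]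

theorem prod₂_neg_right (f : CMat C.Mor X Y) (g : CMat C.Mor Y Z) : prod₂ f (-g) = -prod₂ f g := by
  refine eq_neg_of_add_eq_zero_left ?_
  rw [← prod₂_add_right, neg_add_cancel, prod₂_zero_right]

theorem prod₂_sub_left (f f' : CMat C.Mor X Y) (g : CMat C.Mor Y Z) :
    prod₂ (f - f') g = prod₂ f g - prod₂ f' g := by
  rw [sub_eq_add_neg, prod₂_add_left, prod₂_neg_left, sub_eq_add_neg]

theorem prod₂_sub_right (f : CMat C.Mor X Y) (g g' : CMat C.Mor Y Z) :
    prod₂ f (g - g') = prod₂ f g - prod₂ f g' := by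
  rw [sub_eq_add_neg, prod₂_add_right, prod₂_neg_right, sub_eq_add_neg]

theorem prod₂_sum_left {ι : Type*} (s : Finset ι) (f : ι → CMat C.Mor X Y) (g : CMat C.Mor Y Z) :
    prod₂ (∑ a ∈ s, f a) g = ∑ a ∈ s, prod₂ (f a) g :=
  map_sum (⟨⟨fun f => prod₂ f g, prod₂_zero_left g⟩, fun f f' => prod₂_add_left f f' g⟩ :
    CMat C.Mor X Y →+ CMat C.Mor X Z) _ _

theorem prod₂_sum_right {ι : Type*} (s : Finset ι) (f : CMat C.Mor X Y) (g : ι → CMat C.Mor Y Z) :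
    prod₂ f (∑ a ∈ s, g a) = ∑ a ∈ s, prod₂ f (g a) :=
  map_sum (⟨⟨prod₂ f, prod₂_zero_right f⟩, prod₂_add_right f⟩ :
    CMat C.Mor Y Z →+ CMat C.Mor X Z) _ _

/-! ### Scalar coefficients -/

/-- Matrices with coefficients in `S` are matrices of linear maps. -/
def toL (f : CMat S X Y) : LMat X Y := fun i j => (TensorProduct.lid S (Y.P j)).toLinearMap ∘ₗ f i j

theorem mulBy_scalar_left (β : S →ₗ[S] N →ₗ[S] K) (f : CMat S X Y) (g : CMat N Y Z) :
    mulBy β f g = lact (toL f) (mapC (β 1) g) := by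
  funext i k
  rw [mulBy_apply, lact_apply]
  refine Finset.sum_congr rfl fun j _ => ?_
  have h : extendBy β (g j k) = mapC (β 1) g j k ∘ₗ (TensorProduct.lid S (Y.P j)).toLinearMap := by
    refine TensorProduct.ext' fun s p => ?_
    have e : β s = s • β 1 := by rw [← map_smul, smul_eq_mul, mul_one]
    rw [extendBy_tmul, e, LinearMap.rTensor_smul, LinearMap.comp_apply, mapC_apply,
      LinearEquiv.coe_coe, TensorProduct.lid_tmul, map_smul]
    rfl
  rw [h, LinearMap.comp_assoc]
  rfl

theorem mulBy_scalar_right (β : M →ₗ[S] S →ₗ[S] K) (f : CMat M X Y) (g : CMat S Y Z) :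
    mulBy β f g = ract (mapC (β.flip 1) f) (toL g) := by
  funext i k
  rw [mulBy_apply, ract_apply]
  refine Finset.sum_congr rfl fun j _ => ?_
  have h : extendBy β (g j k) = (toL g j k).lTensor K ∘ₗ (β.flip 1).rTensor (Y.P j) := by
    refine TensorProduct.ext' fun m p => ?_
    rw [extendBy_tmul, LinearMap.comp_apply, LinearMap.rTensor_tmul, LinearMap.lTensor_tmul, toL,
      LinearMap.comp_apply]
    generalize g j k p = z
    induction z using TensorProduct.induction_on with
    | zero => simp
    | tmul s q =>
      have : β m s = s • β m 1 := by rw [← map_smul, smul_eq_mul, mul_one]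
      simp [this, TensorProduct.smul_tmul]
    | add x y hx hy => rw [map_add, map_add, TensorProduct.tmul_add, hx, hy]
  rw [h, LinearMap.comp_assoc]
  rfl

theorem toL_add (f g : CMat S X Y) : toL (f + g) = toL f + toL g := by
  funext i j; simp [toL, LinearMap.comp_add]

theorem toL_zero : toL (0 : CMat S X Y) = 0 := by
  funext i j; simp [toL]

theorem toL_smul (c : S) (f : CMat S X Y) : toL (c • f) = c • toL f := by
  funext i j; simp [toL, LinearMap.comp_smul]

theorem toL_mulBy (f : CMat S X Y) (g : CMat S Y Z) :
    toL (mulBy (LinearMap.mul S S) f g) = lmul (toL f) (toL g) := by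
  have h : LinearMap.mul S S 1 = LinearMap.id := by ext; simp
  rw [mulBy_scalar_left, h, mapC_id]
  funext i k
  simp only [toL, lact_apply, lmul_apply]
  ext p
  simp

theorem toL_scal (c : S) (A : LMat X Y) : toL (scal c A) = c • A := by
  funext i j
  ext p
  simp [toL, scal_apply]

theorem toL_lact (A : LMat X Y) (f : CMat S Y Z) : toL (lact A f) = lmul A (toL f) := by
  funext i j
  ext p
  simp [toL, lact_apply, lmul_apply]

theorem toL_ract (f : CMat S X Y) (A : LMat Y Z) : toL (ract f A) = lmul (toL f) A := by
  funext i j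
  ext p
  simp only [toL, ract_apply, lmul_apply, LinearMap.comp_apply, LinearMap.sum_apply, map_sum,
    LinearEquiv.coe_coe]
  refine Finset.sum_congr rfl fun k _ => ?_
  generalize f i k p = z
  induction z using TensorProduct.induction_on with
  | zero => simp
  | tmul s q => simp
  | add x y hx hy => rw [map_add, map_add, map_add, map_add, hx, hy]

end PreTw

end MinimalAInfCat

end

noncomputable section

attribute [local instance] Classical.propDecidable

namespace MinimalAInfCat

/-! ### Words with identities -/

section

variable {S : Type u} [CommRing S] (C : MinimalAInfCat.{u, w} S)

/-- The coefficient of the empty word. -/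
def aug : TensorAlgebra S C.Mor →ₗ[S] S := TensorAlgebra.algebraMapInv.toLinearMap

/-- The part of length one. -/
def lin : TensorAlgebra S C.Mor →ₗ[S] C.Mor := TensorAlgebra.ιInv

theorem aug_one : C.aug 1 = 1 := by simp [aug]

theorem aug_mul (x y : TensorAlgebra S C.Mor) : C.aug (x * y) = C.aug x * C.aug y := by
  simp [aug]

theorem aug_ι (x : C.Mor) : C.aug (TensorAlgebra.ι S x) = 0 := by
  simp [aug, TensorAlgebra.algebraMapInv]

theorem lin_ι (x : C.Mor) : C.lin (TensorAlgebra.ι S x) = x := TensorAlgebra.ι_leftInverse x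

theorem lin_mul (x y : TensorAlgebra S C.Mor) :
    C.lin (x * y) = C.aug x • C.lin y + C.aug y • C.lin x := by
  letI : Module Sᵐᵒᵖ C.Mor := Module.compHom _ ((RingHom.id S).fromOpposite mul_comm)
  haveI : IsCentralScalar S C.Mor := ⟨fun r m => rfl⟩
  have h : ∀ z : TensorAlgebra S C.Mor, (TensorAlgebra.toTrivSqZeroExt z).fst = C.aug z := by
    intro z
    have : (TrivSqZeroExt.fstHom S S C.Mor).comp TensorAlgebra.toTrivSqZeroExt =
        TensorAlgebra.algebraMapInv := by
      ext x
      simp [TensorAlgebra.algebraMapInv]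
    exact DFunLike.congr_fun this z
  change (TensorAlgebra.toTrivSqZeroExt (x * y)).snd =
    C.aug x • (TensorAlgebra.toTrivSqZeroExt y).snd + C.aug y • (TensorAlgebra.toTrivSqZeroExt x).snd
  rw [map_mul, TrivSqZeroExt.snd_mul, h, h]
  rfl

theorem lin_one : C.lin 1 = 0 := by
  have h := C.lin_mul 1 1
  rw [mul_one, aug_one, one_smul] at h
  exact left_eq_add.mp h

theorem aug_word_cons (x : C.Mor) (l : List C.Mor) : C.aug (C.word (x :: l)) = 0 := by
  rw [word_cons, aug_mul, aug_ι, zero_mul]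

/-- The composition with an identity on the left. -/
def idL (A : C.Obj) : C.Mor →ₗ[S] C.Mor where
  toFun x := C.b (TensorAlgebra.ι S (C.id A) * TensorAlgebra.ι S x)
  map_add' x y := by rw [map_add, mul_add, map_add]
  map_smul' c x := by rw [map_smul, mul_smul_comm, map_smul, RingHom.id_apply]

/-- The signed composition with an identity on the right. -/
def idR (A : C.Obj) : C.Mor →ₗ[S] C.Mor where
  toFun x := C.b (TensorAlgebra.ι S x * TensorAlgebra.ι S (C.id A))
  map_add' x y := by rw [map_add, add_mul, map_add]
  map_smul' c x := by rw [map_smul, smul_mul_assoc, map_smul, RingHom.id_apply]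

theorem sgn_id (A : C.Obj) : C.sgn (C.id A) = C.id A := by
  rw [C.sgn_of_mem (C.id_mem A), sg_zero, one_smul]

theorem sgn_pow_id (A : C.Obj) (n : ℕ) : (C.sgn ^ n) (C.id A) = C.id A := by
  induction n with
  | zero => simp
  | succ n ih => rw [pow_succ, Module.End.mul_apply, sgn_id, ih]

theorem idL_of_mem {A B : C.Obj} {d : ℤ} {x : C.Mor} (hx : x ∈ C.Hom A B d) : C.idL A x = x := by
  change C.b _ = x
  rw [b_ι_mul_ι, sgn_id, C.id_m A B d x hx]

theorem idR_of_mem {A B : C.Obj} {d : ℤ} {x : C.Mor} (hx : x ∈ C.Hom A B d) :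
    C.idR B x = C.sgn x := by
  change C.b _ = _
  rw [b_ι_mul_ι, C.m_id A B d _ (C.sgn_mem hx)]

theorem id_mem_susp {A : C.Obj} {l : List C.Mor} (h : C.id A ∈ l) : C.id A ∈ C.susp l := by
  induction l with
  | nil => exact h
  | cons x l ih =>
    rw [susp]
    rcases List.mem_cons.mp h with rfl | h
    · rw [sgn_pow_id]
      exact List.mem_cons_self
    · exact List.mem_cons_of_mem _ (ih h)

theorem b_word_eq_zero {A : C.Obj} {l : List C.Mor} (h : C.id A ∈ l) (hl : l.length ≠ 2) :
    C.b (C.word l) = 0 := by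
  rw [b_word, ml]
  obtain ⟨i, hi⟩ := List.mem_iff_get.mp (C.id_mem_susp h)
  exact C.m_eq_zero_of_id _ (by rwa [length_susp]) _ i A hi

theorem b_mul_id_mul_word (A : C.Obj) (l l' : List C.Mor) :
    C.b (C.word l * TensorAlgebra.ι S (C.id A) * C.word l') =
      C.aug (C.word l) • C.idL A (C.lin (C.word l')) +
        C.aug (C.word l') • C.idR A (C.lin (C.word l)) := by
  have e : C.word l * TensorAlgebra.ι S (C.id A) * C.word l' = C.word (l ++ C.id A :: l') := by
    rw [word_append, word_cons, mul_assoc]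
  have hm : C.id A ∈ l ++ C.id A :: l' := by simp
  rcases l with - | ⟨x, - | ⟨y, l⟩⟩
  · rw [word_nil, aug_one, lin_one, map_zero, smul_zero, add_zero, one_smul]
    rw [word_nil] at e
    rcases l' with - | ⟨x, - | ⟨y, l'⟩⟩
    · rw [e, b_word_eq_zero C hm (by simp), word_nil, lin_one, map_zero]
    · rw [one_mul, word_cons, word_nil, mul_one, lin_ι]
      rfl
    · rw [e, b_word_eq_zero C hm (by simp), word_cons, lin_mul, aug_ι, aug_word_cons, zero_smul,
        zero_smul, add_zero, map_zero]
  · rw [aug_word_cons, zero_smul, zero_add]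
    rcases l' with - | ⟨y, l'⟩
    · rw [word_nil, aug_one, one_smul, mul_one, word_cons, word_nil, mul_one, lin_ι]
      rfl
    · rw [e, b_word_eq_zero C hm (by simp), aug_word_cons, zero_smul]
  · rw [e, b_word_eq_zero C hm (by simp), aug_word_cons, zero_smul, zero_add, C.word_cons x, lin_mul,
      aug_ι, aug_word_cons, zero_smul, zero_smul, add_zero, map_zero, smul_zero]

theorem b_mul_id_mul (A : C.Obj) (u v : TensorAlgebra S C.Mor) :
    C.b (u * TensorAlgebra.ι S (C.id A) * v) =
      C.aug u • C.idL A (C.lin v) + C.aug v • C.idR A (C.lin u) := by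
  induction C.word_mem_span u, C.word_mem_span v using Submodule.span_induction₂ with
  | mem_mem u v hu hv =>
    obtain ⟨l, -, rfl⟩ := hu
    obtain ⟨l', -, rfl⟩ := hv
    exact C.b_mul_id_mul_word A l l'
  | zero_left => simp
  | zero_right => simp
  | add_left x y z _ _ _ h1 h2 =>
    simp only [add_mul, map_add, add_smul, smul_add, h1, h2]; abel
  | add_right x y z _ _ _ h1 h2 =>
    simp only [mul_add, map_add, add_smul, smul_add, h1, h2]; abel
  | smul_left r x y _ _ h =>
    simp only [smul_mul_assoc, map_smul, h, smul_add, smul_eq_mul, mul_smul, smul_comm r]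
  | smul_right r x y _ _ h =>
    simp only [mul_smul_comm, map_smul, h, smul_add, smul_eq_mul, mul_smul, smul_comm r]

end

namespace PreTw

variable {S : Type u} [CommRing S] {C : MinimalAInfCat.{u, w} S} {W X Y Z : C.PreTw}

local notation:70 f:70 "⬝" g:71 => mulBy (LinearMap.mul _ (TensorAlgebra _ _)) f g

/-- The coefficients of the empty word. -/
def c₀ (f : TMat X Y) : LMat X Y := toL (mapC C.aug f)

/-- The part of length one. -/
def c₁ (f : TMat X Y) : CMat C.Mor X Y := mapC C.lin f

theorem c₀_add (f g : TMat X Y) : c₀ (f + g) = c₀ f + c₀ g := by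
  rw [c₀, mapC_add, toL_add]; rfl

theorem c₁_add (f g : TMat X Y) : c₁ (f + g) = c₁ f + c₁ g := mapC_add _ _ _

theorem c₀_mul (f : TMat X Y) (g : TMat Y Z) : c₀ (f ⬝ g) = lmul (c₀ f) (c₀ g) := by
  have h : (LinearMap.mul S (TensorAlgebra S C.Mor)).compr₂ C.aug =
      (LinearMap.mul S S ∘ₗ C.aug).compl₂ C.aug := LinearMap.ext₂ fun a b => C.aug_mul a b
  rw [c₀, mapC_mulBy, h, ← mulBy_mapC_right, ← mulBy_mapC_left, toL_mulBy]
  rfl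

theorem c₁_mul (f : TMat X Y) (g : TMat Y Z) :
    c₁ (f ⬝ g) = lact (c₀ f) (c₁ g) + ract (c₁ f) (c₀ g) := by
  have h : (LinearMap.mul S (TensorAlgebra S C.Mor)).compr₂ C.lin =
      (LinearMap.lsmul S C.Mor ∘ₗ C.aug).compl₂ C.lin +
        ((LinearMap.lsmul S C.Mor).flip ∘ₗ C.lin).compl₂ C.aug :=
    LinearMap.ext₂ fun a b => C.lin_mul a b
  have h1 : LinearMap.lsmul S C.Mor 1 = LinearMap.id := by ext; simp
  have h2 : (LinearMap.lsmul S C.Mor).flip.flip 1 = LinearMap.id := by ext; simp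
  rw [c₁, mapC_mulBy, h, mulBy_add_coeff, ← mulBy_mapC_right, ← mulBy_mapC_left,
    ← mulBy_mapC_right, ← mulBy_mapC_left, mulBy_scalar_left, mulBy_scalar_right, h1, h2, mapC_id,
    mapC_id]
  rfl

theorem c₀_tone : c₀ (tone X) = lone X := by
  rw [c₀, tone, mapC_scal, aug_one, toL_scal, one_smul]

theorem c₁_tone : c₁ (tone X) = 0 := by
  rw [c₁, tone, mapC_scal, lin_one]
  funext i j
  ext p
  simp [scal_apply]

theorem c₀_ι (f : CMat C.Mor X Y) : c₀ (mapC (TensorAlgebra.ι S) f) = 0 := by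
  have h : C.aug ∘ₗ TensorAlgebra.ι S = 0 := by ext x; exact C.aug_ι x
  rw [c₀, mapC_mapC, h, mapC_map_zero, toL_zero]

theorem c₁_ι (f : CMat C.Mor X Y) : c₁ (mapC (TensorAlgebra.ι S) f) = f := by
  have h : C.lin ∘ₗ TensorAlgebra.ι S = LinearMap.id := by ext x; exact C.lin_ι x
  rw [c₁, mapC_mapC, h, mapC_id]

theorem c₀_lact (A : LMat X Y) (f : TMat Y Z) : c₀ (lact A f) = lmul A (c₀ f) := by
  rw [c₀, mapC_lact, toL_lact]; rfl

theorem c₀_ract (f : TMat X Y) (A : LMat Y Z) : c₀ (ract f A) = lmul (c₀ f) A := by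
  rw [c₀, mapC_ract, toL_ract]; rfl

theorem c₁_lact (A : LMat X Y) (f : TMat Y Z) : c₁ (lact A f) = lact A (c₁ f) := mapC_lact _ _ _

theorem c₁_ract (f : TMat X Y) (A : LMat Y Z) : c₁ (ract f A) = ract (c₁ f) A := mapC_ract _ _ _

theorem c₀_geom : c₀ (geom X) = lone X := by
  rw [geom_eq_add_geom_mul, c₀_add, c₀_mul, δT, c₀_ι, lmul_zero, add_zero, c₀_tone]

theorem c₁_geom : c₁ (geom X) = X.δ := by
  rw [geom_eq_add_geom_mul, c₁_add, c₁_mul, δT, c₀_ι, ract_zero, add_zero, c₁_tone, zero_add,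
    c₀_geom, c₁_ι, lone_lact]

theorem c₀_word₁ (f : CMat C.Mor X Y) : c₀ (word₁ f) = 0 := by
  rw [word₁, c₀_mul, c₀_mul, c₀_ι, lmul_zero, zero_lmul]

theorem c₁_word₁ (f : CMat C.Mor X Y) : c₁ (word₁ f) = f := by
  rw [word₁, c₁_mul, c₁_mul, c₀_mul, c₀_ι, lmul_zero, zero_lact, zero_add, ract_zero, add_zero,
    c₁_ι, c₀_geom, c₀_geom, lone_lact, ract_lone]

theorem c₀_word₂ (f : CMat C.Mor X Y) (g : CMat C.Mor Y Z) : c₀ (word₂ f g) = 0 := by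
  rw [word₂, c₀_mul, c₀_mul, c₀_ι, lmul_zero, zero_lmul]

theorem c₁_word₂ (f : CMat C.Mor X Y) (g : CMat C.Mor Y Z) : c₁ (word₂ f g) = 0 := by
  rw [word₂, c₁_mul, c₁_mul, c₀_mul, c₀_ι, c₀_word₁, zero_lact, ract_zero, lmul_zero, zero_lact,
    add_zero, zero_ract, add_zero]

theorem mulBy_id_mul (A : C.Obj) (f : TMat X Y) (g : TMat Y Z) :
    mulBy ((LinearMap.mul S (TensorAlgebra S C.Mor) ∘ₗ
      (LinearMap.mul S (TensorAlgebra S C.Mor)).flip (TensorAlgebra.ι S (C.id A))).compr₂ C.b) f g =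
      lact (c₀ f) (mapC (C.idL A) (c₁ g)) + ract (mapC (C.idR A) (c₁ f)) (c₀ g) := by
  have h : (LinearMap.mul S (TensorAlgebra S C.Mor) ∘ₗ
      (LinearMap.mul S (TensorAlgebra S C.Mor)).flip (TensorAlgebra.ι S (C.id A))).compr₂ C.b =
      (LinearMap.lsmul S C.Mor ∘ₗ C.aug).compl₂ (C.idL A ∘ₗ C.lin) +
        ((LinearMap.lsmul S C.Mor).flip ∘ₗ C.idR A ∘ₗ C.lin).compl₂ C.aug :=
    LinearMap.ext₂ fun a b => C.b_mul_id_mul A a b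
  have h1 : LinearMap.lsmul S C.Mor 1 = LinearMap.id := by ext; simp
  have h2 : (LinearMap.lsmul S C.Mor).flip.flip 1 = LinearMap.id := by ext; simp
  rw [h, mulBy_add_coeff, ← mulBy_mapC_right, ← mulBy_mapC_left,
    ← mulBy_mapC_right, ← mulBy_mapC_left, mulBy_scalar_left, mulBy_scalar_right, h1, h2, mapC_id,
    mapC_id, ← mapC_mapC, ← mapC_mapC]
  rfl

/-- A word with an identity in it: only the words of length two contribute. -/
theorem mapC_b_mul_id_mul (A : C.Obj) (f : TMat W X) (α : LMat X Y) (g : TMat Y Z) :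
    mapC C.b (f ⬝ scal (TensorAlgebra.ι S (C.id A)) α ⬝ g) =
      lact (lmul (c₀ f) α) (mapC (C.idL A) (c₁ g)) +
        ract (mapC (C.idR A) (c₁ f)) (lmul α (c₀ g)) := by
  rw [mulBy_scal_right, mulBy_ract_left, mapC_mulBy, mulBy_mapC_left, ← lact_lact, ← c₀_lact]
  have := mulBy_id_mul A f (lact α g)
  rw [c₁_lact, mapC_lact] at this
  exact this

theorem mapC_idL {A : C.Obj} (hA : ∀ i, X.obj i = A) {k : ℤ} {f : CMat C.Mor X Y}
    (hf : f ∈ degC X Y k) : mapC (C.idL A) f = f := by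
  funext i j
  ext p
  rw [mapC_apply, LinearMap.comp_apply]
  have := LinearMap.eq_of_mem_tens (L := (C.idL A).rTensor (Y.P j)) (L' := LinearMap.id)
    (fun m hm q => by rw [LinearMap.rTensor_tmul, ← hA i, C.idL_of_mem hm]; rfl) (hf i j p)
  exact this

theorem mapC_idR {A : C.Obj} (hA : ∀ i, Y.obj i = A) {k : ℤ} {f : CMat C.Mor X Y}
    (hf : f ∈ degC X Y k) : mapC (C.idR A) f = mapC C.sgn f := by
  funext i j
  ext p
  rw [mapC_apply, LinearMap.comp_apply, mapC_apply, LinearMap.comp_apply]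
  exact LinearMap.eq_of_mem_tens
    (fun m hm q => by rw [LinearMap.rTensor_tmul, ← hA j, C.idR_of_mem hm]; rfl) (hf i j p)

/-! ### Identities -/

variable (X) in
/-- The unsigned matrix of identities. -/
def idC : CMat C.Mor X X := fun i => Pi.single i (TensorProduct.mk S C.Mor (X.P i) (C.id (X.obj i)))

variable (X) in
theorem idC_mem : idC X ∈ degC X X 0 := by
  intro i j p
  by_cases h : j = i
  · subst h
    have e : idC X j j p = C.id (X.obj j) ⊗ₜ p := by simp [idC]
    have h1 : C.id (X.obj j) ∈ C.Hom (X.obj j) (X.obj j) (0 + X.deg j - X.deg j) := by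
      rw [zero_add, sub_self]; exact C.id_mem _
    rw [e]
    exact Submodule.tmul_mem_tens h1 p
  · have e : idC X i j = 0 := by simp only [idC]; rw [Pi.single_eq_of_ne h]
    rw [e]
    exact Submodule.zero_mem _

variable (X) in
/-- The projection to a summand. -/
def ldelta (i : X.I) : LMat X X := ldiag fun j => if j = i then 1 else 0

variable (X) in
theorem idC_eq : idC X = ∑ i, scal (C.id (X.obj i)) (ldelta X i) := by
  funext i j
  simp only [Finset.sum_apply, scal_apply, ldelta, ldiag]
  by_cases h : j = i
  · subst h
    rw [Finset.sum_eq_single j]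
    · simp [idC]
    · intro b _ hb
      ext p
      simp [Ne.symm hb]
    · simp
  · rw [idC, Pi.single_eq_of_ne h]
    symm
    refine Finset.sum_eq_zero fun b _ => ?_
    rw [Pi.single_eq_of_ne h, LinearMap.comp_zero]

theorem sum_ldelta_lact_idL {k : ℤ} {f : CMat C.Mor X Y} (hf : f ∈ degC X Y k) :
    ∑ i, lact (ldelta X i) (mapC (C.idL (X.obj i)) f) = f := by
  funext a j
  simp only [Finset.sum_apply, ldelta, lact_ldiag_apply]
  rw [Finset.sum_eq_single a]
  · ext p
    simp only [if_true, one_smul, mapC_apply]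
    exact LinearMap.eq_of_mem_tens (L' := LinearMap.id)
      (fun m hm q => by rw [LinearMap.rTensor_tmul, C.idL_of_mem hm]; rfl) (hf a j p)
  · intro b _ hb
    simp [Ne.symm hb]
  · simp

theorem sum_ract_ldelta_idR {k : ℤ} {f : CMat C.Mor X Y} (hf : f ∈ degC X Y k) :
    ∑ j, ract (mapC (C.idR (Y.obj j)) f) (ldelta Y j) = mapC C.sgn f := by
  funext a j
  simp only [Finset.sum_apply, ldelta, ract_ldiag_apply]
  rw [Finset.sum_eq_single j]
  · ext p
    simp only [if_true, one_smul, mapC_apply]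
    exact LinearMap.eq_of_mem_tens (L := (C.idR (Y.obj j)).rTensor (Y.P j))
      (L' := C.sgn.rTensor (Y.P j)) (fun m hm q => by rw [LinearMap.rTensor_tmul, C.idR_of_mem hm]; rfl) (hf a j p)
  · intro b _ hb
    simp [Ne.symm hb]
  · simp

theorem mapC_b_mul_idC_mul {k l : ℤ} (f : TMat X Y) (hf : c₁ f ∈ degC X Y k) (g : TMat Y Z)
    (hg : c₁ g ∈ degC Y Z l) :
    mapC C.b (f ⬝ mapC (TensorAlgebra.ι S) (idC Y) ⬝ g) =
      lact (c₀ f) (c₁ g) + ract (mapC C.sgn (c₁ f)) (c₀ g) := by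
  rw [idC_eq, mapC_sum, mulBy_sum_right, mulBy_sum_left, mapC_sum]
  simp only [mapC_scal, mapC_b_mul_id_mul]
  simp only [← lact_lact, ← ract_ract]
  rw [Finset.sum_add_distrib, ← lact_sum, ← sum_ract, sum_ldelta_lact_idL hg,
    sum_ract_ldelta_idR hf]

theorem mapC_sgn_δ : mapC C.sgn X.δ = -ract (lact (eps X) X.δ) (eps X) := by
  rw [mapC_sgn δ_mem_degC, sg_one]
  funext i j
  ext p
  exact neg_one_smul S (ract (lact (eps X) X.δ) (eps X) i j p)

variable (X) in
/-- The identity morphism. -/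
def one' : CMat C.Mor X X := lact (eps X) (idC X)

variable (X) in
theorem one'_mem : one' X ∈ degC X X 0 := lact_eps_mem (U := C.Hom) (idC_mem X)

theorem mul_ι_one' (f : TMat X Y) :
    f ⬝ mapC (TensorAlgebra.ι S) (one' Y) = ract f (eps Y) ⬝ mapC (TensorAlgebra.ι S) (idC Y) := by
  rw [mulBy_ract_left, one', mapC_lact]

theorem c₁_geom_mem : c₁ (geom X) ∈ degC X X 1 := by rw [c₁_geom]; exact δ_mem_degC

variable (X) in
theorem dif_one' : dif (one' X) = 0 := by
  have h := mapC_b_mul_idC_mul (k := 1) (ract (geom X) (eps X))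
    (by
      rw [c₁_ract]
      exact ract_mem_degC (isDegL_ldiag _) c₁_geom_mem (by simp))
    (geom X) c₁_geom_mem
  rw [dif, word₁, mul_ι_one', h, c₀_ract, c₁_ract, c₀_geom, c₁_geom, ract_lone, lone_lmul,
    mapC_ract, mapC_sgn_δ, neg_ract, ract_eps_ract_eps, add_neg_cancel, lact_zero]

theorem prod₂_one'_left {k : ℤ} {f : CMat C.Mor X Y} (hf : f ∈ degC X Y k) :
    prod₂ (one' X) f = f := by
  have h := mapC_b_mul_idC_mul (k := 1) (ract (geom X) (eps X))
    (by
      rw [c₁_ract]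
      exact ract_mem_degC (isDegL_ldiag _) c₁_geom_mem (by simp))
    (word₁ f) (by rw [c₁_word₁]; exact hf)
  rw [prod₂, word₂_eq, mul_ι_one', h, c₀_ract, c₀_geom, c₀_word₁, c₁_word₁, ract_zero, add_zero,
    lone_lmul, eps_lact_eps_lact]

theorem prod₂_one'_right {k : ℤ} {f : CMat C.Mor X Y} (hf : f ∈ degC X Y k) :
    prod₂ f (one' Y) = sg S k • f := by
  have h := mapC_b_mul_idC_mul (k := k) (ract (word₁ f) (eps Y))
    (by
      rw [c₁_ract, c₁_word₁]
      exact ract_mem_degC (isDegL_ldiag _) hf (by simp))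
    (geom Y) c₁_geom_mem
  rw [prod₂, word₂, mul_ι_one', h, c₀_ract, c₁_ract, c₀_word₁, c₁_word₁, c₀_geom, c₁_geom, ract_lone,
    zero_lmul, zero_lact, zero_add, mapC_ract, mapC_sgn hf, smul_ract, ract_eps_ract_eps, lact_smul,
    eps_lact_eps_lact]

end PreTw

end MinimalAInfCat

end

noncomputable section

attribute [local instance] Classical.propDecidable

namespace MinimalAInfCat

namespace PreTw

variable {S : Type u} [CommRing S] {C : MinimalAInfCat.{u, w} S} {F : C.Obj}
  (hF : C.IsOneSpherical F) {W X Y Z : C.PreTw}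

local notation:70 f:70 "⬝" g:71 => mulBy (LinearMap.mul _ (TensorAlgebra _ _)) f g

/-! ### The blocks of the twist -/

variable (X) in
/-- The complex `hom(F,X) ⊗ F`, shifted. -/
def homTw : C.PreTw where
  I := Σ i, Supp F (X.obj i)
  fintype :=
    haveI : ∀ Y, Finite (Supp F Y) := fun Y => (hF.perfect_left Y).1.to_subtype
    Fintype.ofFinite _
  obj _ := F
  deg q := (twist hF X).deg (.inl q)
  P q := (twist hF X).P (.inl q)
  addCommGroup q := (twist hF X).addCommGroup (.inl q)
  module q := (twist hF X).module (.inl q)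
  finite q := (twist hF X).finite (.inl q)
  projective q := (twist hF X).projective (.inl q)
  rk q := (twist hF X).rk (.inl q)
  δ q q' := (twist hF X).δ (.inl q) (.inl q')
  δ_mem q q' := (twist hF X).δ_mem (.inl q) (.inl q')
  δ_triangular q q' := (twist hF X).δ_triangular (.inl q) (.inl q')

/-- The index of a summand of `hom(F,X) ⊗ F`. -/
def tL (q : (homTw hF X).I) : (twist hF X).I := Sum.inl q

/-- The index of a summand of `X`. -/
def tR (i : X.I) : (twist hF X).I := Sum.inr i

/-- The index of a summand of `hom(F,X_i) ⊗ F`. -/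
def hI (i : X.I) (e : Supp F (X.obj i)) : (homTw hF X).I := ⟨i, e⟩

theorem twist_cases {p : (twist hF X).I → Prop} (hl : ∀ q, p (tL hF q)) (hr : ∀ i, p (tR hF i))
    (q) : p q :=
  match q with
  | .inl q => hl q
  | .inr i => hr i

theorem sum_twist {A : Type*} [AddCommMonoid A] (f : (twist hF X).I → A) :
    ∑ q, f q = ∑ q, f (tL hF q) + ∑ i, f (tR hF i) := by
  refine Eq.trans ?_ (Fintype.sum_sum_type (α₁ := (homTw hF X).I) (α₂ := X.I) f)
  refine Finset.sum_congr (Finset.ext fun q => ?_) fun _ _ => rfl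
  exact iff_of_true (Finset.mem_univ q) (Finset.mem_univ (α := (homTw hF X).I ⊕ X.I) q)

variable (X)

/-- The inclusion of `hom(F,X) ⊗ F`. -/
def inL : LMat (homTw hF X) (twist hF X)
  | q, .inl q' => lone (homTw hF X) q q'
  | _, .inr _ => 0

/-- The inclusion of `X`. -/
def inR : LMat X (twist hF X)
  | _, .inl _ => 0
  | i, .inr j => lone X i j

/-- The projection to `hom(F,X) ⊗ F`. -/
def prL : LMat (twist hF X) (homTw hF X)
  | .inl q, q' => lone (homTw hF X) q q'
  | .inr _, _ => 0

/-- The projection to `X`. -/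
def prR : LMat (twist hF X) X
  | .inl _, _ => 0
  | .inr i, j => lone X i j

/-- The evaluation map. -/
def ev : CMat C.Mor (homTw hF X) X := fun q j => (twist hF X).δ (tL hF q) (tR hF j)

variable {X}

/-- The matrix of linear maps corresponding to a matrix of morphisms with sources `F`. -/
def coev (f : CMat C.Mor Z X) : LMat Z (homTw hF X) :=
  fun i q => (C.proj F (X.obj q.1) q.2).rTensor (X.P q.1) ∘ₗ f i q.1

variable {M : Type u} [AddCommMonoid M] [Module S M]

theorem lact_lone_apply (f : CMat M X Y) (i : X.I) (j : Y.I) : ∑ k, f k j ∘ₗ lone X i k = f i j :=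
  congrFun (congrFun (lone_lact f) i) j

theorem ract_lone_apply (f : CMat M X Y) (i : X.I) (j : Y.I) :
    ∑ k, (lone Y k j).lTensor M ∘ₗ f i k = f i j :=
  congrFun (congrFun (ract_lone f) i) j

theorem lact_inL_apply (f : CMat M (twist hF X) Y) (q j) :
    lact (inL hF X) f q j = f (tL hF q) j := by
  have h : ∀ x : X.I, f (tR hF x) j ∘ₗ inL hF X q (tR hF x) = 0 := fun x =>
    LinearMap.comp_zero (f (tR hF x) j)
  rw [lact_apply, sum_twist, Finset.sum_eq_zero fun x _ => h x, add_zero]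
  exact lact_lone_apply (X := homTw hF X) (fun x i => f (tL hF x) i) q j

theorem lact_inR_apply (f : CMat M (twist hF X) Y) (i j) :
    lact (inR hF X) f i j = f (tR hF i) j := by
  have h : ∀ x, f (tL hF x) j ∘ₗ inR hF X i (tL hF x) = 0 := fun x =>
    LinearMap.comp_zero (f (tL hF x) j)
  rw [lact_apply, sum_twist, Finset.sum_eq_zero fun x _ => h x, zero_add]
  exact lact_lone_apply (X := X) (fun x i => f (tR hF x) i) i j

theorem ract_prL_apply (f : CMat M Y (twist hF X)) (i q) :
    ract f (prL hF X) i q = f i (tL hF q) := by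
  have h : ∀ x : X.I, (prL hF X (tR hF x) q).lTensor M ∘ₗ f i (tR hF x) = 0 := fun x => by
    have : prL hF X (tR hF x) q = 0 := rfl
    rw [this, LinearMap.lTensor_zero, LinearMap.zero_comp]
  rw [ract_apply, sum_twist, Finset.sum_eq_zero fun x _ => h x, add_zero]
  exact ract_lone_apply (Y := homTw hF X) (fun i x => f i (tL hF x)) i q

theorem ract_prR_apply (f : CMat M Y (twist hF X)) (i j) :
    ract f (prR hF X) i j = f i (tR hF j) := by
  have h : ∀ x, (prR hF X (tL hF x) j).lTensor M ∘ₗ f i (tL hF x) = 0 := fun x => by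
    have : prR hF X (tL hF x) j = 0 := rfl
    rw [this, LinearMap.lTensor_zero, LinearMap.zero_comp]
  rw [ract_apply, sum_twist, Finset.sum_eq_zero fun x _ => h x, zero_add]
  exact ract_lone_apply (Y := X) (fun i x => f i (tR hF x)) i j

theorem lact_prL_inl (f : CMat M (homTw hF X) Y) (q j) :
    lact (prL hF X) f (tL hF q) j = f q j := lact_lone_apply f q j

theorem lact_prL_inr (f : CMat M (homTw hF X) Y) (i j) :
    lact (prL hF X) f (tR hF i) j = 0 :=
  Finset.sum_eq_zero fun k _ => LinearMap.comp_zero (f k j)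

theorem lact_prR_inr (f : CMat M X Y) (i j) : lact (prR hF X) f (tR hF i) j = f i j :=
  lact_lone_apply f i j

theorem lact_prR_inl (f : CMat M X Y) (q j) : lact (prR hF X) f (tL hF q) j = 0 :=
  Finset.sum_eq_zero fun k _ => LinearMap.comp_zero (f k j)

theorem ract_inL_inl (f : CMat M Y (homTw hF X)) (i q) :
    ract f (inL hF X) i (tL hF q) = f i q := ract_lone_apply f i q

theorem ract_inL_inr (f : CMat M Y (homTw hF X)) (i j) :
    ract f (inL hF X) i (tR hF j) = 0 :=
  Finset.sum_eq_zero fun k _ => by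
    have : inL hF X k (tR hF j) = 0 := rfl
    rw [this, LinearMap.lTensor_zero, LinearMap.zero_comp]

theorem ract_inR_inr (f : CMat M Y X) (i j) : ract f (inR hF X) i (tR hF j) = f i j :=
  ract_lone_apply f i j

theorem ract_inR_inl (f : CMat M Y X) (i q) : ract f (inR hF X) i (tL hF q) = 0 :=
  Finset.sum_eq_zero fun k _ => by
    have : inR hF X k (tL hF q) = 0 := rfl
    rw [this, LinearMap.lTensor_zero, LinearMap.zero_comp]

theorem ract_inL_prL (f : CMat M Y (homTw hF X)) : ract (ract f (inL hF X)) (prL hF X) = f := by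
  funext i q
  rw [ract_prL_apply, ract_inL_inl]

theorem ract_inL_prR (f : CMat M Y (homTw hF X)) : ract (ract f (inL hF X)) (prR hF X) = 0 := by
  funext i q
  rw [ract_prR_apply, ract_inL_inr]
  rfl

theorem ract_inR_prL (f : CMat M Y X) : ract (ract f (inR hF X)) (prL hF X) = 0 := by
  funext i q
  rw [ract_prL_apply, ract_inR_inl]
  rfl

theorem ract_inR_prR (f : CMat M Y X) : ract (ract f (inR hF X)) (prR hF X) = f := by
  funext i q
  rw [ract_prR_apply, ract_inR_inr]

theorem lact_inL_prL (f : CMat M (homTw hF X) Y) : lact (inL hF X) (lact (prL hF X) f) = f := by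
  funext i q
  rw [lact_inL_apply, lact_prL_inl]

theorem lact_inL_prR (f : CMat M X Y) : lact (inL hF X) (lact (prR hF X) f) = 0 := by
  funext i q
  rw [lact_inL_apply, lact_prR_inl]
  rfl

theorem lact_inR_prL (f : CMat M (homTw hF X) Y) : lact (inR hF X) (lact (prL hF X) f) = 0 := by
  funext i q
  rw [lact_inR_apply, lact_prL_inr]
  rfl

theorem lact_inR_prR (f : CMat M X Y) : lact (inR hF X) (lact (prR hF X) f) = f := by
  funext i q
  rw [lact_inR_apply, lact_prR_inr]

theorem ract_ext {f g : CMat M Y (twist hF X)} (h1 : ract f (prL hF X) = ract g (prL hF X))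
    (h2 : ract f (prR hF X) = ract g (prR hF X)) : f = g := by
  funext i q
  induction q using twist_cases hF with
  | hl q => exact (ract_prL_apply hF f i q).symm.trans (h1 ▸ ract_prL_apply hF g i q)
  | hr j => exact (ract_prR_apply hF f i j).symm.trans (h2 ▸ ract_prR_apply hF g i j)

theorem lact_ext {f g : CMat M (twist hF X) Y} (h1 : lact (inL hF X) f = lact (inL hF X) g)
    (h2 : lact (inR hF X) f = lact (inR hF X) g) : f = g := by
  funext q j
  induction q using twist_cases hF with
  | hl q => exact (lact_inL_apply hF f q j).symm.trans (h1 ▸ lact_inL_apply hF g q j)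
  | hr i => exact (lact_inR_apply hF f i j).symm.trans (h2 ▸ lact_inR_apply hF g i j)

theorem ract_block (f : CMat M Y (twist hF X)) :
    ract (ract f (prL hF X)) (inL hF X) + ract (ract f (prR hF X)) (inR hF X) = f := by
  refine ract_ext hF ?_ ?_
  · rw [add_ract, ract_inL_prL, ract_inR_prL, add_zero]
  · rw [add_ract, ract_inL_prR, ract_inR_prR, zero_add]

theorem isDegL_inL : IsDegL (inL hF X) 0 := by
  rintro q (q' | j) h
  · exact isDegL_ldiag (X := homTw hF X) (fun _ => 1) q q' h
  · exact absurd rfl h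

theorem isDegL_inR : IsDegL (inR hF X) 0 := by
  rintro i (q' | j) h
  · exact absurd rfl h
  · exact isDegL_ldiag (X := X) (fun _ => 1) i j h

theorem isDegL_prL : IsDegL (prL hF X) 0 := by
  rintro (q | i) q' h
  · exact isDegL_ldiag (X := homTw hF X) (fun _ => 1) q q' h
  · exact absurd rfl h

theorem isDegL_prR : IsDegL (prR hF X) 0 := by
  rintro (q | i) q' h
  · exact absurd rfl h
  · exact isDegL_ldiag (X := X) (fun _ => 1) i q' h

/-- Matrices of linear maps of degree `k` commute with the signs up to `(-1)^k`. -/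
theorem lmul_eps {A : LMat X Y} {k : ℤ} (hA : IsDegL A k) :
    lmul A (eps Y) = sg S k • lmul (eps X) A := by
  funext i j
  rw [Pi.smul_apply, Pi.smul_apply, eps, eps, lmul_ldiag_left_apply, lmul_ldiag_right_apply,
    smul_smul]
  by_cases h : A i j = 0
  · rw [h, smul_zero, smul_zero]
  · rw [(hA i j h).2, sg_add, mul_comm]

theorem lmul_eps_zero {A : LMat X Y} (hA : IsDegL A 0) : lmul A (eps Y) = lmul (eps X) A := by
  rw [lmul_eps hA, sg_zero, one_smul]

theorem ev_mem : ev hF X ∈ degC (homTw hF X) X 1 := fun q j =>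
  (twist hF X).δ_mem (tL hF q) (tR hF j)

theorem ev_apply_self (i : X.I) (e : Supp F (X.obj i)) :
    ev hF X (hI hF i e) i = (C.Hom F (X.obj i) e).subtype.rTensor (X.P i) :=
  Pi.single_eq_same (M := fun j => C.Hom F (X.obj i) e ⊗[S] X.P i →ₗ[S] C.Mor ⊗[S] X.P j) i _

theorem ev_apply_ne {i j : X.I} (h : j ≠ i) (e : Supp F (X.obj i)) :
    ev hF X (hI hF i e) j = 0 :=
  Pi.single_eq_of_ne (M := fun j => C.Hom F (X.obj i) e ⊗[S] X.P i →ₗ[S] C.Mor ⊗[S] X.P j) h _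

theorem sum_homTw {A : Type*} [AddCommMonoid A] (f : (homTw hF X).I → A) (j : X.I)
    (hf : ∀ i, i ≠ j → ∀ e, f (hI hF i e) = 0) :
    ∑ q, f q = ∑ᶠ e : Supp F (X.obj j), f (hI hF j e) := by
  haveI : ∀ Y, Finite (Supp F Y) := fun Y => (hF.perfect_left Y).1.to_subtype
  letI : ∀ Y, Fintype (Supp F Y) := fun Y => Fintype.ofFinite _
  have h1 : ∑ q, f q = ∑ i, ∑ e, f (hI hF i e) := by
    refine Eq.trans ?_ (Fintype.sum_sigma (α := fun i => Supp F (X.obj i)) f)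
    refine Finset.sum_congr (Finset.ext fun q => ?_) fun _ _ => rfl
    exact iff_of_true (Finset.mem_univ q) (Finset.mem_univ (α := Σ i, Supp F (X.obj i)) q)
  rw [h1, finsum_eq_sum_of_fintype]
  exact Finset.sum_eq_single j (fun i _ hi => Finset.sum_eq_zero fun e _ => hf i hi e) (by simp)

/-- `coev` is inverse to the composition with the evaluation map. -/
theorem lact_coev_ev (hZ : ∀ i, Z.obj i = F) {k : ℤ} {f : CMat C.Mor Z X} (hf : f ∈ degC Z X k) :
    lact (coev hF f) (ev hF X) = f := by
  haveI : ∀ Y, Finite (Supp F Y) := fun Y => (hF.perfect_left Y).1.to_subtype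
  letI : ∀ Y, Fintype (Supp F Y) := fun Y => Fintype.ofFinite _
  funext i j
  rw [lact_apply, sum_homTw hF _ j fun i' hi e => by rw [ev_apply_ne hF hi.symm]; rfl,
    finsum_eq_sum_of_fintype]
  ext p
  rw [LinearMap.sum_apply]
  have h : ∀ e : Supp F (X.obj j), (ev hF X (hI hF j e) j ∘ₗ coev hF f i (hI hF j e)) p =
      ((C.Hom F (X.obj j) e).subtype ∘ₗ C.proj F (X.obj j) e).rTensor (X.P j) (f i j p) := by
    intro e
    rw [LinearMap.comp_apply, ev_apply_self, LinearMap.rTensor_comp]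
    rfl
  rw [Finset.sum_congr rfl fun e _ => h e, ← LinearMap.sum_apply]
  refine LinearMap.eq_of_mem_tens (L' := LinearMap.id) (fun m hm q => ?_) (hf i j p)
  rw [LinearMap.sum_apply]
  simp only [LinearMap.rTensor_tmul, LinearMap.comp_apply, Submodule.subtype_apply]
  rw [← TensorProduct.sum_tmul, LinearMap.id_apply]
  congr 1
  rw [hZ] at hm
  set d := k + Z.deg i - X.deg j
  by_cases hd : C.Hom F (X.obj j) d = ⊥
  · have : m = 0 := by rw [hd] at hm; exact hm
    simp [this]
  · rw [Finset.sum_eq_single ⟨d, hd⟩]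
    · rw [C.proj_of_mem hm]
    · intro e _ he
      rw [C.proj_eq_zero hm fun h => he (Subtype.ext (Prod.mk.inj (Prod.mk.inj h).2).2.symm)]
      rfl
    · simp

theorem coev_lact_ev (A : LMat Z (homTw hF X)) : coev hF (lact A (ev hF X)) = A := by
  haveI : ∀ Y, Finite (Supp F Y) := fun Y => (hF.perfect_left Y).1.to_subtype
  letI : ∀ Y, Fintype (Supp F Y) := fun Y => Fintype.ofFinite _
  funext z q
  obtain ⟨i, e, rfl⟩ : ∃ i e, q = hI hF i e := ⟨q.1, q.2, rfl⟩
  ext p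
  have h1 : coev hF (lact A (ev hF X)) z (hI hF i e) p =
      (C.proj F (X.obj i) e).rTensor (X.P i) (lact A (ev hF X) z i p) := rfl
  rw [h1, lact_apply, sum_homTw hF _ i fun i' hi e => by
    rw [ev_apply_ne hF hi.symm, LinearMap.zero_comp],
    finsum_eq_sum_of_fintype, LinearMap.sum_apply, map_sum]
  have h2 : ∀ e', (C.proj F (X.obj i) e).rTensor (X.P i)
      ((ev hF X (hI hF i e') i ∘ₗ A z (hI hF i e')) p) =
      (C.proj F (X.obj i) e ∘ₗ (C.Hom F (X.obj i) e').subtype).rTensor (X.P i)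
        (A z (hI hF i e') p) := fun e' => by
    rw [ev_apply_self, LinearMap.rTensor_comp]
    rfl
  rw [Finset.sum_congr rfl fun e' _ => h2 e', Finset.sum_eq_single e]
  · have : C.proj F (X.obj i) e ∘ₗ (C.Hom F (X.obj i) e).subtype = LinearMap.id := by
      ext x
      rw [LinearMap.comp_apply, Submodule.subtype_apply, C.proj_of_mem x.2]
      rfl
    rw [this, LinearMap.rTensor_id]
    rfl
  · intro e' _ he
    have : C.proj F (X.obj i) e ∘ₗ (C.Hom F (X.obj i) e').subtype = 0 := by
      ext x
      rw [LinearMap.comp_apply, Submodule.subtype_apply, C.proj_eq_zero x.2 fun h =>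
        he (Subtype.ext (Prod.mk.inj (Prod.mk.inj h).2).2)]
      rfl
    rw [this, LinearMap.rTensor_zero]
    rfl
  · simp

theorem lact_ev_injective {A B : LMat Z (homTw hF X)}
    (h : lact A (ev hF X) = lact B (ev hF X)) : A = B := by
  rw [← coev_lact_ev hF A, h, coev_lact_ev]

theorem isDegL_coev (hZ : ∀ i, Z.obj i = F) {k : ℤ} {f : CMat C.Mor Z X} (hf : f ∈ degC Z X k) :
    IsDegL (coev hF f) (k - 1) := by
  intro i q h
  refine ⟨hZ i, ?_⟩
  by_contra hne
  apply h
  ext p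
  refine LinearMap.eq_of_mem_tens (L := (C.proj F (X.obj q.1) q.2).rTensor (X.P q.1)) (L' := 0)
    (fun m hm r => ?_) (hf i q.1 p)
  rw [LinearMap.rTensor_tmul, C.proj_eq_zero hm, TensorProduct.zero_tmul]
  · rfl
  · intro h'
    apply hne
    have h3 : k + Z.deg i - X.deg q.1 = q.2 := (Prod.mk.inj (Prod.mk.inj h').2).2
    change (q.2 : ℤ) + X.deg q.1 - 1 = _
    rw [← h3]
    ring

theorem coev_add (f g : CMat C.Mor Z X) : coev hF (f + g) = coev hF f + coev hF g := by
  funext i q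
  exact LinearMap.comp_add _ _ _

theorem coev_smul (c : S) (f : CMat C.Mor Z X) : coev hF (c • f) = c • coev hF f := by
  funext i q
  exact LinearMap.comp_smul _ _ _

theorem coev_neg (f : CMat C.Mor Z X) : coev hF (-f) = -coev hF f := by
  funext i q
  exact LinearMap.comp_neg _ _

theorem coev_zero : coev hF (0 : CMat C.Mor Z X) = 0 := by
  funext i q
  exact LinearMap.comp_zero _

theorem mapC_b_ev_mul (f : TMat X Y) (i : X.I) (e : Supp F (X.obj i)) (j : Y.I) :
    mapC C.b (mapC (TensorAlgebra.ι S) (ev hF X) ⬝ f) (hI hF i e) j =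
      pushB f i j ∘ₗ (C.Hom F (X.obj i) e).subtype.rTensor (X.P i) := by
  rw [mapC_apply, mulBy_apply, Finset.sum_eq_single i]
  · rw [mapC_apply, ev_apply_self]
    rfl
  · intro j _ hj
    rw [mapC_apply, ev_apply_ne hF hj, LinearMap.comp_zero, LinearMap.comp_zero]
  · simp

variable (X) in
/-- The differential of `hom(F,X)`. -/
def difA : LMat (homTw hF X) (homTw hF X) :=
  -coev hF (mapC C.b (mapC (TensorAlgebra.ι S) (ev hF X) ⬝ geom X))

theorem mapC_b_ev_geom_mem :
    mapC C.b (mapC (TensorAlgebra.ι S) (ev hF X) ⬝ geom X) ∈ degC (homTw hF X) X 2 :=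
  mapC_b_mem (tmul_mem (mapC_ι_mem (ev_mem hF)) geom_mem) (by norm_num)

theorem homTw_obj (q : (homTw hF X).I) : (homTw hF X).obj q = F := rfl

theorem isDegL_neg {A : LMat X Y} {k : ℤ} (hA : IsDegL A k) : IsDegL (-A) k := fun i j h =>
  hA i j fun h0 => h (by rw [Pi.neg_apply, Pi.neg_apply, h0, neg_zero])

theorem isDegL_difA : IsDegL (difA hF X) 1 := by
  have := isDegL_coev hF (homTw_obj hF) (mapC_b_ev_geom_mem hF (X := X))
  exact isDegL_neg this

theorem homTw_δ : (homTw hF X).δ = scal (C.id F) (difA hF X) := by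
  funext q q'
  obtain ⟨i, e, rfl⟩ : ∃ i e, q = hI hF i e := ⟨q.1, q.2, rfl⟩
  obtain ⟨j, e', rfl⟩ : ∃ i e, q' = hI hF i e := ⟨q'.1, q'.2, rfl⟩
  have h1 : difA hF X (hI hF i e) (hI hF j e') = -((C.proj F (X.obj j) e').rTensor (X.P j) ∘ₗ
      pushB (geom X) i j ∘ₗ (C.Hom F (X.obj i) e).subtype.rTensor (X.P i)) := by
    rw [← mapC_b_ev_mul]
    rfl
  by_cases h : (e' : ℤ) = e + X.deg i - X.deg j + 1
  · have : (homTw hF X).δ (hI hF i e) (hI hF j e') = _ := if_pos h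
    rw [this, scal_apply, h1]
    exact (LinearMap.comp_neg _ _).symm
  · have : (homTw hF X).δ (hI hF i e) (hI hF j e') = _ := if_neg h
    rw [this, scal_apply]
    have h0 : difA hF X (hI hF i e) (hI hF j e') = 0 := by
      by_contra h0
      have h2 := (isDegL_difA hF _ _ h0).2
      apply h
      change (e' : ℤ) + X.deg j - 1 = e + X.deg i - 1 + 1 at h2
      linarith
    rw [h0, LinearMap.comp_zero]
    rfl

end PreTw

end MinimalAInfCat

end

noncomputable section

attribute [local instance] Classical.propDecidable

namespace MinimalAInfCat

namespace PreTw

variable {S : Type u} [CommRing S] {C : MinimalAInfCat.{u, w} S} {F : C.Obj}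
  (hF : C.IsOneSpherical F) {W X Y Z : C.PreTw}

local notation:70 f:70 "⬝" g:71 => mulBy (LinearMap.mul _ (TensorAlgebra _ _)) f g

theorem lact_inL_δ : lact (inL hF X) (twist hF X).δ =
    ract (homTw hF X).δ (inL hF X) + ract (ev hF X) (inR hF X) := by
  refine ract_ext hF ?_ ?_
  · rw [add_ract, ract_inL_prL, ract_inR_prL, add_zero]
    funext q q'
    rw [ract_prL_apply, lact_inL_apply]
    rfl
  · rw [add_ract, ract_inL_prR, ract_inR_prR, zero_add]
    funext q q'
    rw [ract_prR_apply, lact_inL_apply]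
    rfl

theorem lact_inR_δ : lact (inR hF X) (twist hF X).δ = ract X.δ (inR hF X) := by
  refine ract_ext hF ?_ ?_
  · rw [ract_inR_prL]
    funext q q'
    rw [ract_prL_apply, lact_inR_apply]
    rfl
  · rw [ract_inR_prR]
    funext q q'
    rw [ract_prR_apply, lact_inR_apply]
    rfl

theorem lact_inL_δT : lact (inL hF X) (δT (twist hF X)) =
    ract (δT (homTw hF X)) (inL hF X) +
      ract (mapC (TensorAlgebra.ι S) (ev hF X)) (inR hF X) := by
  simp only [δT, ← mapC_lact, lact_inL_δ, mapC_add, mapC_ract]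

theorem lact_inR_δT : lact (inR hF X) (δT (twist hF X)) = ract (δT X) (inR hF X) := by
  simp only [δT, ← mapC_lact, lact_inR_δ, mapC_ract]

variable (X) in
/-- The matrix `1 + δ + δ ⊗ δ + ⋯` of the twist, in blocks. -/
def blockGeom : TMat (twist hF X) (twist hF X) :=
  lact (prL hF X) (ract (geom (homTw hF X)) (inL hF X)) +
    lact (prL hF X) (ract (geom (homTw hF X) ⬝ mapC (TensorAlgebra.ι S) (ev hF X) ⬝ geom X)
      (inR hF X)) +
    lact (prR hF X) (ract (geom X) (inR hF X))

theorem lact_inL_tone :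
    lact (inL hF X) (tone (twist hF X)) = ract (tone (homTw hF X)) (inL hF X) := by
  rw [tone, tone, lact_scal, ract_scal, lmul_lone, lone_lmul]

theorem lact_inR_tone : lact (inR hF X) (tone (twist hF X)) = ract (tone X) (inR hF X) := by
  rw [tone, tone, lact_scal, ract_scal, lmul_lone, lone_lmul]

theorem geom_twist : geom (twist hF X) = blockGeom hF X := by
  refine eq_of_eq_add_mul_δT (LinearMap.mul S (TensorAlgebra S C.Mor)) (fun m => mul_one m)
    (fun m a c => mul_assoc m a c) (a := tone (twist hF X)) geom_eq_add_geom_mul ?_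
  refine lact_ext hF ?_ ?_
  · simp only [blockGeom, lact_add, lact_inL_prL, lact_inL_prR, add_zero, ← mulBy_lact,
      mulBy_add_left, mulBy_zero_left, mulBy_ract_left, lact_inL_δT, lact_inR_δT, mulBy_add_right,
      mulBy_ract_right, lact_inL_tone]
    conv_lhs => rw [geom_eq_add_geom_mul (X := homTw hF X), geom_eq_add_geom_mul (X := X)]
    rw [add_ract, ← geom_eq_add_geom_mul (X := homTw hF X), mulBy_add_right, tmul_tone, add_ract,
      tmul_assoc _ (geom X)]
    abel
  · simp only [blockGeom, lact_add, lact_inR_prL, lact_inR_prR, zero_add, ← mulBy_lact,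
      mulBy_ract_left, lact_inR_δT, mulBy_ract_right, lact_inR_tone]
    rw [← add_ract, ← geom_eq_add_geom_mul]

theorem lact_inL_geom : lact (inL hF X) (geom (twist hF X)) =
    ract (geom (homTw hF X)) (inL hF X) +
      ract (geom (homTw hF X) ⬝ mapC (TensorAlgebra.ι S) (ev hF X) ⬝ geom X) (inR hF X) := by
  simp only [geom_twist, blockGeom, lact_add, lact_inL_prL, lact_inL_prR, add_zero]

theorem lact_inR_geom : lact (inR hF X) (geom (twist hF X)) = ract (geom X) (inR hF X) := by
  simp only [geom_twist, blockGeom, lact_add, lact_inR_prL, lact_inR_prR, zero_add]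

theorem ract_geom_prL : ract (geom (twist hF X)) (prL hF X) =
    lact (prL hF X) (geom (homTw hF X)) := by
  simp only [geom_twist, blockGeom, add_ract, lact_ract, ract_inL_prL, ract_inR_prL, add_zero]

theorem ract_geom_prR : ract (geom (twist hF X)) (prR hF X) =
    lact (prL hF X) (geom (homTw hF X) ⬝ mapC (TensorAlgebra.ι S) (ev hF X) ⬝ geom X) +
      lact (prR hF X) (geom X) := by
  simp only [geom_twist, blockGeom, add_ract, lact_ract, ract_inL_prR, ract_inR_prR, zero_add]

/-! ### Words in the blocks of the twist -/

theorem word₁_ract_inL (p : CMat C.Mor Z (homTw hF X)) : word₁ (ract p (inL hF X)) =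
    ract (word₁ p) (inL hF X) + ract (word₂ p (ev hF X)) (inR hF X) := by
  simp only [word₁, word₂, mapC_ract, mulBy_ract_right, mulBy_ract_left, lact_inL_geom,
    mulBy_add_right, tmul_assoc]

theorem word₁_ract_inR (q : CMat C.Mor Z X) :
    word₁ (ract q (inR hF X)) = ract (word₁ q) (inR hF X) := by
  simp only [word₁, mapC_ract, mulBy_ract_right, mulBy_ract_left, lact_inR_geom]

theorem word₂_ract_inL (f : CMat C.Mor W Z) (p : CMat C.Mor Z (homTw hF X)) :
    word₂ f (ract p (inL hF X)) =
    ract (word₂ f p) (inL hF X) + ract (word₃ f p (ev hF X)) (inR hF X) := by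
  simp only [word₃, word₂, mapC_ract, mulBy_ract_right, mulBy_ract_left, lact_inL_geom,
    mulBy_add_right, tmul_assoc]

theorem word₂_ract_inR (f : CMat C.Mor W Z) (q : CMat C.Mor Z X) :
    word₂ f (ract q (inR hF X)) = ract (word₂ f q) (inR hF X) := by
  simp only [word₂, mapC_ract, mulBy_ract_right, mulBy_ract_left, lact_inR_geom]

theorem mul_lact_prL (f : TMat W (twist hF X)) (g : TMat (homTw hF X) Z) :
    f ⬝ lact (prL hF X) g = ract f (prL hF X) ⬝ g := (mulBy_ract_left _ _ _ _).symm

theorem mul_lact_prR (f : TMat W (twist hF X)) (g : TMat X Z) :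
    f ⬝ lact (prR hF X) g = ract f (prR hF X) ⬝ g := (mulBy_ract_left _ _ _ _).symm

theorem word₁_lact_prL (p : CMat C.Mor (homTw hF X) Z) :
    word₁ (lact (prL hF X) p) = lact (prL hF X) (word₁ p) := by
  simp only [word₁, mapC_lact, mul_lact_prL, ract_geom_prL, mulBy_lact]

theorem word₁_lact_prR (q : CMat C.Mor X Z) : word₁ (lact (prR hF X) q) =
    lact (prL hF X) (word₂ (ev hF X) q) + lact (prR hF X) (word₁ q) := by
  simp only [word₁, word₂, mapC_lact, mul_lact_prR, ract_geom_prR, mulBy_lact, mulBy_add_left]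

theorem word₂_lact_prL (p : CMat C.Mor (homTw hF X) Z) (g : CMat C.Mor Z W) :
    word₂ (lact (prL hF X) p) g = lact (prL hF X) (word₂ p g) := by
  rw [word₂, word₁_lact_prL, mulBy_lact, mulBy_lact, word₂]

theorem word₂_lact_prR (q : CMat C.Mor X Z) (g : CMat C.Mor Z W) : word₂ (lact (prR hF X) q) g =
    lact (prL hF X) (word₃ (ev hF X) q g) + lact (prR hF X) (word₂ q g) := by
  rw [word₂, word₁_lact_prR, mulBy_add_left, mulBy_add_left, mulBy_lact, mulBy_lact, mulBy_lact,
    mulBy_lact]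
  rfl

theorem word₃_lact_prL {V : C.PreTw} (p : CMat C.Mor (homTw hF X) Z) (g : CMat C.Mor Z W)
    (h : CMat C.Mor W V) : word₃ (lact (prL hF X) p) g h = lact (prL hF X) (word₃ p g h) := by
  rw [word₃, word₂_lact_prL, mulBy_lact, mulBy_lact, word₃]

theorem word₂_inL_prL (p : CMat C.Mor W (homTw hF X)) (g : CMat C.Mor (homTw hF X) Z) :
    word₂ (ract p (inL hF X)) (lact (prL hF X) g) = word₂ p g := by
  rw [word₂, word₁_ract_inL, mapC_lact, mulBy_add_left, mulBy_ract_left, mulBy_ract_left,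
    lact_inL_prL, lact_inR_prL, mulBy_zero_right, add_zero, word₂]

theorem word₂_inL_prR (p : CMat C.Mor W (homTw hF X)) (g : CMat C.Mor X Z) :
    word₂ (ract p (inL hF X)) (lact (prR hF X) g) = word₃ p (ev hF X) g := by
  rw [word₂, word₁_ract_inL, mapC_lact, mulBy_add_left, mulBy_ract_left, mulBy_ract_left,
    lact_inL_prR, lact_inR_prR, mulBy_zero_right, zero_add, word₃]

theorem word₂_inR_prL (q : CMat C.Mor W X) (g : CMat C.Mor (homTw hF X) Z) :
    word₂ (ract q (inR hF X)) (lact (prL hF X) g) = 0 := by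
  rw [word₂, word₁_ract_inR, mapC_lact, mulBy_ract_left, lact_inR_prL, mulBy_zero_right,
    mulBy_zero_left]

theorem word₂_inR_prR (q : CMat C.Mor W X) (g : CMat C.Mor X Z) :
    word₂ (ract q (inR hF X)) (lact (prR hF X) g) = word₂ q g := by
  rw [word₂, word₁_ract_inR, mapC_lact, mulBy_ract_left, lact_inR_prR, word₂]

theorem word₁_add (f g : CMat C.Mor X Y) : word₁ (f + g) = word₁ f + word₁ g := by
  simp only [word₁, mapC_add, mulBy_add_right, mulBy_add_left]

theorem word₂_add_left (f f' : CMat C.Mor X Y) (g : CMat C.Mor Y Z) :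
    word₂ (f + f') g = word₂ f g + word₂ f' g := by
  simp only [word₂, word₁, mapC_add, mulBy_add_right, mulBy_add_left]

theorem word₂_add_right (f : CMat C.Mor X Y) (g g' : CMat C.Mor Y Z) :
    word₂ f (g + g') = word₂ f g + word₂ f g' := by
  simp only [word₂, word₁, mapC_add, mulBy_add_right, mulBy_add_left]

/-! ### Evaluation of words in the twist -/

theorem δT_homTw : δT (homTw hF X) = scal (TensorAlgebra.ι S (C.id F)) (difA hF X) := by
  rw [δT, homTw_δ, mapC_scal]

theorem scal_id_mem {A : LMat X Y} {k : ℤ} (hA : IsDegL A k) (hX : ∀ i, X.obj i = F) :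
    scal (C.id F) A ∈ degC X Y k := by
  intro i j p
  by_cases h : A i j = 0
  · rw [scal_apply, h, LinearMap.comp_zero]
    exact Submodule.zero_mem _
  · obtain ⟨h1, h2⟩ := hA i j h
    have h3 : C.id F ∈ C.Hom (X.obj i) (Y.obj j) (k + X.deg i - Y.deg j) := by
      rw [← h1, hX, h2]
      convert C.id_mem F using 2
      ring
    exact Submodule.tmul_mem_tens h3 _

theorem mapC_b_geom_mul (g : TMat (homTw hF X) Z) (h0 : c₀ g = 0) {k : ℤ}
    (h1 : c₁ g ∈ degC (homTw hF X) Z k) :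
    mapC C.b (geom (homTw hF X) ⬝ g) = mapC C.b g + lact (difA hF X) (c₁ g) := by
  have e : geom (homTw hF X) ⬝ g = g + tone _ ⬝ scal (TensorAlgebra.ι S (C.id F)) (difA hF X) ⬝
      (geom (homTw hF X) ⬝ g) := by
    conv_lhs => rw [geom_eq_add_mul_geom, mulBy_add_left, tone_tmul, tmul_assoc, δT_homTw]
    rw [tone_tmul]
  rw [e, mapC_add, mapC_b_mul_id_mul, c₀_mul, c₁_mul, c₁_tone, mapC_zero, zero_ract, c₀_tone,
    c₀_geom, lone_lmul, lone_lact, h0, ract_zero, add_zero, add_zero, mapC_idL (homTw_obj hF) h1]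

theorem mapC_b_mul_geom (f : TMat Z (homTw hF X)) (h0 : c₀ f = 0) {k : ℤ}
    (h1 : c₁ f ∈ degC Z (homTw hF X) k) :
    mapC C.b (f ⬝ geom (homTw hF X)) = mapC C.b f + ract (mapC C.sgn (c₁ f)) (difA hF X) := by
  have e : f ⬝ geom (homTw hF X) = f + (f ⬝ geom (homTw hF X)) ⬝
      scal (TensorAlgebra.ι S (C.id F)) (difA hF X) ⬝ tone _ := by
    conv_lhs => rw [geom_eq_add_geom_mul, mulBy_add_right, tmul_tone, ← tmul_assoc, δT_homTw]
    rw [tmul_tone]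
  rw [e, mapC_add, mapC_b_mul_id_mul, c₀_mul, c₁_mul, c₁_tone, mapC_zero, lact_zero, c₀_tone,
    c₀_geom, lmul_lone, ract_lone, h0, zero_lact, zero_add, zero_add, mapC_idR (homTw_obj hF) h1]

theorem mapC_b_mul_geom_mul (f : TMat W (homTw hF X)) (h0 : c₀ f = 0) (g : TMat (homTw hF X) Z)
    (h1 : c₀ g = 0) : mapC C.b (f ⬝ geom (homTw hF X) ⬝ g) = mapC C.b (f ⬝ g) := by
  have e : f ⬝ geom (homTw hF X) ⬝ g = f ⬝ g + (f ⬝ geom (homTw hF X)) ⬝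
      scal (TensorAlgebra.ι S (C.id F)) (difA hF X) ⬝ g := by
    conv_lhs => rw [geom_eq_add_geom_mul, mulBy_add_right, tmul_tone, ← tmul_assoc, δT_homTw,
      mulBy_add_left]
  rw [e, mapC_add, mapC_b_mul_id_mul, c₀_mul, h0, zero_lmul, zero_lmul, zero_lact, h1, lmul_zero,
    ract_zero, add_zero, add_zero]

theorem mapC_b_word₁_id (α : LMat (homTw hF X) (homTw hF Y)) :
    mapC C.b (word₁ (scal (C.id F) α)) =
      scal (C.id F) (lmul α (difA hF Y) + lmul (difA hF X) α) := by
  rw [word₁, mapC_scal, mapC_b_mul_id_mul, c₀_geom, c₀_geom, c₁_geom, c₁_geom,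
    mapC_idL (homTw_obj hF) δ_mem_degC, mapC_idR (homTw_obj hF) δ_mem_degC, homTw_δ, homTw_δ,
    mapC_scal, sgn_id, lmul_lone, lone_lmul, lact_scal, ract_scal, scal_add]

theorem mapC_b_word₂_id_left (α : LMat (homTw hF X) (homTw hF Y)) {k : ℤ}
    {g : CMat C.Mor (homTw hF Y) Z} (hg : g ∈ degC (homTw hF Y) Z k) :
    mapC C.b (word₂ (scal (C.id F) α) g) = lact α g := by
  rw [word₂_eq, mapC_scal, mapC_b_mul_id_mul, c₀_geom, c₁_word₁, c₀_word₁, lmul_zero, ract_zero,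
    add_zero, lone_lmul, mapC_idL (homTw_obj hF) hg]

theorem mapC_b_word₃_id_left (α : LMat (homTw hF X) (homTw hF Y))
    (g : CMat C.Mor (homTw hF Y) Z) (h : CMat C.Mor Z W) :
    mapC C.b (word₃ (scal (C.id F) α) g h) = 0 := by
  rw [word₃_eq, mapC_scal, mapC_b_mul_id_mul, c₁_word₂, c₀_word₂, lmul_zero, ract_zero,
    add_zero, mapC_zero, lact_zero]

theorem mapC_b_word₂_id_right (α : LMat (homTw hF X) (homTw hF Y)) {k : ℤ}
    {f : CMat C.Mor Z (homTw hF X)} (hf : f ∈ degC Z (homTw hF X) k) :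
    mapC C.b (word₂ f (scal (C.id F) α)) = ract (mapC C.sgn f) α := by
  rw [word₂, mapC_scal, mapC_b_mul_id_mul, c₀_word₁, c₁_word₁, c₀_geom, zero_lmul, zero_lact,
    zero_add, lmul_lone, mapC_idR (homTw_obj hF) hf]

/-! ### The twist is a twisted complex -/

theorem mapC_b_ev_geom : mapC C.b (mapC (TensorAlgebra.ι S) (ev hF X) ⬝ geom X) =
    -lact (difA hF X) (ev hF X) := by
  rw [difA, neg_lact, lact_coev_ev hF (homTw_obj hF) (mapC_b_ev_geom_mem hF), neg_neg]

theorem mapC_deconc_ι_geom (f : CMat C.Mor Z X) :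
    mapC C.deconc (mapC (TensorAlgebra.ι S) f ⬝ geom X) =
      cutMul (tone Z) (mapC (TensorAlgebra.ι S) f ⬝ geom X) +
        cutMul (mapC (TensorAlgebra.ι S) f ⬝ geom X) (geom X) := by
  refine cmat_add_left_cancel (f := cutMul (mapC (TensorAlgebra.ι S) f) (geom X)) ?_
  rw [add_comm, mapC_deconc_mul, mapC_deconc_ι, mapC_deconc_geom, mulBy_add_left, mul_cutMul,
    cutMul_mul, cutMul_mul, tone_tmul]
  abel

theorem mapC_b_bar_ι_geom (hX : X.IsTwisted) (f : CMat C.Mor Z X) :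
    mapC C.b (mapC (TensorAlgebra.ι S)
      (mapC C.b (mapC (TensorAlgebra.ι S) f ⬝ geom X)) ⬝ geom X) = 0 := by
  have h := mapC_b_bar (mapC (TensorAlgebra.ι S) f ⬝ geom X)
  have h1 : mapC C.barLeft (mapC (TensorAlgebra.ι S) f ⬝ geom X) =
      mapC (TensorAlgebra.ι S) (mapC C.b (mapC (TensorAlgebra.ι S) f ⬝ geom X)) ⬝ geom X := by
    have h2 : mapC C.b (tone Z) = 0 := by
      rw [tone, mapC_scal, C.b_one]
      funext i j
      ext p
      simp [scal_apply]
    rw [barLeft, mapC_conv, mapC_deconc_ι_geom, mapC_add, mapC_cutMul, mapC_cutMul, mapC_ι_comp_b,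
      mapC_ι_comp_b, mapC_id, mapC_id, h2, mapC_zero, mulBy_zero_left, zero_add]
  rw [bar, mapC_conv, mapC_deconc_ι_geom, mapC_add, mapC_cutMul, mapC_cutMul,
    mapC_barLeft_geom hX, mulBy_zero_right, add_zero, mapC_sgT_tone, tone_tmul, h1] at h
  exact h

theorem difA_difA (hX : X.IsTwisted) : lmul (difA hF X) (difA hF X) = 0 := by
  refine lact_ev_injective hF ?_
  have h := mapC_b_bar_ι_geom hX (ev hF X)
  have e := lact_coev_ev hF (homTw_obj hF) (mapC_b_ev_geom_mem hF (X := X))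
  rw [zero_lact, difA, neg_lmul, lmul_neg, neg_neg]
  generalize coev hF _ = B at e ⊢
  rw [← e, mapC_lact, mulBy_lact, mapC_lact, ← e, lact_lact] at h
  exact h

theorem isTwisted_homTw (hX : X.IsTwisted) : (homTw hF X).IsTwisted := by
  have e : geom (homTw hF X) = tone _ + (geom (homTw hF X)) ⬝
      scal (TensorAlgebra.ι S (C.id F)) (difA hF X) ⬝ tone _ := by
    conv_lhs => rw [geom_eq_add_geom_mul, δT_homTw]
    rw [tmul_tone]
  have h2 : mapC C.b (tone (homTw hF X)) = 0 := by
    rw [tone, mapC_scal, C.b_one]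
    funext i j
    ext p
    simp [scal_apply]
  change mapC C.b (geom (homTw hF X)) = 0
  rw [e, mapC_add, h2, mapC_b_mul_id_mul, c₁_tone, c₀_tone, c₁_geom, mapC_zero, lact_zero,
    mapC_idR (homTw_obj hF) δ_mem_degC, homTw_δ, mapC_scal, sgn_id, lmul_lone, ract_scal,
    difA_difA hF hX, scal_zero, add_zero, add_zero]

theorem c₀_ev_geom : c₀ (mapC (TensorAlgebra.ι S) (ev hF X) ⬝ geom X) = 0 := by
  rw [c₀_mul, c₀_ι, zero_lmul]

theorem c₁_ev_geom : c₁ (mapC (TensorAlgebra.ι S) (ev hF X) ⬝ geom X) = ev hF X := by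
  rw [c₁_mul, c₀_ι, zero_lact, zero_add, c₁_ι, c₀_geom, ract_lone]

theorem mapC_b_geom_ev_geom : mapC C.b (geom (homTw hF X) ⬝ mapC (TensorAlgebra.ι S) (ev hF X) ⬝
    geom X) = 0 := by
  rw [tmul_assoc, mapC_b_geom_mul hF _ (c₀_ev_geom hF) (k := 1), c₁_ev_geom, mapC_b_ev_geom,
    neg_add_cancel]
  rw [c₁_ev_geom]
  exact ev_mem hF

theorem dif_ev : dif (ev hF X) = 0 := by
  rw [dif, word₁, mapC_b_geom_ev_geom, lact_zero]

theorem isTwisted_twist (hX : X.IsTwisted) : (twist hF X).IsTwisted := by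
  change mapC C.b (geom (twist hF X)) = 0
  have h1 : mapC C.b (geom (homTw hF X)) = 0 := isTwisted_homTw hF hX
  have h2 : mapC C.b (geom X) = 0 := hX
  simp only [geom_twist, blockGeom, mapC_add, mapC_lact, mapC_ract, h1, h2, mapC_b_geom_ev_geom,
    zero_ract, lact_zero, add_zero]

end PreTw

end MinimalAInfCat

end

noncomputable section

attribute [local instance] Classical.propDecidable

namespace MinimalAInfCat

namespace PreTw

variable {S : Type u} [CommRing S] {C : MinimalAInfCat.{u, w} S} {F : C.Obj}
  (hF : C.IsOneSpherical F) {W X Y Z : C.PreTw}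

local notation:70 f:70 "⬝" g:71 => mulBy (LinearMap.mul _ (TensorAlgebra _ _)) f g

/-! ### The twist on morphisms -/

/-- The action of `f : X → Y` on `hom(F,X)`. -/
def twA (f : CMat C.Mor X Y) : LMat (homTw hF X) (homTw hF Y) :=
  -coev hF (mapC C.b (mapC (TensorAlgebra.ι S) (ev hF X) ⬝ word₁ f))

/-- The diagonal block matrix with `id_F ⊗ α` on `hom(F,X) ⊗ F` and `f` on `X`. -/
def twB (α : LMat (homTw hF X) (homTw hF Y)) (f : CMat C.Mor X Y) :
    CMat C.Mor (twist hF X) (twist hF Y) :=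
  ract (lact (prL hF X) (scal (C.id F) α)) (inL hF Y) + ract (lact (prR hF X) f) (inR hF Y)

/-- The twist of a morphism. -/
def tw (f : CMat C.Mor X Y) : CMat C.Mor (twist hF X) (twist hF Y) := twB hF (twA hF f) f

theorem block_inl {M : Type u} [AddCommMonoid M] [Module S M] (p : CMat M Y (homTw hF X))
    (r : CMat M Y X) (i q) : (ract p (inL hF X) + ract r (inR hF X)) i (tL hF q) = p i q :=
  (congrArg₂ HAdd.hAdd (ract_inL_inl hF p i q) (ract_inR_inl hF r i q)).trans (add_zero (p i q))

theorem block_inr {M : Type u} [AddCommMonoid M] [Module S M] (p : CMat M Y (homTw hF X))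
    (r : CMat M Y X) (i j) : (ract p (inL hF X) + ract r (inR hF X)) i (tR hF j) = r i j :=
  (congrArg₂ HAdd.hAdd (ract_inL_inr hF p i j) (ract_inR_inr hF r i j)).trans (zero_add (r i j))

theorem twistMap_eq_tw (f : CMat C.Mor X Y) : (twistMap hF f : CMat C.Mor _ _) = tw hF f := by
  funext q q'
  induction q' using twist_cases hF with
  | hl q' =>
    refine Eq.trans ?_ (block_inl hF _ _ q q').symm
    induction q using twist_cases hF with
    | hl q =>
      obtain ⟨i, a, rfl⟩ : ∃ i e, q = hI hF i e := ⟨q.1, q.2, rfl⟩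
      obtain ⟨j, a', rfl⟩ : ∃ i e, q' = hI hF i e := ⟨q'.1, q'.2, rfl⟩
      refine Eq.trans ?_ (lact_prL_inl hF (scal (C.id F) (twA hF f)) _ _).symm
      have h1 : twA hF f (hI hF i a) (hI hF j a') =
          -((C.proj F (Y.obj j) a').rTensor (Y.P j) ∘ₗ
            pushB (word₁ f) i j ∘ₗ (C.Hom F (X.obj i) a).subtype.rTensor (X.P i)) := by
        rw [← mapC_b_ev_mul]
        rfl
      rw [scal_apply, h1]
      exact (LinearMap.comp_neg _ _).symm
    | hr i => exact (lact_prL_inr hF _ i q').symm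
  | hr j =>
    refine Eq.trans ?_ (block_inr hF _ _ q j).symm
    induction q using twist_cases hF with
    | hl q => exact (lact_prR_inl hF _ q j).symm
    | hr i => exact (lact_prR_inr hF _ i j).symm

theorem eps_lact_prL {M : Type u} [AddCommGroup M] [Module S M] (f : CMat M (homTw hF X) Y) :
    lact (eps (twist hF X)) (lact (prL hF X) f) = lact (prL hF X) (lact (eps (homTw hF X)) f) := by
  rw [lact_lact, lact_lact, lmul_eps_zero (isDegL_prL hF)]

theorem eps_lact_prR {M : Type u} [AddCommGroup M] [Module S M] (f : CMat M X Y) :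
    lact (eps (twist hF X)) (lact (prR hF X) f) = lact (prR hF X) (lact (eps X) f) := by
  rw [lact_lact, lact_lact, lmul_eps_zero (isDegL_prR hF)]

theorem mapC_b_ev_word₁_mem {k : ℤ} {f : CMat C.Mor X Y} (hf : f ∈ degC X Y k) :
    mapC C.b (mapC (TensorAlgebra.ι S) (ev hF X) ⬝ word₁ f) ∈ degC (homTw hF X) Y (k + 1) :=
  mapC_b_mem (tmul_mem (mapC_ι_mem (ev_mem hF)) (word₁_mem hf)) (by ring)

theorem mapC_b_ev_word₁ {k : ℤ} {f : CMat C.Mor X Y} (hf : f ∈ degC X Y k) :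
    mapC C.b (mapC (TensorAlgebra.ι S) (ev hF X) ⬝ word₁ f) = -lact (twA hF f) (ev hF Y) := by
  rw [twA, neg_lact, lact_coev_ev hF (homTw_obj hF) (mapC_b_ev_word₁_mem hF hf), neg_neg]

theorem isDegL_twA {k : ℤ} {f : CMat C.Mor X Y} (hf : f ∈ degC X Y k) : IsDegL (twA hF f) k := by
  have := isDegL_coev hF (homTw_obj hF) (mapC_b_ev_word₁_mem hF hf)
  rw [add_sub_cancel_right] at this
  exact isDegL_neg this

theorem IsDegL.lmul {A : LMat X Y} {B : LMat Y Z} {k l : ℤ} (hA : IsDegL A k) (hB : IsDegL B l) :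
    IsDegL (lmul A B) (k + l) := by
  intro i j h
  obtain ⟨a, -, ha⟩ := Finset.exists_ne_zero_of_sum_ne_zero h
  have h1 := hA i a fun h0 => ha (by rw [h0, LinearMap.comp_zero])
  have h2 := hB a j fun h0 => ha (by rw [h0, LinearMap.zero_comp])
  exact ⟨h1.1.trans h2.1, by rw [h2.2, h1.2, add_assoc]⟩

theorem isDegL_eps : IsDegL (eps X) 0 := isDegL_ldiag _

theorem twB_mem {k : ℤ} {α : LMat (homTw hF X) (homTw hF Y)} (hα : IsDegL α k)
    {f : CMat C.Mor X Y} (hf : f ∈ degC X Y k) : twB hF α f ∈ degC (twist hF X) (twist hF Y) k := by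
  refine Submodule.add_mem _ ?_ ?_
  · exact ract_mem_degC (isDegL_inL hF) (lact_mem_degC (isDegL_prL hF)
      (scal_id_mem hα (homTw_obj hF)) (zero_add k).symm) (add_zero k).symm
  · exact ract_mem_degC (isDegL_inR hF) (lact_mem_degC (isDegL_prR hF) hf (zero_add k).symm)
      (add_zero k).symm

theorem tw_mem {k : ℤ} {f : CMat C.Mor X Y} (hf : f ∈ degC X Y k) :
    tw hF f ∈ degC (twist hF X) (twist hF Y) k := twB_mem hF (isDegL_twA hF hf) hf

theorem word₃_inL_prL {V : C.PreTw} (p : CMat C.Mor W (homTw hF X))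
    (g : CMat C.Mor (homTw hF X) Z) (h : CMat C.Mor Z V) :
    word₃ (ract p (inL hF X)) (lact (prL hF X) g) h = word₃ p g h := by
  rw [word₃, word₂_inL_prL, word₃]

theorem word₃_inR_prL' {V : C.PreTw} (q : CMat C.Mor W X)
    (g : CMat C.Mor (homTw hF X) Z) (h : CMat C.Mor Z V) :
    word₃ (ract q (inR hF X)) (lact (prL hF X) g) h = 0 := by
  rw [word₃, word₂_inR_prL, mulBy_zero_left, mulBy_zero_left]

theorem lact_eps_scal {M : Type u} [AddCommMonoid M] [Module S M] (m : M) (A : LMat X Y) :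
    lact (eps X) (scal m A) = scal m (lmul (eps X) A) := lact_scal _ _ _

theorem word₃_add_left {V : C.PreTw} (f f' : CMat C.Mor W X) (g : CMat C.Mor X Y)
    (h : CMat C.Mor Y V) : word₃ (f + f') g h = word₃ f g h + word₃ f' g h := by
  simp only [word₃, word₂_add_left, mulBy_add_left]

theorem dif_twB (α : LMat (homTw hF X) (homTw hF Y)) (f : CMat C.Mor X Y) :
    dif (twB hF α f) =
      ract (lact (prL hF X) (scal (C.id F) (lmul (eps _)
        (lmul α (difA hF Y) + lmul (difA hF X) α)))) (inL hF Y) +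
      ract (lact (prL hF X) (lact (eps _) (lact α (ev hF Y)) + prod₂ (ev hF X) f)) (inR hF Y) +
      ract (lact (prR hF X) (dif f)) (inR hF Y) := by
  simp only [dif, twB, word₁_add, word₁_ract_inL, word₁_ract_inR, word₁_lact_prL, word₁_lact_prR,
    word₂_lact_prL, mapC_add, mapC_ract, mapC_lact, mapC_b_word₁_id,
    mapC_b_word₂_id_left hF α (ev_mem hF), add_ract, prod₂]
  simp only [lact_add, lact_ract, eps_lact_prL, eps_lact_prR, lact_eps_scal, add_ract]
  abel

theorem prod₂_twB (α : LMat (homTw hF X) (homTw hF Y)) (f : CMat C.Mor X Y)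
    {k : ℤ} {β : LMat (homTw hF Y) (homTw hF Z)} (hβ : IsDegL β k) (g : CMat C.Mor Y Z) :
    prod₂ (twB hF α f) (twB hF β g) =
      ract (lact (prL hF X) (scal (C.id F) (lmul (eps _) (lmul α β)))) (inL hF Z) +
      ract (lact (prL hF X) (prod₃ (ev hF X) f g)) (inR hF Z) +
      ract (lact (prR hF X) (prod₂ f g)) (inR hF Z) := by
  simp only [prod₂, twB, word₂_add_left, word₂_add_right, word₂_ract_inL, word₂_ract_inR,
    word₂_inL_prL, word₂_inL_prR, word₂_inR_prL, word₂_inR_prR, word₃_inL_prL, word₃_inR_prL',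
    word₃_add_left, word₂_lact_prL, word₂_lact_prR, word₃_lact_prL, mapC_add, mapC_ract, mapC_lact,
    mapC_zero, zero_ract, mapC_b_word₂_id_left hF α (scal_id_mem hβ (homTw_obj hF)),
    mapC_b_word₃_id_left, lact_zero, add_ract, prod₃, add_zero, zero_add]
  simp only [lact_add, lact_ract, lact_zero, eps_lact_prL, eps_lact_prR, add_ract, zero_ract,
    add_zero, zero_add]
  rw [lact_scal α, lact_eps_scal]
  abel

theorem prod₂_ev {k : ℤ} {f : CMat C.Mor X Y} (hf : f ∈ degC X Y k) :
    prod₂ (ev hF X) f = -lact (eps _) (lact (twA hF f) (ev hF Y)) := by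
  have h0 : c₀ (mapC (TensorAlgebra.ι S) (ev hF X) ⬝ word₁ f) = 0 := by
    rw [c₀_mul, c₀_ι, zero_lmul]
  have h1 : c₁ (mapC (TensorAlgebra.ι S) (ev hF X) ⬝ word₁ f) = 0 := by
    rw [c₁_mul, c₀_ι, zero_lact, zero_add, c₀_word₁, ract_zero]
  rw [prod₂, word₂_eq, tmul_assoc, mapC_b_geom_mul hF _ h0 (k := 0), h1, lact_zero, add_zero,
    mapC_b_ev_word₁ hF hf, lact_neg]
  rw [h1]
  exact Submodule.zero_mem _

theorem dif_lact_ev {k : ℤ} {β : LMat (homTw hF X) (homTw hF Y)} (hβ : IsDegL β k) :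
    dif (lact β (ev hF Y)) =
      lact (eps _) (lact (lmul (difA hF X) β - lmul β (difA hF Y)) (ev hF Y)) := by
  have h0 : c₀ (mapC (TensorAlgebra.ι S) (lact β (ev hF Y)) ⬝ geom Y) = 0 := by
    rw [c₀_mul, c₀_ι, zero_lmul]
  have h1 : c₁ (mapC (TensorAlgebra.ι S) (lact β (ev hF Y)) ⬝ geom Y) = lact β (ev hF Y) := by
    rw [c₁_mul, c₀_ι, zero_lact, zero_add, c₀_geom, ract_lone, c₁_ι]
  rw [dif, word₁, tmul_assoc, mapC_b_geom_mul hF _ h0 (k := k + 1), h1, mapC_lact, mulBy_lact,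
    mapC_lact, mapC_b_ev_geom, sub_eq_add_neg, add_lact, neg_lact, lact_neg, lact_lact, lact_lact,
    add_comm]
  rw [h1]
  exact lact_mem_degC hβ (ev_mem hF) rfl

theorem prod₂_lact_ev (β : LMat (homTw hF X) (homTw hF Y)) {k : ℤ} {g : CMat C.Mor Y Z}
    (hg : g ∈ degC Y Z k) :
    prod₂ (lact β (ev hF Y)) g = -lact (eps _) (lact (lmul β (twA hF g)) (ev hF Z)) := by
  have h0 : c₀ (mapC (TensorAlgebra.ι S) (lact β (ev hF Y)) ⬝ word₁ g) = 0 := by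
    rw [c₀_mul, c₀_ι, zero_lmul]
  have h1 : c₁ (mapC (TensorAlgebra.ι S) (lact β (ev hF Y)) ⬝ word₁ g) = 0 := by
    rw [c₁_mul, c₀_ι, zero_lact, zero_add, c₀_word₁, ract_zero]
  rw [prod₂, word₂_eq, tmul_assoc, mapC_b_geom_mul hF _ h0 (k := 0), h1, lact_zero, add_zero,
    mapC_lact, mulBy_lact, mapC_lact, mapC_b_ev_word₁ hF hg, lact_neg, lact_neg, lact_lact β]
  rw [h1]
  exact Submodule.zero_mem _

theorem eps_lmul_eps_lmul (A : LMat X Y) : lmul (eps X) (lmul (eps X) A) = A := by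
  rw [← lmul_assoc, eps_mul_eps, lone_lmul]

theorem difA_eps : lmul (difA hF X) (eps _) = -lmul (eps _) (difA hF X) := by
  rw [lmul_eps (isDegL_difA hF), sg_one]
  funext i j
  ext p
  exact neg_one_smul S (lmul (eps _) (difA hF X) i j p)

theorem eps_lact_inj {M : Type u} [AddCommGroup M] [Module S M] {f g : CMat M X Y}
    (h : lact (eps X) f = lact (eps X) g) : f = g := by
  rw [← eps_lact_eps_lact f, h, eps_lact_eps_lact]

theorem twA_dif (hX : X.IsTwisted) (hY : Y.IsTwisted) {k : ℤ} {f : CMat C.Mor X Y}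
    (hf : f ∈ degC X Y k) :
    twA hF (dif f) = lmul (eps _) (lmul (twA hF f) (difA hF Y) + lmul (difA hF X) (twA hF f)) := by
  refine lact_ev_injective hF (eps_lact_inj ?_)
  have h := dif_prod₂ (isTwisted_homTw hF hX) hX hY (ev_mem hF) f
  rw [dif_ev, prod₂_zero_left, add_zero, sub_self, sg_zero, one_smul, prod₂_ev hF hf,
    prod₂_ev hF (dif_mem hf rfl), dif_neg', lact_lact, dif_lact_ev hF
      (isDegL_eps.lmul (isDegL_twA hF hf)), ← lmul_assoc, difA_eps, ← neg_add, neg_eq_zero] at h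
  rw [eq_neg_of_add_eq_zero_right h, ← lact_neg, ← neg_lact, neg_sub, neg_lmul, sub_neg_eq_add,
    lmul_add, lmul_assoc, lmul_assoc]

theorem dif_tw (hX : X.IsTwisted) (hY : Y.IsTwisted) {k : ℤ} {f : CMat C.Mor X Y}
    (hf : f ∈ degC X Y k) : dif (tw hF f) = tw hF (dif f) := by
  rw [tw, dif_twB, prod₂_ev hF hf, add_neg_cancel, lact_zero, zero_ract, add_zero, tw, twB,
    twA_dif hF hX hY hf]

theorem prod₃_zero_left (g : CMat C.Mor X Y) (h : CMat C.Mor Y Z) :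
    prod₃ (0 : CMat C.Mor W X) g h = 0 := by
  simp only [prod₃, word₃, word₂, word₁, mapC_zero, mulBy_zero_right, mulBy_zero_left, lact_zero]

theorem prod₃_zero_mid (g : CMat C.Mor W X) (h : CMat C.Mor Y Z) :
    prod₃ g (0 : CMat C.Mor X Y) h = 0 := by
  simp only [prod₃, word₃, word₂, word₁, mapC_zero, mulBy_zero_right, mulBy_zero_left, lact_zero]

theorem prod₃_zero_right (g : CMat C.Mor W X) (h : CMat C.Mor X Y) :
    prod₃ g h (0 : CMat C.Mor Y Z) = 0 := by
  simp only [prod₃, word₃, word₂, word₁, mapC_zero, mulBy_zero_right, mulBy_zero_left, lact_zero]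

/-- The homotopy between the twist of a product and the product of the twists. -/
def twC (f : CMat C.Mor X Y) (g : CMat C.Mor Y Z) : LMat (homTw hF X) (homTw hF Z) :=
  coev hF (prod₃ (ev hF X) f g)

theorem prod₃_ev {k l : ℤ} {f : CMat C.Mor X Y} (hf : f ∈ degC X Y k) {g : CMat C.Mor Y Z}
    (hg : g ∈ degC Y Z l) : prod₃ (ev hF X) f g = lact (twC hF f g) (ev hF Z) :=
  (lact_coev_ev hF (homTw_obj hF) (prod₃_mem (ev_mem hF) hf hg rfl)).symm

theorem isDegL_twC {k l : ℤ} {f : CMat C.Mor X Y} (hf : f ∈ degC X Y k) {g : CMat C.Mor Y Z}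
    (hg : g ∈ degC Y Z l) : IsDegL (twC hF f g) (k + l - 1) :=
  isDegL_coev hF (homTw_obj hF) (prod₃_mem (ev_mem hF) hf hg (by ring))

theorem twA_prod₂ (hX : X.IsTwisted) (hY : Y.IsTwisted) (hZ : Z.IsTwisted) {k l : ℤ}
    {f : CMat C.Mor X Y} (hf : f ∈ degC X Y k) (hf0 : dif f = 0) {g : CMat C.Mor Y Z}
    (hg : g ∈ degC Y Z l) (hg0 : dif g = 0) :
    twA hF (prod₂ f g) = lmul (eps _) (lmul (twA hF f) (twA hF g)) +
      (lmul (difA hF X) (twC hF f g) - lmul (twC hF f g) (difA hF Z)) := by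
  refine lact_ev_injective hF (eps_lact_inj ?_)
  have h := dif_prod₃ (isTwisted_homTw hF hX) hX hY hZ (ev_mem hF) hf g
  rw [dif_ev, prod₃_zero_left, zero_add, hf0, hg0, prod₃_zero_mid, prod₃_zero_right, zero_add,
    smul_zero, add_zero, sub_self, sg_zero, one_smul, prod₂_ev hF hf,
    prod₂_ev hF (prod₂_mem hf hg rfl), lact_lact, prod₂_neg_left, prod₂_lact_ev hF _ hg, neg_neg,
    prod₃_ev hF hf hg, dif_lact_ev hF (isDegL_twC hF hf hg), ← lact_add, ← add_lact,
    add_neg_eq_zero] at h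
  rw [← h, lmul_assoc]

theorem prod₂_tw (hX : X.IsTwisted) (hY : Y.IsTwisted) (hZ : Z.IsTwisted) {k l : ℤ}
    {f : CMat C.Mor X Y} (hf : f ∈ degC X Y k) (hf0 : dif f = 0) {g : CMat C.Mor Y Z}
    (hg : g ∈ degC Y Z l) (hg0 : dif g = 0) :
    prod₂ (tw hF f) (tw hF g) =
      tw hF (prod₂ f g) + dif (twB hF (lmul (eps _) (twC hF f g)) 0) := by
  rw [dif_twB, prod₂_zero_right, dif_zero, lact_zero, zero_ract, add_zero, add_zero,
    lact_lact (eps (homTw hF X)), eps_lmul_eps_lmul, lmul_add, lmul_assoc (eps (homTw hF X)),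
    eps_lmul_eps_lmul, ← lmul_assoc (difA hF X), difA_eps, ← prod₃_ev hF hf hg, tw, tw, prod₂_twB hF _ _
    (isDegL_twA hF hg), tw, twB, twA_prod₂ hF hX hY hZ hf hf0 hg hg0, neg_lmul, lmul_neg,
    lmul_assoc (eps _) (difA hF X), eps_lmul_eps_lmul, scal_add, scal_add,
    sub_eq_add_neg, scal_add, scal_neg, scal_neg]
  simp only [lact_add, add_ract, lact_neg, neg_ract]
  abel

theorem idC_homTw : idC (homTw hF X) = scal (C.id F) (lone _) := by
  funext i j
  rw [scal_apply, lone, ldiag]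
  by_cases h : j = i
  · subst h
    rw [idC, Pi.single_eq_same, Pi.single_eq_same, one_smul, LinearMap.comp_id]
    rfl
  · rw [idC, Pi.single_eq_of_ne h, Pi.single_eq_of_ne h, LinearMap.comp_zero]

theorem idC_apply_self (i : X.I) :
    idC X i i = TensorProduct.mk S C.Mor (X.P i) (C.id (X.obj i)) := Pi.single_eq_same i _

theorem idC_apply_ne {i j : X.I} (h : j ≠ i) : idC X i j = 0 := Pi.single_eq_of_ne h _

theorem idC_twist : idC (twist hF X) = ract (lact (prL hF X) (idC (homTw hF X))) (inL hF X) +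
    ract (lact (prR hF X) (idC X)) (inR hF X) := by
  funext q q'
  induction q' using twist_cases hF with
  | hl q' =>
    refine Eq.trans ?_ (block_inl hF _ _ q q').symm
    induction q using twist_cases hF with
    | hl q =>
      refine Eq.trans ?_ (lact_prL_inl hF (idC (homTw hF X)) q q').symm
      by_cases h : q' = q
      · subst h
        exact (idC_apply_self _).trans (idC_apply_self q').symm
      · exact (idC_apply_ne fun h' => h (Sum.inl_injective h')).trans (idC_apply_ne h).symm
    | hr i =>
      exact (idC_apply_ne Sum.inl_ne_inr).trans (lact_prL_inr hF (idC (homTw hF X)) i q').symm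
  | hr j =>
    refine Eq.trans ?_ (block_inr hF _ _ q j).symm
    induction q using twist_cases hF with
    | hl q => exact (idC_apply_ne Sum.inr_ne_inl).trans (lact_prR_inl hF (idC X) q j).symm
    | hr i =>
      refine Eq.trans ?_ (lact_prR_inr hF (idC X) i j).symm
      by_cases h : j = i
      · subst h
        exact (idC_apply_self _).trans (idC_apply_self j).symm
      · exact (idC_apply_ne fun h' => h (Sum.inr_injective h')).trans (idC_apply_ne h).symm

theorem one'_twist : one' (twist hF X) = twB hF (eps _) (one' X) := by
  rw [one', idC_twist, lact_add, lact_ract, lact_ract, eps_lact_prL, eps_lact_prR, idC_homTw,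
    lact_eps_scal, lmul_lone]
  rfl

theorem twA_one' : twA hF (one' X) = eps _ := by
  refine lact_ev_injective hF (eps_lact_inj ?_)
  have h := prod₂_ev hF (one'_mem X)
  rw [prod₂_one'_right (ev_mem hF), sg_one] at h
  have h2 : lact (eps _) (lact (twA hF (one' X)) (ev hF X)) = ev hF X := by
    rw [← neg_eq_iff_eq_neg.mpr h]
    funext i j
    ext p
    change -((-1 : S) • (ev hF X i j p)) = _
    rw [neg_one_smul, neg_neg]
  rw [h2, eps_lact_eps_lact]

theorem tw_one' : tw hF (one' X) = one' (twist hF X) := by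
  rw [one'_twist, tw, twA_one']

/-! ### The canonical morphism -/

variable (X) in
/-- The canonical morphism `X → T_F(X)`. -/
def tmor : CMat C.Mor X (twist hF X) := ract (one' X) (inR hF X)

theorem tmor_mem : tmor hF X ∈ degC X (twist hF X) 0 :=
  ract_mem_degC (isDegL_inR hF) (one'_mem X) (add_zero _).symm

theorem dif_ract_inR (f : CMat C.Mor X Y) : dif (ract f (inR hF Y)) = ract (dif f) (inR hF Y) := by
  rw [dif, word₁_ract_inR, mapC_ract, lact_ract, dif]

theorem prod₂_ract_inR (f : CMat C.Mor X Y) (g : CMat C.Mor Y Z) :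
    prod₂ f (ract g (inR hF Z)) = ract (prod₂ f g) (inR hF Z) := by
  rw [prod₂, word₂_ract_inR, mapC_ract, lact_ract, prod₂]

theorem dif_tmor : dif (tmor hF X) = 0 := by
  rw [tmor, dif_ract_inR, dif_one', zero_ract]

theorem prod₂_tmor {k : ℤ} {f : CMat C.Mor X Y} (hf : f ∈ degC X Y k) :
    prod₂ f (tmor hF Y) = sg S k • ract f (inR hF Y) := by
  rw [tmor, prod₂_ract_inR, prod₂_one'_right hf, smul_ract]

theorem prod₂_inR_twB (q : CMat C.Mor X Y) (α : LMat (homTw hF Y) (homTw hF Z))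
    (f : CMat C.Mor Y Z) :
    prod₂ (ract q (inR hF Y)) (twB hF α f) = ract (prod₂ q f) (inR hF Z) := by
  simp only [prod₂, twB, word₂_add_right, word₂_ract_inL, word₂_ract_inR, word₂_inR_prL,
    word₂_inR_prR, word₃_inR_prL', mapC_add, mapC_ract, mapC_zero, zero_ract, zero_add, lact_ract]

theorem prod₂_tmor_tw {k : ℤ} {f : CMat C.Mor X Y} (hf : f ∈ degC X Y k) :
    prod₂ (tmor hF X) (tw hF f) = ract f (inR hF Y) := by
  rw [tmor, tw, prod₂_inR_twB, prod₂_one'_left hf]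

/-- The homotopy between the two canonical morphisms `T_F(X) → T_F(T_F(X))`. -/
def tmorH : LMat (homTw hF X) (homTw hF (twist hF X)) :=
  -coev hF (ract (idC (homTw hF X)) (inL hF X))

theorem idC_inL_mem : ract (idC (homTw hF X)) (inL hF X) ∈ degC (homTw hF X) (twist hF X) 0 :=
  ract_mem_degC (isDegL_inL hF) (idC_mem _) (add_zero _).symm

theorem lact_tmorH_ev : lact (tmorH hF) (ev hF (twist hF X)) =
    -ract (idC (homTw hF X)) (inL hF X) := by
  rw [tmorH, neg_lact, lact_coev_ev hF (homTw_obj hF) (idC_inL_mem hF)]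

theorem isDegL_tmorH : IsDegL (tmorH hF (X := X)) (-1) := by
  have := isDegL_coev hF (homTw_obj hF) (idC_inL_mem hF (X := X))
  exact isDegL_neg this

theorem mapC_neg_ι_mul (f : CMat C.Mor X Y) (g : TMat Y Z) :
    mapC C.b (mapC (TensorAlgebra.ι S) (-f) ⬝ g) = -mapC C.b (mapC (TensorAlgebra.ι S) f ⬝ g) := by
  have h : mapC C.b (mapC (TensorAlgebra.ι S) (-f) ⬝ g) +
      mapC C.b (mapC (TensorAlgebra.ι S) f ⬝ g) = 0 := by
    rw [← mapC_add, ← mulBy_add_left, ← mapC_add, neg_add_cancel, mapC_zero, mulBy_zero_left,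
      mapC_zero]
  exact eq_neg_of_add_eq_zero_left h

theorem tmorH_difA : lmul (tmorH hF) (difA hF (twist hF X)) =
    lmul (eps _) (twA hF (tmor hF X)) - lmul (difA hF X) (tmorH hF) := by
  refine lact_ev_injective hF ?_
  have h1 : lact (lmul (eps _) (twA hF (tmor hF X))) (ev hF (twist hF X)) =
      ract (ev hF X) (inR hF X) := by
    have h := prod₂_ev hF (tmor_mem hF (X := X))
    rw [prod₂_tmor hF (ev_mem hF), sg_one] at h
    rw [← lact_lact, ← neg_eq_iff_eq_neg.mpr h]
    funext i j
    ext p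
    change -((-1 : S) • (ract (ev hF X) (inR hF X) i j p)) = _
    rw [neg_one_smul, neg_neg]
  have h2 : mapC C.b (mapC (TensorAlgebra.ι S) (ract (idC (homTw hF X)) (inL hF X)) ⬝
      geom (twist hF X)) = ract (scal (C.id F) (difA hF X)) (inL hF X) +
        ract (ev hF X) (inR hF X) := by
    have h3 : ∀ {Y : C.PreTw} (g : TMat (homTw hF X) Y) {k : ℤ}, c₁ g ∈ degC (homTw hF X) Y k →
        mapC C.b (mapC (TensorAlgebra.ι S) (idC (homTw hF X)) ⬝ g) = c₁ g := by
      intro Y g k hg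
      have := mapC_b_mul_idC_mul (tone (homTw hF X)) (k := 0)
        (by rw [c₁_tone]; exact Submodule.zero_mem _) g hg
      rw [tone_tmul, c₀_tone, c₁_tone, lone_lact, mapC_zero, zero_ract, add_zero] at this
      exact this
    have h4 : c₁ (geom (homTw hF X) ⬝ mapC (TensorAlgebra.ι S) (ev hF X) ⬝ geom X) = ev hF X := by
      rw [tmul_assoc, c₁_mul, c₀_ev_geom, c₁_ev_geom, c₀_geom, lone_lact, ract_zero, add_zero]
    rw [mapC_ract, mulBy_ract_left, lact_inL_geom, mulBy_add_right, mulBy_ract_right,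
      mulBy_ract_right, mapC_add, mapC_ract, mapC_ract, h3 _ c₁_geom_mem,
      h3 _ (k := 1) (by rw [h4]; exact ev_mem hF), h4, c₁_geom, homTw_δ]
  have h5 : ∀ {Y : C.PreTw} (A : LMat Y (homTw hF (twist hF X))),
      lact (lmul A (difA hF (twist hF X))) (ev hF (twist hF X)) =
        -mapC C.b (mapC (TensorAlgebra.ι S) (lact A (ev hF (twist hF X))) ⬝ geom (twist hF X)) := by
    intro Y A
    rw [mapC_lact, mulBy_lact, mapC_lact, mapC_b_ev_geom, lact_neg, neg_neg, lact_lact]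
  rw [h5, lact_tmorH_ev, mapC_neg_ι_mul, neg_neg, h2, sub_eq_add_neg, add_lact, h1, neg_lact,
    ← lact_lact, lact_tmorH_ev, lact_neg, neg_neg, lact_ract, idC_homTw, lact_scal, lmul_lone,
    add_comm]

theorem tmor_twist : tmor hF (twist hF X) =
    ract (ract (lact (prL hF X) (scal (C.id F) (eps _))) (inL hF X)) (inR hF (twist hF X)) +
      ract (ract (lact (prR hF X) (one' X)) (inR hF X)) (inR hF (twist hF X)) := by
  rw [tmor, one'_twist, twB, add_ract]

theorem tw_tmor : tw hF (tmor hF X) = tmor hF (twist hF X) + dif (twB hF (tmorH hF) 0) := by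
  rw [dif_twB, prod₂_zero_right, dif_zero, lact_zero, zero_ract, add_zero, add_zero, tmorH_difA,
    sub_add_cancel, eps_lmul_eps_lmul, lact_tmorH_ev, tmor_twist, tw, twB, lact_neg,
    lact_neg, neg_ract, lact_ract, lact_ract, idC_homTw, lact_eps_scal, lmul_lone]
  have h : lact (prR hF X) (tmor hF X) = ract (lact (prR hF X) (one' X)) (inR hF X) := by
    rw [tmor, lact_ract]
  rw [h]
  abel

end PreTw

end MinimalAInfCat

end

noncomputable section

attribute [local instance] Classical.propDecidable

namespace MinimalAInfCat

namespace PreTw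

variable {S : Type u} [CommRing S] {C : MinimalAInfCat.{u, w} S} {F : C.Obj}
  (hF : C.IsOneSpherical F) {W X Y Z : C.PreTw}

local notation:70 f:70 "⬝" g:71 => mulBy (LinearMap.mul _ (TensorAlgebra _ _)) f g

/-! ### Morphisms from an object to a twist -/

variable {A B D : C.Obj}

theorem eps_single : eps (single B) = lone (single B) := by
  rw [eps, lone]
  congr 1
  funext i
  exact sg_zero

theorem eps_lact_single {M : Type u} [AddCommMonoid M] [Module S M] (f : CMat M (single B) X) :
    lact (eps (single B)) f = f := by
  rw [eps_single, lone_lact]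

theorem geom_single : geom (single B) = tone (single B) := by
  have h : δT (single B) = 0 := mapC_zero (X := single B) (Y := single B) (TensorAlgebra.ι S)
  rw [geom_eq_add_mul_geom, h, mulBy_zero_left, add_zero]

theorem isTwisted_single : (single B).IsTwisted := by
  have h : mapC C.b (tone (single B)) = 0 := by
    rw [tone, mapC_scal, b_one]
    funext i j
    rw [scal_apply, map_zero]
    exact LinearMap.zero_comp _
  rw [← geom_single] at h
  exact h

theorem mapC_b_ι (f : CMat C.Mor X Y) : mapC C.b (mapC (TensorAlgebra.ι S) f) = 0 := by
  have h : C.b ∘ₗ TensorAlgebra.ι S = 0 := LinearMap.ext b_ι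
  rw [mapC_mapC, h, mapC_map_zero]

theorem dif_single (f : CMat C.Mor (single A) (single B)) : dif f = 0 := by
  rw [dif, word₁, geom_single, geom_single, tone_tmul, tmul_tone, mapC_b_ι, lact_zero]

theorem prod₂_single (f : CMat C.Mor (single A) (single B)) (g : CMat C.Mor (single B) X) :
    prod₂ f g =
      mapC C.b (mapC (TensorAlgebra.ι S) f ⬝ (mapC (TensorAlgebra.ι S) g ⬝ geom X)) := by
  rw [prod₂, word₂_eq, word₁, geom_single, geom_single, tone_tmul, tone_tmul, eps_lact_single]

theorem prod₃_single (f : CMat C.Mor (single A) (single B)) (g : CMat C.Mor (single B) (single D))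
    (h : CMat C.Mor (single D) X) : prod₃ f g h = mapC C.b (mapC (TensorAlgebra.ι S) f ⬝
      (mapC (TensorAlgebra.ι S) g ⬝ (mapC (TensorAlgebra.ι S) h ⬝ geom X))) := by
  rw [prod₃, word₃_eq, word₂_eq, word₁, geom_single, geom_single, geom_single, tone_tmul, tone_tmul,
    tone_tmul, eps_lact_single]

/-- The four-fold product of matrices, the first three of them of morphisms of `C`. -/
def prod₄ {A' : C.Obj} (e : CMat C.Mor (single A') (single A)) (f : CMat C.Mor (single A) (single B))
    (g : CMat C.Mor (single B) (single D)) (h : CMat C.Mor (single D) X) :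
    CMat C.Mor (single A') X :=
  mapC C.b (mapC (TensorAlgebra.ι S) e ⬝ (mapC (TensorAlgebra.ι S) f ⬝
    (mapC (TensorAlgebra.ι S) g ⬝ (mapC (TensorAlgebra.ι S) h ⬝ geom X))))

/-- The element `v ⊗ Φ` of `hom(B, hom(F,X) ⊗ F)`, as a morphism to the twist of `X`. -/
def cnL (v : CMat C.Mor (single B) (single F)) (Φ : CMat C.Mor (single F) X) :
    CMat C.Mor (single B) (twist hF X) := ract (ract v (coev hF Φ)) (inL hF X)

theorem cnL_add_left (v v' : CMat C.Mor (single B) (single F)) (Φ : CMat C.Mor (single F) X) :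
    cnL hF (v + v') Φ = cnL hF v Φ + cnL hF v' Φ := by
  rw [cnL, add_ract, add_ract, cnL, cnL]

theorem cnL_add_right (v : CMat C.Mor (single B) (single F)) (Φ Φ' : CMat C.Mor (single F) X) :
    cnL hF v (Φ + Φ') = cnL hF v Φ + cnL hF v Φ' := by
  rw [cnL, coev_add, ract_add, add_ract, cnL, cnL]

theorem cnL_smul_left (c : S) (v : CMat C.Mor (single B) (single F))
    (Φ : CMat C.Mor (single F) X) : cnL hF (c • v) Φ = c • cnL hF v Φ := by
  rw [cnL, smul_ract, smul_ract, cnL]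

theorem cnL_smul_right (c : S) (v : CMat C.Mor (single B) (single F))
    (Φ : CMat C.Mor (single F) X) : cnL hF v (c • Φ) = c • cnL hF v Φ := by
  rw [cnL, coev_smul, ract_smul, smul_ract, cnL]

theorem cnL_zero_left (Φ : CMat C.Mor (single F) X) :
    cnL hF (0 : CMat C.Mor (single B) (single F)) Φ = 0 := by
  rw [cnL, zero_ract, zero_ract]

theorem cnL_zero_right (v : CMat C.Mor (single B) (single F)) :
    cnL hF v (0 : CMat C.Mor (single F) X) = 0 := by
  rw [cnL, coev_zero, ract_zero, zero_ract]

theorem cnL_neg_right (v : CMat C.Mor (single B) (single F)) (Φ : CMat C.Mor (single F) X) :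
    cnL hF v (-Φ) = -cnL hF v Φ := by
  rw [cnL, coev_neg, ract_neg, neg_ract, cnL]

theorem cnL_sum_left {ι : Type*} (s : Finset ι) (v : ι → CMat C.Mor (single B) (single F))
    (Φ : CMat C.Mor (single F) X) : cnL hF (∑ a ∈ s, v a) Φ = ∑ a ∈ s, cnL hF (v a) Φ :=
  map_sum (⟨⟨fun v => cnL hF v Φ, cnL_zero_left hF Φ⟩, fun v v' => cnL_add_left hF v v' Φ⟩ :
    CMat C.Mor (single B) (single F) →+ CMat C.Mor (single B) (twist hF X)) v s

theorem cnL_sum_right {ι : Type*} (s : Finset ι) (v : CMat C.Mor (single B) (single F))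
    (Φ : ι → CMat C.Mor (single F) X) : cnL hF v (∑ a ∈ s, Φ a) = ∑ a ∈ s, cnL hF v (Φ a) :=
  map_sum (⟨⟨cnL hF v, cnL_zero_right hF v⟩, cnL_add_right hF v⟩ :
    CMat C.Mor (single F) X →+ CMat C.Mor (single B) (twist hF X)) Φ s

theorem single_obj (i : (single B).I) : (single B).obj i = B := rfl

theorem cnL_mem {d l k : ℤ} {v : CMat C.Mor (single B) (single F)}
    (hv : v ∈ degC (single B) (single F) d) {Φ : CMat C.Mor (single F) X}
    (hΦ : Φ ∈ degC (single F) X l) (h : k = d + l - 1) :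
    cnL hF v Φ ∈ degC (single B) (twist hF X) k :=
  ract_mem_degC (isDegL_inL hF) (ract_mem_degC (isDegL_coev hF single_obj hΦ) hv rfl)
    (by rw [h]; ring)

theorem dif_single_homTw {k : ℤ} {p : CMat C.Mor (single B) (homTw hF X)}
    (hp : p ∈ degC (single B) (homTw hF X) k) :
    dif p = sg S k • ract p (lmul (eps _) (difA hF X)) := by
  have h1 : c₁ (mapC (TensorAlgebra.ι S) p) ∈ degC (single B) (homTw hF X) k := by rwa [c₁_ι]
  rw [dif, eps_lact_single, word₁, geom_single, tone_tmul, mapC_b_mul_geom hF _ (c₀_ι p) h1,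
    mapC_b_ι, zero_add, c₁_ι, mapC_sgn hp, eps_lact_single, smul_ract, ract_ract]

theorem lmul_eps_single {a : ℤ} {y : LMat (single F) X} (hy : IsDegL y a) :
    lmul y (eps X) = sg S a • y := by
  rw [lmul_eps hy, eps_single, lone_lmul]

theorem coev_dif {l : ℤ} {Φ : CMat C.Mor (single F) X} (hΦ : Φ ∈ degC (single F) X l) :
    coev hF (dif Φ) = -lmul (coev hF Φ) (difA hF X) := by
  have h : dif Φ = lact (-lmul (coev hF Φ) (difA hF X)) (ev hF X) := by
    conv_lhs => rw [← lact_coev_ev hF single_obj hΦ]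
    rw [dif, eps_lact_single, word₁, geom_single, tone_tmul, mapC_lact, mulBy_lact, mapC_lact,
      mapC_b_ev_geom, lact_neg, neg_lact, lact_lact]
  rw [h, coev_lact_ev]

theorem coev_prod₂ {l : ℤ} {Φ : CMat C.Mor (single F) X} (hΦ : Φ ∈ degC (single F) X l)
    {k : ℤ} {f : CMat C.Mor X Y} (hf : f ∈ degC X Y k) :
    coev hF (prod₂ Φ f) = -lmul (coev hF Φ) (twA hF f) := by
  have h : prod₂ Φ f = lact (-lmul (coev hF Φ) (twA hF f)) (ev hF Y) := by
    conv_lhs => rw [← lact_coev_ev hF single_obj hΦ]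
    rw [prod₂, eps_lact_single, word₂_eq, geom_single, tone_tmul, mapC_lact, mulBy_lact, mapC_lact,
      mapC_b_ev_word₁ hF hf, lact_neg, neg_lact, lact_lact]
  rw [h, coev_lact_ev]

theorem sg_mul_sg_sub_one (d l : ℤ) : sg S (d + (l - 1)) * sg S (l - 1) = sg S d := by
  rw [sg_add, mul_assoc, sg_mul_self, mul_one]

theorem prod₂_ract_ev (v : CMat C.Mor (single B) (single F)) (y : LMat (single F) (homTw hF X)) :
    prod₂ (ract v y) (ev hF X) = prod₂ v (lact y (ev hF X)) := by
  have h0 : c₀ (mapC (TensorAlgebra.ι S) (ev hF X) ⬝ geom X) = 0 := c₀_ev_geom hF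
  rw [prod₂_single, prod₂, word₂_eq, word₁, geom_single, tone_tmul, eps_lact_single, tmul_assoc,
    ← tmul_assoc (mapC (TensorAlgebra.ι S) (ract v y)), mapC_b_mul_geom_mul hF _ (c₀_ι _) _ h0,
    mapC_ract, mulBy_ract_left, mapC_lact, mulBy_lact]

theorem prod₃_ract_ev (u : CMat C.Mor (single A) (single B)) (v : CMat C.Mor (single B) (single F))
    (y : LMat (single F) (homTw hF X)) :
    prod₃ u (ract v y) (ev hF X) = prod₃ u v (lact y (ev hF X)) := by
  have h0 : c₀ (mapC (TensorAlgebra.ι S) (ev hF X) ⬝ geom X) = 0 := c₀_ev_geom hF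
  have h1 : c₀ (mapC (TensorAlgebra.ι S) u ⬝ mapC (TensorAlgebra.ι S) (ract v y)) = 0 := by
    rw [c₀_mul, c₀_ι, zero_lmul]
  rw [prod₃_single, prod₃, word₃_eq, word₂_eq, word₁, geom_single, geom_single, tone_tmul, tone_tmul,
    eps_lact_single, tmul_assoc (geom (homTw hF X)),
    ← tmul_assoc (mapC (TensorAlgebra.ι S) u) (mapC (TensorAlgebra.ι S) (ract v y)),
    ← tmul_assoc _ (geom (homTw hF X)), mapC_b_mul_geom_mul hF _ h1 _ h0, tmul_assoc,
    mapC_ract, mulBy_ract_left, mapC_lact, mulBy_lact]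

theorem prod₃_ract_ev_left (v : CMat C.Mor (single B) (single F)) (y : LMat (single F) (homTw hF X))
    (f : CMat C.Mor X Y) : prod₃ (ract v y) (ev hF X) f = prod₃ v (lact y (ev hF X)) f := by
  have h0 : c₀ (mapC (TensorAlgebra.ι S) (ev hF X) ⬝ word₁ f) = 0 := by
    rw [c₀_mul, c₀_ι, zero_lmul]
  rw [prod₃, word₃_eq, word₂_eq, geom_single, tone_tmul, eps_lact_single, tmul_assoc (geom _),
    ← tmul_assoc (mapC (TensorAlgebra.ι S) (ract v y)), mapC_b_mul_geom_mul hF _ (c₀_ι _) _ h0,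
    prod₃, word₃_eq, word₂_eq, geom_single, geom_single, tone_tmul, tone_tmul, eps_lact_single,
    mapC_ract, mulBy_ract_left, mapC_lact, mulBy_lact]

theorem dif_cnL {d l : ℤ} {v : CMat C.Mor (single B) (single F)}
    (hv : v ∈ degC (single B) (single F) d) {Φ : CMat C.Mor (single F) X}
    (hΦ : Φ ∈ degC (single F) X l) :
    dif (cnL hF v Φ) = -(sg S d • cnL hF v (dif Φ)) + ract (prod₂ v Φ) (inR hF X) := by
  have hy := isDegL_coev hF single_obj hΦ
  have h1 : dif (ract v (coev hF Φ)) = -(sg S d • ract v (coev hF (dif Φ))) := by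
    rw [dif_single_homTw hF (ract_mem_degC hy hv rfl), ract_ract, ← lmul_assoc,
      lmul_eps_single hy, smul_lmul, ract_smul, smul_smul, sg_mul_sg_sub_one, coev_dif hF hΦ,
      ract_neg, smul_neg, neg_neg]
  have h2 : dif (cnL hF v Φ) = ract (dif (ract v (coev hF Φ))) (inL hF X) +
      ract (prod₂ (ract v (coev hF Φ)) (ev hF X)) (inR hF X) := by
    rw [cnL, dif, eps_lact_single, word₁_ract_inL, mapC_add, mapC_ract, mapC_ract, dif, prod₂,
      eps_lact_single, eps_lact_single]
  rw [h2, h1, prod₂_ract_ev, lact_coev_ev hF single_obj hΦ, neg_ract, smul_ract, cnL]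

theorem mapC_b_word₃_id_mid (α : LMat (homTw hF X) (homTw hF Y)) (f : CMat C.Mor Z (homTw hF X))
    (g : CMat C.Mor (homTw hF Y) W) : mapC C.b (word₃ f (scal (C.id F) α) g) = 0 := by
  rw [← word₁_mul_word₁, mapC_scal, mapC_b_mul_id_mul, c₀_word₁, c₀_word₁, zero_lmul, zero_lact,
    lmul_zero, ract_zero, add_zero]

theorem prod₂_cnL_tw {d l : ℤ} {v : CMat C.Mor (single B) (single F)}
    (hv : v ∈ degC (single B) (single F) d) {Φ : CMat C.Mor (single F) X}
    (hΦ : Φ ∈ degC (single F) X l) {k : ℤ} {f : CMat C.Mor X Y} (hf : f ∈ degC X Y k) :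
    prod₂ (cnL hF v Φ) (tw hF f) =
      -(sg S d • cnL hF v (prod₂ Φ f)) + ract (prod₃ v Φ f) (inR hF Y) := by
  have hy := isDegL_coev hF single_obj hΦ
  have hp := ract_mem_degC hy hv rfl
  have h2 : prod₂ (cnL hF v Φ) (tw hF f) =
      ract (mapC C.b (word₂ (ract v (coev hF Φ)) (scal (C.id F) (twA hF f)))) (inL hF Y) +
        ract (prod₃ (ract v (coev hF Φ)) (ev hF X) f) (inR hF Y) := by
    rw [cnL, prod₂, eps_lact_single, tw, twB, word₂_add_right, word₂_ract_inL, word₂_ract_inR,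
      word₂_inL_prL, word₂_inL_prR, word₃_inL_prL, mapC_add, mapC_add, mapC_ract, mapC_ract,
      mapC_ract, mapC_b_word₃_id_mid, zero_ract, add_zero, prod₃, eps_lact_single]
  rw [h2, mapC_b_word₂_id_right hF _ hp, mapC_sgn hp, eps_lact_single, smul_ract, ract_ract,
    ract_ract, ← lmul_assoc, lmul_eps_single hy, smul_lmul, ract_smul, smul_smul, sg_mul_sg_sub_one,
    prod₃_ract_ev_left, lact_coev_ev hF single_obj hΦ, cnL, coev_prod₂ hF hΦ hf, ract_neg, neg_ract,
    smul_neg, neg_neg, smul_ract]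

theorem prod₂_cnL (u : CMat C.Mor (single A) (single B)) (v : CMat C.Mor (single B) (single F))
    {l : ℤ} {Φ : CMat C.Mor (single F) X} (hΦ : Φ ∈ degC (single F) X l) :
    prod₂ u (cnL hF v Φ) = cnL hF (prod₂ u v) Φ + ract (prod₃ u v Φ) (inR hF X) := by
  have h0 : c₀ (mapC (TensorAlgebra.ι S) u ⬝ mapC (TensorAlgebra.ι S) v) = 0 := by
    rw [c₀_mul, c₀_ι, zero_lmul]
  have h1 : c₁ (mapC (TensorAlgebra.ι S) u ⬝ mapC (TensorAlgebra.ι S) v) = 0 := by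
    rw [c₁_mul, c₀_ι, c₀_ι, zero_lact, ract_zero, zero_add]
  have h2 : prod₂ u (ract v (coev hF Φ)) = ract (prod₂ u v) (coev hF Φ) := by
    rw [prod₂_single, prod₂_single, geom_single, tmul_tone, ← tmul_assoc, mapC_ract,
      mulBy_ract_right, mapC_b_mul_geom hF _ (k := 0), c₁_ract, h1, zero_ract, mapC_zero, zero_ract,
      add_zero, mapC_ract]
    · rw [c₀_ract, h0, zero_lmul]
    · rw [c₁_ract, h1, zero_ract]
      exact Submodule.zero_mem _
  rw [cnL, prod₂, word₂_ract_inL, mapC_add, lact_add, mapC_ract, mapC_ract, lact_ract, lact_ract,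
    ← prod₂, ← prod₃, h2, prod₃_ract_ev, lact_coev_ev hF single_obj hΦ, cnL]

theorem prod₃_cnL (x : CMat C.Mor (single D) (single A)) (u : CMat C.Mor (single A) (single B))
    (v : CMat C.Mor (single B) (single F))
    {l : ℤ} {Φ : CMat C.Mor (single F) X} (hΦ : Φ ∈ degC (single F) X l) :
    prod₃ x u (cnL hF v Φ) = cnL hF (prod₃ x u v) Φ + ract (prod₄ x u v Φ) (inR hF X) := by
  have h0 : c₀ (mapC (TensorAlgebra.ι S) x ⬝ mapC (TensorAlgebra.ι S) u ⬝
      mapC (TensorAlgebra.ι S) v) = 0 := by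
    rw [c₀_mul, c₀_mul, c₀_ι, zero_lmul, zero_lmul]
  have h1 : c₁ (mapC (TensorAlgebra.ι S) x ⬝ mapC (TensorAlgebra.ι S) u ⬝
      mapC (TensorAlgebra.ι S) v) = 0 := by
    rw [c₁_mul, c₀_ι, c₀_mul, c₀_ι, zero_lmul, zero_lact, ract_zero, zero_add]
  have h2 : mapC C.b (mapC (TensorAlgebra.ι S) x ⬝ mapC (TensorAlgebra.ι S) u ⬝
      mapC (TensorAlgebra.ι S) (ract v (coev hF Φ)) ⬝ geom (homTw hF X)) =
        ract (prod₃ x u v) (coev hF Φ) := by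
    rw [prod₃_single, geom_single, tmul_tone, mapC_ract,
      mulBy_ract_right, mapC_b_mul_geom hF _ (k := 0), c₁_ract, h1, zero_ract, mapC_zero, zero_ract,
      add_zero, mapC_ract, tmul_assoc]
    · rw [c₀_ract, h0, zero_lmul]
    · rw [c₁_ract, h1, zero_ract]
      exact Submodule.zero_mem _
  have h3 : mapC C.b (mapC (TensorAlgebra.ι S) x ⬝ mapC (TensorAlgebra.ι S) u ⬝
      mapC (TensorAlgebra.ι S) (ract v (coev hF Φ)) ⬝ (geom (homTw hF X) ⬝
        mapC (TensorAlgebra.ι S) (ev hF X) ⬝ geom X)) = prod₄ x u v Φ := by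
    have h4 : c₀ (mapC (TensorAlgebra.ι S) x ⬝ mapC (TensorAlgebra.ι S) u ⬝
        mapC (TensorAlgebra.ι S) (ract v (coev hF Φ))) = 0 := by
      rw [c₀_mul, c₀_mul, c₀_ι, zero_lmul, zero_lmul]
    rw [tmul_assoc (geom (homTw hF X)), ← tmul_assoc _ (geom (homTw hF X)),
      mapC_b_mul_geom_mul hF _ h4 _ (c₀_ev_geom hF), tmul_assoc, tmul_assoc, mapC_ract,
      mulBy_ract_left, ← mulBy_lact, ← mapC_lact, lact_coev_ev hF single_obj hΦ, prod₄]
  have h5 : mapC (TensorAlgebra.ι S) (ract (ract v (coev hF Φ)) (inL hF X)) ⬝ geom (twist hF X) =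
      ract (mapC (TensorAlgebra.ι S) (ract v (coev hF Φ)) ⬝ geom (homTw hF X)) (inL hF X) +
      ract (mapC (TensorAlgebra.ι S) (ract v (coev hF Φ)) ⬝ (geom (homTw hF X) ⬝
        mapC (TensorAlgebra.ι S) (ev hF X) ⬝ geom X)) (inR hF X) := by
    rw [mapC_ract, mulBy_ract_left, lact_inL_geom, mulBy_add_right, mulBy_ract_right,
      mulBy_ract_right]
  rw [cnL, cnL]
  generalize ract v (coev hF Φ) = p at h2 h3 h5 ⊢
  rw [prod₃_single, h5, ← tmul_assoc, mulBy_add_right, mulBy_ract_right, mulBy_ract_right,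
    mapC_add, mapC_ract, mapC_ract, ← tmul_assoc _ _ (geom (homTw hF X)), h2, ← tmul_assoc, h3]

end PreTw

end MinimalAInfCat

end

noncomputable section

attribute [local instance] Classical.propDecidable

namespace MinimalAInfCat

namespace PreTw

variable {S : Type u} [CommRing S] {C : MinimalAInfCat.{u, w} S} {F : C.Obj}
  (hF : C.IsOneSpherical F) {W X Y Z : C.PreTw}

/-! ### Matrices of single morphisms -/

variable {A B D : C.Obj}

instance : Unique (single B).I := inferInstanceAs (Unique Unit)

variable (A B) in
/-- The identity matrix between single objects. -/
def sgl : LMat (C := C) (single A) (single B) := fun _ _ => LinearMap.id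

theorem sgl_lmul_sgl : lmul (sgl A B) (sgl B D) = sgl A D := by
  funext i j
  rw [lmul_apply]
  exact Fintype.sum_unique _

theorem sgl_self : sgl B B = lone (single B) := by
  funext i j
  rw [lone, ldiag, Subsingleton.elim j i, Pi.single_eq_same, one_smul]
  rfl

variable (A B) in
/-- A morphism, as a morphism of twisted complexes. -/
def hat (x : C.Mor) : CMat C.Mor (single A) (single B) := scal x (sgl A B)

theorem hat_add (x y : C.Mor) : hat A B (x + y) = hat A B x + hat A B y := by
  funext i j
  ext p
  exact TensorProduct.add_tmul x y _

theorem hat_smul (c : S) (x : C.Mor) : hat A B (c • x) = c • hat A B x := by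
  funext i j
  ext p
  exact (TensorProduct.smul_tmul' c x _).symm

theorem hat_zero : hat A B 0 = 0 := by
  funext i j
  ext p
  exact TensorProduct.zero_tmul _ _

theorem hat_neg (x : C.Mor) : hat A B (-x) = -hat A B x := by
  refine eq_neg_of_add_eq_zero_left ?_
  rw [← hat_add, neg_add_cancel, hat_zero]

theorem hat_sum {ι : Type*} (s : Finset ι) (x : ι → C.Mor) :
    hat A B (∑ a ∈ s, x a) = ∑ a ∈ s, hat A B (x a) :=
  map_sum (⟨⟨hat A B, hat_zero⟩, hat_add⟩ : C.Mor →+ CMat C.Mor (single A) (single B)) x s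

theorem hat_mem {d : ℤ} {x : C.Mor} (hx : x ∈ C.Hom A B d) :
    hat A B x ∈ degC (single A) (single B) d := by
  intro i j p
  refine Submodule.tmul_mem_tens ?_ _
  change x ∈ C.Hom A B (d + 0 - 0)
  rwa [add_zero, sub_zero]

variable (A B) in
/-- The morphism given by a matrix between single objects. -/
def unhat : CMat C.Mor (single A) (single B) →ₗ[S] C.Mor :=
  (TensorProduct.rid S C.Mor).toLinearMap ∘ₗ LinearMap.applyₗ (1 : S) ∘ₗ
    LinearMap.proj (R := S) (φ := fun _ : Unit => S →ₗ[S] C.Mor ⊗[S] S) () ∘ₗ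
    LinearMap.proj (R := S) (φ := fun _ : Unit => ∀ _ : Unit, S →ₗ[S] C.Mor ⊗[S] S) ()

theorem unhat_hat (x : C.Mor) : unhat A B (hat A B x) = x := by
  change TensorProduct.rid S C.Mor (x ⊗ₜ (1 : S)) = x
  rw [TensorProduct.rid_tmul, one_smul]

theorem hat_unhat (f : CMat C.Mor (single A) (single B)) : hat A B (unhat A B f) = f := by
  funext i j
  apply LinearMap.ext_ring
  change (TensorProduct.rid S C.Mor (f () () (1 : S))) ⊗ₜ[S] (1 : S) = f () () (1 : S)
  exact (TensorProduct.rid S C.Mor).symm_apply_apply _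

theorem unhat_mem {d : ℤ} {f : CMat C.Mor (single A) (single B)}
    (hf : f ∈ degC (single A) (single B) d) : unhat A B f ∈ C.Hom A B d := by
  have h := hf () () (1 : S)
  change f () () (1 : S) ∈ LinearMap.range
    ((C.Hom A B (d + 0 - 0)).subtype.rTensor S) at h
  rw [add_zero, sub_zero] at h
  exact Submodule.map_mem_of_mem_tens (L := (TensorProduct.rid S C.Mor).toLinearMap)
    (N' := C.Hom A B d) (fun m hm p => by
      change TensorProduct.rid S C.Mor (m ⊗ₜ p) ∈ _
      rw [TensorProduct.rid_tmul]
      exact Submodule.smul_mem _ _ hm) h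

theorem mapC_ι_hat (x : C.Mor) :
    mapC (TensorAlgebra.ι S) (hat A B x) = scal (TensorAlgebra.ι S x) (sgl A B) := mapC_scal _ _ _

theorem hat_id : hat B B (C.id B) = one' (single B) := by
  rw [one', eps_lact_single, hat, sgl_self]
  funext i j
  rw [scal_apply, lone, ldiag, Subsingleton.elim j i, Pi.single_eq_same, one_smul, idC_apply_self]
  exact LinearMap.comp_id _

theorem prod₂_hat (x y : C.Mor) : prod₂ (hat A B x) (hat B D y) =
    hat A D (C.b (TensorAlgebra.ι S x * TensorAlgebra.ι S y)) := by
  rw [prod₂_single, geom_single, tmul_tone, mapC_ι_hat, mapC_ι_hat, mulBy_scal_left, mapC_scal,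
    lact_scal, sgl_lmul_sgl, mapC_scal, hat]
  rfl

theorem prod₃_hat {G : C.Obj} (x y z : C.Mor) : prod₃ (hat A B x) (hat B D y) (hat D G z) =
    hat A G (C.b (TensorAlgebra.ι S x * (TensorAlgebra.ι S y * TensorAlgebra.ι S z))) := by
  rw [prod₃_single, geom_single, tmul_tone, mapC_ι_hat, mapC_ι_hat, mapC_ι_hat, mulBy_scal_left,
    mulBy_scal_left, mapC_scal, lact_scal, sgl_lmul_sgl, mapC_scal, lact_scal, sgl_lmul_sgl,
    mapC_scal, hat]
  rfl

theorem prod₄_hat {G H : C.Obj} (x y z w : C.Mor) :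
    prod₄ (hat A B x) (hat B D y) (hat D G z) (hat G H w) =
    hat A H (C.b (TensorAlgebra.ι S x * (TensorAlgebra.ι S y * (TensorAlgebra.ι S z *
      TensorAlgebra.ι S w)))) := by
  rw [prod₄, geom_single, tmul_tone, mapC_ι_hat, mapC_ι_hat, mapC_ι_hat, mapC_ι_hat,
    mulBy_scal_left, mulBy_scal_left, mulBy_scal_left, mapC_scal, lact_scal, sgl_lmul_sgl,
    mapC_scal, lact_scal, sgl_lmul_sgl, mapC_scal, lact_scal, sgl_lmul_sgl, mapC_scal, hat]
  rfl

theorem mapC_smulRight (c : C.Mor →ₗ[S] S) (x : C.Mor) (f : CMat C.Mor X Y) :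
    mapC (c.smulRight x) f = scal x (toL (mapC c f)) := by
  funext i j
  ext p
  change (c.smulRight x).rTensor (Y.P j) (f i j p) =
    x ⊗ₜ TensorProduct.lid S (Y.P j) (c.rTensor (Y.P j) (f i j p))
  induction f i j p using TensorProduct.induction_on with
  | zero => rw [map_zero, map_zero, map_zero, TensorProduct.tmul_zero]
  | tmul m q =>
    rw [LinearMap.rTensor_tmul, LinearMap.rTensor_tmul, TensorProduct.lid_tmul,
      LinearMap.smulRight_apply, TensorProduct.smul_tmul]
  | add a b ha hb => rw [map_add, map_add, map_add, TensorProduct.tmul_add, ha, hb]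

/-! ### Coefficients -/

/-- The coefficient `Φ` of `v ⊗ Φ`, where `c` is the coordinate of `v`. -/
def cf (c : C.Mor →ₗ[S] S) (f : CMat C.Mor (single B) (twist hF X)) : CMat C.Mor (single F) X :=
  lact (lmul (sgl F B) (toL (mapC c (ract f (prL hF X))))) (ev hF X)

theorem cf_add (c : C.Mor →ₗ[S] S) (f g : CMat C.Mor (single B) (twist hF X)) :
    cf hF c (f + g) = cf hF c f + cf hF c g := by
  rw [cf, add_ract, mapC_add, toL_add, lmul_add, add_lact, cf, cf]

theorem cf_smul (c : C.Mor →ₗ[S] S) (a : S) (f : CMat C.Mor (single B) (twist hF X)) :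
    cf hF c (a • f) = a • cf hF c f := by
  rw [cf, smul_ract, mapC_smul, toL_smul, lmul_smul, smul_lact, cf]

/-- `cf` as a linear map. -/
def cfₗ (c : C.Mor →ₗ[S] S) :
    CMat C.Mor (single B) (twist hF X) →ₗ[S] CMat C.Mor (single F) X where
  toFun := cf hF c
  map_add' := cf_add hF c
  map_smul' := cf_smul hF c

theorem cf_neg (c : C.Mor →ₗ[S] S) (f : CMat C.Mor (single B) (twist hF X)) :
    cf hF c (-f) = -cf hF c f := map_neg (cfₗ hF c) f

theorem cf_zero (c : C.Mor →ₗ[S] S) : cf hF c (0 : CMat C.Mor (single B) (twist hF X)) = 0 :=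
  map_zero (cfₗ hF c)

theorem cf_sum {ι : Type*} (c : C.Mor →ₗ[S] S) (s : Finset ι)
    (f : ι → CMat C.Mor (single B) (twist hF X)) :
    cf hF c (∑ a ∈ s, f a) = ∑ a ∈ s, cf hF c (f a) := map_sum (cfₗ hF c) f s

theorem cf_inR (c : C.Mor →ₗ[S] S) (q : CMat C.Mor (single B) X) :
    cf hF c (ract q (inR hF X)) = 0 := by
  rw [cf, ract_inR_prL, mapC_zero, toL_zero, lmul_zero, zero_lact]

theorem cf_cnL (c : C.Mor →ₗ[S] S) (x : C.Mor) {l : ℤ} {Φ : CMat C.Mor (single F) X}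
    (hΦ : Φ ∈ degC (single F) X l) : cf hF c (cnL hF (hat B F x) Φ) = c x • Φ := by
  rw [cf, cnL, ract_inL_prL, hat, ract_scal, mapC_scal, toL_scal, lmul_smul, ← lmul_assoc,
    sgl_lmul_sgl, sgl_self, lone_lmul, smul_lact, lact_coev_ev hF single_obj hΦ]

variable (F B) in
/-- Coordinates on `Hom(B,F)`. -/
structure Frame (ι : Type) [Fintype ι] where
  x : ι → C.Mor
  c : ι → C.Mor →ₗ[S] S
  d : ι → ℤ
  mem : ∀ a, x a ∈ C.Hom B F (d a)
  sum_eq : ∀ k, ∀ y ∈ C.Hom B F k, ∑ a, c a y • x a = y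
  eq_zero : ∀ a k, k ≠ d a → ∀ y ∈ C.Hom B F k, c a y = 0

variable {ι : Type} [Fintype ι] (R : Frame F B ι)

theorem Frame.isDegL_coeff {k : ℤ} {p : CMat C.Mor (single B) (homTw hF X)}
    (hp : p ∈ degC (single B) (homTw hF X) k) (a : ι) :
    IsDegL (lmul (sgl F B) (toL (mapC (R.c a) p))) (k - R.d a) := by
  intro i j h
  refine ⟨rfl, ?_⟩
  by_contra hne
  apply h
  have h0 : ∀ i, toL (mapC (R.c a) p) i j = 0 := by
    intro i
    refine LinearMap.ext fun q => ?_
    refine LinearMap.eq_of_mem_tens (L := (TensorProduct.lid S ((homTw hF X).P j)).toLinearMap ∘ₗ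
      (R.c a).rTensor ((homTw hF X).P j)) (L' := 0) (fun m hm r => ?_) (hp i j q)
    rw [LinearMap.comp_apply, LinearMap.rTensor_tmul, R.eq_zero a _ ?_ m hm,
      TensorProduct.zero_tmul, map_zero]
    · rfl
    · intro h'
      apply hne
      change k + 0 - (homTw hF X).deg j = R.d a at h'
      change (homTw hF X).deg j = 0 + (k - R.d a)
      rw [← h']
      ring
  rw [lmul_apply]
  refine Finset.sum_eq_zero fun i _ => ?_
  rw [h0]
  rfl

theorem Frame.sum_scal {k : ℤ} {p : CMat C.Mor (single B) (homTw hF X)}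
    (hp : p ∈ degC (single B) (homTw hF X) k) :
    ∑ a, ract (hat B F (R.x a)) (lmul (sgl F B) (toL (mapC (R.c a) p))) = p := by
  have h1 : ∀ a, ract (hat B F (R.x a)) (lmul (sgl F B) (toL (mapC (R.c a) p))) =
      mapC ((R.c a).smulRight (R.x a)) p := fun a => by
    rw [hat, ract_scal, ← lmul_assoc, sgl_lmul_sgl, sgl_self, lone_lmul, mapC_smulRight]
  have h2 : ∑ a, mapC ((R.c a).smulRight (R.x a)) p =
      mapC (∑ a, (R.c a).smulRight (R.x a)) p :=
    (map_sum (⟨⟨fun c => mapC c p, mapC_map_zero p⟩, fun c c' => mapC_map_add c c' p⟩ :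
      (C.Mor →ₗ[S] C.Mor) →+ CMat C.Mor (single B) (homTw hF X)) _ _).symm
  rw [Finset.sum_congr rfl fun a _ => h1 a, h2]
  funext i j
  refine LinearMap.ext fun q => ?_
  refine LinearMap.eq_of_mem_tens
    (L := (∑ a, (R.c a).smulRight (R.x a)).rTensor ((homTw hF X).P j)) (L' := LinearMap.id) (fun m hm r => ?_) (hp i j q)
  rw [LinearMap.rTensor_tmul, LinearMap.sum_apply]
  exact congrArg (· ⊗ₜ[S] r) (R.sum_eq _ m hm)

theorem ract_prL_mem {k : ℤ} {f : CMat C.Mor W (twist hF X)} (hf : f ∈ degC W (twist hF X) k) :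
    ract f (prL hF X) ∈ degC W (homTw hF X) k :=
  ract_mem_degC (isDegL_prL hF) hf (add_zero k).symm

theorem ract_prR_mem {k : ℤ} {f : CMat C.Mor W (twist hF X)} (hf : f ∈ degC W (twist hF X) k) :
    ract f (prR hF X) ∈ degC W X k :=
  ract_mem_degC (isDegL_prR hF) hf (add_zero k).symm

theorem ract_inR_mem {k : ℤ} {f : CMat C.Mor W X} (hf : f ∈ degC W X k) :
    ract f (inR hF X) ∈ degC W (twist hF X) k :=
  ract_mem_degC (isDegL_inR hF) hf (add_zero k).symm

theorem ract_inR_injective {f g : CMat C.Mor W X} (h : ract f (inR hF X) = ract g (inR hF X)) :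
    f = g := by
  rw [← ract_inR_prR hF f, h, ract_inR_prR]

theorem Frame.cf_mem {k l : ℤ} {f : CMat C.Mor (single B) (twist hF X)}
    (hf : f ∈ degC (single B) (twist hF X) k) (a : ι) (h : l = k + 1 - R.d a) :
    cf hF (R.c a) f ∈ degC (single F) X l :=
  lact_mem_degC (R.isDegL_coeff hF (ract_prL_mem hF hf) a) (ev_mem hF) (by rw [h]; ring)

theorem Frame.sum_cnL {k : ℤ} {f : CMat C.Mor (single B) (twist hF X)}
    (hf : f ∈ degC (single B) (twist hF X) k) :
    ∑ a, cnL hF (hat B F (R.x a)) (cf hF (R.c a) f) + ract (ract f (prR hF X)) (inR hF X) = f := by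
  conv_rhs => rw [← ract_block hF f, ← R.sum_scal hF (ract_prL_mem hF hf)]
  rw [sum_ract]
  refine congrArg (· + ract (ract f (prR hF X)) (inR hF X)) (Finset.sum_congr rfl fun a _ => ?_)
  rw [cnL, cf, coev_lact_ev]

end PreTw

end MinimalAInfCat

end

noncomputable section

attribute [local instance] Classical.propDecidable

namespace MinimalAInfCat

namespace PreTw

variable {S : Type u} [CommRing S] {C : MinimalAInfCat.{u, w} S} {F : C.Obj}
  (hF : C.IsOneSpherical F) {W X Y Z : C.PreTw}

/-! ### Cocycles and coboundaries -/

variable {B : C.Obj}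

/-- `f` is the differential of a morphism of degree `k - 1`. -/
def IsCob (k : ℤ) (f : CMat C.Mor X Y) : Prop := ∃ g ∈ degC X Y (k - 1), dif g = f

theorem IsCob.add {k : ℤ} {f g : CMat C.Mor X Y} (hf : IsCob k f) (hg : IsCob k g) :
    IsCob k (f + g) := by
  obtain ⟨f', hf', rfl⟩ := hf
  obtain ⟨g', hg', rfl⟩ := hg
  exact ⟨f' + g', Submodule.add_mem _ hf' hg', dif_add _ _⟩

theorem IsCob.neg {k : ℤ} {f : CMat C.Mor X Y} (hf : IsCob k f) : IsCob k (-f) := by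
  obtain ⟨f', hf', rfl⟩ := hf
  exact ⟨-f', Submodule.neg_mem _ hf', dif_neg' _⟩

theorem IsCob.zero (k : ℤ) : IsCob k (0 : CMat C.Mor X Y) := ⟨0, Submodule.zero_mem _, dif_zero⟩

theorem IsCob.sum {k : ℤ} {ι : Type*} {s : Finset ι} {f : ι → CMat C.Mor X Y}
    (hf : ∀ a ∈ s, IsCob k (f a)) : IsCob k (∑ a ∈ s, f a) := by
  induction s using Finset.induction_on with
  | empty => exact IsCob.zero k
  | insert a s ha ih =>
    rw [Finset.sum_insert ha]
    exact (hf a (Finset.mem_insert_self a s)).add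
      (ih fun b hb => hf b (Finset.mem_insert_of_mem hb))

/-! ### Morphisms from the spherical object to a twist -/

/-- `S ≅ Hom⁰(F,F)`. -/
def homZero : S ≃ₗ[S] C.Hom F F 0 :=
  LinearEquiv.ofBijective
    { toFun := fun s => (⟨s • C.id F, Submodule.smul_mem _ s (C.id_mem F)⟩ : C.Hom F F 0)
      map_add' := fun a b => Subtype.ext (add_smul a b _)
      map_smul' := fun a b => Subtype.ext (mul_smul a b _) } hF.hom_zero

/-- The coordinate of `id_F`. -/
def coordId : C.Mor →ₗ[S] S := (homZero hF).symm.toLinearMap ∘ₗ C.proj F F 0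

variable (θ : S ≃ₗ[S] C.Hom F F 1)

/-- The coordinate of the generator of `Hom¹(F,F)`. -/
def coordXi : C.Mor →ₗ[S] S := θ.symm.toLinearMap ∘ₗ C.proj F F 1

theorem coordXi_xi : coordXi θ (θ 1) = 1 := by
  rw [coordXi, LinearMap.comp_apply, C.proj_of_mem (θ 1).2]
  exact θ.symm_apply_apply 1

theorem coordId_of_mem {k : ℤ} (hk : k ≠ 0) {x : C.Mor} (hx : x ∈ C.Hom F F k) :
    coordId hF x = 0 := by
  rw [coordId, LinearMap.comp_apply, C.proj_eq_zero hx, map_zero]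
  intro h
  exact hk (Prod.mk.inj (Prod.mk.inj h).2).2

theorem coordXi_of_mem {k : ℤ} (hk : k ≠ 1) {x : C.Mor} (hx : x ∈ C.Hom F F k) :
    coordXi θ x = 0 := by
  rw [coordXi, LinearMap.comp_apply, C.proj_eq_zero hx, map_zero]
  intro h
  exact hk (Prod.mk.inj (Prod.mk.inj h).2).2

/-- The coordinates on `Hom(F,F)`. -/
def frameF : Frame F F (Fin 2) where
  x := ![C.id F, θ 1]
  c := ![coordId hF, coordXi θ]
  d := ![0, 1]
  mem a := by
    fin_cases a
    · exact C.id_mem F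
    · exact (θ 1).2
  sum_eq k y hy := by
    rw [Fin.sum_univ_two]
    change coordId hF y • C.id F + coordXi θ y • (θ 1 : C.Mor) = y
    by_cases h0 : k = 0
    · subst h0
      rw [coordXi_of_mem θ zero_ne_one hy, zero_smul, add_zero, coordId, LinearMap.comp_apply,
        C.proj_of_mem hy]
      exact congrArg Subtype.val ((homZero hF).apply_symm_apply ⟨y, hy⟩)
    · rw [coordId_of_mem hF h0 hy, zero_smul, zero_add]
      by_cases h1 : k = 1
      · subst h1
        rw [coordXi, LinearMap.comp_apply, C.proj_of_mem hy, ← Submodule.coe_smul, ← map_smul,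
          smul_eq_mul, mul_one]
        exact congrArg Subtype.val (θ.apply_symm_apply ⟨y, hy⟩)
      · have : y = 0 := by
          rw [hF.hom_eq_bot k h0 h1] at hy
          exact hy
        rw [this, map_zero, zero_smul]
  eq_zero a k hk y hy := by
    fin_cases a
    · exact coordId_of_mem hF hk hy
    · exact coordXi_of_mem θ hk hy

/-- The map `Hom(F,T_F(X)) → Hom(F,X)`. -/
def psi (f : CMat C.Mor (single F) (twist hF X)) : CMat C.Mor (single F) X := cf hF (coordXi θ) f

theorem psi_mem {k : ℤ} {f : CMat C.Mor (single F) (twist hF X)}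
    (hf : f ∈ degC (single F) (twist hF X) k) : psi hF θ f ∈ degC (single F) X k :=
  (frameF hF θ).cf_mem hF hf 1 (by change k = k + 1 - 1; ring)

theorem coordId_mem (θ : S ≃ₗ[S] C.Hom F F 1) {k : ℤ} {f : CMat C.Mor (single F) (twist hF X)}
    (hf : f ∈ degC (single F) (twist hF X) k) :
    cf hF (coordId hF) f ∈ degC (single F) X (k + 1) :=
  (frameF hF θ).cf_mem hF hf 0 (by change k + 1 = k + 1 - 0; ring)

theorem eq_cnL_psi {k : ℤ} {f : CMat C.Mor (single F) (twist hF X)}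
    (hf : f ∈ degC (single F) (twist hF X) k) :
    f = cnL hF (hat F F (C.id F)) (cf hF (coordId hF) f) +
      cnL hF (hat F F (θ 1)) (psi hF θ f) + ract (ract f (prR hF X)) (inR hF X) := by
  have h := (frameF hF θ).sum_cnL hF hf
  rw [Fin.sum_univ_two] at h
  exact h.symm

theorem psi_cnL_id {l : ℤ} {Φ : CMat C.Mor (single F) X} (hΦ : Φ ∈ degC (single F) X l) :
    psi hF θ (cnL hF (hat F F (C.id F)) Φ) = 0 := by
  rw [psi, cf_cnL hF _ _ hΦ, coordXi_of_mem θ zero_ne_one (C.id_mem F), zero_smul]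

theorem psi_cnL_xi {l : ℤ} {Φ : CMat C.Mor (single F) X} (hΦ : Φ ∈ degC (single F) X l) :
    psi hF θ (cnL hF (hat F F (θ 1)) Φ) = Φ := by
  rw [psi, cf_cnL hF _ _ hΦ, coordXi_xi, one_smul]

theorem psi_inR (q : CMat C.Mor (single F) X) : psi hF θ (ract q (inR hF X)) = 0 :=
  cf_inR hF _ q

theorem psi_add (f g : CMat C.Mor (single F) (twist hF X)) :
    psi hF θ (f + g) = psi hF θ f + psi hF θ g := cf_add hF _ f g

theorem psi_neg (f : CMat C.Mor (single F) (twist hF X)) : psi hF θ (-f) = -psi hF θ f :=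
  cf_neg hF _ f

theorem dif_cnL_id {l : ℤ} {Φ : CMat C.Mor (single F) X} (hΦ : Φ ∈ degC (single F) X l) :
    dif (cnL hF (hat F F (C.id F)) Φ) =
      -cnL hF (hat F F (C.id F)) (dif Φ) + ract Φ (inR hF X) := by
  rw [dif_cnL hF (hat_mem (C.id_mem F)) hΦ, sg_zero, one_smul, hat_id, prod₂_one'_left hΦ]

theorem dif_cnL_xi {l : ℤ} {Φ : CMat C.Mor (single F) X} (hΦ : Φ ∈ degC (single F) X l) :
    dif (cnL hF (hat F F (θ 1)) Φ) =
      cnL hF (hat F F (θ 1)) (dif Φ) + ract (prod₂ (hat F F (θ 1)) Φ) (inR hF X) := by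
  rw [dif_cnL hF (hat_mem (θ 1).2) hΦ, sg_one]
  congr 1
  rw [neg_eq_iff_eq_neg]
  funext i j
  refine LinearMap.ext fun p => ?_
  exact neg_one_smul S (cnL hF (hat F F (θ 1)) (dif Φ) i j p)

theorem psi_dif {k : ℤ} {f : CMat C.Mor (single F) (twist hF X)}
    (hf : f ∈ degC (single F) (twist hF X) k) : psi hF θ (dif f) = dif (psi hF θ f) := by
  have h1 := coordId_mem hF θ hf
  have h2 := psi_mem hF θ hf
  conv_lhs => rw [eq_cnL_psi hF θ hf]
  rw [dif_add, dif_add, dif_cnL_id hF h1, dif_cnL_xi hF θ h2, dif_ract_inR, psi_add, psi_add,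
    psi_add, psi_add, psi_neg, psi_cnL_id hF θ (dif_mem h1 rfl), psi_cnL_xi hF θ (dif_mem h2 rfl),
    psi_inR, psi_inR, psi_inR, neg_zero, zero_add, zero_add, add_zero, add_zero]

theorem psi_prod₂_tw {k l : ℤ} {f : CMat C.Mor (single F) (twist hF X)}
    (hf : f ∈ degC (single F) (twist hF X) k) {g : CMat C.Mor X Y} (hg : g ∈ degC X Y l) :
    psi hF θ (prod₂ f (tw hF g)) = prod₂ (psi hF θ f) g := by
  have h1 := coordId_mem hF θ hf
  have h2 := psi_mem hF θ hf
  have h3 : -(sg S 1 • cnL hF (hat F F (θ 1)) (prod₂ (psi hF θ f) g)) =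
      cnL hF (hat F F (θ 1)) (prod₂ (psi hF θ f) g) := by
    rw [sg_one, neg_eq_iff_eq_neg]
    funext i j
    refine LinearMap.ext fun p => ?_
    exact neg_one_smul S (cnL hF (hat F F (θ 1)) (prod₂ (psi hF θ f) g) i j p)
  conv_lhs => rw [eq_cnL_psi hF θ hf]
  rw [prod₂_add_left, prod₂_add_left, prod₂_cnL_tw hF (hat_mem (C.id_mem F)) h1 hg,
    prod₂_cnL_tw hF (hat_mem (θ 1).2) h2 hg, h3, tw, prod₂_inR_twB, psi_add, psi_add,
    psi_add, psi_add, psi_neg, sg_zero, one_smul, psi_cnL_id hF θ (prod₂_mem h1 hg rfl),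
    psi_cnL_xi hF θ (prod₂_mem h2 hg rfl),
    psi_inR, psi_inR, psi_inR, neg_zero, zero_add, zero_add, add_zero, add_zero]

theorem isCob_of_psi (hX : X.IsTwisted) {k : ℤ} {f : CMat C.Mor (single F) (twist hF X)}
    (hf : f ∈ degC (single F) (twist hF X) k) (hf0 : dif f = 0) (h : IsCob k (psi hF θ f)) :
    IsCob k f := by
  obtain ⟨z, hz, hzf⟩ := h
  have hz1 : cnL hF (hat F F (θ 1)) z ∈ degC (single F) (twist hF X) (k - 1) :=
    cnL_mem hF (hat_mem (θ 1).2) hz (by ring)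
  set f' := f - dif (cnL hF (hat F F (θ 1)) z) with hf'
  have hT := isTwisted_twist hF hX
  have hf'm : f' ∈ degC (single F) (twist hF X) k :=
    Submodule.sub_mem _ hf (dif_mem hz1 (by ring))
  have hf'0 : dif f' = 0 := by
    rw [hf', dif_sub, hf0, dif_dif isTwisted_single hT, sub_zero]
  have hψ : psi hF θ f' = 0 := by
    rw [hf', sub_eq_add_neg, psi_add, psi_neg, dif_cnL_xi hF θ hz, psi_add, psi_inR, add_zero,
      psi_cnL_xi hF θ (dif_mem hz rfl), hzf, add_neg_cancel]
  have h1 := coordId_mem hF θ hf'm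
  have e := eq_cnL_psi hF θ hf'm
  rw [hψ, cnL_zero_right, add_zero] at e
  set x := cf hF (coordId hF) f'
  set q := ract f' (prR hF X)
  have hq : q ∈ degC (single F) X k := ract_prR_mem hF hf'm
  have h3 : x = -dif q := by
    rw [e, dif_add, dif_cnL_id hF h1, dif_ract_inR, add_assoc, ← add_ract] at hf'0
    have := congrArg (fun f => ract f (prR hF X)) hf'0
    simp only [add_ract, neg_ract, cnL, ract_inL_prR, ract_inR_prR, zero_ract, neg_zero,
      zero_add] at this
    exact eq_neg_of_add_eq_zero_left this
  refine ⟨cnL hF (hat F F (θ 1)) z + cnL hF (hat F F (C.id F)) q, Submodule.add_mem _ hz1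
    (cnL_mem hF (hat_mem (C.id_mem F)) hq (by ring)), ?_⟩
  rw [dif_add, dif_cnL_id hF hq, ← cnL_neg_right, ← h3, ← e, hf']
  abel

theorem exists_psi_eq (hX : X.IsTwisted) {k : ℤ} {y : CMat C.Mor (single F) X}
    (hy : y ∈ degC (single F) X k) (hy0 : dif y = 0) :
    ∃ f ∈ degC (single F) (twist hF X) k, dif f = 0 ∧ psi hF θ f = y := by
  have hx : prod₂ (hat F F (θ 1)) y ∈ degC (single F) X (k + 1) :=
    prod₂_mem (hat_mem (θ 1).2) hy (by ring)
  refine ⟨cnL hF (hat F F (θ 1)) y - cnL hF (hat F F (C.id F)) (prod₂ (hat F F (θ 1)) y),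
    Submodule.sub_mem _ (cnL_mem hF (hat_mem (θ 1).2) hy (by ring))
      (cnL_mem hF (hat_mem (C.id_mem F)) hx (by ring)), ?_, ?_⟩
  · have h := dif_prod₂ isTwisted_single isTwisted_single hX (hat_mem (θ 1).2) y
    rw [dif_single, prod₂_zero_left, hy0, prod₂_zero_right, smul_zero, add_zero, add_zero] at h
    rw [dif_sub, dif_cnL_xi hF θ hy, dif_cnL_id hF hx, h, hy0, cnL_zero_right, cnL_zero_right,
      neg_zero, sub_self]
  · rw [sub_eq_add_neg, psi_add, psi_neg, psi_cnL_id hF θ hx, psi_cnL_xi hF θ hy, neg_zero, add_zero]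

end PreTw

end MinimalAInfCat

end

noncomputable section

attribute [local instance] Classical.propDecidable

namespace MinimalAInfCat

namespace PreTw

variable {S : Type u} [CommRing S] {C : MinimalAInfCat.{u, w} S} {F : C.Obj}
  (hF : C.IsOneSpherical F) {W X Y Z : C.PreTw}

/-! ### The tower -/

variable {E : C.Obj}

theorem isTwisted_tower : ∀ i, (tower hF E i).IsTwisted
  | 0 => isTwisted_single
  | i + 1 => isTwisted_twist hF (isTwisted_tower i)

/-- The powers of the twist, on morphisms from `E_0`. -/
def twP {i : ℕ} (a : CMat C.Mor (single E) (tower hF E i)) :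
    ∀ j, CMat C.Mor (tower hF E j) (tower hF E (i + j))
  | 0 => a
  | j + 1 => tw hF (twP a j)

theorem twP_mem {i : ℕ} {a : CMat C.Mor (single E) (tower hF E i)} {k : ℤ}
    (ha : a ∈ degC (single E) (tower hF E i) k) :
    ∀ j, twP hF a j ∈ degC (tower hF E j) (tower hF E (i + j)) k
  | 0 => ha
  | j + 1 => tw_mem hF (twP_mem ha j)

theorem dif_twP {i : ℕ} {a : CMat C.Mor (single E) (tower hF E i)} {k : ℤ}
    (ha : a ∈ degC (single E) (tower hF E i) k) (ha0 : dif a = 0) :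
    ∀ j, dif (twP hF a j) = 0
  | 0 => ha0
  | j + 1 => by
    have h := dif_tw hF (isTwisted_tower hF j) (isTwisted_tower hF (i + j)) (twP_mem hF ha j)
    rw [dif_twP ha ha0 j] at h
    refine h.trans ?_
    have h0 : tw hF (0 : CMat C.Mor (tower hF E j) (tower hF E (i + j))) = 0 := by
      have := dif_tw hF (isTwisted_tower hF j) (isTwisted_tower hF (i + j))
        (Submodule.zero_mem (degC (tower hF E j) (tower hF E (i + j)) k))
      rw [tw, twA, word₁, mapC_zero, mulBy_zero_right, mulBy_zero_left, mulBy_zero_right, mapC_zero,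
        coev_zero, neg_zero, twB, scal_zero, lact_zero, zero_ract, lact_zero, zero_ract, add_zero]
    exact h0

variable (θ : S ≃ₗ[S] C.Hom F F 1)

/-- `psi` as a linear map. -/
def psiₗ : CMat C.Mor (single F) (twist hF X) →ₗ[S] CMat C.Mor (single F) X :=
  cfₗ hF (coordXi θ)

variable (E) in
/-- The map `Hom(F,E_i) → Hom(F,E)`. -/
def Psi : ∀ i, CMat C.Mor (single F) (tower hF E i) →ₗ[S] C.Mor
  | 0 => unhat F E
  | i + 1 => Psi i ∘ₗ psiₗ hF θ

theorem Psi_mem {k : ℤ} : ∀ (i : ℕ) {f : CMat C.Mor (single F) (tower hF E i)},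
    f ∈ degC (single F) (tower hF E i) k → Psi hF E θ i f ∈ C.Hom F E k
  | 0, _, hf => unhat_mem hf
  | i + 1, _, hf => Psi_mem i (psi_mem hF θ hf)

theorem Psi_dif {k : ℤ} : ∀ (i : ℕ) {f : CMat C.Mor (single F) (tower hF E i)},
    f ∈ degC (single F) (tower hF E i) k → Psi hF E θ i (dif f) = 0
  | 0, f, hf => by
    have h : dif f = 0 := dif_single (A := F) (B := E) f
    rw [h, map_zero]
  | i + 1, f, hf =>
    (congrArg (Psi hF E θ i) (psi_dif hF θ hf)).trans (Psi_dif i (psi_mem hF θ hf))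

theorem isCob_of_Psi {k : ℤ} : ∀ (i : ℕ) {f : CMat C.Mor (single F) (tower hF E i)},
    f ∈ degC (single F) (tower hF E i) k → dif f = 0 → Psi hF E θ i f = 0 → IsCob k f
  | 0, f, hf, hf0, h => by
    have h2 : f = 0 := by
      have h1 := hat_unhat (A := F) (B := E) f
      have h3 : unhat F E f = 0 := h
      rw [h3, hat_zero] at h1
      exact h1.symm
    rw [h2]
    exact IsCob.zero k
  | i + 1, f, hf, hf0, h =>
    isCob_of_psi hF θ (isTwisted_tower hF i) hf hf0 (isCob_of_Psi i (psi_mem hF θ hf)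
      ((psi_dif hF θ hf).symm.trans ((congrArg (psi hF θ) hf0).trans (cf_zero hF _))) h)

theorem exists_Psi_eq {k : ℤ} {x : C.Mor} (hx : x ∈ C.Hom F E k) : ∀ i : ℕ,
    ∃ f ∈ degC (single F) (tower hF E i) k, dif f = 0 ∧ Psi hF E θ i f = x
  | 0 => ⟨hat F E x, hat_mem hx, dif_single _, unhat_hat x⟩
  | i + 1 => by
    obtain ⟨y, hy, hy0, hyx⟩ := exists_Psi_eq hx i
    obtain ⟨f, hf, hf0, hfy⟩ := exists_psi_eq hF θ (isTwisted_tower hF i) hy hy0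
    exact ⟨f, hf, hf0, (congrArg (Psi hF E θ i) hfy).trans hyx⟩

theorem Psi_prod₂_twP {i : ℕ} {a : CMat C.Mor (single E) (tower hF E i)} {k l : ℤ}
    (ha : a ∈ degC (single E) (tower hF E i) k) :
    ∀ (j : ℕ) {f : CMat C.Mor (single F) (tower hF E j)},
      f ∈ degC (single F) (tower hF E j) l →
      Psi hF E θ (i + j) (prod₂ f (twP hF a j)) =
        Psi hF E θ i (prod₂ (hat F E (Psi hF E θ j f)) a)
  | 0, f, hf => by
    have h : hat F E (Psi hF E θ 0 f) = f := hat_unhat (A := F) (B := E) f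
    rw [h]
    rfl
  | j + 1, f, hf =>
    (congrArg (Psi hF E θ (i + j)) (psi_prod₂_tw hF θ hf (twP_mem hF ha j))).trans
      (Psi_prod₂_twP ha j (psi_mem hF θ hf))

theorem hom_eq_bot_of_dual (hF : C.IsOneSpherical F) {d : ℤ} (h : C.Hom E F (1 - d) = ⊥) (θ : S ≃ₗ[S] C.Hom F F 1) :
    C.Hom F E d = ⊥ := by
  have := ((hF.perfect_left E).2 d).1
  have := ((hF.perfect_left E).2 d).2
  have hb := hF.duality E d (1 - d) (by ring)
  rw [Submodule.eq_bot_iff]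
  intro x hx
  have h0 : ∀ φ : Module.Dual S (C.Hom F E d), φ ⟨x, hx⟩ = 0 := by
    intro φ
    obtain ⟨v, hv⟩ := hb.2 (θ.toLinearMap ∘ₗ φ)
    have hv0 : v = 0 := Subtype.ext ((Submodule.eq_bot_iff _).mp h v v.2)
    rw [hv0, map_zero] at hv
    have := LinearMap.congr_fun hv ⟨x, hx⟩
    exact (θ.map_eq_zero_iff.mp this.symm)
  have h1 : Module.evalEquiv S (C.Hom F E d) ⟨x, hx⟩ = 0 := LinearMap.ext h0
  exact congrArg Subtype.val ((Module.evalEquiv S (C.Hom F E d)).map_eq_zero_iff.mp h1)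

variable {n : ℕ} (e : Module.Basis (Fin n) S (C.Hom E F 0))

/-- The coordinates on `Hom(E,F)`. -/
def frameE (hE : ∀ d, d ≠ 0 → C.Hom E F d = ⊥) : Frame F E (Fin n) where
  x j := e j
  c j := e.coord j ∘ₗ C.proj E F 0
  d _ := 0
  mem j := (e j).2
  sum_eq k y hy := by
    by_cases hk : k = 0
    · subst hk
      simp only [LinearMap.comp_apply, C.proj_of_mem hy]
      have := congrArg Subtype.val (e.sum_repr ⟨y, hy⟩)
      rw [AddSubmonoidClass.coe_finsetSum] at this
      exact this
    · have : y = 0 := by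
        rw [hE k hk] at hy
        exact hy
      rw [this]
      exact Finset.sum_eq_zero fun a _ => by rw [map_zero, zero_smul]
  eq_zero a k hk y hy := by
    have : y = 0 := by
      rw [hE k hk] at hy
      exact hy
    rw [this, map_zero]

theorem isCob_of_ne_one (hE : ∀ d, d ≠ 0 → C.Hom E F d = ⊥) (θ : S ≃ₗ[S] C.Hom F F 1) {i : ℕ}
    {k : ℤ} (hk : k ≠ 1) {f : CMat C.Mor (single F) (tower hF E i)}
    (hf : f ∈ degC (single F) (tower hF E i) k) (hf0 : dif f = 0) : IsCob k f := by
  refine isCob_of_Psi hF θ i hf hf0 ?_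
  have h := Psi_mem hF θ i hf
  rw [hom_eq_bot_of_dual hF (hE (1 - k) fun h => hk (by omega)) θ] at h
  exact h

/-- `⟨u,v⟩` is minus the coordinate of the product. -/
theorem coordXi_b (u : C.Hom F E 1) (v : C.Hom E F 0) :
    coordXi θ (C.b (TensorAlgebra.ι S (u : C.Mor) * TensorAlgebra.ι S (v : C.Mor))) = -C.pair θ u v := by
  have h : C.m 2 ![C.sgn u, (v : C.Mor)] = -C.m₂ v u := by
    rw [C.sgn_of_mem u.2, sg_one, neg_one_smul]
    have h := (C.m 2).map_update_smul ![0, (v : C.Mor)] 0 (-1 : S) (u : C.Mor)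
    have e : ∀ z : C.Mor, Function.update ![0, (v : C.Mor)] 0 z = ![z, (v : C.Mor)] := by
      intro z; ext i; fin_cases i <;> simp
    rw [e, e, neg_one_smul, neg_one_smul] at h
    exact h
  rw [b_ι_mul_ι, h, map_neg]
  rfl

/-- The action on `Hom¹(F,E)` of a morphism `E_0 → E_i`. -/
def sy (i : ℕ) (a : CMat C.Mor (single E) (tower hF E i)) :
    Module.End S (C.Hom F E 1) where
  toFun u := -C.proj F E 1 (Psi hF E θ i (prod₂ (hat F E u) a))
  map_add' u v := by
    rw [Submodule.coe_add, hat_add, prod₂_add_left, map_add, map_add, neg_add]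
  map_smul' c u := by
    rw [Submodule.coe_smul, hat_smul, prod₂_smul_left, map_smul, map_smul, RingHom.id_apply,
      smul_neg]

theorem sy_apply {i : ℕ} {a : CMat C.Mor (single E) (tower hF E i)}
    (ha : a ∈ degC (single E) (tower hF E i) 0) (u : C.Hom F E 1) :
    (sy hF θ i a u : C.Mor) = -Psi hF E θ i (prod₂ (hat F E u) a) := by
  have h : Psi hF E θ i (prod₂ (hat F E u) a) ∈ C.Hom F E 1 :=
    Psi_mem hF θ i (prod₂_mem (hat_mem u.2) ha (by norm_num))
  change ((-C.proj F E 1 _ : C.Hom F E 1) : C.Mor) = _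
  rw [C.proj_of_mem h]
  rfl

theorem sy_eq_zero_of_isCob {i : ℕ} {a : CMat C.Mor (single E) (tower hF E i)}
    (ha : a ∈ degC (single E) (tower hF E i) 0) (h : IsCob 0 a) : sy hF θ i a = 0 := by
  refine LinearMap.ext fun u => Subtype.ext ?_
  rw [sy_apply hF θ ha]
  obtain ⟨g, hg, rfl⟩ := h
  have h1 := dif_prod₂ isTwisted_single isTwisted_single (isTwisted_tower hF i)
    (hat_mem u.2) g
  have h3 : dif (hat F E (u : C.Mor)) = 0 := dif_single _
  rw [h3, prod₂_zero_left, add_zero, sub_self, sg_zero, one_smul] at h1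
  rw [eq_neg_of_add_eq_zero_right h1, map_neg,
    Psi_dif hF θ i (prod₂_mem (hat_mem u.2) hg rfl), neg_zero]
  exact neg_zero

theorem sy_prod₂ {i j : ℕ} {a : CMat C.Mor (single E) (tower hF E i)}
    (ha : a ∈ degC (single E) (tower hF E i) 0) (ha0 : dif a = 0)
    {b : CMat C.Mor (single E) (tower hF E j)}
    (hb : b ∈ degC (single E) (tower hF E j) 0) (hb0 : dif b = 0) :
    sy hF θ (i + j) (prod₂ b (twP hF a j)) = sy hF θ i a * sy hF θ j b := by
  refine LinearMap.ext fun u => Subtype.ext ?_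
  have hT := isTwisted_tower hF (E := E)
  have h1 := dif_prod₃ isTwisted_single (isTwisted_single) (hT j) (hT (i + j)) (hat_mem u.2) hb (twP hF a j)
  have h3 : dif (hat F E (u : C.Mor)) = 0 := dif_single (A := F) (B := E) _
  have hub : prod₂ (hat F E u) b ∈ degC (single F) (tower hF E j) 1 :=
    prod₂_mem (hat_mem u.2) hb (by norm_num)
  rw [h3, prod₃_zero_left, zero_add, hb0, prod₃_zero_mid, zero_add, dif_twP hF ha ha0,
    prod₃_zero_right, smul_zero, add_zero, sub_self, sg_zero, one_smul] at h1
  rw [sy_apply hF θ (prod₂_mem hb (twP_mem hF ha j) (by norm_num)),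
    eq_neg_of_add_eq_zero_right h1, map_neg, map_add,
    Psi_dif hF θ (i + j) (prod₃_mem (hat_mem u.2) hb (twP_mem hF ha j) rfl), add_zero, neg_neg,
    Psi_prod₂_twP hF θ ha j hub, Module.End.mul_apply, sy_apply hF θ ha, sy_apply hF θ hb, hat_neg,
    prod₂_neg_left, map_neg, neg_neg]

end PreTw

end MinimalAInfCat

end

noncomputable section

attribute [local instance] Classical.propDecidable

namespace MinimalAInfCat

namespace PreTw

variable {S : Type u} [CommRing S] {C : MinimalAInfCat.{u, w} S} {F : C.Obj}
  (hF : C.IsOneSpherical F) {W X Y Z : C.PreTw}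

/-! ### Morphisms from `E` to a twist -/

theorem cmat_neg_smul (c : S) (f : CMat C.Mor X Y) : (-c) • f = -(c • f) := by
  funext i j
  refine LinearMap.ext fun p => ?_
  exact neg_smul c (f i j p)

variable {E : C.Obj} {n : ℕ} (e : Module.Basis (Fin n) S (C.Hom E F 0))

/-- The coefficient of `e_j` of a morphism from `E` to a twist. -/
def coef (j : Fin n) (f : CMat C.Mor (single E) (twist hF X)) : CMat C.Mor (single F) X :=
  cf hF (e.coord j ∘ₗ C.proj E F 0) f

theorem coord_proj (i j : Fin n) :
    (e.coord j ∘ₗ C.proj E F 0) (e i) = if i = j then 1 else 0 := by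
  rw [LinearMap.comp_apply, C.proj_of_mem (e i).2, Module.Basis.coord_apply]
  change e.repr (e i) j = _
  rw [e.repr_self, Finsupp.single_apply]

theorem coef_sum_cnL {l : ℤ} {Φ : Fin n → CMat C.Mor (single F) X}
    (hΦ : ∀ j, Φ j ∈ degC (single F) X l) (q : CMat C.Mor (single E) X) (j : Fin n) :
    coef hF e j (∑ i, cnL hF (hat E F (e i)) (Φ i) + ract q (inR hF X)) = Φ j := by
  rw [coef, cf_add, cf_inR, add_zero, cf_sum, Finset.sum_congr rfl fun i _ =>
    cf_cnL hF (e.coord j ∘ₗ C.proj E F 0) (e i : C.Mor) (hΦ i), Finset.sum_eq_single j]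
  · rw [coord_proj, if_pos rfl, one_smul]
  · intro i _ hi
    rw [coord_proj, if_neg hi, zero_smul]
  · intro h
    exact absurd (Finset.mem_univ j) h

theorem ract_prR_sum_cnL (Φ : Fin n → CMat C.Mor (single F) X) (q : CMat C.Mor (single E) X) :
    ract (∑ i, cnL hF (hat E F (e i)) (Φ i) + ract q (inR hF X)) (prR hF X) = q := by
  rw [add_ract, ract_inR_prR, sum_ract, Finset.sum_eq_zero, zero_add]
  intro i _
  rw [cnL, ract_inL_prR]

theorem dif_sum_cnL {l : ℤ} {Φ : Fin n → CMat C.Mor (single F) X}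
    (hΦ : ∀ j, Φ j ∈ degC (single F) X l) (q : CMat C.Mor (single E) X) :
    dif (∑ i, cnL hF (hat E F (e i)) (Φ i) + ract q (inR hF X)) =
      ∑ i, cnL hF (hat E F (e i)) (-dif (Φ i)) +
        ract (∑ i, prod₂ (hat E F (e i)) (Φ i) + dif q) (inR hF X) := by
  rw [dif_add, dif_sum, Finset.sum_congr rfl fun i _ => dif_cnL hF (hat_mem (e i).2) (hΦ i),
    Finset.sum_add_distrib, dif_ract_inR, add_ract, sum_ract, add_assoc]
  congr 1
  refine Finset.sum_congr rfl fun i _ => ?_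
  rw [sg_zero, one_smul, cnL_neg_right]

theorem prod₂_dif_hat (hX : X.IsTwisted) {v : C.Mor} (hv : v ∈ C.Hom E F 0)
    (z : CMat C.Mor (single F) X) : prod₂ (hat E F v) (dif z) = dif (prod₂ (hat E F v) z) := by
  have h := dif_prod₂ isTwisted_single isTwisted_single hX (hat_mem hv) z
  have h1 : sg S (0 - 1) • prod₂ (hat E F v) (dif z) = -prod₂ (hat E F v) (dif z) := by
    rw [sg_sub, sg_zero, sg_one, one_mul]
    funext i j
    refine LinearMap.ext fun p => ?_
    exact neg_one_smul S (prod₂ (hat E F v) (dif z) i j p)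
  rw [dif_single, prod₂_zero_left, add_zero, h1, add_neg_eq_zero] at h
  exact h.symm

variable (hE : ∀ d, d ≠ 0 → C.Hom E F d = ⊥)

theorem eq_sum_cnL (hE : ∀ d, d ≠ 0 → C.Hom E F d = ⊥) {k : ℤ}
    {f : CMat C.Mor (single E) (twist hF X)} (hf : f ∈ degC (single E) (twist hF X) k) :
    f = ∑ j, cnL hF (hat E F (e j)) (coef hF e j f) + ract (ract f (prR hF X)) (inR hF X) :=
  ((frameE e hE).sum_cnL hF hf).symm

theorem coef_mem (hE : ∀ d, d ≠ 0 → C.Hom E F d = ⊥) {k l : ℤ}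
    {f : CMat C.Mor (single E) (twist hF X)} (hf : f ∈ degC (single E) (twist hF X) k) (j : Fin n)
    (h : l = k + 1) : coef hF e j f ∈ degC (single F) X l :=
  (frameE e hE).cf_mem hF hf j (by rw [h]; exact (sub_zero _).symm)

theorem dif_coef (hE : ∀ d, d ≠ 0 → C.Hom E F d = ⊥) {k : ℤ}
    {f : CMat C.Mor (single E) (twist hF X)} (hf : f ∈ degC (single E) (twist hF X) k) (j : Fin n) :
    coef hF e j (dif f) = -dif (coef hF e j f) := by
  have hΦ := fun j => coef_mem hF e hE hf j rfl
  conv_lhs => rw [eq_sum_cnL hF e hE hf, dif_sum_cnL hF e hΦ]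
  exact coef_sum_cnL hF e (fun j => Submodule.neg_mem _ (dif_mem (hΦ j) rfl)) _ j

theorem ract_prR_dif (hE : ∀ d, d ≠ 0 → C.Hom E F d = ⊥) {k : ℤ}
    {f : CMat C.Mor (single E) (twist hF X)} (hf : f ∈ degC (single E) (twist hF X) k) :
    ract (dif f) (prR hF X) =
      ∑ j, prod₂ (hat E F (e j)) (coef hF e j f) + dif (ract f (prR hF X)) := by
  have hΦ := fun j => coef_mem hF e hE hf j rfl
  conv_lhs => rw [eq_sum_cnL hF e hE hf, dif_sum_cnL hF e hΦ]
  exact ract_prR_sum_cnL hF e _ _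

theorem dif_coef_eq_zero (hE : ∀ d, d ≠ 0 → C.Hom E F d = ⊥) {k : ℤ}
    {f : CMat C.Mor (single E) (twist hF X)} (hf : f ∈ degC (single E) (twist hF X) k)
    (hf0 : dif f = 0) (j : Fin n) : dif (coef hF e j f) = 0 := by
  have h := dif_coef hF e hE hf j
  rw [hf0, coef, cf_zero] at h
  exact neg_eq_zero.mp h.symm

/-- A cocycle all of whose coefficients are coboundaries comes from `X`. -/
theorem exists_isCob_sub_inR (hE : ∀ d, d ≠ 0 → C.Hom E F d = ⊥) (hX : X.IsTwisted) {k : ℤ}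
    {f : CMat C.Mor (single E) (twist hF X)} (hf : f ∈ degC (single E) (twist hF X) k)
    (hf0 : dif f = 0) (h : ∀ j, IsCob (k + 1) (coef hF e j f)) :
    ∃ q ∈ degC (single E) X k, dif q = 0 ∧ IsCob k (f - ract q (inR hF X)) := by
  choose z hz hzf using h
  have hz' : ∀ j, z j ∈ degC (single F) X k := fun j => by
    have := hz j
    rwa [add_sub_cancel_right] at this
  have hw : ∑ j, cnL hF (hat E F (e j)) (-z j) ∈ degC (single E) (twist hF X) (k - 1) :=
    Submodule.sum_mem _ fun j _ => cnL_mem hF (hat_mem (e j).2) (Submodule.neg_mem _ (hz' j))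
      (by ring)
  have hdw : dif (∑ j, cnL hF (hat E F (e j)) (-z j)) =
      ∑ j, cnL hF (hat E F (e j)) (coef hF e j f) +
        ract (∑ j, prod₂ (hat E F (e j)) (-z j)) (inR hF X) := by
    have h1 := dif_sum_cnL hF e (Φ := fun j => -z j) (l := k)
      (fun j => Submodule.neg_mem _ (hz' j)) 0
    have h2 : ∀ j, -dif (-z j) = coef hF e j f := fun j => by rw [dif_neg', neg_neg, hzf]
    rw [zero_ract, add_zero, dif_zero, add_zero] at h1
    simp only [h2] at h1
    exact h1
  have hq : ract f (prR hF X) - ∑ j, prod₂ (hat E F (e j)) (-z j) ∈ degC (single E) X k :=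
    Submodule.sub_mem _ (ract_prR_mem hF hf) (Submodule.sum_mem _ fun j _ =>
      prod₂_mem (hat_mem (e j).2) (Submodule.neg_mem _ (hz' j)) (zero_add k).symm)
  have hfw : f - ract (ract f (prR hF X) - ∑ j, prod₂ (hat E F (e j)) (-z j)) (inR hF X) =
      dif (∑ j, cnL hF (hat E F (e j)) (-z j)) := by
    have h1 := eq_sum_cnL hF e hE hf
    rw [hdw, sub_eq_iff_eq_add, sub_eq_add_neg, add_ract, neg_ract]
    nth_rw 1 [h1]
    abel
  refine ⟨_, hq, ?_, ⟨_, hw, hfw.symm⟩⟩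
  have h2 := congrArg dif hfw
  rw [dif_sub, hf0, dif_dif isTwisted_single (isTwisted_twist hF hX), zero_sub, neg_eq_zero,
    dif_ract_inR] at h2
  exact ract_inR_injective hF (h2.trans (zero_ract _).symm)

/-- A morphism to `X` that becomes a coboundary in the twist is a coboundary. -/
theorem isCob_of_inR (e : Module.Basis (Fin n) S (C.Hom E F 0)) (hE : ∀ d, d ≠ 0 → C.Hom E F d = ⊥) (hX : X.IsTwisted) {k : ℤ}
    (hk : ∀ y ∈ degC (single F) X k, dif y = 0 → IsCob k y)
    {q : CMat C.Mor (single E) X} (h : IsCob k (ract q (inR hF X))) : IsCob k q := by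
  obtain ⟨f, hf, hfq⟩ := h
  have h1 : ∀ j, dif (coef hF e j f) = 0 := fun j => by
    have h := dif_coef hF e hE hf j
    rw [hfq, coef, cf_inR] at h
    exact neg_eq_zero.mp h.symm
  have h2 := ract_prR_dif hF e hE hf
  rw [hfq, ract_inR_prR] at h2
  rw [h2]
  refine IsCob.add (IsCob.sum fun j _ => ?_) ⟨_, ract_prR_mem hF hf, rfl⟩
  obtain ⟨z, hz, hzj⟩ := hk _ (coef_mem hF e hE hf j (sub_add_cancel k 1).symm) (h1 j)
  exact ⟨prod₂ (hat E F (e j)) z, prod₂_mem (hat_mem (e j).2) hz (zero_add _).symm, by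
    rw [← hzj, prod₂_dif_hat hX (e j).2]⟩

/-! ### Morphisms from `E` to the tower -/

variable (θ : S ≃ₗ[S] C.Hom F F 1)

theorem psi_prod₂_cnL (u : C.Hom F E 1) (v : C.Hom E F 0) {l : ℤ} {Φ : CMat C.Mor (single F) X}
    (hΦ : Φ ∈ degC (single F) X l) :
    psi hF θ (prod₂ (hat F E u) (cnL hF (hat E F v) Φ)) = -(C.pair θ u v • Φ) := by
  rw [prod₂_cnL hF _ _ hΦ, psi_add, psi_inR, add_zero, prod₂_hat, psi, cf_cnL hF _ _ hΦ,
    coordXi_b, cmat_neg_smul]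

theorem psi_prod₂_inR (u : C.Mor) (q : CMat C.Mor (single E) X) :
    psi hF θ (prod₂ (hat F E u) (ract q (inR hF X))) = 0 := by
  rw [prod₂_ract_inR, psi_inR]

theorem psi_prod₂_hat (hE : ∀ d, d ≠ 0 → C.Hom E F d = ⊥) {k : ℤ}
    {f : CMat C.Mor (single E) (twist hF X)} (hf : f ∈ degC (single E) (twist hF X) k)
    (u : C.Hom F E 1) :
    psi hF θ (prod₂ (hat F E u) f) = -∑ j, C.pair θ u (e j) • coef hF e j f := by
  conv_lhs => rw [eq_sum_cnL hF e hE hf, prod₂_add_right, prod₂_sum_right]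
  rw [psi_add, psi_prod₂_inR, add_zero, psi, cf_sum, ← Finset.sum_neg_distrib]
  exact Finset.sum_congr rfl fun j _ => psi_prod₂_cnL hF θ u (e j) (coef_mem hF e hE hf j rfl)

theorem sy_succ (hE : ∀ d, d ≠ 0 → C.Hom E F d = ⊥) {i : ℕ}
    {f : CMat C.Mor (single E) (tower hF E (i + 1))}
    (hf : f ∈ degC (single E) (tower hF E (i + 1)) 0) (u : C.Hom F E 1) :
    (sy hF θ (i + 1) f u : C.Mor) =
      ∑ j, C.pair θ u (e j) • Psi hF E θ i (coef (X := tower hF E i) hF e j f) := by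
  rw [sy_apply hF θ hf]
  change -Psi hF E θ i (psi (X := tower hF E i) hF θ (prod₂ (hat F E u) f)) = _
  rw [psi_prod₂_hat (X := tower hF E i) hF e θ hE hf u, map_neg, neg_neg, map_sum]
  exact Finset.sum_congr rfl fun j _ => map_smul _ _ _

end PreTw

end MinimalAInfCat

end

noncomputable section

attribute [local instance] Classical.propDecidable

section EndAlgebra

variable {S : Type u} [CommRing S] {V L : Type u} [AddCommGroup V] [Module S V]
  [AddCommGroup L] [Module S L]

theorem trMul_tmul (a b : Module.End S V) (l : L) :
    trMul (a ⊗ₜ[S] l) b = LinearMap.trace S V (a * b) • l := rfl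

theorem trMul_contract [Module.Invertible S L] (g : Module.End S V ⊗[S] L)
    (h : Module.End S V ⊗[S] Module.Dual S L) (l : L) :
    trMul g (contract h l) = trPair g h • l := by
  induction h using TensorProduct.induction_on with
  | zero => simp [contract, trPair]
  | add h h' ih ih' =>
    have e : contract (h + h') l = contract h l + contract h' l := by simp [contract]
    have e' : trPair g (h + h') = trPair g h + trPair g h' := by simp [trPair]
    rw [e, e', map_add, ih, ih', add_smul]
  | tmul b φ =>
    have e : contract (b ⊗ₜ[S] φ) l = φ l • b := by simp [contract]
    have e' : trPair g (b ⊗ₜ[S] φ) = φ (trMul g b) := by simp [trPair]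
    have h2 : φ l • trMul g b = φ (trMul g b) • l := by
      have := congrArg (TensorProduct.lid S L ∘ φ.rTensor L)
        (Module.Invertible.tmul_comm (R := S) (m₁ := l) (m₂ := trMul g b))
      simpa using this
    rw [e, e', map_smul, h2]

theorem trMul_gDual [Module.Free S V] [Module.Finite S V] (g : Module.End S V ⊗[S] L)
    (a : Module.End S V) : trMul (gDual g) a.dualMap = trMul g a := by
  induction g using TensorProduct.induction_on with
  | zero => simp [gDual]
  | add g g' h h' =>
    have e : gDual (g + g') = gDual g + gDual g' := map_add _ _ _
    rw [e, map_add, map_add, LinearMap.add_apply, LinearMap.add_apply, h, h']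
  | tmul b l =>
    have e : gDual (b ⊗ₜ[S] l) = b.dualMap ⊗ₜ[S] l := rfl
    have e' : b.dualMap * a.dualMap = Module.Dual.transpose (R := S) (a * b) := rfl
    rw [e, trMul_tmul, trMul_tmul, e', LinearMap.trace_transpose', LinearMap.trace_mul_comm]

end EndAlgebra

namespace MinimalAInfCat

variable {S : Type u} [CommRing S] {C : MinimalAInfCat.{u, w} S} {E F : C.Obj}
  (θ : S ≃ₗ[S] C.Hom F F 1) {n : ℕ} (hF : C.IsOneSpherical F)
  (e : Module.Basis (Fin n) S (C.Hom E F 0))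

theorem pair_dualVec (i : Fin n) : C.pair θ (C.dualVec θ hF e i) = e.coord i :=
  (C.pairEquiv θ hF).apply_symm_apply (e.coord i)

theorem pair_dualVec_basis (i j : Fin n) :
    C.pair θ (C.dualVec θ hF e i) (e j) = if j = i then 1 else 0 := by
  rw [pair_dualVec, Module.Basis.coord_apply, e.repr_self, Finsupp.single_apply]

theorem pair_ext (θ : S ≃ₗ[S] C.Hom F F 1) (hF : C.IsOneSpherical F) {u u' : C.Hom F E 1} (h : ∀ v, C.pair θ u v = C.pair θ u' v) : u = u' :=
  (C.pair_bijective θ hF).1 (LinearMap.ext h)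

theorem sum_pair_smul_dualVec (u : C.Hom F E 1) :
    ∑ j, C.pair θ u (e j) • C.dualVec θ hF e j = u := by
  refine pair_ext θ hF fun v => ?_
  rw [map_sum, LinearMap.sum_apply]
  simp only [map_smul, LinearMap.smul_apply, pair_dualVec]
  conv_rhs => rw [← e.sum_repr v, map_sum]
  refine Finset.sum_congr rfl fun j _ => ?_
  rw [map_smul, Module.Basis.coord_apply, smul_eq_mul, smul_eq_mul, mul_comm]

theorem basis_pair_ext {v v' : C.Hom E F 0}
    (h : ∀ i, C.pair θ (C.dualVec θ hF e i) v = C.pair θ (C.dualVec θ hF e i) v') : v = v' := by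
  refine e.ext_elem fun i => ?_
  have := h i
  rwa [pair_dualVec] at this

/-- The transpose of an endomorphism of `Hom¹(F,E) ≅ V^∨`. -/
def transp : Module.End S (C.Hom F E 1) →ₗ[S] Module.End S (C.Hom E F 0) where
  toFun φ := ∑ j, (C.pair θ (φ (C.dualVec θ hF e j))).smulRight (e j)
  map_add' φ ψ := by
    rw [← Finset.sum_add_distrib]
    refine Finset.sum_congr rfl fun j _ => LinearMap.ext fun v => ?_
    simp [add_smul]
  map_smul' c φ := by
    rw [Finset.smul_sum]
    refine Finset.sum_congr rfl fun j _ => LinearMap.ext fun v => ?_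
    simp [mul_smul]

theorem pair_transp (φ : Module.End S (C.Hom F E 1)) (u : C.Hom F E 1) (v : C.Hom E F 0) :
    C.pair θ u (transp θ hF e φ v) = C.pair θ (φ u) v := by
  have h1 : transp θ hF e φ v = ∑ j, C.pair θ (φ (C.dualVec θ hF e j)) v • e j := by
    change (∑ j, (C.pair θ (φ (C.dualVec θ hF e j))).smulRight (e j)) v = _
    rw [LinearMap.sum_apply]
    rfl
  conv_rhs => rw [← sum_pair_smul_dualVec θ hF e u]
  rw [h1, map_sum, map_sum, map_sum, LinearMap.sum_apply]
  refine Finset.sum_congr rfl fun j _ => ?_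
  rw [map_smul, map_smul, map_smul, LinearMap.smul_apply, smul_eq_mul, smul_eq_mul, mul_comm]

theorem transp_mul (φ ψ : Module.End S (C.Hom F E 1)) :
    transp θ hF e (φ * ψ) = transp θ hF e ψ * transp θ hF e φ := by
  refine LinearMap.ext fun v => basis_pair_ext θ hF e fun i => ?_
  rw [pair_transp, Module.End.mul_apply, Module.End.mul_apply, pair_transp, pair_transp]

theorem transp_one : transp θ hF e 1 = 1 := by
  refine LinearMap.ext fun v => basis_pair_ext θ hF e fun i => ?_
  rw [pair_transp, Module.End.one_apply, Module.End.one_apply]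

/-- The transpose of an endomorphism of `V`, acting on `Hom¹(F,E) ≅ V^∨`. -/
def cotransp : Module.End S (C.Hom E F 0) →ₗ[S] Module.End S (C.Hom F E 1) where
  toFun a := (C.pairEquiv θ hF).symm.toLinearMap ∘ₗ a.dualMap ∘ₗ C.pair θ
  map_add' a b := by
    refine LinearMap.ext fun u => ?_
    simp only [LinearMap.comp_apply, LinearMap.add_apply, ← map_add]
    congr 1
    refine LinearMap.ext fun v => ?_
    simp
  map_smul' c a := by
    refine LinearMap.ext fun u => ?_
    simp only [LinearMap.comp_apply, LinearMap.smul_apply, ← map_smul, RingHom.id_apply]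
    congr 1
    refine LinearMap.ext fun v => ?_
    simp

theorem pair_cotransp (a : Module.End S (C.Hom E F 0)) (u : C.Hom F E 1) (v : C.Hom E F 0) :
    C.pair θ (cotransp θ hF a u) v = C.pair θ u (a v) := by
  have h : C.pair θ (cotransp θ hF a u) = a.dualMap (C.pair θ u) :=
    (C.pairEquiv θ hF).apply_symm_apply _
  rw [h, LinearMap.dualMap_apply]

theorem transp_cotransp (a : Module.End S (C.Hom E F 0)) :
    transp θ hF e (cotransp θ hF a) = a := by
  refine LinearMap.ext fun v => basis_pair_ext θ hF e fun i => ?_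
  rw [pair_transp, pair_cotransp]

theorem cotransp_transp (φ : Module.End S (C.Hom F E 1)) :
    cotransp θ hF (transp θ hF e φ) = φ := by
  refine LinearMap.ext fun u => pair_ext θ hF fun v => ?_
  rw [pair_cotransp, pair_transp]

theorem sum_basis_dualVec {M : Type*} [AddCommGroup M] [Module S M]
    (β : C.Hom E F 0 →ₗ[S] C.Hom F E 1 →ₗ[S] M) (a : Module.End S (C.Hom E F 0)) :
    ∑ j, β (a (e j)) (C.dualVec θ hF e j) = ∑ i, β (e i) (cotransp θ hF a (C.dualVec θ hF e i)) := by
  have h1 : ∀ i, cotransp θ hF a (C.dualVec θ hF e i) =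
      ∑ j, C.pair θ (C.dualVec θ hF e i) (a (e j)) • C.dualVec θ hF e j := fun i => by
    rw [← sum_pair_smul_dualVec θ hF e (cotransp θ hF a (C.dualVec θ hF e i))]
    simp only [pair_cotransp]
  have h2 : ∀ j, a (e j) = ∑ i, C.pair θ (C.dualVec θ hF e i) (a (e j)) • e i := fun j => by
    simp only [pair_dualVec]
    exact (e.sum_repr _).symm
  simp only [h1, map_sum, map_smul]
  rw [Finset.sum_comm]
  refine Finset.sum_congr rfl fun j _ => ?_
  conv_lhs => rw [h2 j, map_sum, LinearMap.sum_apply]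
  simp only [map_smul, LinearMap.smul_apply]

theorem trMul_gElt (a : Module.End S (C.Hom E F 0)) :
    trMul (C.gElt θ hF e) a =
      ∑ j, C.compHom E F E 0 1 1 (C.dualVec θ hF e j) (a (e j)) := by
  have : Module.Free S (C.Hom E F 0) := Module.Free.of_basis e
  have : Module.Finite S (C.Hom E F 0) := Module.Finite.of_basis e
  simp only [gElt, map_sum, LinearMap.sum_apply, trMul_tmul]
  refine Finset.sum_congr rfl fun i _ => ?_
  have h : ∀ j, (e.coord j).smulRight (e i) * a = (e.coord j ∘ₗ a).smulRight (e i) :=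
    fun j => rfl
  have h2 : a (e i) = ∑ j, e.coord j (a (e i)) • e j := (e.sum_repr _).symm
  conv_rhs => rw [h2, map_sum]
  refine Finset.sum_congr rfl fun j _ => ?_
  rw [h, map_smul, LinearMap.trace_eq_matrix_trace S e, Matrix.trace]
  congr 1
  rw [Finset.sum_eq_single i]
  · simp [LinearMap.toMatrix_apply, Matrix.vecMulVec_apply]
  · intro k _ hk
    simp [LinearMap.toMatrix_apply, Matrix.vecMulVec_apply, Finsupp.single_apply, hk.symm]
  · intro h
    exact absurd (Finset.mem_univ i) h

end MinimalAInfCat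

end

noncomputable section

attribute [local instance] Classical.propDecidable

namespace MinimalAInfCat

namespace PreTw

variable {S : Type u} [CommRing S] {C : MinimalAInfCat.{u, w} S} {F : C.Obj}
  (hF : C.IsOneSpherical F) {W X Y Z : C.PreTw}

/-! ### The morphisms from `E` to the tower, up to homotopy -/

variable {E : C.Obj} {n : ℕ} (θ : S ≃ₗ[S] C.Hom F F 1) (e : Module.Basis (Fin n) S (C.Hom E F 0))

/-- The morphism `v ⊗ u` from `E` to the summand `Hom¹(F,E) ⊗ F` of `T_F(E)`. -/
def cnB : C.Hom E F 0 →ₗ[S] C.Hom F E 1 →ₗ[S] CMat C.Mor (single E) (twist hF (single E)) :=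
  LinearMap.mk₂ S (fun v u => cnL hF (hat E F v) (hat F E u))
    (fun v v' u => by rw [Submodule.coe_add, hat_add, cnL_add_left])
    (fun c v u => by rw [Submodule.coe_smul, hat_smul, cnL_smul_left])
    (fun v u u' => by rw [Submodule.coe_add, hat_add, cnL_add_right])
    (fun c v u => by rw [Submodule.coe_smul, hat_smul, cnL_smul_right])

/-- The morphism `E → T_F(E)` given by an endomorphism of `V`. -/
def kap : Module.End S (C.Hom E F 0) →ₗ[S] CMat C.Mor (single E) (twist hF (single E)) where
  toFun a := ∑ j, cnB hF (a (e j)) (C.dualVec θ hF e j)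
  map_add' a b := by
    simp only [LinearMap.add_apply, map_add, Finset.sum_add_distrib]
  map_smul' c a := by
    simp only [LinearMap.smul_apply, map_smul, Finset.smul_sum, RingHom.id_apply]

theorem kap_apply (a : Module.End S (C.Hom E F 0)) :
    kap hF θ e a = ∑ j, cnL hF (hat E F (a (e j))) (hat F E (C.dualVec θ hF e j)) := rfl

theorem kap_eq (a : Module.End S (C.Hom E F 0)) :
    kap hF θ e a = ∑ j, cnL hF (hat E F (e j)) (hat F E (cotransp θ hF a (C.dualVec θ hF e j))) :=
  sum_basis_dualVec θ hF e (cnB hF) a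

theorem kap_mem (a : Module.End S (C.Hom E F 0)) :
    kap hF θ e a ∈ degC (single E) (twist hF (single E)) 0 :=
  Submodule.sum_mem _ fun j _ => cnL_mem hF (hat_mem (a (e j)).2) (hat_mem (C.dualVec θ hF e j).2)
    (by norm_num)

theorem compHom_eq_b (u : C.Hom F E 1) (v : C.Hom E F 0) :
    (C.compHom E F E 0 1 1 u v : C.Mor) =
      C.b (TensorAlgebra.ι S (v : C.Mor) * TensorAlgebra.ι S (u : C.Mor)) := by
  have h : C.m₂ (u : C.Mor) v ∈ C.Hom E E 1 := by
    have := C.m_mem 2 ![E, F, E] ![0, 1] ![(v : C.Mor), u] (by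
      intro i
      fin_cases i
      · exact v.2
      · exact u.2)
    simpa [m₂] using this
  rw [b_ι_mul_ι, C.sgn_of_mem v.2, sg_zero, one_smul]
  change ((C.proj E E 1 (C.m₂ u v) : C.Hom E E 1) : C.Mor) = _
  rw [C.proj_of_mem h]
  rfl

theorem sum_prod₂_hat (a : Module.End S (C.Hom E F 0)) :
    ∑ j, prod₂ (hat E F (a (e j))) (hat F E (C.dualVec θ hF e j)) =
      hat E E (trMul (C.gElt θ hF e) a : C.Hom E E 1) := by
  rw [trMul_gElt, AddSubmonoidClass.coe_finsetSum, hat_sum]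
  refine Finset.sum_congr rfl fun j _ => ?_
  rw [compHom_eq_b, prod₂_hat]

theorem dif_kap (a : Module.End S (C.Hom E F 0)) :
    dif (kap hF θ e a) =
      ract (hat E E (trMul (C.gElt θ hF e) a : C.Hom E E 1)) (inR hF (single E)) := by
  rw [kap_apply, dif_sum, ← sum_prod₂_hat hF θ e, sum_ract]
  refine Finset.sum_congr rfl fun j _ => ?_
  rw [dif_cnL hF (hat_mem (a (e j)).2) (hat_mem (C.dualVec θ hF e j).2), dif_single,
    cnL_zero_right, smul_zero, neg_zero, zero_add]

theorem sy_kap (hE : ∀ d, d ≠ 0 → C.Hom E F d = ⊥) (a : Module.End S (C.Hom E F 0)) :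
    sy (i := 1) hF θ (kap hF θ e a) = cotransp θ hF a := by
  refine LinearMap.ext fun u => Subtype.ext ?_
  rw [sy_succ hF e θ hE (i := 0) (kap_mem hF θ e a)]
  have h1 : ∀ j, coef (X := tower hF E 0) hF e j (kap hF θ e a) =
      hat F E (cotransp θ hF a (C.dualVec θ hF e j)) := fun j => by
    have := coef_sum_cnL hF e (X := single E) (l := 1)
      (Φ := fun j => hat F E (cotransp θ hF a (C.dualVec θ hF e j)))
      (fun j => hat_mem (cotransp θ hF a (C.dualVec θ hF e j)).2) 0 j
    rw [zero_ract, add_zero, ← kap_eq] at this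
    exact this
  have h2 : ∀ x : C.Mor, Psi hF E θ 0 (hat F E x) = x := fun x => unhat_hat x
  simp only [h1, h2]
  conv_rhs => rw [← sum_pair_smul_dualVec θ hF e u]
  rw [map_sum, AddSubmonoidClass.coe_finsetSum]
  refine Finset.sum_congr rfl fun j _ => ?_
  rw [map_smul]
  rfl

theorem trMul_transp_sy (hE : ∀ d, d ≠ 0 → C.Hom E F d = ⊥)
    {f : CMat C.Mor (single E) (tower hF E 1)}
    (hf : f ∈ degC (single E) (tower hF E 1) 0) (hf0 : dif f = 0) :
    trMul (C.gElt θ hF e) (transp θ hF e (sy hF θ 1 f)) = 0 := by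
  have hc : ∀ j, coef (X := single E) hF e j f =
      hat F E (cotransp θ hF (transp θ hF e (sy hF θ 1 f)) (C.dualVec θ hF e j)) := fun j => by
    rw [cotransp_transp, sy_succ hF e θ hE (i := 0) hf]
    simp only [pair_dualVec_basis, ite_smul, one_smul, zero_smul]
    rw [Finset.sum_ite_eq' Finset.univ j, if_pos (Finset.mem_univ j)]
    exact (hat_unhat (A := F) (B := E) _).symm
  have h := ract_prR_dif (X := single E) hF e hE hf
  have h0 : dif (X := single E) (Y := twist hF (single E)) f = 0 := hf0
  rw [h0, zero_ract, dif_single, add_zero] at h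
  simp only [hc] at h
  have h2 : ∑ j, prod₂ (hat E F (e j)) (hat F E
      (cotransp θ hF (transp θ hF e (sy hF θ 1 f)) (C.dualVec θ hF e j))) =
      hat E E (trMul (C.gElt θ hF e) (transp θ hF e (sy hF θ 1 f)) : C.Hom E E 1) := by
    rw [← sum_prod₂_hat hF θ e]
    exact (sum_basis_dualVec θ hF e (LinearMap.mk₂ S (fun v u => prod₂ (hat E F v) (hat F E u))
      (fun v v' u => by rw [Submodule.coe_add, hat_add, prod₂_add_left])
      (fun c v u => by rw [Submodule.coe_smul, hat_smul, prod₂_smul_left])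
      (fun v u u' => by rw [Submodule.coe_add, hat_add, prod₂_add_right])
      (fun c v u => by rw [Submodule.coe_smul, hat_smul, prod₂_smul_right])) _).symm
  rw [h2] at h
  have := congrArg (unhat E E) h
  rw [unhat_hat, map_zero] at this
  exact Subtype.ext this.symm

/-- The morphism `E → E_i → E_{i+1}`. -/
def stepT {i : ℕ} (q : CMat C.Mor (single E) (tower hF E i)) :
    CMat C.Mor (single E) (tower hF E (i + 1)) := ract q (inR hF (tower hF E i))

theorem IsCob.of_sub {k : ℤ} {f g : CMat C.Mor X Y} (h : IsCob k (f - g)) (hg : IsCob k g) :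
    IsCob k f := by
  have := h.add hg
  rwa [sub_add_cancel] at this

/-- The cocycles of degree `0` with vanishing symbol come from the preceding step. -/
theorem exists_isCob_sub_inR_of_sy (hE : ∀ d, d ≠ 0 → C.Hom E F d = ⊥)
    (e : Module.Basis (Fin n) S (C.Hom E F 0)) {i : ℕ}
    {f : CMat C.Mor (single E) (tower hF E (i + 1))}
    (hf : f ∈ degC (single E) (tower hF E (i + 1)) 0) (hf0 : dif f = 0) (h : sy hF θ (i + 1) f = 0) :
    ∃ q ∈ degC (single E) (tower hF E i) 0, dif q = 0 ∧
      IsCob 0 (f - stepT hF q) := by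
  refine exists_isCob_sub_inR (X := tower hF E i) hF e hE (isTwisted_tower hF i) hf hf0 fun j => ?_
  have hc := coef_mem (X := tower hF E i) hF e hE hf j rfl
  refine isCob_of_Psi hF θ i hc (dif_coef_eq_zero (X := tower hF E i) hF e hE hf hf0 j) ?_
  have h1 := sy_succ hF e θ hE hf (C.dualVec θ hF e j)
  simp only [pair_dualVec_basis, ite_smul, one_smul, zero_smul] at h1
  rw [Finset.sum_ite_eq' Finset.univ j, if_pos (Finset.mem_univ j), h] at h1
  exact h1.symm

theorem isCob_of_tower_inR (e : Module.Basis (Fin n) S (C.Hom E F 0))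
    (hE : ∀ d, d ≠ 0 → C.Hom E F d = ⊥) (θ : S ≃ₗ[S] C.Hom F F 1) {i : ℕ}
    {q : CMat C.Mor (single E) (tower hF E i)} (h : IsCob 0 (stepT hF q)) :
    IsCob 0 q :=
  isCob_of_inR hF e hE (isTwisted_tower hF i)
    (fun _ hy hy0 => isCob_of_ne_one hF hE θ zero_ne_one hy hy0) h

variable {h : Module.End S (C.Hom E F 0) ⊗[S] Module.Dual S (C.Hom E E 1)}

/-- The morphisms of nonzero degree from `E` to the tower vanish up to homotopy. -/
theorem isCob_of_ne_zero (hE : ∀ d, d ≠ 0 → C.Hom E F d = ⊥)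
    (hinv : Module.Invertible S (C.Hom E E 1)) (hEE : ∀ d, d ≠ 0 → d ≠ 1 → C.Hom E E d = ⊥)
    (hh : trPair (C.gElt θ hF e) h = 1) {k : ℤ} (hk : k ≠ 0) : ∀ (i : ℕ)
    {f : CMat C.Mor (single E) (tower hF E (i + 1))},
    f ∈ degC (single E) (tower hF E (i + 1)) k → dif f = 0 → IsCob k f := by
  intro i
  induction i with
  | zero =>
    intro f hf hf0
    obtain ⟨q, hq, hq0, hc⟩ := exists_isCob_sub_inR (X := single E) hF e hE isTwisted_single hf hf0
      fun j => isCob_of_ne_one (i := 0) hF hE θ (fun h => hk (by omega))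
        (coef_mem (X := single E) hF e hE hf j rfl)
        (dif_coef_eq_zero (X := single E) hF e hE hf hf0 j)
    have hx := unhat_mem hq
    have hq' : IsCob k (ract q (inR hF (single E))) := by
      by_cases h1 : k = 1
      · subst h1
        refine ⟨kap hF θ e (contract h ⟨_, hx⟩), ?_, ?_⟩
        · rw [sub_self]
          exact kap_mem hF θ e _
        · rw [dif_kap, trMul_contract, hh, one_smul, hat_unhat]
      · rw [hEE k hk h1] at hx
        have h2 := hat_unhat q
        rw [show unhat E E q = 0 from hx, hat_zero] at h2
        rw [← h2, zero_ract]
        exact IsCob.zero k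
    exact hc.of_sub hq'
  | succ i ih =>
    intro f hf hf0
    obtain ⟨q, hq, hq0, hc⟩ := exists_isCob_sub_inR (X := tower hF E (i + 1)) hF e hE
      (isTwisted_tower hF _) hf hf0
      fun j => isCob_of_ne_one (i := i + 1) hF hE θ (fun h => hk (by omega))
        (coef_mem (X := tower hF E (i + 1)) hF e hE hf j rfl)
        (dif_coef_eq_zero (X := tower hF E (i + 1)) hF e hE hf hf0 j)
    obtain ⟨p, hp, rfl⟩ := ih hq hq0
    exact hc.of_sub
      ⟨ract p (inR hF (tower hF E (i + 1))), ract_inR_mem hF hp, dif_ract_inR hF p⟩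

theorem exists_sy_eq (hE : ∀ d, d ≠ 0 → C.Hom E F d = ⊥)
    (hinv : Module.Invertible S (C.Hom E E 1)) (hEE : ∀ d, d ≠ 0 → d ≠ 1 → C.Hom E E d = ⊥)
    (hh : trPair (C.gElt θ hF e) h = 1) (i : ℕ) (φ : Module.End S (C.Hom F E 1)) :
    ∃ f ∈ degC (single E) (tower hF E (i + 2)) 0, dif f = 0 ∧ sy hF θ (i + 2) f = φ := by
  choose Φ hΦ hΦ0 hΦx using fun j =>
    exists_Psi_eq hF θ (E := E) (φ (C.dualVec θ hF e j)).2 (i + 1)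
  have hT := isTwisted_tower hF (E := E) (i + 1)
  have hs : ∑ j, prod₂ (hat E F (e j)) (Φ j) ∈ degC (single E) (tower hF E (i + 1)) 1 :=
    Submodule.sum_mem _ fun j _ => prod₂_mem (hat_mem (e j).2) (hΦ j) (by norm_num)
  obtain ⟨q, hq, hqs⟩ := isCob_of_ne_zero hF θ e hE hinv hEE hh one_ne_zero i hs (by
    rw [dif_sum]
    refine Finset.sum_eq_zero fun j _ => ?_
    rw [← prod₂_dif_hat hT (e j).2, hΦ0, prod₂_zero_right])
  rw [sub_self] at hq
  have hf : ∑ j, cnL hF (hat E F (e j)) (Φ j) + ract (-q) (inR hF (tower hF E (i + 1))) ∈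
      degC (single E) (tower hF E (i + 2)) 0 :=
    Submodule.add_mem _ (Submodule.sum_mem _ fun j _ =>
      cnL_mem hF (hat_mem (e j).2) (hΦ j) (by norm_num)) (ract_inR_mem hF (Submodule.neg_mem _ hq))
  refine ⟨_, hf, ?_, ?_⟩
  · refine (dif_sum_cnL hF e hΦ (-q)).trans ?_
    rw [dif_neg', hqs, add_neg_cancel, zero_ract, add_zero]
    refine Finset.sum_eq_zero fun j _ => ?_
    rw [hΦ0, neg_zero, cnL_zero_right]
  · refine LinearMap.ext fun u => Subtype.ext ?_
    rw [sy_succ hF e θ hE (i := i + 1) hf]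
    conv_rhs => rw [← sum_pair_smul_dualVec θ hF e u]
    rw [map_sum, AddSubmonoidClass.coe_finsetSum]
    refine Finset.sum_congr rfl fun j _ => ?_
    rw [map_smul, Submodule.coe_smul, ← hΦx]
    exact congrArg (fun z => C.pair θ u (e j) • Psi hF E θ (i + 1) z)
      (coef_sum_cnL hF e hΦ (-q) j)

/-- `Hom⁰(E,E) = S · id_E`. -/
theorem smul_id_bijective (hw : Nonempty (C.Hom E E 0 ≃ₗ[S] S)) :
    Function.Bijective (fun s : S => (s • ⟨C.id E, C.id_mem E⟩ : C.Hom E E 0)) := by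
  obtain ⟨w⟩ := hw
  have hx : ∀ x : C.Hom E E 0, x = w x • w.symm 1 := fun x => by
    rw [← map_smul, smul_eq_mul, mul_one, w.symm_apply_apply]
  set c := w ⟨C.id E, C.id_mem E⟩
  have hc : (⟨C.id E, C.id_mem E⟩ : C.Hom E E 0) = c • w.symm 1 := hx _
  have h1 : C.compHom E E E 0 0 0 ⟨C.id E, C.id_mem E⟩ (w.symm 1) = w.symm 1 := by
    change C.proj E E 0 (C.m 2 ![(w.symm 1 : C.Hom E E 0), C.id E]) = _
    rw [C.m_id E E 0 _ (w.symm 1).2, C.proj_of_mem (w.symm 1).2]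
  set d := w (C.compHom E E E 0 0 0 (w.symm 1) (w.symm 1))
  have hd : C.compHom E E E 0 0 0 (w.symm 1) (w.symm 1) = d • w.symm 1 := hx _
  rw [hc, map_smul, LinearMap.smul_apply, hd] at h1
  have hcd : c * d = 1 := by
    have := congrArg w h1
    simpa using this
  constructor
  · intro s s' hs
    have := congrArg w hs
    simp only [map_smul, smul_eq_mul] at this
    have h2 := congrArg (· * d) this
    simp only [mul_assoc] at h2
    change s * (c * d) = s' * (c * d) at h2
    simpa [hcd] using h2
  · intro x
    refine ⟨w x * d, ?_⟩
    change (w x * d) • (⟨C.id E, C.id_mem E⟩ : C.Hom E E 0) = x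
    rw [hc, smul_smul, mul_assoc, mul_comm d, hcd, mul_one, ← hx]

theorem sy_id (c : S) : sy hF θ (E := E) 0 (hat E E (c • C.id E)) = c • 1 := by
  refine LinearMap.ext fun u => Subtype.ext ?_
  refine (sy_apply (i := 0) hF θ (hat_mem (Submodule.smul_mem _ c (C.id_mem E))) u).trans ?_
  have h : prod₂ (hat F E u) (hat E E (C.id E)) = hat F E (-(u : C.Mor)) := by
    rw [prod₂_hat, b_ι_mul_ι, C.sgn_of_mem u.2, sg_one, neg_one_smul]
    congr 1
    exact C.m_id F E 1 _ (Submodule.neg_mem _ u.2)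
  have h2 : Psi hF E θ 0 (hat F E (-(u : C.Mor))) = -(u : C.Mor) := unhat_hat _
  have h3 : prod₂ (hat F E u) (hat E E (c • C.id E)) = c • hat F E (-(u : C.Mor)) := by
    rw [hat_smul, prod₂_smul_right, h]
  refine (congrArg (fun z => -Psi hF E θ 0 z) h3).trans ?_
  refine (congrArg Neg.neg (map_smul (Psi hF E θ 0) c _)).trans ?_
  refine (congrArg (fun z => -(c • z)) h2).trans ?_
  rw [smul_neg, neg_neg]
  rfl

end PreTw

end MinimalAInfCat

end

noncomputable section

attribute [local instance] Classical.propDecidable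

namespace MinimalAInfCat

namespace PreTw

variable {S : Type u} [CommRing S] {C : MinimalAInfCat.{u, w} S} {F : C.Obj}
  (hF : C.IsOneSpherical F) {W X Y Z : C.PreTw}

/-! ### The homotopy category of twisted complexes -/

theorem d_eq_dif (f : CMat C.Mor X Y) : (d X Y f : CMat C.Mor X Y) = dif f := by
  funext i j
  rw [dif, eps, lact_ldiag_apply]
  refine LinearMap.ext fun p => ?_
  exact (sg_smul_eq (S := S) (M := C.Mor ⊗[S] Y.P j) (X.deg i) _)

theorem comp_eq_prod₂ (f : CMat C.Mor X Y) (g : CMat C.Mor Y Z) :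
    (comp f g : CMat C.Mor X Z) = prod₂ f g := by
  funext i j
  rw [prod₂, eps, lact_ldiag_apply]
  refine LinearMap.ext fun p => ?_
  exact (sg_smul_eq (S := S) (M := C.Mor ⊗[S] Z.P j) (X.deg i) _)

theorem idMat_eq_one' : (idMat X : CMat C.Mor X X) = one' X := by
  funext i j
  rw [one', eps, lact_ldiag_apply]
  refine LinearMap.ext fun p => ?_
  exact (sg_smul_eq (S := S) (M := C.Mor ⊗[S] X.P j) (X.deg i) _)

theorem toTwist_eq_tmor : (toTwist hF X : CMat C.Mor X (twist hF X)) = tmor hF X := by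
  funext i q
  induction q using twist_cases hF with
  | hl q => exact (ract_inR_inl hF _ i q).symm
  | hr j => exact (congrFun (congrFun idMat_eq_one' i) j).trans (ract_inR_inr hF _ i j).symm

theorem mem_cocycles {k : ℤ} {f : CMat C.Mor X Y} (hf : f ∈ degC X Y k) (hf0 : dif f = 0) :
    (f : Mat X Y) ∈ cocycles X Y k :=
  ⟨hf, LinearMap.mem_ker.mpr ((d_eq_dif f).trans hf0)⟩

/-- The class of a cocycle. -/
def cls {k : ℤ} (f : CMat C.Mor X Y) (hf : f ∈ degC X Y k) (hf0 : dif f = 0) : HomH X Y k :=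
  Submodule.Quotient.mk ⟨f, mem_cocycles hf hf0⟩

theorem cls_eq_cls {k : ℤ} {f g : CMat C.Mor X Y} {hf : f ∈ degC X Y k} {hf0 : dif f = 0}
    {hg : g ∈ degC X Y k} {hg0 : dif g = 0} : cls f hf hf0 = cls g hg hg0 ↔ IsCob k (f - g) := by
  rw [cls, cls, Submodule.Quotient.eq]
  change (∃ z, z ∈ homDeg X Y (k - 1) ∧ d X Y z = (f - g : CMat C.Mor X Y)) ↔ _
  exact exists_congr fun z => and_congr Iff.rfl
    ⟨fun h => (d_eq_dif z).symm.trans h, fun h => (d_eq_dif z).trans h⟩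

theorem cls_congr {k : ℤ} {f g : CMat C.Mor X Y} {hf : f ∈ degC X Y k} {hf0 : dif f = 0}
    (h : f = g) : cls f hf hf0 = cls g (h ▸ hf) (h ▸ hf0) := by
  subst h
  rfl

theorem exists_cls {k : ℤ} (x : HomH X Y k) : ∃ f hf hf0, x = cls f hf hf0 := by
  obtain ⟨⟨f, hf, hf0⟩, rfl⟩ := Submodule.Quotient.mk_surjective _ x
  exact ⟨f, hf, (d_eq_dif f).symm.trans (LinearMap.mem_ker.mp hf0), rfl⟩

theorem represents_cls {k : ℤ} {f : CMat C.Mor X Y} {hf : f ∈ degC X Y k} {hf0 : dif f = 0} :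
    Represents (f : Mat X Y) (cls f hf hf0) := ⟨mem_cocycles hf hf0, rfl⟩

theorem Represents.exists_cls {k : ℤ} {f : CMat C.Mor X Y} {x : HomH X Y k}
    (h : Represents (f : Mat X Y) x) : ∃ hf hf0, x = cls f hf hf0 := by
  obtain ⟨hf, rfl⟩ := h
  exact ⟨hf.1, (d_eq_dif f).symm.trans (LinearMap.mem_ker.mp hf.2), rfl⟩

theorem dif_add_eq_zero {f g : CMat C.Mor X Y} (hf0 : dif f = 0) (hg0 : dif g = 0) :
    dif (f + g) = 0 := by
  rw [dif_add, hf0, hg0, add_zero]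

theorem dif_smul_eq_zero (c : S) {f : CMat C.Mor X Y} (hf0 : dif f = 0) : dif (c • f) = 0 := by
  rw [dif_smul, hf0, smul_zero]

theorem cls_eq_zero {k : ℤ} {f : CMat C.Mor X Y} {hf : f ∈ degC X Y k} {hf0 : dif f = 0} :
    cls f hf hf0 = 0 ↔ IsCob k f := by
  have h : (0 : HomH X Y k) = cls 0 (Submodule.zero_mem _) dif_zero := rfl
  rw [h, cls_eq_cls, sub_zero]

theorem smul_neg_one_eq (f : CMat C.Mor X Y) : sg S (0 - 1) • f = -f := by
  rw [sg_sub, sg_zero, sg_one, one_mul, cmat_neg_smul, one_smul]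

theorem dif_prod₂_eq_zero (hX : X.IsTwisted) (hY : Y.IsTwisted) (hZ : Z.IsTwisted)
    {f : CMat C.Mor X Y} (hf : f ∈ degC X Y 0) (hf0 : dif f = 0) {g : CMat C.Mor Y Z}
    (hg0 : dif g = 0) : dif (prod₂ f g) = 0 := by
  have h := dif_prod₂ hX hY hZ hf g
  rwa [hf0, hg0, prod₂_zero_left, prod₂_zero_right, smul_zero, add_zero, add_zero] at h

theorem IsCob.prod₂_left (hX : X.IsTwisted) (hY : Y.IsTwisted) (hZ : Z.IsTwisted)
    {f : CMat C.Mor X Y} (hf : IsCob 0 f) {g : CMat C.Mor Y Z} (hg : g ∈ degC Y Z 0)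
    (hg0 : dif g = 0) : IsCob 0 (prod₂ f g) := by
  obtain ⟨z, hz, rfl⟩ := hf
  have h := dif_prod₂ hX hY hZ hz g
  rw [hg0, prod₂_zero_right, smul_zero, add_zero] at h
  exact ⟨-prod₂ z g, Submodule.neg_mem _ (prod₂_mem hz hg (by norm_num)), by
    rw [dif_neg']
    exact (eq_neg_of_add_eq_zero_right h).symm⟩

theorem IsCob.prod₂_right (hX : X.IsTwisted) (hY : Y.IsTwisted) (hZ : Z.IsTwisted)
    {f : CMat C.Mor X Y} (hf : f ∈ degC X Y 0) (hf0 : dif f = 0) {g : CMat C.Mor Y Z}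
    (hg : IsCob 0 g) : IsCob 0 (prod₂ f g) := by
  obtain ⟨z, hz, rfl⟩ := hg
  have h := dif_prod₂ hX hY hZ hf z
  rw [hf0, prod₂_zero_left, add_zero, smul_neg_one_eq] at h
  exact ⟨prod₂ f z, prod₂_mem hf hz (by norm_num), by
    rw [eq_neg_of_add_eq_zero_left h, neg_neg]⟩

theorem isCob_prod₂_assoc (hW : W.IsTwisted) (hX : X.IsTwisted) (hY : Y.IsTwisted)
    (hZ : Z.IsTwisted) {f : CMat C.Mor W X} (hf : f ∈ degC W X 0) (hf0 : dif f = 0)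
    {g : CMat C.Mor X Y} (hg : g ∈ degC X Y 0) (hg0 : dif g = 0) {h : CMat C.Mor Y Z}
    (hh : h ∈ degC Y Z 0) (hh0 : dif h = 0) :
    IsCob 0 (prod₂ (prod₂ f g) h - prod₂ f (prod₂ g h)) := by
  have H := dif_prod₃ hW hX hY hZ hf hg h
  rw [hf0, hg0, hh0, prod₃_zero_left, prod₃_zero_mid, prod₃_zero_right, smul_zero, zero_add,
    zero_add, add_zero, smul_neg_one_eq] at H
  refine ⟨-prod₃ f g h, Submodule.neg_mem _ (prod₃_mem hf hg hh (by norm_num)), ?_⟩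
  rw [dif_neg', neg_eq_iff_add_eq_zero, ← H]
  abel

theorem tw_add (f g : CMat C.Mor X Y) : tw hF (f + g) = tw hF f + tw hF g := by
  rw [tw, twA, word₁_add, mulBy_add_right, mapC_add, coev_add, neg_add, twB, scal_add, lact_add,
    lact_add, add_ract, add_ract, tw, tw, twB, twB, twA, twA]
  abel

theorem tw_smul (c : S) (f : CMat C.Mor X Y) : tw hF (c • f) = c • tw hF f := by
  rw [tw, twA, word₁, mapC_smul, mulBy_smul_right, mulBy_smul_left, mulBy_smul_right, mapC_smul,
    coev_smul, ← smul_neg, twB, scal_smul, lact_smul, lact_smul, smul_ract, smul_ract, ← smul_add]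
  rfl

theorem tw_sub (f g : CMat C.Mor X Y) : tw hF (f - g) = tw hF f - tw hF g :=
  map_sub (⟨⟨tw hF, tw_add hF⟩, tw_smul hF⟩ :
    CMat C.Mor X Y →ₗ[S] CMat C.Mor (twist hF X) (twist hF Y)) f g

theorem IsCob.tw (hX : X.IsTwisted) (hY : Y.IsTwisted) {k : ℤ} {f : CMat C.Mor X Y}
    (hf : IsCob k f) : IsCob k (tw hF f) := by
  obtain ⟨z, hz, rfl⟩ := hf
  exact ⟨PreTw.tw hF z, tw_mem hF hz, dif_tw hF hX hY hz⟩

theorem dif_tw_eq_zero (hX : X.IsTwisted) (hY : Y.IsTwisted) {k : ℤ} {f : CMat C.Mor X Y}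
    (hf : f ∈ degC X Y k) (hf0 : dif f = 0) : dif (tw hF f) = 0 := by
  have h : tw hF (0 : CMat C.Mor X Y) = 0 := by
    have := tw_smul hF 0 (0 : CMat C.Mor X Y)
    rwa [zero_smul, zero_smul] at this
  rw [dif_tw hF hX hY hf, hf0, h]

theorem dif_ract_inR_eq_zero {f : CMat C.Mor X Y} (hf0 : dif f = 0) :
    dif (ract f (inR hF Y)) = 0 := by
  rw [dif_ract_inR, hf0, zero_ract]

end PreTw

open PreTw CategoryTheory

variable {S : Type u} [CommRing S]

/-- The twisted complexes. -/
structure TwC (C : MinimalAInfCat.{u, w} S) where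
  obj : C.PreTw
  isTwisted : obj.IsTwisted

variable {C : MinimalAInfCat.{u, w} S} {F : C.Obj}

namespace TwC

/-- The composition of morphisms in the homotopy category. -/
def compH {X Y Z : TwC C} (x : HomH X.obj Y.obj 0) (y : HomH Y.obj Z.obj 0) :
    HomH X.obj Z.obj 0 :=
  cls (prod₂ (exists_cls x).choose (exists_cls y).choose)
    (prod₂_mem (exists_cls x).choose_spec.choose (exists_cls y).choose_spec.choose (add_zero 0).symm)
    (dif_prod₂_eq_zero X.2 Y.2 Z.2 (exists_cls x).choose_spec.choose
      (exists_cls x).choose_spec.choose_spec.choose (exists_cls y).choose_spec.choose_spec.choose)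

theorem compH_cls {X Y Z : TwC C} {f : CMat C.Mor X.obj Y.obj} (hf : f ∈ degC X.obj Y.obj 0)
    (hf0 : dif f = 0) {g : CMat C.Mor Y.obj Z.obj} (hg : g ∈ degC Y.obj Z.obj 0)
    (hg0 : dif g = 0) : compH (cls f hf hf0) (cls g hg hg0) =
      cls (prod₂ f g) (prod₂_mem hf hg (add_zero 0).symm)
        (dif_prod₂_eq_zero X.2 Y.2 Z.2 hf hf0 hg0) := by
  obtain ⟨hf', hf0', ef⟩ := (exists_cls (cls f hf hf0)).choose_spec
  obtain ⟨hg', hg0', eg⟩ := (exists_cls (cls g hg hg0)).choose_spec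
  rw [compH, cls_eq_cls]
  generalize (exists_cls (cls f hf hf0)).choose = f' at *
  generalize (exists_cls (cls g hg hg0)).choose = g' at *
  have h1 := ((cls_eq_cls.mp ef).neg).prod₂_left X.2 Y.2 Z.2 hg' hg0'
  have h2 := ((cls_eq_cls.mp eg).neg).prod₂_right X.2 Y.2 Z.2 hf hf0
  rw [neg_sub, prod₂_sub_left] at h1
  rw [neg_sub, prod₂_sub_right] at h2
  have := h1.add h2
  rwa [sub_add_sub_cancel] at this

instance : Category.{u} (TwC C) where
  Hom X Y := HomH X.obj Y.obj 0
  id X := cls (one' X.obj) (one'_mem X.obj) (dif_one' X.obj)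
  comp := compH
  id_comp {X Y} x := by
    obtain ⟨f, hf, hf0, rfl⟩ := exists_cls x
    rw [compH_cls]
    exact cls_congr (prod₂_one'_left hf)
  comp_id {X Y} x := by
    obtain ⟨f, hf, hf0, rfl⟩ := exists_cls x
    rw [compH_cls]
    exact cls_congr ((prod₂_one'_right hf).trans (by rw [sg_zero, one_smul]))
  assoc {W X Y Z} x y z := by
    obtain ⟨f, hf, hf0, rfl⟩ := exists_cls x
    obtain ⟨g, hg, hg0, rfl⟩ := exists_cls y
    obtain ⟨h, hh, hh0, rfl⟩ := exists_cls z
    rw [compH_cls, compH_cls, compH_cls, compH_cls, cls_eq_cls]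
    exact isCob_prod₂_assoc W.2 X.2 Y.2 Z.2 hf hf0 hg hg0 hh hh0

/-- The morphism given by a cocycle. -/
def hom {X Y : TwC C} (f : CMat C.Mor X.obj Y.obj) (hf : f ∈ degC X.obj Y.obj 0)
    (hf0 : dif f = 0) : X ⟶ Y := cls f hf hf0

theorem exists_hom {X Y : TwC C} (x : X ⟶ Y) : ∃ f hf hf0, x = hom f hf hf0 := exists_cls x

theorem hom_eq_hom {X Y : TwC C} {f g : CMat C.Mor X.obj Y.obj} {hf : f ∈ degC X.obj Y.obj 0}
    {hf0 : dif f = 0} {hg : g ∈ degC X.obj Y.obj 0} {hg0 : dif g = 0} :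
    hom f hf hf0 = hom g hg hg0 ↔ IsCob 0 (f - g) := cls_eq_cls

theorem hom_congr {X Y : TwC C} {f g : CMat C.Mor X.obj Y.obj} {hf : f ∈ degC X.obj Y.obj 0}
    {hf0 : dif f = 0} (h : f = g) : hom f hf hf0 = hom g (h ▸ hf) (h ▸ hf0) := cls_congr h

theorem hom_comp_hom {X Y Z : TwC C} {f : CMat C.Mor X.obj Y.obj} (hf : f ∈ degC X.obj Y.obj 0)
    (hf0 : dif f = 0) {g : CMat C.Mor Y.obj Z.obj} (hg : g ∈ degC Y.obj Z.obj 0)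
    (hg0 : dif g = 0) : hom f hf hf0 ≫ hom g hg hg0 =
      hom (prod₂ f g) (prod₂_mem hf hg (add_zero 0).symm)
        (dif_prod₂_eq_zero X.2 Y.2 Z.2 hf hf0 hg0) := compH_cls hf hf0 hg hg0

instance : Preadditive (TwC C) where
  homGroup X Y := inferInstanceAs (AddCommGroup (HomH X.obj Y.obj 0))
  add_comp X Y Z x x' y := by
    obtain ⟨f, hf, hf0, rfl⟩ := exists_hom x
    obtain ⟨f', hf', hf0', rfl⟩ := exists_hom x'
    obtain ⟨g, hg, hg0, rfl⟩ := exists_hom y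
    rw [hom_comp_hom, hom_comp_hom]
    exact (hom_comp_hom (Submodule.add_mem _ hf hf') (dif_add_eq_zero hf0 hf0') hg hg0).trans
      (hom_congr (prod₂_add_left f f' g))
  comp_add X Y Z x y y' := by
    obtain ⟨f, hf, hf0, rfl⟩ := exists_hom x
    obtain ⟨g, hg, hg0, rfl⟩ := exists_hom y
    obtain ⟨g', hg', hg0', rfl⟩ := exists_hom y'
    rw [hom_comp_hom, hom_comp_hom]
    exact (hom_comp_hom hf hf0 (Submodule.add_mem _ hg hg') (dif_add_eq_zero hg0 hg0')).trans
      (hom_congr (prod₂_add_right f g g'))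

instance : Linear S (TwC C) where
  homModule X Y := inferInstanceAs (Module S (HomH X.obj Y.obj 0))
  smul_comp X Y Z c x y := by
    obtain ⟨f, hf, hf0, rfl⟩ := exists_hom x
    obtain ⟨g, hg, hg0, rfl⟩ := exists_hom y
    rw [hom_comp_hom]
    exact (hom_comp_hom (Submodule.smul_mem _ c hf) (dif_smul_eq_zero c hf0) hg hg0).trans
      (hom_congr (prod₂_smul_left c f g))
  comp_smul X Y Z x c y := by
    obtain ⟨f, hf, hf0, rfl⟩ := exists_hom x
    obtain ⟨g, hg, hg0, rfl⟩ := exists_hom y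
    rw [hom_comp_hom]
    exact (hom_comp_hom hf hf0 (Submodule.smul_mem _ c hg) (dif_smul_eq_zero c hg0)).trans
      (hom_congr (prod₂_smul_right c f g))

/-- The spherical twist of a twisted complex. -/
abbrev twistObj (hF : C.IsOneSpherical F) (X : TwC C) : TwC C :=
  ⟨twist hF X.obj, isTwisted_twist hF X.2⟩

/-- The spherical twist of a morphism in the homotopy category. -/
def twistH (hF : C.IsOneSpherical F) {X Y : TwC C} (x : X ⟶ Y) : twistObj hF X ⟶ twistObj hF Y :=
  hom (X := twistObj hF X) (Y := twistObj hF Y) (tw hF (exists_hom x).choose)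
    (tw_mem hF (exists_hom x).choose_spec.choose)
    (dif_tw_eq_zero hF X.2 Y.2 (exists_hom x).choose_spec.choose
      (exists_hom x).choose_spec.choose_spec.choose)

theorem twistH_hom (hF : C.IsOneSpherical F) {X Y : TwC C} {f : CMat C.Mor X.obj Y.obj}
    (hf : f ∈ degC X.obj Y.obj 0) (hf0 : dif f = 0) :
    twistH hF (hom f hf hf0) = hom (X := twistObj hF X) (Y := twistObj hF Y) (tw hF f)
      (tw_mem hF hf) (dif_tw_eq_zero hF X.2 Y.2 hf hf0) := by
  obtain ⟨hf', hf0', ef⟩ := (exists_hom (hom f hf hf0)).choose_spec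
  rw [twistH, hom_eq_hom]
  generalize (exists_hom (hom f hf hf0)).choose = f' at *
  have h := (hom_eq_hom.mp ef).neg.tw hF X.2 Y.2
  rwa [neg_sub, tw_sub] at h

theorem twistH_comp (hF : C.IsOneSpherical F) {X Y Z : TwC C} (x : X ⟶ Y) (y : Y ⟶ Z) :
    twistH hF (x ≫ y) = twistH hF x ≫ twistH hF y := by
  obtain ⟨f, hf, hf0, rfl⟩ := exists_hom x
  obtain ⟨g, hg, hg0, rfl⟩ := exists_hom y
  rw [hom_comp_hom, twistH_hom, twistH_hom, twistH_hom, hom_comp_hom, hom_eq_hom]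
  have h := prod₂_tw hF X.2 Y.2 Z.2 hf hf0 hg hg0
  have hm : twB hF (lmul (eps _) (twC hF f g)) 0 ∈
      degC (twist hF X.obj) (twist hF Z.obj) (0 - 1) :=
    twB_mem hF (by simpa using (isDegL_eps (X := homTw hF X.obj)).lmul (isDegL_twC hF hf hg))
      (Submodule.zero_mem _)
  refine ⟨-twB hF (lmul (eps _) (twC hF f g)) 0, Submodule.neg_mem _ hm, ?_⟩
  refine (dif_neg' _).trans (eq_sub_of_add_eq ?_)
  refine (congrArg _ h).trans ?_
  exact (add_comm _ _).trans (add_neg_cancel_right _ _)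

theorem twistH_add (hF : C.IsOneSpherical F) {X Y : TwC C} (x y : X ⟶ Y) :
    twistH hF (x + y) = twistH hF x + twistH hF y := by
  obtain ⟨f, hf, hf0, rfl⟩ := exists_hom x
  obtain ⟨g, hg, hg0, rfl⟩ := exists_hom y
  rw [twistH_hom, twistH_hom]
  exact (twistH_hom hF (Submodule.add_mem _ hf hg) (dif_add_eq_zero hf0 hg0)).trans
    (hom_congr (tw_add hF f g))

theorem twistH_smul (hF : C.IsOneSpherical F) {X Y : TwC C} (c : S) (x : X ⟶ Y) :
    twistH hF (c • x) = c • twistH hF x := by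
  obtain ⟨f, hf, hf0, rfl⟩ := exists_hom x
  rw [twistH_hom]
  exact (twistH_hom hF (Submodule.smul_mem _ c hf) (dif_smul_eq_zero c hf0)).trans
    (hom_congr (tw_smul hF c f))

/-- The canonical morphism `X → T_F(X)`. -/
def ηH (hF : C.IsOneSpherical F) (X : TwC C) : X ⟶ twistObj hF X :=
  hom (Y := twistObj hF X) (tmor hF X.obj) (tmor_mem hF) (dif_tmor hF)

theorem hom_comp_ηH (hF : C.IsOneSpherical F) {X Y : TwC C} {f : CMat C.Mor X.obj Y.obj}
    (hf : f ∈ degC X.obj Y.obj 0) (hf0 : dif f = 0) : hom f hf hf0 ≫ ηH hF Y =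
      hom (Y := twistObj hF Y) (ract f (inR hF Y.obj)) (ract_inR_mem hF hf)
        (dif_ract_inR_eq_zero hF hf0) := by
  have e : prod₂ f (tmor hF Y.obj) = ract f (inR hF Y.obj) := by
    rw [prod₂_tmor hF hf, sg_zero, one_smul]
  exact (hom_comp_hom (Z := twistObj hF Y) hf hf0 (tmor_mem hF) (dif_tmor hF)).trans (hom_congr e)

theorem ηH_naturality (hF : C.IsOneSpherical F) {X Y : TwC C} (x : X ⟶ Y) :
    x ≫ ηH hF Y = ηH hF X ≫ twistH hF x := by
  obtain ⟨f, hf, hf0, rfl⟩ := exists_hom x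
  rw [twistH_hom, hom_comp_ηH]
  have e : ract f (inR hF Y.obj) = prod₂ (tmor hF X.obj) (tw hF f) := (prod₂_tmor_tw hF hf).symm
  exact (hom_congr e).trans (hom_comp_hom (Y := twistObj hF X) (Z := twistObj hF Y)
    (tmor_mem hF) (dif_tmor hF) (tw_mem hF hf) (dif_tw_eq_zero hF X.2 Y.2 hf hf0)).symm

theorem twistH_ηH (hF : C.IsOneSpherical F) (X : TwC C) :
    twistH hF (ηH hF X) = ηH hF (twistObj hF X) := by
  rw [ηH, twistH_hom, ηH, hom_eq_hom]
  exact ⟨twB hF (tmorH hF) 0, twB_mem hF (isDegL_tmorH hF) (Submodule.zero_mem _),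
    eq_sub_of_add_eq' (tw_tmor hF).symm⟩

theorem twistH_id (hF : C.IsOneSpherical F) (X : TwC C) : twistH hF (𝟙 X) = 𝟙 (twistObj hF X) :=
  (twistH_hom hF (one'_mem X.obj) (dif_one' X.obj)).trans (hom_congr (tw_one' hF))

end TwC

end MinimalAInfCat

end

noncomputable section

attribute [local instance] Classical.propDecidable

namespace MinimalAInfCat

open PreTw CategoryTheory

namespace TwC

variable {S : Type u} [CommRing S] {C : MinimalAInfCat.{u, w} S} {F : C.Obj}

/-! ### The graded algebra of the tower -/

variable (hF : C.IsOneSpherical F) (E : C.Obj)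

/-- `E_i`, as an object of the homotopy category. -/
abbrev towerObj (i : ℕ) : TwC C := ⟨tower hF E i, isTwisted_tower hF i⟩

variable {E}

/-- `T_F^j(a) : E_j → E_{i+j}` for `a : E_0 → E_i`. -/
def twPH {i : ℕ} (a : towerObj hF E 0 ⟶ towerObj hF E i) :
    ∀ j, towerObj hF E j ⟶ towerObj hF E (i + j)
  | 0 => a
  | j + 1 => twistH hF (twPH a j)

theorem twistH_comp_eqToHom {X Y Z : TwC C} (x : X ⟶ Y) (h : Y = Z) :
    twistH hF (x ≫ eqToHom h) = twistH hF x ≫ eqToHom (congrArg (twistObj hF) h) := by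
  subst h
  rw [eqToHom_refl, eqToHom_refl, Category.comp_id, Category.comp_id]

theorem twPH_comp {i j : ℕ} (x : towerObj hF E 0 ⟶ towerObj hF E i)
    (y : towerObj hF E 0 ⟶ towerObj hF E j) : ∀ k, twPH hF (y ≫ twPH hF x j) k =
      (twPH hF y k ≫ twPH hF x (j + k)) ≫
        eqToHom (congrArg (towerObj hF E) (add_assoc i j k).symm)
  | 0 => (Category.comp_id _).symm
  | k + 1 => by
    have h : twPH hF (y ≫ twPH hF x j) (k + 1) = twistH hF (twPH hF (y ≫ twPH hF x j) k) := rfl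
    rw [h, twPH_comp x y k, twistH_comp_eqToHom, twistH_comp]
    rfl

theorem twPH_id : ∀ j, twPH hF (𝟙 (towerObj hF E 0)) j =
    eqToHom (congrArg (towerObj hF E) (zero_add j).symm)
  | 0 => rfl
  | j + 1 => by
    have h : twPH hF (𝟙 (towerObj hF E 0)) (j + 1) =
      twistH hF (𝟙 _ ≫ twPH hF (𝟙 (towerObj hF E 0)) j) := by
        rw [Category.id_comp]
        rfl
    rw [h, twPH_id j, twistH_comp_eqToHom, twistH_id]
    exact Category.id_comp _

variable (E) in
/-- The canonical morphism `E_i → E_{i+1}`. -/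
def ηT (i : ℕ) : towerObj hF E i ⟶ towerObj hF E (i + 1) := ηH hF (towerObj hF E i)

theorem twistH_ηT (i : ℕ) : twistH hF (ηT hF E i) = ηT hF E (i + 1) :=
  twistH_ηH hF (towerObj hF E i)

theorem twPH_ηT : ∀ j, twPH hF (ηT hF E 0) j =
    ηT hF E j ≫ eqToHom (congrArg (towerObj hF E) (add_comm j 1))
  | 0 => (Category.comp_id _).symm
  | j + 1 => by
    have h : twPH hF (ηT hF E 0) (j + 1) = twistH hF (twPH hF (ηT hF E 0) j) := rfl
    rw [h, twPH_ηT j, twistH_comp_eqToHom, twistH_ηT]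
    rfl

theorem twPH_add {i : ℕ} (x y : towerObj hF E 0 ⟶ towerObj hF E i) :
    ∀ j, twPH hF (x + y) j = twPH hF x j + twPH hF y j
  | 0 => rfl
  | j + 1 => (congrArg (twistH hF) (twPH_add x y j)).trans (twistH_add hF _ _)

theorem twPH_smul {i : ℕ} (c : S) (x : towerObj hF E 0 ⟶ towerObj hF E i) :
    ∀ j, twPH hF (c • x) j = c • twPH hF x j
  | 0 => rfl
  | j + 1 => (congrArg (twistH hF) (twPH_smul c x j)).trans (twistH_smul hF _ _)

variable (E)

/-- The components of the algebra, as morphisms of the homotopy category. -/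
abbrev RH (i : ℕ) : Type u := towerObj hF E 0 ⟶ towerObj hF E i

variable {E}

theorem gmk_comp_eqToHom {i j : ℕ} (h : i = j) (x : RH hF E i) :
    (⟨j, x ≫ eqToHom (congrArg (towerObj hF E) h)⟩ : GradedMonoid (RH hF E)) = ⟨i, x⟩ := by
  subst h
  rw [eqToHom_refl, Category.comp_id]

/-- The product `ab = T_F^j(a) ∘ b`. -/
def mulH {i j : ℕ} (x : RH hF E i) (y : RH hF E j) : RH hF E (i + j) := y ≫ twPH hF x j

theorem mulH_add {i j : ℕ} (x : RH hF E i) (y z : RH hF E j) :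
    mulH hF x (y + z) = mulH hF x y + mulH hF x z := Preadditive.add_comp _ _ _ _ _ _

theorem add_mulH {i j : ℕ} (x y : RH hF E i) (z : RH hF E j) :
    mulH hF (x + y) z = mulH hF x z + mulH hF y z := by
  rw [mulH, twPH_add]
  exact Preadditive.comp_add _ _ _ _ _ _

theorem mulH_smul {i j : ℕ} (c : S) (x : RH hF E i) (y : RH hF E j) :
    mulH hF x (c • y) = c • mulH hF x y := Linear.smul_comp _ _ _ _ _ _

theorem smul_mulH {i j : ℕ} (c : S) (x : RH hF E i) (y : RH hF E j) :
    mulH hF (c • x) y = c • mulH hF x y := by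
  rw [mulH, twPH_smul]
  exact Linear.comp_smul _ _ _ _ _ _

variable (E) in
/-- The unit of the graded algebra. -/
abbrev gOne : GradedMonoid.GOne (RH hF E) := ⟨𝟙 (towerObj hF E 0)⟩

variable (E) in
/-- The product of the graded algebra. -/
abbrev gMul : GradedMonoid.GMul (RH hF E) := ⟨mulH hF⟩

attribute [local instance] gOne gMul

variable (E) in
/-- The graded monoid `⊔ Hom⁰(E_0,E_i)`. -/
abbrev gMonoid : GradedMonoid.GMonoid (RH hF E) where
  one_mul := by
    rintro ⟨i, x⟩
    refine Eq.trans ?_ (gmk_comp_eqToHom hF (zero_add i).symm x)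
    exact congrArg (fun z => (⟨0 + i, x ≫ z⟩ : GradedMonoid (RH hF E))) (twPH_id hF i)
  mul_one := by
    rintro ⟨i, x⟩
    exact congrArg (fun z => (⟨i, z⟩ : GradedMonoid (RH hF E))) (Category.id_comp x)
  mul_assoc := by
    rintro ⟨i, x⟩ ⟨j, y⟩ ⟨k, z⟩
    refine Eq.trans ?_ (gmk_comp_eqToHom hF (add_assoc i j k).symm (mulH hF x (mulH hF y z)))
    refine congrArg (fun z => (⟨i + j + k, z⟩ : GradedMonoid (RH hF E))) ?_
    change z ≫ twPH hF (y ≫ twPH hF x j) k = _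
    rw [twPH_comp, mulH, mulH, Category.assoc, Category.assoc, Category.assoc]

theorem mulH_zero {i j : ℕ} (x : RH hF E i) : mulH hF x (0 : RH hF E j) = 0 := by
  have h := mulH_smul hF 0 x (0 : RH hF E j)
  rwa [zero_smul, zero_smul] at h

theorem zero_mulH {i j : ℕ} (x : RH hF E j) : mulH hF (0 : RH hF E i) x = 0 := by
  have h := smul_mulH hF 0 (0 : RH hF E i) x
  rwa [zero_smul, zero_smul] at h

variable (E)

/-- The graded ring `⊕ Hom⁰(E_0,E_i)`. -/
abbrev gRing : DirectSum.GRing (RH hF E) where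
  __ := gMonoid hF E
  mul_zero x := mulH_zero hF x
  zero_mul x := zero_mulH hF x
  mul_add x y z := mulH_add hF x y z
  add_mul x y z := add_mulH hF x y z
  natCast n := n • 𝟙 (towerObj hF E 0)
  natCast_zero := zero_smul _ _
  natCast_succ n := succ_nsmul _ n
  intCast n := n • 𝟙 (towerObj hF E 0)
  intCast_ofNat n := natCast_zsmul _ n
  intCast_negSucc_ofNat n := negSucc_zsmul _ n

/-- The element `t`. -/
def tH : RH hF E 1 := ηT hF E 0

variable {E}

theorem mulH_tH {i : ℕ} (x : RH hF E i) : mulH hF x (tH hF E) = x ≫ ηT hF E i :=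
  (ηH_naturality hF x).symm

theorem gmk_tH_mulH {j : ℕ} (x : RH hF E j) :
    (⟨1 + j, mulH hF (tH hF E) x⟩ : GradedMonoid (RH hF E)) = ⟨j + 1, mulH hF x (tH hF E)⟩ := by
  refine Eq.trans ?_ (gmk_comp_eqToHom hF (add_comm j 1) (mulH hF x (tH hF E)))
  refine congrArg (fun z => (⟨1 + j, z⟩ : GradedMonoid (RH hF E))) ?_
  rw [mulH_tH, mulH, tH, twPH_ηT, Category.assoc]

/-! ### Representatives -/

/-- The class of a cocycle. -/
abbrev homE {i : ℕ} (f : CMat C.Mor (single E) (tower hF E i))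
    (hf : f ∈ degC (single E) (tower hF E i) 0) (hf0 : dif f = 0) : RH hF E i :=
  hom (X := towerObj hF E 0) (Y := towerObj hF E i) f hf hf0

theorem exists_homE {i : ℕ} (x : RH hF E i) :
    ∃ (f : CMat C.Mor (single E) (tower hF E i)) (hf : f ∈ degC (single E) (tower hF E i) 0)
      (hf0 : dif f = 0), x = homE hF f hf hf0 := exists_hom x

theorem homE_eq_homE {i : ℕ} {f g : CMat C.Mor (single E) (tower hF E i)}
    {hf : f ∈ degC (single E) (tower hF E i) 0} {hf0 : dif f = 0}
    {hg : g ∈ degC (single E) (tower hF E i) 0} {hg0 : dif g = 0} :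
    homE hF f hf hf0 = homE hF g hg hg0 ↔ IsCob 0 (f - g) := cls_eq_cls

theorem homE_eq_zero {i : ℕ} {f : CMat C.Mor (single E) (tower hF E i)}
    {hf : f ∈ degC (single E) (tower hF E i) 0} {hf0 : dif f = 0} :
    homE hF f hf hf0 = 0 ↔ IsCob 0 f := cls_eq_zero

theorem twPH_homE {i : ℕ} {f : CMat C.Mor (single E) (tower hF E i)}
    (hf : f ∈ degC (single E) (tower hF E i) 0) (hf0 : dif f = 0) :
    ∀ j, twPH hF (homE hF f hf hf0) j = hom (X := towerObj hF E j) (Y := towerObj hF E (i + j))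
      (twP hF f j) (twP_mem hF hf j) (dif_twP hF hf hf0 j)
  | 0 => rfl
  | j + 1 => (congrArg (twistH hF) (twPH_homE hf hf0 j)).trans
    (twistH_hom (X := towerObj hF E j) (Y := towerObj hF E (i + j)) hF (twP_mem hF hf j)
      (dif_twP hF hf hf0 j))

theorem dif_prod₂_twP {i j : ℕ} {f : CMat C.Mor (single E) (tower hF E i)}
    (hf : f ∈ degC (single E) (tower hF E i) 0) (hf0 : dif f = 0)
    {g : CMat C.Mor (single E) (tower hF E j)} (hg : g ∈ degC (single E) (tower hF E j) 0)
    (hg0 : dif g = 0) : dif (prod₂ g (twP hF f j)) = 0 :=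
  dif_prod₂_eq_zero isTwisted_single (isTwisted_tower hF j) (isTwisted_tower hF (i + j)) hg hg0
    (dif_twP hF hf hf0 j)

theorem mulH_homE {i j : ℕ} {f : CMat C.Mor (single E) (tower hF E i)}
    (hf : f ∈ degC (single E) (tower hF E i) 0) (hf0 : dif f = 0)
    {g : CMat C.Mor (single E) (tower hF E j)} (hg : g ∈ degC (single E) (tower hF E j) 0)
    (hg0 : dif g = 0) : mulH hF (homE hF f hf hf0) (homE hF g hg hg0) =
      homE hF (prod₂ g (twP hF f j)) (prod₂_mem hg (twP_mem hF hf j) (add_zero 0).symm)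
        (dif_prod₂_twP hF hf hf0 hg hg0) := by
  rw [mulH, twPH_homE]
  exact hom_comp_hom (X := towerObj hF E 0) hg hg0 (twP_mem hF hf j) (dif_twP hF hf hf0 j)

theorem dif_stepT {i : ℕ} {f : CMat C.Mor (single E) (tower hF E i)} (hf0 : dif f = 0) :
    dif (stepT hF f) = 0 := dif_ract_inR_eq_zero hF hf0

theorem stepT_mem {i : ℕ} {f : CMat C.Mor (single E) (tower hF E i)} {k : ℤ}
    (hf : f ∈ degC (single E) (tower hF E i) k) :
    stepT hF f ∈ degC (single E) (tower hF E (i + 1)) k := ract_inR_mem hF hf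

theorem mulH_homE_tH {i : ℕ} {f : CMat C.Mor (single E) (tower hF E i)}
    (hf : f ∈ degC (single E) (tower hF E i) 0) (hf0 : dif f = 0) :
    mulH hF (homE hF f hf hf0) (tH hF E) = homE hF (stepT hF f) (stepT_mem hF hf)
      (dif_stepT hF hf0) := by
  rw [mulH_tH]
  exact hom_comp_ηH (X := towerObj hF E 0) hF hf hf0

theorem twistPow_eq_twP {i : ℕ} (a : CMat C.Mor (single E) (tower hF E i)) :
    ∀ j, (twistPow hF a j : CMat C.Mor (tower hF E j) (tower hF E (i + j))) = twP hF a j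
  | 0 => rfl
  | j + 1 => by
    refine (twistMap_eq_tw hF (X := tower hF E j) (Y := tower hF E (i + j))
      (twistPow hF a j)).trans ?_
    exact congrArg (tw hF) (twistPow_eq_twP a j)

theorem mulMat_eq {i j : ℕ} (a : CMat C.Mor (single E) (tower hF E i))
    (b : CMat C.Mor (single E) (tower hF E j)) :
    (mulMat hF a b : CMat C.Mor (single E) (tower hF E (i + j))) = prod₂ b (twP hF a j) := by
  rw [← twistPow_eq_twP]
  exact comp_eq_prod₂ (Y := tower hF E j) b (twistPow hF a j)

theorem represents_mulH {i j : ℕ} {a : Mat (tower hF E 0) (tower hF E i)}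
    {b : Mat (tower hF E 0) (tower hF E j)} {x : RH hF E i} {y : RH hF E j}
    (ha : Represents (k := 0) a x) (hb : Represents (k := 0) b y) :
    Represents (k := 0) (mulMat hF a b) (mulH hF x y) := by
  obtain ⟨ha', ha0, rfl⟩ := Represents.exists_cls ha
  obtain ⟨hb', hb0, rfl⟩ := Represents.exists_cls hb
  have h := mulH_homE hF ha' ha0 hb' hb0
  have h2 : Represents (X := tower hF E 0) (Y := tower hF E (i + j)) (k := 0)
      (prod₂ b (twP hF a j)) (mulH hF (homE hF a ha' ha0) (homE hF b hb' hb0)) := by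
    rw [h]
    exact represents_cls
  have e : ∀ {f g : Mat (tower hF E 0) (tower hF E (i + j))} {x : R hF E (i + j)}, f = g →
      Represents f x → Represents g x := fun h hf => h ▸ hf
  exact e (mulMat_eq hF a b).symm h2

end TwC

end MinimalAInfCat

end

noncomputable section

attribute [local instance] Classical.propDecidable

/-! ### Graded algebras with a central regular element of degree one -/

open Polynomial (monomial)

/-- A graded algebra with a central regular element `t` of degree one, and with a map from it onto
`E(V,g)^op` whose kernel is generated by `t`. -/
structure SymbolData {S : Type u} [CommRing S] {V L : Type u} [AddCommGroup V] [Module S V]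
    [AddCommGroup L] [Module S L] (g : Module.End S V ⊗[S] L) (R : ℕ → Type u)
    [∀ i, AddCommGroup (R i)] [∀ i, Module S (R i)] [DirectSum.GRing R] where
  t : R 1
  smul_mul : ∀ {i j} (c : S) (x : R i) (y : R j),
    GradedMonoid.GMul.mul (c • x) y = c • (GradedMonoid.GMul.mul x y : R (i + j))
  mul_smul : ∀ {i j} (c : S) (x : R i) (y : R j),
    GradedMonoid.GMul.mul x (c • y) = c • (GradedMonoid.GMul.mul x y : R (i + j))
  t_mul : ∀ {i} (x : R i), (⟨1 + i, GradedMonoid.GMul.mul t x⟩ : GradedMonoid R) =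
    ⟨i + 1, GradedMonoid.GMul.mul x t⟩
  eq_zero_of_mul_t : ∀ {i} (x : R i), (GradedMonoid.GMul.mul x t : R (i + 1)) = 0 → x = 0
  σ : ∀ i, R i →ₗ[S] Module.End S V
  σ_one : σ 0 GradedMonoid.GOne.one = 1
  σ_mul : ∀ {i j} (x : R i) (y : R j), σ (i + j) (GradedMonoid.GMul.mul x y) = σ j y * σ i x
  σ_eq_zero : ∀ {i} (x : R (i + 1)), σ (i + 1) x = 0 ↔ ∃ y : R i, x = GradedMonoid.GMul.mul y t
  σ_zero_injective : Function.Injective (σ 0)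
  σ_zero : ∀ x, ∃ s : S, σ 0 x = algebraMap S _ s
  σ_one_range : ∀ a, (∃ x, σ 1 x = a) ↔ a ∈ EndG g
  σ_surjective : ∀ i, Function.Surjective (σ (i + 2))

namespace SymbolData

variable {S : Type u} [CommRing S] {V L : Type u} [AddCommGroup V] [Module S V]
  [AddCommGroup L] [Module S L] {g : Module.End S V ⊗[S] L} {R : ℕ → Type u}
  [∀ i, AddCommGroup (R i)] [∀ i, Module S (R i)] [DirectSum.GRing R] (D : SymbolData g R)

theorem smul_of (c : S) {i : ℕ} (x : R i) :
    c • DirectSum.of R i x = DirectSum.of R i (c • x) := (map_smul (DirectSum.lof S ℕ R i) c x).symm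

theorem smul_mul_assoc' (D : SymbolData g R) (c : S) (x y : ⨁ i, R i) : c • x * y = c • (x * y) := by
  induction x using DirectSum.induction_on with
  | zero => rw [smul_zero, zero_mul, smul_zero]
  | add x x' h h' => rw [smul_add, add_mul, add_mul, smul_add, h, h']
  | of i x =>
    induction y using DirectSum.induction_on with
    | zero => rw [mul_zero, mul_zero, smul_zero]
    | add y y' h h' => rw [mul_add, mul_add, smul_add, h, h']
    | of j y =>
      rw [smul_of, DirectSum.of_mul_of, DirectSum.of_mul_of, D.smul_mul, smul_of]

theorem mul_smul_comm' (D : SymbolData g R) (c : S) (x y : ⨁ i, R i) : x * c • y = c • (x * y) := by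
  induction x using DirectSum.induction_on with
  | zero => rw [zero_mul, zero_mul, smul_zero]
  | add x x' h h' => rw [add_mul, add_mul, smul_add, h, h']
  | of i x =>
    induction y using DirectSum.induction_on with
    | zero => rw [smul_zero, mul_zero, smul_zero]
    | add y y' h h' => rw [smul_add, mul_add, mul_add, smul_add, h, h']
    | of j y =>
      rw [smul_of, DirectSum.of_mul_of, DirectSum.of_mul_of, D.mul_smul, smul_of]

/-- The algebra structure. -/
abbrev algebra : Algebra S (⨁ i, R i) := Algebra.ofModule D.smul_mul_assoc' D.mul_smul_comm'

/-- The element `t` of the direct sum. -/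
def τ : ⨁ i, R i := DirectSum.of R 1 D.t

theorem of_mul_τ {i : ℕ} (x : R i) : DirectSum.of R i x * D.τ =
    DirectSum.of R (i + 1) (GradedMonoid.GMul.mul x D.t) := DirectSum.of_mul_of _ _

theorem τ_mul (x : ⨁ i, R i) : D.τ * x = x * D.τ := by
  induction x using DirectSum.induction_on with
  | zero => rw [zero_mul, mul_zero]
  | add x x' h h' => rw [mul_add, add_mul, h, h']
  | of i x =>
    rw [of_mul_τ, τ, DirectSum.of_mul_of]
    exact DirectSum.of_eq_of_gradedMonoid_eq (D.t_mul x)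

theorem mul_τ_zero (x : ⨁ i, R i) : (x * D.τ) 0 = 0 := by
  induction x using DirectSum.induction_on with
  | zero => rw [zero_mul, DirectSum.zero_apply]
  | add x x' h h' => rw [add_mul, DirectSum.add_apply, h, h', add_zero]
  | of i x =>
    rw [of_mul_τ]
    exact DirectSum.of_eq_of_ne _ _ _ (by omega)

theorem mul_τ_succ (x : ⨁ i, R i) (k : ℕ) :
    (x * D.τ) (k + 1) = GradedMonoid.GMul.mul (x k) D.t := by
  induction x using DirectSum.induction_on with
  | zero =>
    rw [zero_mul, DirectSum.zero_apply, DirectSum.zero_apply]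
    exact (DirectSum.GNonUnitalNonAssocSemiring.zero_mul _).symm
  | add x x' h h' =>
    rw [add_mul, DirectSum.add_apply, DirectSum.add_apply, h, h']
    exact (DirectSum.GNonUnitalNonAssocSemiring.add_mul _ _ _).symm
  | of i x =>
    rw [of_mul_τ]
    by_cases h : k = i
    · subst h
      rw [DirectSum.of_eq_same, DirectSum.of_eq_same]
    · rw [DirectSum.of_eq_of_ne _ _ _ (by omega), DirectSum.of_eq_of_ne _ _ _ h]
      exact (DirectSum.GNonUnitalNonAssocSemiring.zero_mul _).symm

theorem eq_zero_of_of_eq {i : ℕ} {x : R i} {z : ⨁ i, R i}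
    (h : DirectSum.of R i x = z * (D.τ - 1)) : x = 0 := by
  have hz : ∀ k, DirectSum.of R i x (k + 1) = GradedMonoid.GMul.mul (z k) D.t - z (k + 1) :=
    fun k => by rw [h, mul_sub, mul_one, DirectSum.sub_apply, mul_τ_succ]
  have hz0 : DirectSum.of R i x 0 = -z 0 := by
    rw [h, mul_sub, mul_one, DirectSum.sub_apply, mul_τ_zero, zero_sub]
  have hlow : ∀ k, k < i → z k = 0 := by
    intro k
    induction k with
    | zero =>
      intro hk
      rw [DirectSum.of_eq_of_ne _ _ _ (by omega)] at hz0
      exact neg_eq_zero.mp hz0.symm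
    | succ k ih =>
      intro hk
      have h1 := hz k
      rw [DirectSum.of_eq_of_ne _ _ _ (by omega), ih (by omega)] at h1
      have h2 : (GradedMonoid.GMul.mul (0 : R k) D.t : R (k + 1)) = 0 :=
        DirectSum.GNonUnitalNonAssocSemiring.zero_mul _
      rw [h2, zero_sub] at h1
      exact neg_eq_zero.mp h1.symm
  have hi : x = -z i := by
    cases i with
    | zero => rwa [DirectSum.of_eq_same] at hz0
    | succ i =>
      have h1 := hz i
      have h2 : (GradedMonoid.GMul.mul (0 : R i) D.t : R (i + 1)) = 0 :=
        DirectSum.GNonUnitalNonAssocSemiring.zero_mul _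
      rwa [DirectSum.of_eq_same, hlow i (by omega), h2, zero_sub] at h1
  obtain ⟨N, hN⟩ : ∃ N, ∀ k, N ≤ k → z k = 0 := by
    refine ⟨(DFinsupp.support z).sup id + 1, fun k hk => ?_⟩
    by_contra hne
    have := Finset.le_sup (f := id) (DFinsupp.mem_support_iff.mpr hne)
    simp only [id] at this
    omega
  have hdown : ∀ m k, i ≤ k → N ≤ k + m → z k = 0 := by
    intro m
    induction m with
    | zero => exact fun k _ hk => hN k hk
    | succ m ih =>
      intro k hk hm
      have h1 := hz k
      rw [DirectSum.of_eq_of_ne _ _ _ (by omega), ih (k + 1) (by omega) (by omega), sub_zero] at h1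
      exact D.eq_zero_of_mul_t _ h1.symm
  rw [hi, hdown N i le_rfl (by omega), neg_zero]

/-- The left ideal generated by `t - 1`. -/
def ideal : Ideal (⨁ i, R i) := Ideal.span {D.τ - 1}

theorem mem_ideal {x : ⨁ i, R i} : x ∈ D.ideal ↔ ∃ z, x = z * (D.τ - 1) := by
  rw [ideal, Ideal.mem_span_singleton']
  exact exists_congr fun z => eq_comm

instance : D.ideal.IsTwoSided where
  mul_mem_of_left {a} b ha := by
    obtain ⟨z, rfl⟩ := D.mem_ideal.mp ha
    refine D.mem_ideal.mpr ⟨z * b, ?_⟩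
    have h : (D.τ - 1) * b = b * (D.τ - 1) := by rw [sub_mul, mul_sub, τ_mul, one_mul, mul_one]
    rw [mul_assoc, h, mul_assoc]

/-- The specialization `t = 1`. -/
abbrev Quo : Type u := (⨁ i, R i) ⧸ D.ideal

/-- The algebra structure of the specialization. -/
abbrev quoAlgebra : Algebra S D.Quo :=
  letI := D.algebra
  inferInstance

/-- The map from the components to the specialization. -/
def π (i : ℕ) : letI := D.quoAlgebra; R i →ₗ[S] D.Quo :=
  letI := D.algebra
  letI := D.quoAlgebra
  (Ideal.Quotient.mkₐ S D.ideal).toLinearMap ∘ₗ DirectSum.lof S ℕ R i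

theorem π_apply {i : ℕ} (x : R i) : D.π i x = Ideal.Quotient.mk D.ideal (DirectSum.of R i x) := rfl

theorem π_injective (i : ℕ) : Function.Injective (D.π i) := by
  letI := D.quoAlgebra
  refine (injective_iff_map_eq_zero (D.π i)).mpr fun x hx => ?_
  rw [π_apply, Ideal.Quotient.eq_zero_iff_mem] at hx
  obtain ⟨z, hz⟩ := D.mem_ideal.mp hx
  exact D.eq_zero_of_of_eq hz

theorem π_mul {i j : ℕ} (x : R i) (y : R j) :
    D.π (i + j) (GradedMonoid.GMul.mul x y) = D.π i x * D.π j y := by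
  rw [π_apply, π_apply, π_apply, ← map_mul, DirectSum.of_mul_of]

theorem π_t : D.π 1 D.t = 1 := by
  rw [π_apply, ← map_one (Ideal.Quotient.mk D.ideal), Ideal.Quotient.eq]
  exact D.mem_ideal.mpr ⟨1, (one_mul _).symm⟩

theorem π_one : D.π 0 GradedMonoid.GOne.one = 1 := rfl

theorem π_mul_t {i : ℕ} (x : R i) : D.π (i + 1) (GradedMonoid.GMul.mul x D.t) = D.π i x := by
  rw [π_mul, π_t, mul_one]

/-- The filtered algebra with the given Rees algebra. -/
def filtered : FilteredAlg S :=
  letI := D.quoAlgebra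
  { A := D.Quo
    fil := fun i => LinearMap.range (D.π i)
    mono := monotone_nat_of_le_succ fun i => by
      rintro _ ⟨x, rfl⟩
      exact ⟨_, D.π_mul_t x⟩
    one_mem := ⟨_, D.π_one⟩
    mul_mem := by
      rintro i j _ _ ⟨x, rfl⟩ ⟨y, rfl⟩
      exact ⟨_, D.π_mul x y⟩
    exhaustive := by
      have hm : Monotone fun i => LinearMap.range (D.π i) := monotone_nat_of_le_succ fun i => by
        rintro _ ⟨x, rfl⟩
        exact ⟨_, D.π_mul_t x⟩
      intro x
      obtain ⟨x, rfl⟩ := Ideal.Quotient.mk_surjective x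
      induction x using DirectSum.induction_on with
      | zero => exact ⟨0, 0, by rw [map_zero, map_zero]⟩
      | of i x => exact ⟨i, x, rfl⟩
      | add x y hx hy =>
        obtain ⟨i, hi⟩ := hx
        obtain ⟨j, hj⟩ := hy
        refine ⟨max i j, ?_⟩
        rw [map_add]
        exact Submodule.add_mem _ (hm (le_max_left i j) hi) (hm (le_max_right i j) hj) }

/-- The components of the filtration. -/
def filEquiv (i : ℕ) : R i ≃ₗ[S] D.filtered.fil i :=
  letI := D.quoAlgebra
  LinearEquiv.ofInjective (D.π i) (D.π_injective i)

theorem filEquiv_mul {i j : ℕ} (x : R i) (y : R j) :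
    (D.filEquiv (i + j) (GradedMonoid.GMul.mul x y) : D.filtered.A) =
      D.filEquiv i x * D.filEquiv j y := D.π_mul x y

theorem filEquiv_t : (D.filEquiv 1 D.t : D.filtered.A) = 1 := D.π_t

theorem filEquiv_mul_t {i : ℕ} (x : R i) :
    (D.filEquiv (i + 1) (GradedMonoid.GMul.mul x D.t) : D.filtered.A) = D.filEquiv i x :=
  D.π_mul_t x

theorem monomial_mem_rees {A : FilteredAlg S} {i : ℕ} (y : A.fil i) :
    monomial i (y : A.A) ∈ A.rees := by
  intro k
  rw [Polynomial.coeff_monomial]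
  split_ifs with h
  · subst h
    exact y.2
  · exact Submodule.zero_mem _

/-- The map to the Rees algebra. -/
def toRees : (⨁ i, R i) →+* D.filtered.rees :=
  DirectSum.toSemiring
    (fun i =>
      { toFun := fun x => ⟨monomial i (D.filEquiv i x : D.filtered.A), monomial_mem_rees _⟩
        map_zero' := Subtype.ext (by rw [map_zero]; exact map_zero _)
        map_add' := fun x y => Subtype.ext (by rw [map_add]; exact map_add _ _ _) })
    (Subtype.ext rfl)
    (fun x y => Subtype.ext (by
      change monomial _ _ = monomial _ _ * monomial _ _
      rw [filEquiv_mul, Polynomial.monomial_mul_monomial]))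

theorem toRees_of {i : ℕ} (x : R i) : (D.toRees (DirectSum.of R i x) : Polynomial D.filtered.A) =
    monomial i (D.filEquiv i x : D.filtered.A) :=
  congrArg Subtype.val (DirectSum.toSemiring_of _ _ _ i x)

theorem coeff_toRees (x : ⨁ i, R i) (k : ℕ) :
    (D.toRees x : Polynomial D.filtered.A).coeff k = D.filEquiv k (x k) := by
  induction x using DirectSum.induction_on with
  | zero =>
    rw [map_zero, DirectSum.zero_apply, map_zero]
    rfl
  | add x y hx hy =>
    rw [map_add, DirectSum.add_apply, map_add, Submodule.coe_add, ← hx, ← hy]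
    rfl
  | of i x =>
    rw [toRees_of, Polynomial.coeff_monomial]
    split_ifs with h
    · subst h
      rw [DirectSum.of_eq_same]
    · rw [DirectSum.of_eq_of_ne _ _ _ (Ne.symm h), map_zero]
      rfl

theorem toRees_bijective : Function.Bijective D.toRees := by
  constructor
  · refine (injective_iff_map_eq_zero D.toRees).mpr fun x hx => DFinsupp.ext fun k => ?_
    have h := D.coeff_toRees x k
    rw [hx] at h
    exact (D.filEquiv k).map_eq_zero_iff.mp (Subtype.ext h.symm)
  · rintro ⟨p, hp⟩
    refine ⟨∑ i ∈ p.support, DirectSum.of R i ((D.filEquiv i).symm ⟨p.coeff i, hp i⟩),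
      Subtype.ext ?_⟩
    rw [map_sum, AddSubmonoidClass.coe_finsetSum]
    refine Eq.trans ?_ p.as_sum_support.symm
    refine Finset.sum_congr rfl fun i _ => ?_
    rw [toRees_of, LinearEquiv.apply_symm_apply]

/-- The symbol on the associated graded algebra. -/
def grσ (i : ℕ) : D.filtered.Gr i →ₗ[S] Module.End S V :=
  ((D.filtered.filPred i).submoduleOf (D.filtered.fil i)).liftQ
    (D.σ i ∘ₗ (D.filEquiv i).symm.toLinearMap) (by
      intro y hy
      obtain ⟨x, rfl⟩ := (D.filEquiv i).surjective y
      rw [LinearMap.mem_ker, LinearMap.comp_apply, LinearEquiv.coe_coe,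
        LinearEquiv.symm_apply_apply]
      cases i with
      | zero =>
        have h : (D.filEquiv 0 x : D.filtered.A) = 0 := hy
        rw [(D.filEquiv 0).map_eq_zero_iff.mp (Subtype.ext h), map_zero]
      | succ i =>
        obtain ⟨z, hz⟩ : (D.filEquiv (i + 1) x : D.filtered.A) ∈ D.filtered.fil i := hy
        refine (D.σ_eq_zero x).mpr ⟨z, (D.filEquiv (i + 1)).injective (Subtype.ext ?_)⟩
        rw [filEquiv_mul_t]
        exact hz.symm)

theorem grσ_symb {i : ℕ} (x : R i) : D.grσ i (D.filtered.symb (D.filEquiv i x)) = D.σ i x := by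
  change D.σ i ((D.filEquiv i).symm (D.filEquiv i x)) = _
  rw [LinearEquiv.symm_apply_apply]

theorem exists_symb {i : ℕ} (y : D.filtered.Gr i) :
    ∃ x : R i, y = D.filtered.symb (D.filEquiv i x) := by
  obtain ⟨y, rfl⟩ := D.filtered.symb_surjective y
  exact ⟨(D.filEquiv i).symm y, by rw [LinearEquiv.apply_symm_apply]⟩

theorem eq_zero_of_grσ {i : ℕ} {y : D.filtered.Gr i} (h : D.grσ i y = 0) : y = 0 := by
  obtain ⟨x, rfl⟩ := D.exists_symb y
  rw [grσ_symb] at h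
  refine (Submodule.Quotient.mk_eq_zero _).mpr ?_
  cases i with
  | zero =>
    have hx : x = 0 := D.σ_zero_injective (h.trans (map_zero _).symm)
    rw [hx, map_zero]
    exact Submodule.zero_mem _
  | succ i =>
    obtain ⟨z, hz⟩ := (D.σ_eq_zero x).mp h
    change (D.filEquiv (i + 1) x : D.filtered.A) ∈ D.filtered.fil i
    rw [hz, filEquiv_mul_t]
    exact ⟨z, rfl⟩

theorem monomial_σ_mem {i : ℕ} (x : R i) : monomial i (D.σ i x) ∈ EAlg g := by
  refine ⟨?_, ?_⟩
  · rw [Polynomial.coeff_monomial]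
    split_ifs with h
    · subst h
      exact D.σ_zero x
    · exact ⟨0, (map_zero _).symm⟩
  · rw [Polynomial.coeff_monomial]
    split_ifs with h
    · subst h
      exact (D.σ_one_range _).mp ⟨x, rfl⟩
    · exact Submodule.zero_mem _

theorem monomial_grσ_mem {i : ℕ} (y : D.filtered.Gr i) : monomial i (D.grσ i y) ∈ EAlg g := by
  obtain ⟨x, rfl⟩ := D.exists_symb y
  rw [grσ_symb]
  exact D.monomial_σ_mem x

/-- The map from the associated graded algebra to `E(V,g)^op`. -/
def toEAlg : (⨁ i, D.filtered.Gr i) →+* (EAlg g)ᵐᵒᵖ :=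
  DirectSum.toSemiring
    (fun i =>
      { toFun := fun y => MulOpposite.op ⟨monomial i (D.grσ i y), D.monomial_grσ_mem y⟩
        map_zero' := MulOpposite.unop_injective (Subtype.ext (by
          change monomial i (D.grσ i 0) = 0
          rw [map_zero, map_zero]))
        map_add' := fun x y => MulOpposite.unop_injective (Subtype.ext (by
          change monomial i (D.grσ i (x + y)) = monomial i (D.grσ i x) + monomial i (D.grσ i y)
          rw [map_add, map_add])) })
    (MulOpposite.unop_injective (Subtype.ext (by
      change monomial 0 (D.grσ 0 (D.filtered.symb (D.filEquiv 0 GradedMonoid.GOne.one))) = 1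
      rw [grσ_symb, σ_one]
      rfl)))
    (fun {i j} x y => MulOpposite.unop_injective (Subtype.ext (by
      obtain ⟨x, rfl⟩ := D.exists_symb x
      obtain ⟨y, rfl⟩ := D.exists_symb y
      change monomial (i + j) (D.grσ (i + j) (D.filtered.grMul _ _)) =
        monomial j (D.grσ j _) * monomial i (D.grσ i _)
      rw [FilteredAlg.grMul_symb, grσ_symb, grσ_symb, Polynomial.monomial_mul_monomial,
        ← D.σ_mul, add_comm j i, ← D.grσ_symb]
      congr 3
      exact Subtype.ext (D.filEquiv_mul x y).symm)))

theorem toEAlg_of {i : ℕ} (y : D.filtered.Gr i) :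
    ((D.toEAlg (DirectSum.of D.filtered.Gr i y)).unop : Polynomial (Module.End S V)) =
      monomial i (D.grσ i y) :=
  congrArg (fun z : (EAlg g)ᵐᵒᵖ => (z.unop : Polynomial (Module.End S V)))
    (DirectSum.toSemiring_of _ _ _ i y)

theorem coeff_toEAlg (x : ⨁ i, D.filtered.Gr i) (k : ℕ) :
    ((D.toEAlg x).unop : Polynomial (Module.End S V)).coeff k = D.grσ k (x k) := by
  induction x using DirectSum.induction_on with
  | zero =>
    rw [map_zero, DirectSum.zero_apply, map_zero]
    rfl
  | add x y hx hy =>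
    rw [map_add, DirectSum.add_apply, map_add, ← hx, ← hy]
    rfl
  | of i x =>
    rw [toEAlg_of, Polynomial.coeff_monomial]
    split_ifs with h
    · subst h
      rw [DirectSum.of_eq_same]
    · rw [DirectSum.of_eq_of_ne _ _ _ (Ne.symm h), map_zero]

theorem exists_σ_eq_coeff {p : Polynomial (Module.End S V)} (hp : p ∈ EAlg g) :
    ∀ k, ∃ x : R k, D.σ k x = p.coeff k
  | 0 => by
    obtain ⟨s, hs⟩ := hp.1
    refine ⟨s • GradedMonoid.GOne.one, ?_⟩
    rw [map_smul, σ_one, hs, Algebra.algebraMap_eq_smul_one]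
  | 1 => (D.σ_one_range _).mpr hp.2
  | k + 2 => D.σ_surjective k _

theorem toEAlg_bijective : Function.Bijective D.toEAlg := by
  constructor
  · refine (injective_iff_map_eq_zero D.toEAlg).mpr fun x hx => DFinsupp.ext fun k => ?_
    have h := D.coeff_toEAlg x k
    rw [hx] at h
    exact D.eq_zero_of_grσ h.symm
  · intro q
    obtain ⟨⟨p, hp⟩, rfl⟩ := MulOpposite.op_surjective q
    choose x hx using D.exists_σ_eq_coeff hp
    refine ⟨∑ i ∈ p.support, DirectSum.of D.filtered.Gr i (D.filtered.symb (D.filEquiv i (x i))),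
      MulOpposite.unop_injective (Subtype.ext ?_)⟩
    refine (map_sum (((EAlg g).val : EAlg g →+ Polynomial (Module.End S V)).comp
      (MulOpposite.opAddEquiv.symm.toAddMonoidHom.comp D.toEAlg.toAddMonoidHom)) _ _).trans ?_
    refine Eq.trans ?_ p.as_sum_support.symm
    refine Finset.sum_congr rfl fun i _ => ?_
    refine (D.toEAlg_of _).trans ?_
    rw [grσ_symb, hx]

/-- The isomorphism with the Rees algebra. -/
def reesEquiv : (⨁ i, R i) ≃+* D.filtered.rees := RingEquiv.ofBijective D.toRees D.toRees_bijective

/-- The isomorphism of the associated graded algebra with `E(V,g)^op`. -/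
def grEquiv : (⨁ i, D.filtered.Gr i) ≃+* (EAlg g)ᵐᵒᵖ :=
  RingEquiv.ofBijective D.toEAlg D.toEAlg_bijective

theorem reesEquiv_smul (s : S) (x : ⨁ i, R i) : D.reesEquiv (s • x) = s • D.reesEquiv x := by
  refine Subtype.ext (Polynomial.ext fun k => ?_)
  refine (D.coeff_toRees (s • x) k).trans ?_
  rw [DirectSum.smul_apply, map_smul]
  exact congrArg (s • ·) (D.coeff_toRees x k).symm

theorem grEquiv_smul (s : S) (x : ⨁ i, D.filtered.Gr i) :
    D.grEquiv (s • x) = s • D.grEquiv x := by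
  refine MulOpposite.unop_injective (Subtype.ext (Polynomial.ext fun k => ?_))
  refine (D.coeff_toEAlg (s • x) k).trans ?_
  rw [DirectSum.smul_apply, map_smul]
  exact congrArg (s • ·) (D.coeff_toEAlg x k).symm

theorem reesEquiv_of {i : ℕ} (x : R i) :
    (D.reesEquiv (DirectSum.of R i x) : Polynomial D.filtered.A) =
      monomial i (D.filEquiv i x : D.filtered.A) := D.toRees_of x

theorem reesEquiv_t :
    (D.reesEquiv (DirectSum.of R 1 D.t) : Polynomial D.filtered.A) = Polynomial.X := by
  rw [reesEquiv_of, filEquiv_t]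
  rfl

theorem grEquiv_of {i : ℕ} (y : D.filtered.Gr i) :
    ((D.grEquiv (DirectSum.of D.filtered.Gr i y)).unop : Polynomial (Module.End S V)) =
      monomial i (D.grσ i y) := D.toEAlg_of y

theorem grEquiv_symb {i : ℕ} (x : R i) (y : D.filtered.fil i)
    (h : (D.reesEquiv (DirectSum.of R i x) : Polynomial D.filtered.A) =
      monomial i (y : D.filtered.A)) :
    ((D.grEquiv (DirectSum.of D.filtered.Gr i (D.filtered.symb y))).unop :
      Polynomial (Module.End S V)) = monomial i (D.σ i x) := by
  have hy : D.filEquiv i x = y := by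
    rw [reesEquiv_of] at h
    exact Subtype.ext (Polynomial.monomial_injective i h)
  rw [grEquiv_of, ← hy, grσ_symb]

end SymbolData

/-! ### Transposition -/

section Transpose

variable {S : Type u} [CommRing S] {V L : Type u} [AddCommGroup V] [Module S V]
  [AddCommGroup L] [Module S L]

/-- Transposition of endomorphisms of a finite free module. -/
def dualEnd [Module.Free S V] [Module.Finite S V] :
    (Module.End S V)ᵐᵒᵖ ≃ₐ[S] Module.End S (Module.Dual S V) :=
  AlgEquiv.ofBijective
    (AlgHom.ofLinearMap
      ((Module.Dual.transpose (R := S) (M := V) (M' := V)).comp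
        (MulOpposite.opLinearEquiv S).symm.toLinearMap) rfl
      fun a b => rfl) (by
    constructor
    · refine (injective_iff_map_eq_zero _).mpr fun a ha => MulOpposite.unop_injective ?_
      refine LinearMap.ext fun v => (Module.forall_dual_apply_eq_zero_iff S _).mp fun φ => ?_
      exact LinearMap.congr_fun (LinearMap.congr_fun ha φ) v
    · intro φ
      refine ⟨MulOpposite.op ((Module.evalEquiv S V).symm.toLinearMap ∘ₗ φ.dualMap ∘ₗ
        (Module.evalEquiv S V).toLinearMap), LinearMap.ext fun ψ => LinearMap.ext fun v => ?_⟩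
      change ψ ((Module.evalEquiv S V).symm (φ.dualMap (Module.evalEquiv S V v))) = φ ψ v
      rw [Module.apply_evalEquiv_symm_apply]
      rfl)

theorem dualMap_algebraMap (s : S) :
    (algebraMap S (Module.End S V) s).dualMap = algebraMap S (Module.End S (Module.Dual S V)) s := by
  refine LinearMap.ext fun φ => LinearMap.ext fun v => ?_
  simp [Module.algebraMap_end_apply]

variable [Module.Free S V] [Module.Finite S V]

/-- Transposition of the coefficients of polynomials. -/
def polyDual : (Polynomial (Module.End S V))ᵐᵒᵖ ≃+*
    Polynomial (Module.End S (Module.Dual S V)) :=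
  (Polynomial.opRingEquiv (Module.End S V)).trans
    (Polynomial.mapEquiv (dualEnd (S := S) (V := V)).toRingEquiv)

theorem coeff_polyDual (p : Polynomial (Module.End S V)) (k : ℕ) :
    (polyDual (MulOpposite.op p)).coeff k = (p.coeff k).dualMap := by
  refine (Polynomial.coeff_map _ k).trans ?_
  exact congrArg (dualEnd (S := S) (V := V)).toRingEquiv
    (Polynomial.coeff_opRingEquiv (MulOpposite.op p) k)

theorem polyDual_mem (g : Module.End S V ⊗[S] L) {p : Polynomial (Module.End S V)}  :
    polyDual (MulOpposite.op p) ∈ EAlg (gDual g) ↔ p ∈ EAlg g := by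
  refine and_congr (exists_congr fun s => ?_) ?_
  · rw [coeff_polyDual, ← dualMap_algebraMap]
    refine ⟨fun h => ?_, fun h => by rw [h]⟩
    exact MulOpposite.op_injective (dualEnd.injective h)
  · rw [coeff_polyDual, EndG, EndG, LinearMap.mem_ker, LinearMap.mem_ker, trMul_gDual]

/-- Transposition of coefficients, `E(V,g)^op ≅ E(V^∨,g^*)`. -/
def eAlgDual (g : Module.End S V ⊗[S] L) : (EAlg g)ᵐᵒᵖ ≃ₐ[S] EAlg (gDual g) :=
  AlgEquiv.ofBijective
    { toFun := fun p => ⟨polyDual (MulOpposite.op (p.unop : Polynomial (Module.End S V))),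
        (polyDual_mem g).mpr p.unop.2⟩
      map_one' := Subtype.ext (map_one polyDual)
      map_mul' := fun p q => Subtype.ext (map_mul polyDual (MulOpposite.op (p.unop : Polynomial (Module.End S V))) (MulOpposite.op (q.unop : Polynomial (Module.End S V))))
      map_zero' := Subtype.ext (map_zero polyDual)
      map_add' := fun p q => Subtype.ext (map_add polyDual (MulOpposite.op (p.unop : Polynomial (Module.End S V))) (MulOpposite.op (q.unop : Polynomial (Module.End S V))))
      commutes' := fun s => Subtype.ext (Polynomial.ext fun k => by
        refine (coeff_polyDual _ k).trans ?_
        change ((algebraMap S (Polynomial (Module.End S V)) s).coeff k).dualMap =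
          (algebraMap S (Polynomial (Module.End S (Module.Dual S V))) s).coeff k
        rw [Polynomial.algebraMap_apply, Polynomial.algebraMap_apply, Polynomial.coeff_C,
          Polynomial.coeff_C]
        split_ifs
        · exact dualMap_algebraMap s
        · exact LinearMap.ext fun φ => LinearMap.ext fun v => map_zero φ) }
    (by
      constructor
      · intro p q h
        exact MulOpposite.unop_injective (Subtype.ext (MulOpposite.op_injective
          (polyDual.injective (congrArg Subtype.val h))))
      · rintro ⟨q, hq⟩
        obtain ⟨p, rfl⟩ := polyDual.surjective q
        exact ⟨MulOpposite.op ⟨p.unop, (polyDual_mem g).mp hq⟩, rfl⟩)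

theorem coeff_eAlgDual (g : Module.End S V ⊗[S] L) (p : EAlg g) (k : ℕ) :
    (eAlgDual g (MulOpposite.op p) : Polynomial (Module.End S (Module.Dual S V))).coeff k =
      ((p : Polynomial (Module.End S V)).coeff k).dualMap := coeff_polyDual _ k

end Transpose

end

noncomputable section

attribute [local instance] Classical.propDecidable

namespace MinimalAInfCat

namespace PreTw

variable {S : Type u} [CommRing S] {C : MinimalAInfCat.{u, w} S} {F : C.Obj}
  (hF : C.IsOneSpherical F) {W X Y Z : C.PreTw}

variable {E : C.Obj} (θ : S ≃ₗ[S] C.Hom F F 1)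

theorem sy_add {i : ℕ} (a b : CMat C.Mor (single E) (tower hF E i)) :
    sy hF θ i (a + b) = sy hF θ i a + sy hF θ i b := by
  refine LinearMap.ext fun u => ?_
  change -C.proj F E 1 (Psi hF E θ i (prod₂ (hat F E u) (a + b))) = -_ + -_
  rw [prod₂_add_right, map_add, map_add, neg_add]

theorem sy_smul {i : ℕ} (c : S) (a : CMat C.Mor (single E) (tower hF E i)) :
    sy hF θ i (c • a) = c • sy hF θ i a := by
  refine LinearMap.ext fun u => ?_
  change -C.proj F E 1 (Psi hF E θ i (prod₂ (hat F E u) (c • a))) = c • -_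
  rw [prod₂_smul_right, map_smul, map_smul, smul_neg]

theorem sy_neg {i : ℕ} (a : CMat C.Mor (single E) (tower hF E i)) :
    sy hF θ i (-a) = -sy hF θ i a := by
  refine LinearMap.ext fun u => ?_
  change -C.proj F E 1 (Psi hF E θ i (prod₂ (hat F E u) (-a))) = - -_
  rw [prod₂_neg_right, map_neg, map_neg]

theorem sy_eq_of_isCob {i : ℕ} {a b : CMat C.Mor (single E) (tower hF E i)}
    (ha : a ∈ degC (single E) (tower hF E i) 0) (hb : b ∈ degC (single E) (tower hF E i) 0)
    (h : IsCob 0 (a - b)) : sy hF θ i a = sy hF θ i b := by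
  have h1 := sy_eq_zero_of_isCob hF θ (Submodule.sub_mem _ ha hb) h
  rw [sub_eq_add_neg, sy_add, sy_neg, ← sub_eq_add_neg, sub_eq_zero] at h1
  exact h1

theorem sy_stepT {i : ℕ} {q : CMat C.Mor (single E) (tower hF E i)}
    (hq : q ∈ degC (single E) (tower hF E i) 0) : sy hF θ (i + 1) (stepT hF q) = 0 := by
  refine LinearMap.ext fun u => Subtype.ext ?_
  rw [sy_apply hF θ (ract_inR_mem hF hq)]
  have h := psi_prod₂_inR (X := tower hF E i) hF θ (u : C.Mor) q
  refine (congrArg (fun z => -Psi hF E θ i z) h).trans ?_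
  rw [map_zero]
  exact neg_zero

end PreTw

open PreTw CategoryTheory

namespace TwC

attribute [local instance] gRing

variable {S : Type u} [CommRing S] {C : MinimalAInfCat.{u, w} S} {E F : C.Obj}
  (hF : C.IsOneSpherical F) {n : ℕ} (θ : S ≃ₗ[S] C.Hom F F 1)
  (e : Module.Basis (Fin n) S (C.Hom E F 0))

/-! ### The symbols -/

/-- The symbol of a class. -/
def symbFun (i : ℕ) (x : RH hF E i) : Module.End S (C.Hom E F 0) :=
  (-1 : S) ^ i • transp θ hF e (sy hF θ i (exists_homE hF x).choose)

theorem symbFun_homE {i : ℕ} {f : CMat C.Mor (single E) (tower hF E i)}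
    (hf : f ∈ degC (single E) (tower hF E i) 0) (hf0 : dif f = 0) :
    symbFun hF θ e i (homE hF f hf hf0) = (-1 : S) ^ i • transp θ hF e (sy hF θ i f) := by
  obtain ⟨hg, hg0, h⟩ := (exists_homE hF (homE hF f hf hf0)).choose_spec
  rw [symbFun, ← sy_eq_of_isCob hF θ hf hg ((homE_eq_homE hF).mp h)]

/-- The symbol, as a linear map. -/
def symbMap (i : ℕ) : RH hF E i →ₗ[S] Module.End S (C.Hom E F 0) where
  toFun := symbFun hF θ e i
  map_add' x y := by
    obtain ⟨f, hf, hf0, rfl⟩ := exists_homE hF x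
    obtain ⟨g, hg, hg0, rfl⟩ := exists_homE hF y
    have h : homE hF f hf hf0 + homE hF g hg hg0 =
      homE hF (f + g) (Submodule.add_mem _ hf hg) (dif_add_eq_zero hf0 hg0) := rfl
    rw [h, symbFun_homE, symbFun_homE, symbFun_homE, sy_add, map_add, smul_add]
  map_smul' c x := by
    obtain ⟨f, hf, hf0, rfl⟩ := exists_homE hF x
    have h : c • homE hF f hf hf0 =
      homE hF (c • f) (Submodule.smul_mem _ c hf) (dif_smul_eq_zero c hf0) := rfl
    rw [h, symbFun_homE, symbFun_homE, sy_smul, map_smul, smul_comm, RingHom.id_apply]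

theorem symbMap_homE {i : ℕ} {f : CMat C.Mor (single E) (tower hF E i)}
    (hf : f ∈ degC (single E) (tower hF E i) 0) (hf0 : dif f = 0) :
    symbMap hF θ e i (homE hF f hf hf0) = (-1 : S) ^ i • transp θ hF e (sy hF θ i f) :=
  symbFun_homE hF θ e hf hf0

theorem symbMap_mulH {i j : ℕ} (x : RH hF E i) (y : RH hF E j) :
    symbMap hF θ e (i + j) (mulH hF x y) = symbMap hF θ e j y * symbMap hF θ e i x := by
  obtain ⟨f, hf, hf0, rfl⟩ := exists_homE hF x
  obtain ⟨g, hg, hg0, rfl⟩ := exists_homE hF y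
  rw [mulH_homE, symbMap_homE, symbMap_homE, symbMap_homE, sy_prod₂ hF θ hf hf0 hg hg0,
    transp_mul, smul_mul_smul_comm, pow_add, mul_comm ((-1 : S) ^ i)]

theorem symbMap_mulH_tH {i : ℕ} (x : RH hF E i) :
    symbMap hF θ e (i + 1) (mulH hF x (tH hF E)) = 0 := by
  obtain ⟨f, hf, hf0, rfl⟩ := exists_homE hF x
  rw [mulH_homE_tH, symbMap_homE, sy_stepT hF θ hf, map_zero, smul_zero]

theorem symbMap_eq_zero (hE : ∀ d, d ≠ 0 → C.Hom E F d = ⊥) {i : ℕ} (x : RH hF E (i + 1)) :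
    symbMap hF θ e (i + 1) x = 0 ↔ ∃ y : RH hF E i, x = mulH hF y (tH hF E) := by
  refine ⟨fun h => ?_, ?_⟩
  · obtain ⟨f, hf, hf0, rfl⟩ := exists_homE hF x
    rw [symbMap_homE] at h
    have h1 : sy hF θ (i + 1) f = 0 := by
      have h2 := congrArg (fun z => (-1 : S) ^ (i + 1) • z) h
      simp only [smul_smul, ← mul_pow, neg_mul_neg, one_mul, one_pow, one_smul, smul_zero] at h2
      rw [← cotransp_transp θ hF e (sy hF θ (i + 1) f), h2, map_zero]
    obtain ⟨q, hq, hq0, hc⟩ := exists_isCob_sub_inR_of_sy hF θ hE e hf hf0 h1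
    refine ⟨homE hF q hq hq0, ?_⟩
    rw [mulH_homE_tH]
    exact (homE_eq_homE hF).mpr hc
  · rintro ⟨y, rfl⟩
    exact symbMap_mulH_tH hF θ e y

theorem eq_zero_of_mulH_tH (hE : ∀ d, d ≠ 0 → C.Hom E F d = ⊥)
    (e : Module.Basis (Fin n) S (C.Hom E F 0)) (θ : S ≃ₗ[S] C.Hom F F 1) {i : ℕ} (x : RH hF E i)
    (h : mulH hF x (tH hF E) = 0) : x = 0 := by
  obtain ⟨f, hf, hf0, rfl⟩ := exists_homE hF x
  rw [mulH_homE_tH] at h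
  exact (homE_eq_zero hF).mpr (isCob_of_tower_inR hF e hE θ ((homE_eq_zero hF).mp h))

theorem one_eq_homE (hf : hat E E (C.id E) ∈ degC (single E) (tower hF E 0) 0)
    (hf0 : dif (Y := tower hF E 0) (hat E E (C.id E)) = 0) :
    homE (i := 0) hF (hat E E (C.id E)) hf hf0 = 𝟙 (towerObj hF E 0) :=
  hom_congr (X := towerObj hF E 0) (Y := towerObj hF E 0) hat_id

/-- Every class in degree zero is a multiple of the identity. -/
theorem exists_smul_one (hw : Nonempty (C.Hom E E 0 ≃ₗ[S] S)) (x : RH hF E 0) :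
    ∃ s : S, x = s • 𝟙 (towerObj hF E 0) := by
  obtain ⟨f, hf, hf0, rfl⟩ := exists_homE hF x
  obtain ⟨s, hs⟩ := (smul_id_bijective hw).2 ⟨unhat E E f, unhat_mem hf⟩
  have h1 : f = s • hat E E (C.id E) := by
    rw [← hat_smul]
    exact (hat_unhat (A := E) (B := E) f).symm.trans
      (congrArg (fun z => hat E E (z : C.Hom E E 0)) hs.symm)
  refine ⟨s, ?_⟩
  rw [← one_eq_homE hF (hat_mem (C.id_mem E)) (dif_single (A := E) (B := E) _)]
  exact hom_congr h1

theorem symbMap_one : symbMap hF θ e 0 (𝟙 (towerObj hF E 0)) = 1 := by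
  rw [← one_eq_homE hF (hat_mem (C.id_mem E)) (dif_single (A := E) (B := E) _)]
  refine (symbMap_homE (i := 0) hF θ e _ _).trans ?_
  have h := sy_id hF θ (E := E) (1 : S)
  rw [one_smul, one_smul] at h
  rw [pow_zero, one_smul]
  exact (congrArg (transp θ hF e) h).trans (transp_one θ hF e)

theorem eq_zero_of_smul_one (hn : 0 < n) (e : Module.Basis (Fin n) S (C.Hom E F 0)) {s : S}
    (h : s • (1 : Module.End S (C.Hom E F 0)) = 0) : s = 0 := by
  have h1 := congrArg (fun z : Module.End S (C.Hom E F 0) => e.coord ⟨0, hn⟩ (z (e ⟨0, hn⟩))) h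
  simpa using h1

theorem symbMap_one_range (hE : ∀ d, d ≠ 0 → C.Hom E F d = ⊥) (x : RH hF E 1) :
    symbMap hF θ e 1 x ∈ EndG (C.gElt θ hF e) := by
  obtain ⟨f, hf, hf0, rfl⟩ := exists_homE hF x
  rw [symbMap_homE]
  exact Submodule.smul_mem _ _ (LinearMap.mem_ker.mpr (trMul_transp_sy hF θ e hE hf hf0))

theorem dif_kap_eq_zero {a : Module.End S (C.Hom E F 0)} (ha : a ∈ EndG (C.gElt θ hF e)) :
    dif (kap hF θ e a) = 0 := by
  rw [dif_kap, LinearMap.mem_ker.mp ha, Submodule.coe_zero, hat_zero, zero_ract]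

/-- The classes of a linear family of cocycles. -/
def homEL {M : Type u} [AddCommMonoid M] [Module S M] {i : ℕ}
    (φ : M →ₗ[S] CMat C.Mor (single E) (tower hF E i))
    (h : ∀ m, φ m ∈ degC (single E) (tower hF E i) 0) (h0 : ∀ m, dif (φ m) = 0) :
    M →ₗ[S] RH hF E i where
  toFun m := homE hF (φ m) (h m) (h0 m)
  map_add' a b := (homE_eq_homE hF (hf := h (a + b)) (hf0 := h0 (a + b))
    (hg := Submodule.add_mem _ (h a) (h b)) (hg0 := dif_add_eq_zero (h0 a) (h0 b))).mpr
      (by rw [map_add, sub_self]; exact IsCob.zero 0)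
  map_smul' c a := (homE_eq_homE hF (hf := h (c • a)) (hf0 := h0 (c • a))
    (hg := Submodule.smul_mem _ c (h a)) (hg0 := dif_smul_eq_zero c (h0 a))).mpr
      (by rw [map_smul, sub_self]; exact IsCob.zero 0)

/-- `kap`, with values in the morphisms to `E_1`. -/
def kapT : Module.End S (C.Hom E F 0) →ₗ[S] CMat C.Mor (single E) (tower hF E 1) := kap hF θ e

theorem kapT_mem (a : Module.End S (C.Hom E F 0)) :
    kapT hF θ e a ∈ degC (single E) (tower hF E 1) 0 := kap_mem hF θ e a

theorem dif_kapT {a : Module.End S (C.Hom E F 0)} (ha : a ∈ EndG (C.gElt θ hF e)) :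
    dif (kapT hF θ e a) = 0 := dif_kap_eq_zero hF θ e ha

theorem sy_kapT (hE : ∀ d, d ≠ 0 → C.Hom E F d = ⊥) (a : Module.End S (C.Hom E F 0)) :
    sy hF θ 1 (kapT hF θ e a) = cotransp θ hF a := sy_kap hF θ e hE a

/-- The negative of `kap`, on `End_g(V)`. -/
def kapG : EndG (C.gElt θ hF e) →ₗ[S] CMat C.Mor (single E) (tower hF E 1) where
  toFun a := kapT hF θ e (-(a : Module.End S (C.Hom E F 0)))
  map_add' a b := by rw [Submodule.coe_add, neg_add, map_add]
  map_smul' c a := by rw [Submodule.coe_smul, ← smul_neg, map_smul, RingHom.id_apply]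

theorem kapG_apply (a : EndG (C.gElt θ hF e)) :
    kapG hF θ e a = kapT hF θ e (-(a : Module.End S (C.Hom E F 0))) := rfl

theorem kapG_mem (a : EndG (C.gElt θ hF e)) :
    kapG hF θ e a ∈ degC (single E) (tower hF E 1) 0 := by
  rw [kapG_apply]
  exact kapT_mem hF θ e _

theorem dif_kapG (a : EndG (C.gElt θ hF e)) : dif (kapG hF θ e a) = 0 := by
  rw [kapG_apply]
  exact dif_kapT hF θ e (Submodule.neg_mem _ a.2)

/-- The embedding of `End_g(V)` in degree one. -/
def embOne : EndG (C.gElt θ hF e) →ₗ[S] RH hF E 1 :=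
  homEL hF (kapG hF θ e) (kapG_mem hF θ e) (dif_kapG hF θ e)

theorem embOne_apply (a : EndG (C.gElt θ hF e)) : embOne hF θ e a =
    homE hF (kapG hF θ e a) (kapG_mem hF θ e a) (dif_kapG hF θ e a) := rfl

theorem symbMap_embOne (hE : ∀ d, d ≠ 0 → C.Hom E F d = ⊥) (a : EndG (C.gElt θ hF e)) :
    symbMap hF θ e 1 (embOne hF θ e a) = a := by
  rw [embOne_apply, symbMap_homE, kapG_apply, sy_kapT hF θ e hE, transp_cotransp, pow_one, smul_neg]
  exact neg_eq_iff_eq_neg.mpr ((neg_smul _ _).trans (congrArg Neg.neg (one_smul S _)))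

variable {h : Module.End S (C.Hom E F 0) ⊗[S] Module.Dual S (C.Hom E E 1)}

/-- The symbols of the graded algebra of the tower. -/
def symbolData (hn : 0 < n) (hE : ∀ d, d ≠ 0 → C.Hom E F d = ⊥)
    (hw : Nonempty (C.Hom E E 0 ≃ₗ[S] S))
    (hinv : Module.Invertible S (C.Hom E E 1)) (hEE : ∀ d, d ≠ 0 → d ≠ 1 → C.Hom E E d = ⊥)
    (hh : trPair (C.gElt θ hF e) h = 1) : SymbolData (C.gElt θ hF e) (RH hF E) where
  t := tH hF E
  smul_mul c x y := smul_mulH hF c x y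
  mul_smul c x y := mulH_smul hF c x y
  t_mul x := gmk_tH_mulH hF x
  eq_zero_of_mul_t x hx := eq_zero_of_mulH_tH hF hE e θ x hx
  σ := symbMap hF θ e
  σ_one := symbMap_one hF θ e
  σ_mul x y := symbMap_mulH hF θ e x y
  σ_eq_zero x := symbMap_eq_zero hF θ e hE x
  σ_zero_injective := by
    refine (injective_iff_map_eq_zero _).mpr fun x hx => ?_
    obtain ⟨s, rfl⟩ := exists_smul_one hF hw x
    rw [map_smul, symbMap_one] at hx
    rw [eq_zero_of_smul_one hn e hx, zero_smul]
  σ_zero x := by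
    obtain ⟨s, rfl⟩ := exists_smul_one hF hw x
    exact ⟨s, by rw [map_smul, symbMap_one, Algebra.algebraMap_eq_smul_one]⟩
  σ_one_range a := by
    refine ⟨?_, fun ha => ⟨_, symbMap_embOne hF θ e hE ⟨a, ha⟩⟩⟩
    rintro ⟨x, rfl⟩
    exact symbMap_one_range hF θ e hE x
  σ_surjective i a := by
    obtain ⟨f, hf, hf0, hs⟩ := exists_sy_eq hF θ e hE hinv hEE hh i
      (cotransp θ hF ((-1 : S) ^ (i + 2) • a))
    refine ⟨homE hF f hf hf0, ?_⟩
    rw [symbMap_homE, hs, transp_cotransp, smul_smul, ← mul_pow, neg_mul_neg, one_mul, one_pow,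
      one_smul]

end TwC

end MinimalAInfCat

end

noncomputable section

attribute [local instance] Classical.propDecidable

namespace MinimalAInfCat

namespace PreTw

variable {S : Type u} [CommRing S] {C : MinimalAInfCat.{u, w} S} {F : C.Obj}
  (hF : C.IsOneSpherical F) {W X Y Z : C.PreTw}

variable {A B D G E : C.Obj}

/-! ### The products of a weak pair as components of `b` -/

theorem b_mul₃_mem {d d' d'' k : ℤ} {x y z : C.Mor} (hx : x ∈ C.Hom A B d) (hy : y ∈ C.Hom B D d')
    (hz : z ∈ C.Hom D G d'') (hk : k = d + d' + d'' - 1) :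
    C.b (TensorAlgebra.ι S x * (TensorAlgebra.ι S y * TensorAlgebra.ι S z)) ∈ C.Hom A G k := by
  have h := unhat_mem (prod₃_mem (hat_mem hx) (hat_mem hy) (hat_mem hz) hk)
  rwa [prod₃_hat, unhat_hat] at h

theorem b_ι_mul₃ (x y z : C.Mor) :
    C.b (TensorAlgebra.ι S x * (TensorAlgebra.ι S y * TensorAlgebra.ι S z)) =
      C.m₃ z (C.sgn y) (C.sgn (C.sgn x)) := by
  have h : TensorAlgebra.ι S x * (TensorAlgebra.ι S y * TensorAlgebra.ι S z) = C.word [x, y, z] := by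
    simp [word]
  have e : C.susp [x, y, z] = List.ofFn ![C.sgn (C.sgn x), C.sgn y, z] := by simp [susp, pow_two]
  rw [h, b_word, e, ml_ofFn]
  rfl

theorem b_ι_mul₄ (x y z t : C.Mor) :
    C.b (TensorAlgebra.ι S x * (TensorAlgebra.ι S y * (TensorAlgebra.ι S z * TensorAlgebra.ι S t))) =
      C.m₄ t (C.sgn z) (C.sgn (C.sgn y)) (C.sgn (C.sgn (C.sgn x))) := by
  have h : TensorAlgebra.ι S x * (TensorAlgebra.ι S y * (TensorAlgebra.ι S z *
    TensorAlgebra.ι S t)) = C.word [x, y, z, t] := by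
    simp [word]
  have e : C.susp [x, y, z, t] =
      List.ofFn ![C.sgn (C.sgn (C.sgn x)), C.sgn (C.sgn y), C.sgn z, t] := by
    simp [susp, pow_succ]
  rw [h, b_word, e, ml_ofFn]
  rfl

theorem sgn_of_mem_zero {x : C.Mor} (hx : x ∈ C.Hom A B 0) : C.sgn x = x := by
  rw [C.sgn_of_mem hx, sg_zero, one_smul]

theorem sgn_of_mem_one {x : C.Mor} (hx : x ∈ C.Hom A B 1) : C.sgn x = -x := by
  rw [C.sgn_of_mem hx, sg_one, neg_one_smul]

theorem sgn_sgn_of_mem_one {x : C.Mor} (hx : x ∈ C.Hom A B 1) : C.sgn (C.sgn x) = x := by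
  rw [sgn_of_mem_one hx, map_neg, sgn_of_mem_one hx, neg_neg]

theorem m₃_neg_mid (x y z : C.Mor) : C.m₃ z (-y) x = -C.m₃ z y x := by
  have h := (C.m 3).map_update_smul ![x, 0, z] 1 (-1 : S) y
  have e : ∀ y : C.Mor, Function.update ![x, 0, z] 1 y = ![x, y, z] := by
    intro y; ext i; fin_cases i <;> simp
  rw [e, e, neg_one_smul, neg_one_smul] at h
  exact h

theorem m₃_of_one {x y : C.Mor} (hx : x ∈ C.Hom A B 0) (hy : y ∈ C.Hom B D 1) (z : C.Mor) :
    C.m₃ z y x = -C.b (TensorAlgebra.ι S x * (TensorAlgebra.ι S y * TensorAlgebra.ι S z)) := by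
  rw [b_ι_mul₃, sgn_of_mem_zero hx, sgn_of_mem_zero hx, sgn_of_mem_one hy, m₃_neg_mid, neg_neg]

theorem m₃_of_zero {x y : C.Mor} (hx : x ∈ C.Hom A B 1) (hy : y ∈ C.Hom B D 0) (z : C.Mor) :
    C.m₃ z y x = C.b (TensorAlgebra.ι S x * (TensorAlgebra.ι S y * TensorAlgebra.ι S z)) := by
  rw [b_ι_mul₃, sgn_sgn_of_mem_one hx, sgn_of_mem_zero hy]

theorem m₄_eq_b {x y z : C.Mor} (hx : x ∈ C.Hom A B 0) (hy : y ∈ C.Hom B D 1)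
    (hz : z ∈ C.Hom D G 0) (t : C.Mor) : C.m₄ t z y x =
      C.b (TensorAlgebra.ι S x * (TensorAlgebra.ι S y * (TensorAlgebra.ι S z *
        TensorAlgebra.ι S t))) := by
  rw [b_ι_mul₄, sgn_of_mem_zero hx, sgn_of_mem_zero hx, sgn_of_mem_zero hx, sgn_sgn_of_mem_one hy,
    sgn_of_mem_zero hz]

theorem prod₃_hat_id {x y : C.Mor} : prod₃ (hat A B x) (hat B B (C.id B)) (hat B D y) = 0 := by
  have h : TensorAlgebra.ι S x * (TensorAlgebra.ι S (C.id B) * TensorAlgebra.ι S y) =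
      C.word [x, C.id B, y] := by
    simp [word]
  rw [prod₃_hat, h, C.b_word_eq_zero (A := B) (by simp) (by simp), hat_zero]

variable {n : ℕ} (θ : S ≃ₗ[S] C.Hom F F 1) (e : Module.Basis (Fin n) S (C.Hom E F 0))

theorem sMap_eq (a : Module.End S (C.Hom E F 0)) : C.sMap θ hF e a =
    -∑ j, C.proj E E 1 (C.b (TensorAlgebra.ι S (a (e j) : C.Mor) *
      (TensorAlgebra.ι S (θ 1 : C.Mor) * TensorAlgebra.ι S (C.dualVec θ hF e j : C.Mor)))) := by
  rw [sMap, ← Finset.sum_neg_distrib]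
  refine Finset.sum_congr rfl fun j _ => ?_
  rw [m₃_of_one (a (e j)).2 (θ 1).2, map_neg]

/-- `s`, as a linear map. -/
def sMapₗ : Module.End S (C.Hom E F 0) →ₗ[S] C.Hom E E 1 where
  toFun := C.sMap θ hF e
  map_add' a b := by
    simp only [sMap_eq, LinearMap.add_apply, Submodule.coe_add, map_add, add_mul,
      Finset.sum_add_distrib, neg_add]
  map_smul' c a := by
    simp only [sMap_eq, LinearMap.smul_apply, Submodule.coe_smul, map_smul, smul_mul_assoc,
      ← Finset.smul_sum, smul_neg, RingHom.id_apply]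

theorem hat_sMap (a : Module.End S (C.Hom E F 0)) : hat E E (C.sMap θ hF e a : C.Hom E E 1) =
    -∑ j, prod₃ (hat E F (a (e j))) (hat F F (θ 1)) (hat F E (C.dualVec θ hF e j)) := by
  rw [sMap_eq, Submodule.coe_neg, hat_neg, AddSubmonoidClass.coe_finsetSum, hat_sum]
  congr 1
  refine Finset.sum_congr rfl fun j _ => ?_
  rw [C.proj_of_mem (b_mul₃_mem (a (e j)).2 (θ 1).2 (C.dualVec θ hF e j).2 (by norm_num)), prod₃_hat]

theorem rMap_apply (b : Module.End S (C.Hom E F 0)) (v : C.Hom E F 0) :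
    (C.rMap θ hF e b v : C.Mor) = -∑ j, C.b (TensorAlgebra.ι S (b (e j) : C.Mor) *
      (TensorAlgebra.ι S (C.dualVec θ hF e j : C.Mor) * TensorAlgebra.ι S (v : C.Mor))) := by
  conv_rhs => rw [← e.sum_repr v]
  simp only [rMap, LinearMap.sum_apply, LinearMap.smulRight_apply, AddSubmonoidClass.coe_finsetSum,
    Submodule.coe_smul, map_sum, map_smul, Finset.mul_sum, mul_smul_comm]
  rw [Finset.sum_comm, ← Finset.sum_neg_distrib]
  refine Finset.sum_congr rfl fun i _ => ?_
  rw [← Finset.smul_sum, ← smul_neg, ← Finset.sum_neg_distrib]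
  congr 1
  refine Finset.sum_congr rfl fun j _ => ?_
  rw [m₃_of_one (b (e j)).2 (C.dualVec θ hF e j).2, C.proj_of_mem (Submodule.neg_mem _
    (b_mul₃_mem (b (e j)).2 (C.dualVec θ hF e j).2 (e i).2 (by norm_num)))]

/-- The element `∑_j m₃(e_j^*, a e_j, e_i^*)`. -/
def rho (a : Module.End S (C.Hom E F 0)) (i : Fin n) : C.Hom F E 1 :=
  ∑ j, C.proj F E 1 (C.m₃ (C.dualVec θ hF e j) (a (e j)) (C.dualVec θ hF e i))

theorem hat_rho (a : Module.End S (C.Hom E F 0)) (i : Fin n) : hat F E (rho hF θ e a i) =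
    ∑ j, prod₃ (hat F E (C.dualVec θ hF e i)) (hat E F (a (e j))) (hat F E (C.dualVec θ hF e j)) := by
  rw [rho, AddSubmonoidClass.coe_finsetSum, hat_sum]
  refine Finset.sum_congr rfl fun j _ => ?_
  rw [m₃_of_zero (C.dualVec θ hF e i).2 (a (e j)).2, C.proj_of_mem
    (b_mul₃_mem (C.dualVec θ hF e i).2 (a (e j)).2 (C.dualVec θ hF e j).2 (by norm_num)), prod₃_hat]

theorem cotransp_rMap' (a : Module.End S (C.Hom E F 0)) (i : Fin n) :
    cotransp θ hF (C.rMap' θ hF e a) (C.dualVec θ hF e i) = rho hF θ e a i := by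
  refine pair_ext θ hF fun v => ?_
  rw [pair_cotransp, rMap', LinearMap.sum_apply, map_sum]
  simp only [LinearMap.smulRight_apply, map_smul, pair_dualVec_basis, smul_eq_mul, mul_ite, mul_one,
    mul_zero]
  rw [Finset.sum_ite_eq' Finset.univ i, if_pos (Finset.mem_univ i)]
  rfl

theorem hat_m₄Map (a b : Module.End S (C.Hom E F 0)) : hat E E (C.m₄Map θ hF e a b) =
    ∑ j, ∑ k, prod₄ (hat E F (b (e j))) (hat F E (C.dualVec θ hF e j)) (hat E F (a (e k)))
      (hat F E (C.dualVec θ hF e k)) := by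
  rw [m₄Map, Finset.sum_comm, hat_sum]
  refine Finset.sum_congr rfl fun j _ => ?_
  rw [hat_sum]
  refine Finset.sum_congr rfl fun k _ => ?_
  rw [m₄_eq_b (b (e j)).2 (C.dualVec θ hF e j).2 (a (e k)).2, prod₄_hat]

theorem m₄Map_mem (a b : Module.End S (C.Hom E F 0)) : C.m₄Map θ hF e a b ∈ C.Hom E E 0 := by
  refine Submodule.sum_mem _ fun j _ => Submodule.sum_mem _ fun k _ => ?_
  have h := C.m_mem 4 ![E, F, E, F, E] ![0, 1, 0, 1] ![(b (e k) : C.Mor), C.dualVec θ hF e k,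
    a (e j), C.dualVec θ hF e j] (by
      intro i
      fin_cases i
      · exact (b (e k)).2
      · exact (C.dualVec θ hF e k).2
      · exact (a (e j)).2
      · exact (C.dualVec θ hF e j).2)
  have hd : ∑ i, (![0, 1, 0, 1] : Fin 4 → ℤ) i + 2 - (4 : ℕ) = 0 := by
    simp [Fin.sum_univ_succ]
  rw [hd] at h
  exact h

end PreTw

end MinimalAInfCat

end

noncomputable section

attribute [local instance] Classical.propDecidable

namespace MinimalAInfCat

namespace PreTw

variable {S : Type u} [CommRing S] {C : MinimalAInfCat.{u, w} S} {F : C.Obj}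
  (hF : C.IsOneSpherical F) {W X Y Z : C.PreTw}

variable {E : C.Obj} {n : ℕ} (θ : S ≃ₗ[S] C.Hom F F 1) (e : Module.Basis (Fin n) S (C.Hom E F 0))

/-! ### The product of two morphisms `E → T_F(E)` -/

theorem prod₃_add_right (f : CMat C.Mor W X) (g : CMat C.Mor X Y) (h h' : CMat C.Mor Y Z) :
    prod₃ f g (h + h') = prod₃ f g h + prod₃ f g h' := by
  simp only [prod₃, word₃, mapC_add, mulBy_add_right, mulBy_add_left, lact_add]

theorem prod₃_sum_right {ι : Type*} (s : Finset ι) (f : CMat C.Mor W X) (g : CMat C.Mor X Y)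
    (h : ι → CMat C.Mor Y Z) : prod₃ f g (∑ a ∈ s, h a) = ∑ a ∈ s, prod₃ f g (h a) :=
  map_sum (⟨⟨prod₃ f g, prod₃_zero_right f g⟩, prod₃_add_right f g⟩ :
    CMat C.Mor Y Z →+ CMat C.Mor W Z) _ _

theorem cnL_neg_left {B : C.Obj} (v : CMat C.Mor (single B) (single F))
    (Φ : CMat C.Mor (single F) X) : cnL hF (-v) Φ = -cnL hF v Φ := by
  rw [cnL, neg_ract, neg_ract, cnL]

/-- The morphism `v ⊗ ξ ⊗ u` from `E` to `T_F²(E)`. -/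
def cnX : C.Hom E F 0 →ₗ[S] C.Hom F E 1 →ₗ[S] CMat C.Mor (single E) (twist hF (twist hF (single E))) :=
  LinearMap.mk₂ S (fun v u => cnL hF (hat E F v) (cnL hF (hat F F (θ 1)) (hat F E u)))
    (fun v v' u => by rw [Submodule.coe_add, hat_add, cnL_add_left])
    (fun c v u => by rw [Submodule.coe_smul, hat_smul, cnL_smul_left])
    (fun v u u' => by rw [Submodule.coe_add, hat_add, cnL_add_right, cnL_add_right])
    (fun c v u => by rw [Submodule.coe_smul, hat_smul, cnL_smul_right, cnL_smul_right])

/-- The morphism `E → T_F²(E)` given by an endomorphism of `V`. -/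
def lam : Module.End S (C.Hom E F 0) →ₗ[S] CMat C.Mor (single E) (twist hF (twist hF (single E))) where
  toFun a := ∑ j, cnX hF θ (a (e j)) (C.dualVec θ hF e j)
  map_add' a b := by
    simp only [LinearMap.add_apply, map_add, Finset.sum_add_distrib]
  map_smul' c a := by
    simp only [LinearMap.smul_apply, map_smul, Finset.smul_sum, RingHom.id_apply]

theorem lam_apply (a : Module.End S (C.Hom E F 0)) : lam hF θ e a =
    ∑ j, cnL hF (hat E F (a (e j))) (cnL hF (hat F F (θ 1)) (hat F E (C.dualVec θ hF e j))) := rfl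

theorem lam_mul (b a : Module.End S (C.Hom E F 0)) : lam hF θ e (b * a) =
    ∑ j, cnL hF (hat E F (b (e j)))
      (cnL hF (hat F F (θ 1)) (hat F E (cotransp θ hF a (C.dualVec θ hF e j)))) :=
  sum_basis_dualVec θ hF e (cnX hF θ ∘ₗ b) a

theorem kap_mul (b a : Module.End S (C.Hom E F 0)) : kap hF θ e (b * a) =
    ∑ j, cnL hF (hat E F (b (e j))) (hat F E (cotransp θ hF a (C.dualVec θ hF e j))) :=
  sum_basis_dualVec θ hF e (cnB hF ∘ₗ b) a

theorem cnL_xi_mem (u : C.Hom F E 1) :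
    cnL hF (hat F F (θ 1)) (hat F E u) ∈ degC (single F) (twist hF (single E)) 1 :=
  cnL_mem hF (hat_mem (θ 1).2) (hat_mem u.2) (by norm_num)

theorem lam_mem (a : Module.End S (C.Hom E F 0)) :
    lam hF θ e a ∈ degC (single E) (twist hF (twist hF (single E))) 0 :=
  Submodule.sum_mem _ fun j _ => cnL_mem hF (hat_mem (a (e j)).2)
    (cnL_xi_mem hF θ (C.dualVec θ hF e j)) (by norm_num)

theorem prod₂_hat_eq_zero {A B D : C.Obj} {d d' : ℤ} {x y : C.Mor} (hx : x ∈ C.Hom A B d)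
    (hy : y ∈ C.Hom B D d') (h : C.Hom A D (d + d') = ⊥) : prod₂ (hat A B x) (hat B D y) = 0 := by
  have h1 := unhat_mem (prod₂_mem (hat_mem hx) (hat_mem hy) rfl)
  rw [h, Submodule.mem_bot] at h1
  rw [← hat_unhat (prod₂ (hat A B x) (hat B D y)), h1, hat_zero]

theorem dif_lam (hE : ∀ d, d ≠ 0 → C.Hom E F d = ⊥) (a : Module.End S (C.Hom E F 0)) :
    dif (lam hF θ e a) = -ract (ract (hat E E (C.sMap θ hF e a : C.Hom E E 1)) (inR hF (single E)))
      (inR hF (twist hF (single E))) := by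
  rw [lam_apply, dif_sum, hat_sMap, neg_ract, neg_ract, neg_neg, sum_ract, sum_ract]
  refine Finset.sum_congr rfl fun j _ => ?_
  have h1 : dif (cnL hF (hat F F (θ 1)) (hat F E (C.dualVec θ hF e j))) = 0 := by
    rw [dif_cnL_xi hF θ (hat_mem (C.dualVec θ hF e j).2), dif_single, cnL_zero_right, zero_add,
      prod₂_hat_eq_zero (θ 1).2 (C.dualVec θ hF e j).2
        (hom_eq_bot_of_dual hF (hE _ (by norm_num)) θ), zero_ract]
  rw [dif_cnL hF (hat_mem (a (e j)).2) (cnL_xi_mem hF θ (C.dualVec θ hF e j)), h1, cnL_zero_right,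
    smul_zero, neg_zero, zero_add, prod₂_cnL hF _ _ (hat_mem (C.dualVec θ hF e j).2),
    prod₂_hat_eq_zero (a (e j)).2 (θ 1).2 (hE _ (by norm_num)), cnL_zero_left, zero_add]

theorem prod₂_hat_hat (u : C.Hom F E 1) (v : C.Hom E F 0) :
    prod₂ (hat F E u) (hat E F v) = -(C.pair θ u v • hat F F (θ 1)) := by
  have hm := unhat_mem (prod₂_mem (hat_mem u.2) (hat_mem v.2) (rfl : (1 + 0 : ℤ) = _))
  rw [prod₂_hat, unhat_hat, add_zero] at hm
  have h := coordXi_b θ u v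
  rw [coordXi, LinearMap.comp_apply, C.proj_of_mem hm] at h
  have h2 : (⟨_, hm⟩ : C.Hom F F 1) = -(C.pair θ u v • θ 1) := by
    rw [← neg_smul, ← map_smul, smul_eq_mul, mul_one]
    exact θ.symm_apply_eq.mp h
  rw [prod₂_hat, ← hat_smul, ← hat_neg]
  exact congrArg (fun z : C.Hom F F 1 => hat F F (z : C.Mor)) h2

theorem prod₂_hat_kap (a : Module.End S (C.Hom E F 0)) (i : Fin n) :
    prod₂ (hat F E (C.dualVec θ hF e i)) (kap hF θ e a) =
      -cnL hF (hat F F (θ 1)) (hat F E (cotransp θ hF a (C.dualVec θ hF e i))) +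
        ract (hat F E (rho hF θ e a i)) (inR hF (single E)) := by
  have h1 : ∑ j, C.pair θ (C.dualVec θ hF e i) (a (e j)) • C.dualVec θ hF e j =
      cotransp θ hF a (C.dualVec θ hF e i) := by
    conv_rhs => rw [← sum_pair_smul_dualVec θ hF e (cotransp θ hF a (C.dualVec θ hF e i))]
    simp only [pair_cotransp]
  rw [kap_apply, prod₂_sum_right, hat_rho, sum_ract, ← h1, AddSubmonoidClass.coe_finsetSum, hat_sum,
    cnL_sum_right, ← Finset.sum_neg_distrib, ← Finset.sum_add_distrib]
  refine Finset.sum_congr rfl fun j _ => ?_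
  rw [prod₂_cnL hF _ _ (hat_mem (C.dualVec θ hF e j).2), prod₂_hat_hat θ, cnL_neg_left,
    cnL_smul_left, Submodule.coe_smul, hat_smul, cnL_smul_right]

theorem sum_prod₃_kap (a b : Module.End S (C.Hom E F 0)) :
    ∑ j, prod₃ (hat E F (b (e j))) (hat F E (C.dualVec θ hF e j)) (kap hF θ e a) =
      -kap hF θ e (C.rMap θ hF e b * a) +
        ract (hat E E (C.m₄Map θ hF e a b)) (inR hF (single E)) := by
  have h1 : ∀ v : C.Hom E F 0, hat E F (C.rMap θ hF e b v) =
      -∑ j, prod₃ (hat E F (b (e j))) (hat F E (C.dualVec θ hF e j)) (hat E F v) := fun v => by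
    rw [rMap_apply, hat_neg, hat_sum]
    simp only [prod₃_hat]
  simp only [kap_apply, prod₃_sum_right, prod₃_cnL hF _ _ _ (hat_mem (C.dualVec θ hF e _).2),
    Finset.sum_add_distrib, Module.End.mul_apply, h1, cnL_neg_left, cnL_sum_left,
    Finset.sum_neg_distrib, neg_neg]
  rw [Finset.sum_comm, hat_m₄Map, sum_ract]
  simp only [sum_ract]

/-- The product of the morphisms given by two endomorphisms. -/
theorem isCob_prod₂_kap (a b : Module.End S (C.Hom E F 0)) :
    IsCob 0 (prod₂ (kap hF θ e b) (tw hF (kap hF θ e a)) - (lam hF θ e (b * a) -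
      ract (kap hF θ e (C.rMap θ hF e b * a + b * C.rMap' θ hF e a)) (inR hF (twist hF (single E))) +
        ract (ract (hat E E (C.m₄Map θ hF e a b)) (inR hF (single E)))
          (inR hF (twist hF (single E))))) := by
  have hid : ∀ i, cnL hF (hat F F (C.id F)) (hat F E (rho hF θ e a i)) ∈
      degC (single F) (twist hF (single E)) 0 := fun i =>
    cnL_mem hF (hat_mem (C.id_mem F)) (hat_mem (rho hF θ e a i).2) (by norm_num)
  have h1 : prod₂ (kap hF θ e b) (tw hF (kap hF θ e a)) = lam hF θ e (b * a) -
      ∑ j, cnL hF (hat E F (b (e j))) (ract (hat F E (rho hF θ e a j)) (inR hF (single E))) -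
      ract (kap hF θ e (C.rMap θ hF e b * a)) (inR hF (twist hF (single E))) +
      ract (ract (hat E E (C.m₄Map θ hF e a b)) (inR hF (single E)))
        (inR hF (twist hF (single E))) := by
    have h2 := congrArg (fun z => ract z (inR hF (twist hF (single E)))) (sum_prod₃_kap hF θ e a b)
    simp only [sum_ract, add_ract, neg_ract] at h2
    have h3 : prod₂ (kap hF θ e b) (tw hF (kap hF θ e a)) =
        ∑ j, (-cnL hF (hat E F (b (e j))) (prod₂ (hat F E (C.dualVec θ hF e j)) (kap hF θ e a)) +
          ract (prod₃ (hat E F (b (e j))) (hat F E (C.dualVec θ hF e j)) (kap hF θ e a))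
            (inR hF (twist hF (single E)))) := by
      conv_lhs => rw [kap_apply hF θ e b, prod₂_sum_left]
      refine Finset.sum_congr rfl fun j _ => ?_
      rw [prod₂_cnL_tw hF (hat_mem (b (e j)).2) (hat_mem (C.dualVec θ hF e j).2)
        (kap_mem hF θ e a), sg_zero, one_smul]
    rw [h3, Finset.sum_add_distrib, h2, lam_mul]
    simp only [prod₂_hat_kap, cnL_add_right, cnL_neg_right, neg_add, neg_neg,
      Finset.sum_add_distrib, Finset.sum_neg_distrib]
    abel
  have h4 : ∀ j, dif (cnL hF (hat E F (b (e j)))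
      (cnL hF (hat F F (C.id F)) (hat F E (rho hF θ e a j)))) =
      -cnL hF (hat E F (b (e j))) (ract (hat F E (rho hF θ e a j)) (inR hF (single E))) +
        ract (cnL hF (hat E F (b (e j))) (hat F E (rho hF θ e a j)))
          (inR hF (twist hF (single E))) := fun j => by
    rw [dif_cnL hF (hat_mem (b (e j)).2) (hid j), dif_cnL_id hF (hat_mem (rho hF θ e a j).2),
      dif_single, cnL_zero_right, neg_zero, zero_add, sg_zero, one_smul,
      prod₂_cnL hF _ _ (hat_mem (rho hF θ e a j).2), prod₃_hat_id, zero_ract, add_zero, hat_id,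
      prod₂_one'_right (hat_mem (b (e j)).2), sg_zero, one_smul]
  refine ⟨∑ j, cnL hF (hat E F (b (e j)))
    (cnL hF (hat F F (C.id F)) (hat F E (rho hF θ e a j))), Submodule.sum_mem _ fun j _ =>
      cnL_mem hF (hat_mem (b (e j)).2) (hid j) (by norm_num), ?_⟩
  rw [dif_sum, h1, map_add, add_ract, kap_mul hF θ e b (C.rMap' θ hF e a)]
  simp only [h4, cotransp_rMap', sum_ract, Finset.sum_add_distrib, Finset.sum_neg_distrib]
  abel

variable (h : Module.End S (C.Hom E F 0) ⊗[S] Module.Dual S (C.Hom E E 1))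

/-- The lift of `a z²`. -/
def mu : Module.End S (C.Hom E F 0) →ₗ[S] CMat C.Mor (single E) (twist hF (twist hF (single E))) where
  toFun a := lam hF θ e a +
    ract (kap hF θ e (contract h (C.sMap θ hF e a))) (inR hF (twist hF (single E)))
  map_add' a b := by
    have hs := map_add (sMapₗ hF θ e) a b
    change C.sMap θ hF e (a + b) = C.sMap θ hF e a + C.sMap θ hF e b at hs
    rw [hs, map_add, map_add, map_add, add_ract]
    abel
  map_smul' c a := by
    have hs := map_smul (sMapₗ hF θ e) c a
    change C.sMap θ hF e (c • a) = c • C.sMap θ hF e a at hs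
    rw [hs, map_smul, map_smul, map_smul, smul_ract, RingHom.id_apply, smul_add]

theorem mu_apply (a : Module.End S (C.Hom E F 0)) : mu hF θ e h a = lam hF θ e a +
    ract (kap hF θ e (contract h (C.sMap θ hF e a))) (inR hF (twist hF (single E))) := rfl

theorem mu_mem (a : Module.End S (C.Hom E F 0)) :
    mu hF θ e h a ∈ degC (single E) (twist hF (twist hF (single E))) 0 :=
  Submodule.add_mem _ (lam_mem hF θ e a) (ract_inR_mem hF (kap_mem hF θ e _))

variable {h}

theorem dif_mu (hE : ∀ d, d ≠ 0 → C.Hom E F d = ⊥) (hinv : Module.Invertible S (C.Hom E E 1))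
    (hh : trPair (C.gElt θ hF e) h = 1) (a : Module.End S (C.Hom E F 0)) :
    dif (mu hF θ e h a) = 0 := by
  rw [mu_apply, dif_add, dif_lam hF θ e hE, dif_ract_inR, dif_kap, trMul_contract, hh, one_smul,
    neg_add_cancel]

/-- The coefficient of `t` lies in `End_g(V)`. -/
theorem coeff_mem_EndG (hE : ∀ d, d ≠ 0 → C.Hom E F d = ⊥)
    (hinv : Module.Invertible S (C.Hom E E 1)) (hh : trPair (C.gElt θ hF e) h = 1)
    {a b : Module.End S (C.Hom E F 0)} (ha : a ∈ EndG (C.gElt θ hF e))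
    (hb : b ∈ EndG (C.gElt θ hF e)) :
    C.rMap θ hF e b * a + b * C.rMap' θ hF e a + contract h (C.sMap θ hF e (b * a)) ∈
      EndG (C.gElt θ hF e) := by
  have hT := isTwisted_tower hF (E := E)
  have hd : ∀ {a}, a ∈ EndG (C.gElt θ hF e) → dif (kap hF θ e a) = 0 := fun ha => by
    rw [dif_kap, LinearMap.mem_ker.mp ha, Submodule.coe_zero, hat_zero, zero_ract]
  have h0 : dif (prod₂ (kap hF θ e b) (tw hF (kap hF θ e a))) = 0 :=
    dif_prod₂_eq_zero isTwisted_single (hT 1) (hT 2) (kap_mem hF θ e b) (hd hb)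
      (dif_tw_eq_zero hF (hT 0) (hT 1) (kap_mem hF θ e a) (hd ha))
  obtain ⟨z, -, hz⟩ := isCob_prod₂_kap hF θ e a b
  have h1 := congrArg dif hz
  have hzz : dif (dif z) = 0 := dif_dif isTwisted_single (hT 2) z
  rw [hzz] at h1
  have h2 := dif_mu hF θ e hE hinv hh (b * a)
  have h3 : ract (dif (kap hF θ e (C.rMap θ hF e b * a + b * C.rMap' θ hF e a +
      contract h (C.sMap θ hF e (b * a))))) (inR hF (twist hF (single E))) = 0 := by
    rw [mu_apply, dif_add, dif_ract_inR] at h2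
    rw [sub_eq_add_neg, dif_add, dif_neg', dif_add, sub_eq_add_neg, dif_add, dif_neg', h0,
      dif_ract_inR, dif_ract_inR, dif_ract_inR, dif_single, zero_ract, zero_ract, add_zero,
      zero_add, zero_eq_neg] at h1
    rw [map_add, dif_add, add_ract]
    have h4 := sub_eq_zero.mpr (h2.trans h1.symm)
    refine Eq.trans ?_ h4
    abel
  have h5 := ract_inR_injective hF (h3.trans (zero_ract _).symm)
  simp only [dif_kap] at h5
  have h6 := congrArg (unhat E E) (ract_inR_injective hF (h5.trans (zero_ract _).symm))
  rw [unhat_hat, map_zero] at h6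
  exact LinearMap.mem_ker.mpr (Subtype.ext h6)

end PreTw

end MinimalAInfCat

end

noncomputable section

attribute [local instance] Classical.propDecidable

namespace MinimalAInfCat

namespace PreTw

variable {S : Type u} [CommRing S] {C : MinimalAInfCat.{u, w} S} {F : C.Obj}
  (hF : C.IsOneSpherical F) {W X Y Z : C.PreTw}

variable {E : C.Obj} {n : ℕ} (θ : S ≃ₗ[S] C.Hom F F 1) (e : Module.Basis (Fin n) S (C.Hom E F 0))

theorem tw_neg (f : CMat C.Mor X Y) : tw hF (-f) = -tw hF f := by
  have h := tw_smul hF (-1 : S) f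
  rwa [cmat_neg_smul, cmat_neg_smul, one_smul, one_smul] at h

variable {h : Module.End S (C.Hom E F 0) ⊗[S] Module.Dual S (C.Hom E E 1)}

theorem isCob_prod₂_kap_neg {a b c : Module.End S (C.Hom E F 0)} {m : S}
    (hc : c = C.rMap θ hF e b * a + b * C.rMap' θ hF e a + contract h (C.sMap θ hF e (b * a)))
    (hm : C.m₄Map θ hF e a b = m • C.id E) :
    IsCob 0 (prod₂ (kap hF θ e (-b)) (tw hF (kap hF θ e (-a))) - (mu hF θ e h (b * a) +
      ract (kap hF θ e (-c)) (inR hF (twist hF (single E))) +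
        m • ract (ract (hat E E (C.id E)) (inR hF (single E))) (inR hF (twist hF (single E))))) := by
  have h1 := isCob_prod₂_kap hF θ e a b
  have h2 : mu hF θ e h (b * a) + ract (kap hF θ e (-c)) (inR hF (twist hF (single E))) =
      lam hF θ e (b * a) - ract (kap hF θ e (C.rMap θ hF e b * a + b * C.rMap' θ hF e a))
        (inR hF (twist hF (single E))) := by
    rw [mu_apply, hc, map_neg, neg_ract, map_add (kap hF θ e) (C.rMap θ hF e b * a + _), add_ract]
    abel
  rw [hm, hat_smul, smul_ract, smul_ract] at h1
  rw [h2, map_neg, map_neg, tw_neg, prod₂_neg_left, prod₂_neg_right, neg_neg]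
  exact h1

theorem sy_mu (hE : ∀ d, d ≠ 0 → C.Hom E F d = ⊥) (a : Module.End S (C.Hom E F 0)) :
    sy (i := 2) hF θ (mu hF θ e h a) = cotransp θ hF a := by
  refine LinearMap.ext fun u => Subtype.ext ?_
  rw [sy_succ hF e θ hE (i := 1) (mu_mem hF θ e h a)]
  have h0 := lam_mul hF θ e 1 a
  rw [one_mul] at h0
  have h1 : ∀ j, coef (X := tower hF E 1) hF e j (mu hF θ e h a) =
      cnL hF (hat F F (θ 1)) (hat F E (cotransp θ hF a (C.dualVec θ hF e j))) := fun j => by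
    have := coef_sum_cnL hF e (X := twist hF (single E)) (l := 1)
      (Φ := fun j => cnL hF (hat F F (θ 1)) (hat F E (cotransp θ hF a (C.dualVec θ hF e j))))
      (fun j => cnL_xi_mem hF θ (cotransp θ hF a (C.dualVec θ hF e j)))
      (kap hF θ e (contract h (C.sMap θ hF e a))) j
    rw [← this, mu_apply, h0]
    rfl
  have h2 : ∀ u : C.Hom F E 1,
      Psi hF E θ 1 (cnL hF (hat F F (θ 1)) (hat F E u)) = (u : C.Mor) := fun u =>
    (congrArg (Psi hF E θ 0) (psi_cnL_xi hF θ (hat_mem u.2))).trans (unhat_hat _)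
  conv_rhs => rw [← sum_pair_smul_dualVec θ hF e u]
  rw [map_sum, AddSubmonoidClass.coe_finsetSum]
  refine Finset.sum_congr rfl fun j _ => ?_
  rw [map_smul, Submodule.coe_smul, h1]
  exact congrArg (fun z => C.pair θ u (e j) • z) (h2 _)

end PreTw

open PreTw CategoryTheory

namespace TwC

variable {S : Type u} [CommRing S] {C : MinimalAInfCat.{u, w} S} {E F : C.Obj}
  (hF : C.IsOneSpherical F) {n : ℕ} (θ : S ≃ₗ[S] C.Hom F F 1)
  (e : Module.Basis (Fin n) S (C.Hom E F 0))
  (h : Module.End S (C.Hom E F 0) ⊗[S] Module.Dual S (C.Hom E E 1))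

/-! ### The decompositions in degrees one and two -/

/-- `mu`, with values in the morphisms to `E_2`. -/
def muT : Module.End S (C.Hom E F 0) →ₗ[S] CMat C.Mor (single E) (tower hF E (1 + 1)) :=
  mu hF θ e h

theorem muT_mem (a : Module.End S (C.Hom E F 0)) :
    muT hF θ e h a ∈ degC (single E) (tower hF E (1 + 1)) 0 := mu_mem hF θ e h a

variable {h}

theorem dif_muT (hE : ∀ d, d ≠ 0 → C.Hom E F d = ⊥) (hinv : Module.Invertible S (C.Hom E E 1))
    (hh : trPair (C.gElt θ hF e) h = 1) (a : Module.End S (C.Hom E F 0)) :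
    dif (muT hF θ e h a) = 0 := dif_mu hF θ e hE hinv hh a

theorem sy_muT (hE : ∀ d, d ≠ 0 → C.Hom E F d = ⊥) (a : Module.End S (C.Hom E F 0)) :
    sy hF θ (1 + 1) (muT hF θ e h a) = cotransp θ hF a := sy_mu hF θ e hE a

/-- The embedding of `End(V)` in degree two. -/
def embTwo (hE : ∀ d, d ≠ 0 → C.Hom E F d = ⊥) (hinv : Module.Invertible S (C.Hom E E 1))
    (hh : trPair (C.gElt θ hF e) h = 1) : Module.End S (C.Hom E F 0) →ₗ[S] RH hF E (1 + 1) :=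
  homEL hF (muT hF θ e h) (muT_mem hF θ e h) (dif_muT hF θ e hE hinv hh)

theorem embTwo_apply (hE : ∀ d, d ≠ 0 → C.Hom E F d = ⊥)
    (hinv : Module.Invertible S (C.Hom E E 1)) (hh : trPair (C.gElt θ hF e) h = 1)
    (a : Module.End S (C.Hom E F 0)) : embTwo hF θ e hE hinv hh a =
      homE hF (muT hF θ e h a) (muT_mem hF θ e h a) (dif_muT hF θ e hE hinv hh a) := rfl

theorem symbMap_embTwo (hE : ∀ d, d ≠ 0 → C.Hom E F d = ⊥)
    (hinv : Module.Invertible S (C.Hom E E 1)) (hh : trPair (C.gElt θ hF e) h = 1)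
    (a : Module.End S (C.Hom E F 0)) :
    symbMap hF θ e (1 + 1) (embTwo hF θ e hE hinv hh a) = a := by
  rw [embTwo_apply, symbMap_homE, sy_muT hF θ e hE, transp_cotransp, pow_add, pow_one, neg_mul_neg,
    one_mul, one_smul]

/-- The identity of `E`, as a morphism to `E_0`. -/
def idT (E : C.Obj) : CMat C.Mor (single E) (tower hF E 0) := hat E E (C.id E)

theorem idT_mem : idT hF E ∈ degC (single E) (tower hF E 0) 0 := hat_mem (C.id_mem E)

theorem dif_idT : dif (idT hF E) = 0 := dif_single (A := E) (B := E) _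

theorem homE_idT : homE hF (idT hF E) (idT_mem hF) (dif_idT hF) = 𝟙 (towerObj hF E 0) :=
  one_eq_homE hF _ _

theorem one_mulH_tH : mulH hF (𝟙 (towerObj hF E 0)) (tH hF E) = tH hF E := by
  rw [mulH_tH]
  exact Category.id_comp _

theorem tH_eq_homE : tH hF E = homE hF (stepT hF (idT hF E)) (stepT_mem hF (idT_mem hF))
    (dif_stepT hF (dif_idT hF)) := by
  rw [← mulH_homE_tH hF (idT_mem hF) (dif_idT hF), homE_idT, one_mulH_tH]

theorem tH_mulH_tH : mulH hF (tH hF E) (tH hF E) = homE hF (stepT hF (stepT hF (idT hF E)))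
    (stepT_mem hF (stepT_mem hF (idT_mem hF))) (dif_stepT hF (dif_stepT hF (dif_idT hF))) := by
  rw [← mulH_homE_tH hF (stepT_mem hF (idT_mem hF)) (dif_stepT hF (dif_idT hF)), ← tH_eq_homE]

theorem homE_add {i : ℕ} {f g : CMat C.Mor (single E) (tower hF E i)}
    (hf : f ∈ degC (single E) (tower hF E i) 0) (hf0 : dif f = 0)
    (hg : g ∈ degC (single E) (tower hF E i) 0) (hg0 : dif g = 0) :
    homE hF f hf hf0 + homE hF g hg hg0 =
      homE hF (f + g) (Submodule.add_mem _ hf hg) (dif_add_eq_zero hf0 hg0) := rfl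

theorem smul_homE {i : ℕ} (c : S) {f : CMat C.Mor (single E) (tower hF E i)}
    (hf : f ∈ degC (single E) (tower hF E i) 0) (hf0 : dif f = 0) :
    c • homE hF f hf hf0 =
      homE hF (c • f) (Submodule.smul_mem _ c hf) (dif_smul_eq_zero c hf0) := rfl

theorem isCob_prod₂_kapG {a b c : EndG (C.gElt θ hF e)} {m : S}
    (hc : (c : Module.End S (C.Hom E F 0)) = C.rMap θ hF e b * a + b * C.rMap' θ hF e a +
      contract h (C.sMap θ hF e (b * a)))
    (hm : C.m₄Map θ hF e a b = m • C.id E) :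
    IsCob 0 (prod₂ (kapG hF θ e b) (twP hF (kapG hF θ e a) 1) -
      (muT hF θ e h (b * a) + stepT hF (kapG hF θ e c) + m • stepT hF (stepT hF (idT hF E)))) :=
  isCob_prod₂_kap_neg hF θ e hc hm

/-- The product in degree one. -/
theorem embOne_mulH_embOne (hE : ∀ d, d ≠ 0 → C.Hom E F d = ⊥)
    (hinv : Module.Invertible S (C.Hom E E 1)) (hh : trPair (C.gElt θ hF e) h = 1)
    {a b c : EndG (C.gElt θ hF e)} {m : S}
    (hc : (c : Module.End S (C.Hom E F 0)) = C.rMap θ hF e b * a + b * C.rMap' θ hF e a +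
      contract h (C.sMap θ hF e (b * a)))
    (hm : C.m₄Map θ hF e a b = m • C.id E) :
    mulH hF (embOne hF θ e a) (embOne hF θ e b) = embTwo hF θ e hE hinv hh (b * a) +
      mulH hF (embOne hF θ e c) (tH hF E) + m • mulH hF (tH hF E) (tH hF E) := by
  rw [embOne_apply, embOne_apply, embOne_apply, embTwo_apply, mulH_homE, mulH_homE_tH, tH_mulH_tH,
    smul_homE, homE_add, homE_add, homE_eq_homE]
  exact isCob_prod₂_kapG hF θ e hc hm

theorem smul_tH_injective (hn : 0 < n) (hE : ∀ d, d ≠ 0 → C.Hom E F d = ⊥)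
    (e : Module.Basis (Fin n) S (C.Hom E F 0)) (θ : S ≃ₗ[S] C.Hom F F 1) {s : S}
    (hs : s • tH hF E = 0) : s = 0 := by
  rw [← one_mulH_tH, ← smul_mulH] at hs
  have h1 := congrArg (symbMap hF θ e 0) (eq_zero_of_mulH_tH hF hE e θ _ hs)
  rw [map_smul, symbMap_one, map_zero] at h1
  exact eq_zero_of_smul_one hn e h1

theorem symbMap_tH : symbMap hF θ e 1 (tH hF E) = 0 := by
  have h := symbMap_mulH_tH hF θ e (𝟙 (towerObj hF E 0))
  rwa [one_mulH_tH] at h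

/-- `R_1 = End_g(V) ⊕ S t`. -/
theorem existsUnique_one (hn : 0 < n) (hE : ∀ d, d ≠ 0 → C.Hom E F d = ⊥)
    (hw : Nonempty (C.Hom E E 0 ≃ₗ[S] S)) (x : RH hF E 1) :
    ∃! p : EndG (C.gElt θ hF e) × S, x = embOne hF θ e p.1 + p.2 • tH hF E := by
  set a : EndG (C.gElt θ hF e) := ⟨_, symbMap_one_range hF θ e hE x⟩ with ha
  obtain ⟨y, hy⟩ := (symbMap_eq_zero hF θ e hE (i := 0) (x - embOne hF θ e a)).mp (by
    rw [map_sub]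
    exact sub_eq_zero.mpr (symbMap_embOne hF θ e hE a).symm)
  obtain ⟨s, rfl⟩ := exists_smul_one hF hw y
  rw [smul_mulH, one_mulH_tH] at hy
  refine ⟨(a, s), (eq_add_of_sub_eq' hy), ?_⟩
  rintro ⟨b, r⟩ hb
  simp only at hb
  have hba : b = a := Subtype.ext (by
    have h1 := congrArg (symbMap hF θ e 1) hb
    rw [map_add, map_smul, symbMap_tH, smul_zero, add_zero, symbMap_embOne hF θ e hE] at h1
    exact h1.symm)
  subst hba
  have h2 : (r - s) • tH hF E = 0 := by
    rw [sub_smul, sub_eq_zero]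
    exact (eq_sub_of_add_eq' hb.symm).trans hy
  exact Prod.ext rfl (sub_eq_zero.mp (smul_tH_injective hF hn hE e θ h2))

/-- `R_2 = End(V) ⊕ End_g(V) t ⊕ S t²`. -/
theorem existsUnique_two (hn : 0 < n) (hE : ∀ d, d ≠ 0 → C.Hom E F d = ⊥)
    (hw : Nonempty (C.Hom E E 0 ≃ₗ[S] S)) (hinv : Module.Invertible S (C.Hom E E 1))
    (hh : trPair (C.gElt θ hF e) h = 1) (x : RH hF E (1 + 1)) :
    ∃! p : Module.End S (C.Hom E F 0) × EndG (C.gElt θ hF e) × S,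
      x = embTwo hF θ e hE hinv hh p.1 + mulH hF (embOne hF θ e p.2.1) (tH hF E) +
        p.2.2 • mulH hF (tH hF E) (tH hF E) := by
  have hmul : ∀ (b : EndG (C.gElt θ hF e)) (s : S), mulH hF (embOne hF θ e b) (tH hF E) +
      s • mulH hF (tH hF E) (tH hF E) = mulH hF (embOne hF θ e b + s • tH hF E) (tH hF E) :=
    fun b s => by rw [add_mulH, smul_mulH]
  set a := symbMap hF θ e (1 + 1) x with ha
  obtain ⟨y, hy⟩ := (symbMap_eq_zero hF θ e hE (i := 1) (x - embTwo hF θ e hE hinv hh a)).mp (by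
    rw [map_sub]
    exact sub_eq_zero.mpr (symbMap_embTwo hF θ e hE hinv hh a).symm)
  obtain ⟨⟨b, s⟩, hbs, huniq⟩ := existsUnique_one hF θ e hn hE hw y
  refine ⟨(a, b, s), ?_, ?_⟩
  · simp only at hbs ⊢
    rw [add_assoc, hmul, ← hbs]
    exact eq_add_of_sub_eq' hy
  · rintro ⟨a', b', s'⟩ hx
    simp only at hx
    rw [add_assoc, hmul] at hx
    have haa : a' = a := by
      have h1 := congrArg (symbMap hF θ e (1 + 1)) hx
      rw [map_add, symbMap_mulH_tH, add_zero, symbMap_embTwo] at h1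
      exact h1.symm
    subst haa
    have h2 : mulH hF (y - (embOne hF θ e b' + s' • tH hF E)) (tH hF E) = 0 := by
      rw [sub_eq_add_neg, add_mulH, ← hy, ← neg_one_smul S, smul_mulH, neg_one_smul,
        ← sub_eq_add_neg, sub_eq_zero]
      exact sub_eq_of_eq_add' hx
    have h3 := huniq (b', s') (sub_eq_zero.mp (eq_zero_of_mulH_tH hF hE e θ _ h2))
    rw [Prod.mk.injEq] at h3
    rw [h3.1, h3.2]

end TwC

end MinimalAInfCat

end

noncomputable section

attribute [local instance] Classical.propDecidable

namespace MinimalAInfCat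

open PreTw CategoryTheory

namespace TwC

attribute [local instance] gRing

variable {S : Type u} [CommRing S] {C : MinimalAInfCat.{u, w} S} {E F : C.Obj}
  (hF : C.IsOneSpherical F)

theorem of_decomp {x y z : RH hF E (1 + 1)} {u v t : RH hF E 1} {s : S}
    (hz : mulH hF u v = z) :
    DirectSum.of (RH hF E) 2 x = DirectSum.of (RH hF E) 2 y +
        DirectSum.of (RH hF E) 1 u * DirectSum.of (RH hF E) 1 v +
        s • DirectSum.of (RH hF E) 1 t ^ 2 ↔ x = y + z + s • mulH hF t t := by
  have h1 : DirectSum.of (RH hF E) 1 u * DirectSum.of (RH hF E) 1 v =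
      DirectSum.of (RH hF E) (1 + 1) z := by
    rw [DirectSum.of_mul_of, ← hz]
    rfl
  have h2 : s • DirectSum.of (RH hF E) 1 t ^ 2 =
      DirectSum.of (RH hF E) (1 + 1) (s • mulH hF t t) := by
    rw [pow_two, DirectSum.of_mul_of, SymbolData.smul_of]
    rfl
  rw [h1, h2]
  change DirectSum.of (RH hF E) (1 + 1) x = DirectSum.of (RH hF E) (1 + 1) y + _ + _ ↔ _
  rw [← map_add, ← map_add]
  exact (DirectSum.of_injective (β := RH hF E) (1 + 1)).eq_iff

theorem represents_tH : Represents (k := 0) (toTwist hF (tower hF E 0)) (tH hF E) := by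
  have e : ∀ {f g : Mat (tower hF E 0) (tower hF E 1)} {x : R hF E 1}, f = g →
      Represents f x → Represents g x := fun h hf => h ▸ hf
  exact e (toTwist_eq_tmor hF (X := tower hF E 0)).symm
    (represents_cls (hf := tmor_mem hF) (hf0 := dif_tmor hF))

theorem represents_one :
    Represents (k := 0) (idMat (tower hF E 0)) (𝟙 (towerObj hF E 0)) := by
  have e : ∀ {f g : Mat (tower hF E 0) (tower hF E 0)} {x : R hF E 0}, f = g →
      Represents f x → Represents g x := fun h hf => h ▸ hf
  exact e (idMat_eq_one' (X := tower hF E 0)).symm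
    (represents_cls (hf := one'_mem _) (hf0 := dif_one' _))

theorem exists_m₄Map {n : ℕ} (θ : S ≃ₗ[S] C.Hom F F 1) (e : Module.Basis (Fin n) S (C.Hom E F 0))
    (hw : Nonempty (C.Hom E E 0 ≃ₗ[S] S)) (a b : Module.End S (C.Hom E F 0)) :
    ∃ m : S, C.m₄Map θ hF e a b = m • C.id E := by
  obtain ⟨m, hm⟩ := (smul_id_bijective hw).2 ⟨_, m₄Map_mem hF θ e a b⟩
  exact ⟨m, (congrArg Subtype.val hm).symm⟩

/-- The structure of the algebra of the tower. -/
theorem exists_rees {n : ℕ} (hn : 0 < n) (θ : S ≃ₗ[S] C.Hom F F 1)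
    (e : Module.Basis (Fin n) S (C.Hom E F 0)) (hE : ∀ d, d ≠ 0 → C.Hom E F d = ⊥)
    (hw : Nonempty (C.Hom E E 0 ≃ₗ[S] S)) (hinv : Module.Invertible S (C.Hom E E 1))
    (hEE : ∀ d, d ≠ 0 → d ≠ 1 → C.Hom E E d = ⊥)
    (h : Module.End S (C.Hom E F 0) ⊗[S] Module.Dual S (C.Hom E E 1))
    (hh : trPair (C.gElt θ hF e) h = 1) :
      ∃ (A : FilteredAlg S) (Φ : (⨁ i, RH hF E i) ≃+* A.rees)
        (γ : (⨁ i, A.Gr i) ≃+* (EAlg (C.gElt θ hF e))ᵐᵒᵖ) (t : RH hF E 1)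
        (ι₁ : EndG (C.gElt θ hF e) →ₗ[S] RH hF E 1)
        (ι₂ : Module.End S (C.Hom E F 0) →ₗ[S] RH hF E 2),
        (∀ (s : S) (x : ⨁ i, RH hF E i), Φ (s • x) = s • Φ x) ∧
        (∀ (i : ℕ) (x : RH hF E i), ∃ y : A.fil i,
          (Φ (DirectSum.of (RH hF E) i x) : Polynomial A.A) = Polynomial.monomial i (y : A.A)) ∧
        (∀ (s : S) (x : ⨁ i, A.Gr i), γ (s • x) = s • γ x) ∧
        (∀ (i : ℕ) (y : A.Gr i), ∃ a : Module.End S (C.Hom E F 0),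
          ((γ (DirectSum.of A.Gr i y)).unop : Polynomial (Module.End S (C.Hom E F 0))) =
            Polynomial.monomial i a) ∧
        Represents (k := 0) (toTwist hF (tower hF E 0)) t ∧
        (Φ (DirectSum.of (RH hF E) 1 t) : Polynomial A.A) = Polynomial.X ∧
        (∀ (a : EndG (C.gElt θ hF e)) (y : A.fil 1),
          (Φ (DirectSum.of (RH hF E) 1 (ι₁ a)) : Polynomial A.A) =
            Polynomial.monomial 1 (y : A.A) →
          ((γ (DirectSum.of A.Gr 1 (A.symb y))).unop :
            Polynomial (Module.End S (C.Hom E F 0))) = Polynomial.monomial 1 (a : Module.End S _)) ∧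
        (∀ (a : Module.End S (C.Hom E F 0)) (y : A.fil 2),
          (Φ (DirectSum.of (RH hF E) 2 (ι₂ a)) : Polynomial A.A) =
            Polynomial.monomial 2 (y : A.A) →
          ((γ (DirectSum.of A.Gr 2 (A.symb y))).unop :
            Polynomial (Module.End S (C.Hom E F 0))) = Polynomial.monomial 2 a) ∧
        (∀ x : RH hF E 1, ∃! p : EndG (C.gElt θ hF e) × S, x = ι₁ p.1 + p.2 • t) ∧
        (∀ x : RH hF E 2, ∃! p : Module.End S (C.Hom E F 0) × EndG (C.gElt θ hF e) × S,
          DirectSum.of (RH hF E) 2 x = DirectSum.of (RH hF E) 2 (ι₂ p.1) +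
            DirectSum.of (RH hF E) 1 (ι₁ p.2.1) * DirectSum.of (RH hF E) 1 t +
            p.2.2 • DirectSum.of (RH hF E) 1 t ^ 2) ∧
        (∀ a b : EndG (C.gElt θ hF e), ∃ (c : EndG (C.gElt θ hF e)) (m : S),
          (c : Module.End S (C.Hom E F 0)) =
            C.rMap θ hF e b * a + b * C.rMap' θ hF e a +
              contract h (C.sMap θ hF e (b * a)) ∧
          C.m₄Map θ hF e a b = m • C.id E ∧
          DirectSum.of (RH hF E) 1 (ι₁ a) * DirectSum.of (RH hF E) 1 (ι₁ b) =
            DirectSum.of (RH hF E) 2 (ι₂ (b * a)) +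
              DirectSum.of (RH hF E) 1 (ι₁ c) * DirectSum.of (RH hF E) 1 t +
              m • DirectSum.of (RH hF E) 1 t ^ 2) := by
  let D := symbolData hF θ e hn hE hw hinv hEE hh
  refine ⟨D.filtered, D.reesEquiv, D.grEquiv, tH hF E, embOne hF θ e, embTwo hF θ e hE hinv hh,
    D.reesEquiv_smul, fun i x => ⟨_, D.reesEquiv_of x⟩, D.grEquiv_smul,
    fun i y => ⟨_, D.grEquiv_of y⟩, represents_tH hF, D.reesEquiv_t, fun a y hy => ?_,
    fun a y hy => ?_, existsUnique_one hF θ e hn hE hw, fun x => ?_, fun a b => ?_⟩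
  · exact (D.grEquiv_symb _ y hy).trans
      (congrArg (Polynomial.monomial 1) (symbMap_embOne hF θ e hE a))
  · exact (D.grEquiv_symb _ y hy).trans
      (congrArg (Polynomial.monomial 2) (symbMap_embTwo hF θ e hE hinv hh a))
  · exact (existsUnique_congr fun p => of_decomp hF rfl).mpr
      (existsUnique_two hF θ e hn hE hw hinv hh x)
  · obtain ⟨m, hm⟩ := exists_m₄Map hF θ e hw a b
    refine ⟨⟨_, coeff_mem_EndG hF θ e hE hinv hh a.2 b.2⟩, m, rfl, hm, ?_⟩
    have h1 := embOne_mulH_embOne hF θ e hE hinv hh (a := a) (b := b)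
      (c := ⟨_, coeff_mem_EndG hF θ e hE hinv hh a.2 b.2⟩) rfl hm
    rw [DirectSum.of_mul_of]
    exact (of_decomp hF rfl).mpr h1

end TwC

end MinimalAInfCat

end

open scoped TensorProduct DirectSum in
open MinimalAInfCat.PreTw in
theorem theorem2p7 {S : Type u} [CommRing S] (C : MinimalAInfCat.{u, w} S) (E F : C.Obj)
    (n : ℕ) (hn : 2 ≤ n) (hEF : C.IsWeakPair n E F) (hF : C.IsOneSpherical F)
    -- `hF` is part of `hEF`, named because the twist refers to it;
    -- the trivialization of `Hom¹(F,F)` and a basis of `V = Hom⁰(E,F)`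
    (θ : S ≃ₗ[S] C.Hom F F 1) (e : Module.Basis (Fin n) S (C.Hom E F 0))
    -- the element `g ∈ End(V) ⊗ L_E`, and `h ∈ End(V) ⊗ L_E⁻¹` with `tr(gh) = 1`
    (g : Module.End S (C.Hom E F 0) ⊗[S] C.Hom E E 1) (hg : g = C.gElt θ hF e)
    (h : Module.End S (C.Hom E F 0) ⊗[S] Module.Dual S (C.Hom E E 1)) (hh : trPair g h = 1) :
    -- the `E_i` are twisted complexes
    (∀ i, (tower hF E i).IsTwisted) ∧
    -- `Hom^{≠0}(E_0,E_i) = 0` for `i > 0`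
    (∀ i, 0 < i → ∀ k : ℤ, k ≠ 0 → Subsingleton (HomH (tower hF E 0) (tower hF E i) k)) ∧
    -- `E(V,g)^op ≅ E(V^∨,g^*)`
    (∃ φ : (EAlg g)ᵐᵒᵖ ≃ₐ[S] EAlg (gDual g), ∀ (p : EAlg g) (k : ℕ),
      (φ (MulOpposite.op p) : Polynomial (Module.End S (Module.Dual S (C.Hom E F 0)))).coeff k =
        ((p : Polynomial (Module.End S (C.Hom E F 0))).coeff k).dualMap) ∧
    -- `R = ⊕ Hom⁰(E_0,E_i)` is a graded associative algebra with the product `ab = T^j(a) ∘ b`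
    ∃ _ : DirectSum.GRing (R hF E),
      (∀ (i j : ℕ) (a : Mat (tower hF E 0) (tower hF E i)) (b : Mat (tower hF E 0) (tower hF E j))
        (x : R hF E i) (y : R hF E j), Represents a x → Represents b y →
          Represents (mulMat hF a b) (GradedMonoid.GMul.mul x y : R hF E (i + j))) ∧
      Represents (idMat (tower hF E 0)) (GradedMonoid.GOne.one : R hF E 0) ∧
      ∃ (A : FilteredAlg S) (Φ : (⨁ i, R hF E i) ≃+* A.rees)
        (γ : (⨁ i, A.Gr i) ≃+* (EAlg g)ᵐᵒᵖ) (t : R hF E 1)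
        (ι₁ : EndG g →ₗ[S] R hF E 1) (ι₂ : Module.End S (C.Hom E F 0) →ₗ[S] R hF E 2),
        -- `Φ` is an isomorphism of graded `S`-algebras from `R` to the Rees algebra of `A`
        (∀ (s : S) (x : ⨁ i, R hF E i), Φ (s • x) = s • Φ x) ∧
        (∀ (i : ℕ) (x : R hF E i), ∃ y : A.fil i,
          (Φ (DirectSum.of (R hF E) i x) : Polynomial A.A) = Polynomial.monomial i (y : A.A)) ∧
        -- `γ` is an isomorphism of graded `S`-algebras from `gr A` to `E(V,g)^op`
        (∀ (s : S) (x : ⨁ i, A.Gr i), γ (s • x) = s • γ x) ∧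
        (∀ (i : ℕ) (y : A.Gr i), ∃ a : Module.End S (C.Hom E F 0),
          ((γ (DirectSum.of A.Gr i y)).unop : Polynomial (Module.End S (C.Hom E F 0))) =
            Polynomial.monomial i a) ∧
        -- `t` is the class of the canonical morphism `E → T(E)`, and corresponds to the element
        -- `t` of the Rees algebra
        Represents (toTwist hF (tower hF E 0)) t ∧
        (Φ (DirectSum.of (R hF E) 1 t) : Polynomial A.A) = Polynomial.X ∧
        -- `ι₁ a` and `ι₂ a` have the symbols `a z` and `a z²`
        (∀ (a : EndG g) (y : A.fil 1),
          (Φ (DirectSum.of (R hF E) 1 (ι₁ a)) : Polynomial A.A) = Polynomial.monomial 1 (y : A.A) →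
          ((γ (DirectSum.of A.Gr 1 (A.symb y))).unop :
            Polynomial (Module.End S (C.Hom E F 0))) = Polynomial.monomial 1 (a : Module.End S _)) ∧
        (∀ (a : Module.End S (C.Hom E F 0)) (y : A.fil 2),
          (Φ (DirectSum.of (R hF E) 2 (ι₂ a)) : Polynomial A.A) = Polynomial.monomial 2 (y : A.A) →
          ((γ (DirectSum.of A.Gr 2 (A.symb y))).unop :
            Polynomial (Module.End S (C.Hom E F 0))) = Polynomial.monomial 2 a) ∧
        -- `R_1 = End_g(V) ⊕ S t` and `R_2 = End(V) ⊕ End_g(V) t ⊕ S t²`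
        (∀ x : R hF E 1, ∃! p : EndG g × S, x = ι₁ p.1 + p.2 • t) ∧
        (∀ x : R hF E 2, ∃! p : Module.End S (C.Hom E F 0) × EndG g × S,
          DirectSum.of (R hF E) 2 x = DirectSum.of (R hF E) 2 (ι₂ p.1) +
            DirectSum.of (R hF E) 1 (ι₁ p.2.1) * DirectSum.of (R hF E) 1 t +
            p.2.2 • DirectSum.of (R hF E) 1 t ^ 2) ∧
        -- `a · b = ba + [r(b)a + b r'(a) + s(ba)h] t + m₄(a ⊗ b) t²`
        (∀ a b : EndG g, ∃ (c : EndG g) (m : S),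
          (c : Module.End S (C.Hom E F 0)) =
            C.rMap θ hF e b * a + b * C.rMap' θ hF e a +
              contract h (C.sMap θ hF e (b * a)) ∧
          C.m₄Map θ hF e a b = m • C.id E ∧
          DirectSum.of (R hF E) 1 (ι₁ a) * DirectSum.of (R hF E) 1 (ι₁ b) =
            DirectSum.of (R hF E) 2 (ι₂ (b * a)) +
              DirectSum.of (R hF E) 1 (ι₁ c) * DirectSum.of (R hF E) 1 t +
              m • DirectSum.of (R hF E) 1 t ^ 2) := by
  subst hg
  have hn' : 0 < n := by omega
  have : Module.Free S (C.Hom E F 0) := Module.Free.of_basis e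
  have : Module.Finite S (C.Hom E F 0) := Module.Finite.of_basis e
  refine ⟨fun i => isTwisted_tower hF i, fun i hi k hk => ⟨fun x y => ?_⟩,
    ⟨eAlgDual _, coeff_eAlgDual _⟩, MinimalAInfCat.TwC.gRing hF E, fun i j a b x y ha hb =>
      MinimalAInfCat.TwC.represents_mulH hF ha hb, MinimalAInfCat.TwC.represents_one hF,
    MinimalAInfCat.TwC.exists_rees hF hn' θ e hEF.homEF_eq_bot hEF.homEE_zero hEF.homEE_one
      hEF.homEE_eq_bot h hh⟩
  obtain ⟨i, rfl⟩ := Nat.exists_eq_succ_of_ne_zero hi.ne'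
  have h0 : ∀ x : HomH (tower hF E 0) (tower hF E (i + 1)) k, x = 0 := fun x => by
    obtain ⟨f, hf, hf0, rfl⟩ := exists_cls x
    exact cls_eq_zero.mpr (isCob_of_ne_zero hF θ e hEF.homEF_eq_bot hEF.homEE_one hEF.homEE_eq_bot
      hh hk i hf hf0)
  exact (h0 x).trans (h0 y).symm
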